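/- Let $R_1,\dots,R_n$ be pairwise disjoint open axis-aligned rectangles in the plane in general position, that is, no two of them have corners (one from each) with the same $x$- or the same $y$-coordinate, and let $\mathsf D=\mathbb R^2\setminus\bigcup_i R_i$. Let $S\subseteq\mathsf D$ be a vertical segment with upper endpoint $s$. Let $\pi_{\mathsf{ru}}(s)$ be the path that starts at $s$, goes rightwards until it hits a rectangle, then upwards to the top-left corner of that rectangle, then again rightwards, and so on (its last piece is a rightward ray). Let $\pi_{\mathsf{ur}}(s)$ be the path that starts at $s$, goes upwards until it hits a rectangle, then rightwards to the bottom-right corner of that rectangle, then again upwards, and so on (its last piece is an upward ray). Let $\mathsf D_{xy}$ be the region of $\mathsf D$ bounded by these two paths, i.e. the set of points of $\mathsf D$ on or above $\pi_{\mathsf{ru}}(s)$ and on or to the right of $\pi_{\mathsf{ur}}(s)$. A rectilinear path consists of horizontal and vertical segments, called links. A shortest path from $S$ to a point $t$ is a rectilinear path in $\mathsf D$ from a point of $S$ to $t$ whose length is minimum among all such paths, and a minimum-link shortest path is a shortest path with the minimum number of links among all shortest paths from $S$ to $t$. Then there is an algorithm on the real RAM (unit-cost arithmetic and comparisons on real numbers,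 integers of $O(\log n)$ bits) that, given the rectangles, $S$, and a point $t\in\mathsf D_{xy}$, computes a minimum-link shortest path from $S$ to $t$ in $O(n\log n)$ time using $O(n)$ space. -/

import Mathlib

/-! ## Rectangular domains, rectilinear paths, and the region `D_xy` -/

namespace MinLinkPath

/-- An axis-aligned rectangle `(x₁, x₂) × (y₁, y₂)` of positive width and height. -/
structure Rect where
  x₁ : ℝ
  x₂ : ℝ
  y₁ : ℝ
  y₂ : ℝ
  hx : x₁ < x₂
  hy : y₁ < y₂

/-- The obstacle given by a rectangle: an open set. -/
def Rect.toSet (r : Rect) : Set (ℝ × ℝ) := Set.Ioo r.x₁ r.x₂ ×ˢ Set.Ioo r.y₁ r.y₂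

/-- A (nondegenerate) vertical segment `{x} × [y₁, y₂]`. -/
structure VSeg where
  x : ℝ
  y₁ : ℝ
  y₂ : ℝ
  hy : y₁ < y₂

def VSeg.toSet (S : VSeg) : Set (ℝ × ℝ) := {S.x} ×ˢ Set.Icc S.y₁ S.y₂

/-- The upper endpoint `s` of `S`. -/
def VSeg.top (S : VSeg) : ℝ × ℝ := (S.x, S.y₂)

/-- The free space: the plane minus the open rectangles. -/
def domain {n : ℕ} (R : Fin n → Rect) : Set (ℝ × ℝ) := (⋃ i, (R i).toSet)ᶜ

/-- No corner of one rectangle shares an `x`- or a `y`-coordinate with a corner of another one. -/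
def GeneralPosition {n : ℕ} (R : Fin n → Rect) : Prop :=
  ∀ i j, i ≠ j →
    ((R i).x₁ ≠ (R j).x₁ ∧ (R i).x₁ ≠ (R j).x₂ ∧ (R i).x₂ ≠ (R j).x₁ ∧ (R i).x₂ ≠ (R j).x₂) ∧
    ((R i).y₁ ≠ (R j).y₁ ∧ (R i).y₁ ≠ (R j).y₂ ∧ (R i).y₂ ≠ (R j).y₁ ∧ (R i).y₂ ≠ (R j).y₂)

/-- `π`, the list of its successive vertices, is a rectilinear path in `D` from a point of `A` to a
point of `B`: any two successive vertices span a horizontal or vertical segment (a link)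
contained in `D`. A list with one vertex is the constant path. -/
def IsRectPath (D A B : Set (ℝ × ℝ)) (π : List (ℝ × ℝ)) : Prop :=
  (∃ p ∈ A, π.head? = some p) ∧ (∃ q ∈ B, π.getLast? = some q) ∧
  (∀ p ∈ π, p ∈ D) ∧
  π.IsChain (fun p q => (p.1 = q.1 ∨ p.2 = q.2) ∧ segment ℝ p q ⊆ D)

/-- The length of a rectilinear path. -/
def pathLength : List (ℝ × ℝ) → ℝ
  | [] => 0
  | [_] => 0
  | p :: q :: l => |q.1 - p.1| + |q.2 - p.2| + pathLength (q :: l)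

/-- The number of links (segments) of a path given by its vertices. -/
def links (π : List (ℝ × ℝ)) : ℕ := π.length - 1

def IsShortestPath (D A B : Set (ℝ × ℝ)) (π : List (ℝ × ℝ)) : Prop :=
  IsRectPath D A B π ∧ ∀ π', IsRectPath D A B π' → pathLength π ≤ pathLength π'

def IsMinLinkShortestPath (D A B : Set (ℝ × ℝ)) (π : List (ℝ × ℝ)) : Prop :=
  IsShortestPath D A B π ∧ ∀ π', IsShortestPath D A B π' → links π ≤ links π'

/-- The horizontal ray from `q` going rightwards stops at the left side of the rectangle `R i`. -/
def HitsRight {n : ℕ} (R : Fin n → Rect) (q : ℝ × ℝ) (i : Fin n) : Prop :=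
  q.2 ∈ Set.Ioo (R i).y₁ (R i).y₂ ∧ q.1 ≤ (R i).x₁ ∧ segment ℝ q ((R i).x₁, q.2) ⊆ domain R

/-- The vertical ray from `q` going upwards stops at the bottom side of the rectangle `R i`. -/
def HitsUp {n : ℕ} (R : Fin n → Rect) (q : ℝ × ℝ) (i : Fin n) : Prop :=
  q.1 ∈ Set.Ioo (R i).x₁ (R i).x₂ ∧ q.2 ≤ (R i).y₁ ∧ segment ℝ q (q.1, (R i).y₁) ⊆ domain R

/-- The points `p = p₁, p₂, p₃, …` at which the rightward rays of `π_ru(p)` start: when the ray from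
`pₖ` hits a rectangle, `pₖ₊₁` is the top-left corner of that rectangle. -/
inductive StartRU {n : ℕ} (R : Fin n → Rect) (p : ℝ × ℝ) : ℝ × ℝ → Prop
  | first : StartRU R p p
  | next (q : ℝ × ℝ) (i : Fin n) :
      StartRU R p q → HitsRight R q i → StartRU R p ((R i).x₁, (R i).y₂)

/-- The points at which the upward rays of `π_ur(p)` start: when the ray from one of them
hits a rectangle, the next one is the bottom-right corner of that rectangle. -/
inductive StartUR {n : ℕ} (R : Fin n → Rect) (p : ℝ × ℝ) : ℝ × ℝ → Prop
  | first : StartUR R p p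
  | next (q : ℝ × ℝ) (i : Fin n) :
      StartUR R p q → HitsUp R q i → StartUR R p ((R i).x₂, (R i).y₁)

/-- The rightwards-upwards path `π_ru(p)`, as a set: the horizontal pieces (a ray is followed as
long as it stays in the domain), and the vertical pieces up to the top-left corners. -/
def pathRU {n : ℕ} (R : Fin n → Rect) (p : ℝ × ℝ) : Set (ℝ × ℝ) :=
  {z | ∃ q, StartRU R p q ∧
    ((z.2 = q.2 ∧ q.1 ≤ z.1 ∧ segment ℝ q z ⊆ domain R) ∨
      ∃ i, HitsRight R q i ∧ z.1 = (R i).x₁ ∧ q.2 ≤ z.2 ∧ z.2 ≤ (R i).y₂)}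

/-- The upwards-rightwards path `π_ur(p)`, as a set. -/
def pathUR {n : ℕ} (R : Fin n → Rect) (p : ℝ × ℝ) : Set (ℝ × ℝ) :=
  {z | ∃ q, StartUR R p q ∧
    ((z.1 = q.1 ∧ q.2 ≤ z.2 ∧ segment ℝ q z ⊆ domain R) ∨
      ∃ i, HitsUp R q i ∧ z.2 = (R i).y₁ ∧ q.1 ≤ z.1 ∧ z.1 ≤ (R i).x₂)}

/-- The region `D_xy` of the domain bounded by `π_ru(s)` and `π_ur(s)`, where `s` is the upper endpoint
of `S`: the points of the domain on or above `π_ru(s)` and on or to the right of `π_ur(s)`. -/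
def Dxy {n : ℕ} (R : Fin n → Rect) (S : VSeg) : Set (ℝ × ℝ) :=
  {t | t ∈ domain R ∧ (∃ z ∈ pathRU R S.top, z.1 = t.1 ∧ z.2 ≤ t.2) ∧
    (∃ z ∈ pathUR R S.top, z.2 = t.2 ∧ z.1 ≤ t.1)}

/-! ## The real RAM

Programs are structured programs over finitely many named integer variables, real variables,
integer arrays and real arrays. The machine has a memory bound `M`: every array has the cells
`0, …, M - 1`, and an integer word holds a number below `M`; an integer overflow (in particular an
array index out of range) makes the program fail. Since a program names only
finitely many variables and arrays, its space is `O(M)`.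
Every operation on integers or reals, every memory access and every test costs one step. -/

structure State where
  ivar : ℕ → ℕ
  rvar : ℕ → ℝ
  iarr : ℕ → ℕ → ℕ
  rarr : ℕ → ℕ → ℝ

/-- Integer expressions; `get a e` is the cell `e` of the integer array `a`. -/
inductive IExpr
  | lit (k : ℕ)
  | var (x : ℕ)
  | get (a : ℕ) (e : IExpr)
  | add (e f : IExpr)
  | sub (e f : IExpr)
  | mul (e f : IExpr)
  | div (e f : IExpr)

/-- Real expressions; `get a e` is the cell `e` of the real array `a`. -/
inductive RExpr
  | lit (c : ℚ)
  | var (x : ℕ)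
  | get (a : ℕ) (e : IExpr)
  | add (e f : RExpr)
  | sub (e f : RExpr)
  | mul (e f : RExpr)
  | div (e f : RExpr)

/-- Tests. -/
inductive BExpr
  | ile (e f : IExpr)
  | rle (e f : RExpr)
  | not (b : BExpr)
  | and (b c : BExpr)

/-- Programs. -/
inductive Cmd
  | skip
  | setI (x : ℕ) (e : IExpr)
  | setR (x : ℕ) (e : RExpr)
  | putI (a : ℕ) (i e : IExpr)
  | putR (a : ℕ) (i : IExpr) (e : RExpr)
  | seq (c d : Cmd)
  | ite (b : BExpr) (c d : Cmd)
  | loop (b : BExpr) (c : Cmd)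

/-- The number of elementary operations in an expression. -/
def IExpr.cost : IExpr → ℕ
  | lit _ => 1
  | var _ => 1
  | get _ e => e.cost + 1
  | add e f => e.cost + f.cost + 1
  | sub e f => e.cost + f.cost + 1
  | mul e f => e.cost + f.cost + 1
  | div e f => e.cost + f.cost + 1

def RExpr.cost : RExpr → ℕ
  | lit _ => 1
  | var _ => 1
  | get _ e => e.cost + 1
  | add e f => e.cost + f.cost + 1
  | sub e f => e.cost + f.cost + 1
  | mul e f => e.cost + f.cost + 1
  | div e f => e.cost + f.cost + 1

def BExpr.cost : BExpr → ℕ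
  | ile e f => e.cost + f.cost + 1
  | rle e f => e.cost + f.cost + 1
  | not b => b.cost + 1
  | and b c => b.cost + c.cost + 1

/-- Integers below `M` fit into a word; others do not. -/
def word (M v : ℕ) : Option ℕ := if v < M then some v else none

/-- The value of an integer expression, `none` if a number does not fit into a word. Values
are below `M`, so array indices are in range. -/
def IExpr.eval (M : ℕ) (σ : State) : IExpr → Option ℕ
  | lit k => word M k
  | var x => word M (σ.ivar x)
  | get a e => (e.eval M σ).bind fun i => word M (σ.iarr a i)
  | add e f => (e.eval M σ).bind fun u => (f.eval M σ).bind fun v => word M (u + v)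
  | sub e f => (e.eval M σ).bind fun u => (f.eval M σ).bind fun v => word M (u - v)
  | mul e f => (e.eval M σ).bind fun u => (f.eval M σ).bind fun v => word M (u * v)
  | div e f => (e.eval M σ).bind fun u => (f.eval M σ).bind fun v => word M (u / v)

noncomputable def RExpr.eval (M : ℕ) (σ : State) : RExpr → Option ℝ
  | lit c => some (c : ℝ)
  | var x => some (σ.rvar x)
  | get a e => (e.eval M σ).bind fun i => some (σ.rarr a i)
  | add e f => (e.eval M σ).bind fun u => (f.eval M σ).bind fun v => some (u + v)
  | sub e f => (e.eval M σ).bind fun u => (f.eval M σ).bind fun v => some (u - v)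
  | mul e f => (e.eval M σ).bind fun u => (f.eval M σ).bind fun v => some (u * v)
  | div e f => (e.eval M σ).bind fun u => (f.eval M σ).bind fun v => some (u / v)

noncomputable def BExpr.eval (M : ℕ) (σ : State) : BExpr → Option Bool
  | ile e f => (e.eval M σ).bind fun u => (f.eval M σ).bind fun v => some (decide (u ≤ v))
  | rle e f => (e.eval M σ).bind fun u => (f.eval M σ).bind fun v => some (decide (u ≤ v))
  | not b => (b.eval M σ).bind fun u => some (!u)
  | and b c => (b.eval M σ).bind fun u => (c.eval M σ).bind fun v => some (u && v)

/-- `Exec M c σ σ' k`: with memory bound `M`, the program `c` started in the state `σ` halts in the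
state `σ'` after `k` steps, without failing. The execution is deterministic. -/
inductive Exec (M : ℕ) : Cmd → State → State → ℕ → Prop
  | skip (σ : State) : Exec M .skip σ σ 1
  | setI (σ : State) (x : ℕ) (e : IExpr) (v : ℕ) (he : e.eval M σ = some v) :
      Exec M (.setI x e) σ { σ with ivar := Function.update σ.ivar x v } (e.cost + 1)
  | setR (σ : State) (x : ℕ) (e : RExpr) (v : ℝ) (he : e.eval M σ = some v) :
      Exec M (.setR x e) σ { σ with rvar := Function.update σ.rvar x v } (e.cost + 1)
  | putI (σ : State) (a : ℕ) (i e : IExpr) (u v : ℕ)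
      (hi : i.eval M σ = some u) (he : e.eval M σ = some v) :
      Exec M (.putI a i e) σ
        { σ with iarr := Function.update σ.iarr a (Function.update (σ.iarr a) u v) }
        (i.cost + e.cost + 1)
  | putR (σ : State) (a : ℕ) (i : IExpr) (e : RExpr) (u : ℕ) (v : ℝ)
      (hi : i.eval M σ = some u) (he : e.eval M σ = some v) :
      Exec M (.putR a i e) σ
        { σ with rarr := Function.update σ.rarr a (Function.update (σ.rarr a) u v) }
        (i.cost + e.cost + 1)
  | seq (c d : Cmd) (σ σ' σ'' : State) (k l : ℕ)
      (hc : Exec M c σ σ' k) (hd : Exec M d σ' σ'' l) :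
      Exec M (.seq c d) σ σ'' (k + l)
  | iteTrue (b : BExpr) (c d : Cmd) (σ σ' : State) (k : ℕ)
      (hb : b.eval M σ = some true) (hc : Exec M c σ σ' k) :
      Exec M (.ite b c d) σ σ' (b.cost + 1 + k)
  | iteFalse (b : BExpr) (c d : Cmd) (σ σ' : State) (k : ℕ)
      (hb : b.eval M σ = some false) (hd : Exec M d σ σ' k) :
      Exec M (.ite b c d) σ σ' (b.cost + 1 + k)
  | loopTrue (b : BExpr) (c : Cmd) (σ σ' σ'' : State) (k l : ℕ)
      (hb : b.eval M σ = some true) (hc : Exec M c σ σ' k) (hl : Exec M (.loop b c) σ' σ'' l) :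
      Exec M (.loop b c) σ σ'' (b.cost + 1 + k + l)
  | loopFalse (b : BExpr) (c : Cmd) (σ : State)
      (hb : b.eval M σ = some false) :
      Exec M (.loop b c) σ σ (b.cost + 1)

/-- The initial state: the integer variable `0` holds the number `n` of rectangles, the real
arrays `0, 1, 2, 3` hold the coordinates `x₁, x₂, y₁, y₂` of the rectangles in the given order, and
the real variables `0, …, 4` hold `x(S)`, `y₁(S)`, `y₂(S)`, `x(t)`, `y(t)`. All else is zero. -/
noncomputable def inputState {n : ℕ} (R : Fin n → Rect) (S : VSeg) (t : ℝ × ℝ) : State where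
  ivar := fun x => if x = 0 then n else 0
  rvar := fun x => match x with
    | 0 => S.x
    | 1 => S.y₁
    | 2 => S.y₂
    | 3 => t.1
    | 4 => t.2
    | _ => 0
  iarr := fun _ _ => 0
  rarr := fun a i => if h : i < n then
      match a with
      | 0 => (R ⟨i, h⟩).x₁
      | 1 => (R ⟨i, h⟩).x₂
      | 2 => (R ⟨i, h⟩).y₁
      | 3 => (R ⟨i, h⟩).y₂
      | _ => 0
    else 0

/-- The path reported in a final state: the integer variable `1` holds the number of its
vertices, the real arrays `4` and `5` hold their `x`- and `y`-coordinates. -/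
def outputPath (σ : State) : List (ℝ × ℝ) :=
  (List.range (σ.ivar 1)).map fun i => (σ.rarr 4 i, σ.rarr 5 i)

end MinLinkPath

/-! Geometry. Let s be the upper endpoint of S. A target t in `Dxy` lies above and to the right of
s, and some staircase, that is, a path leading only rightwards and upwards, joins s to t
(`reachable_of_mem_Dxy`). A staircase is as long as the L1 distance of s and t. No path from S to t
is shorter, and equality forces a path to start at s and to be a staircase
(`isMinLinkShortestPath_of_stair`). So the task is to find a staircase from s to t with the fewest
links.

Discretization. The lines through the sides of the rectangles form a grid whose cells are entirely
free or entirely blocked, and a staircase becomes a sequence of steps between free cells (`Reach`).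
For a fixed direction of the first link, encoded by `r`, the number of links is determined by the
number of vertical runs and the direction of the last link.

Sweep. The columns are passed from left to right, and for each row k the least number v k of
vertical runs is kept with which the cell is reached horizontally. The main invariant is closure: if
the column is free from row j up to row k, then v k ≤ v j + 1 (`Col.clo`), so a vertical run inside
the column improves nothing. Closure survives a left side, where rows only become blocked
(`Col.left`). At a right side the rows that become free receive one plus the minimum over the free
run below them, and this value spreads upwards until it meets a blocked row or a smaller value
(`Col.right`). Hence, apart from the column of s, vertical runs are needed only on right sides of
rectangles. The values are lower bounds by `Comp.next`; they are attained because every vertical run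
is recorded together with its predecessor (`Wit`, `Sound.left`, `Sound.right`).

Complexity. The function v is piecewise constant. Its pieces form a linked list, and a tournament
tree on their starts answers predecessor queries in O(log n) time. Neighbouring pieces have
different values, unreached ones excepted, so by closure the minimum over a run is found in its last
two pieces (`Col.min_le`). Each side of a rectangle creates boundedly many pieces, and each further
operation removes one, which is paid by a credit deposited at its creation (`wp_absorb_loop`). This
gives O(n log n) time in O(n) cells. The same tree sorts the coordinates. A best path is traced back
through the recorded runs (`wp_traceC`); both directions of the first link are tried and the better
path is kept. Programs are verified with a weakest precondition calculus that carries the elapsed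
time. -/

namespace MinLinkPath

/-! ## Symbolic execution of programs -/

/-- The value of an integer expression when no intermediate result overflows. -/
def IExpr.val (σ : State) : IExpr → ℕ
  | lit k => k
  | var x => σ.ivar x
  | get a e => σ.iarr a (e.val σ)
  | add e f => e.val σ + f.val σ
  | sub e f => e.val σ - f.val σ
  | mul e f => e.val σ * f.val σ
  | div e f => e.val σ / f.val σ

/-- No intermediate result of the evaluation overflows. -/
def IExpr.ok (M : ℕ) (σ : State) : IExpr → Prop
  | lit k => k < M
  | var x => σ.ivar x < M
  | get a e => e.ok M σ ∧ σ.iarr a (e.val σ) < M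
  | add e f => e.ok M σ ∧ f.ok M σ ∧ e.val σ + f.val σ < M
  | sub e f => e.ok M σ ∧ f.ok M σ
  | mul e f => e.ok M σ ∧ f.ok M σ ∧ e.val σ * f.val σ < M
  | div e f => e.ok M σ ∧ f.ok M σ

theorem IExpr.val_lt {M : ℕ} {σ : State} : ∀ {e : IExpr}, e.ok M σ → e.val σ < M
  | lit _, h => h
  | var _, h => h
  | get _ _, h => h.2
  | add _ _, h => h.2.2
  | sub _ _, h => lt_of_le_of_lt (Nat.sub_le _ _) (IExpr.val_lt h.1)
  | mul _ _, h => h.2.2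
  | div _ _, h => lt_of_le_of_lt (Nat.div_le_self _ _) (IExpr.val_lt h.1)

theorem IExpr.eval_eq {M : ℕ} {σ : State} : ∀ {e : IExpr}, e.ok M σ → e.eval M σ = some (e.val σ)
  | lit _, h => if_pos h
  | var _, h => if_pos h
  | get a e, h => by
      simp only [IExpr.eval, IExpr.eval_eq h.1, Option.bind_some, IExpr.val]
      exact if_pos h.2
  | add _ _, h => by
      simp only [IExpr.eval, IExpr.eval_eq h.1, IExpr.eval_eq h.2.1, Option.bind_some, IExpr.val]
      exact if_pos h.2.2
  | sub e f, h => by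
      simp only [IExpr.eval, IExpr.eval_eq h.1, IExpr.eval_eq h.2, Option.bind_some, IExpr.val]
      exact if_pos (IExpr.val_lt (e := .sub e f) h)
  | mul _ _, h => by
      simp only [IExpr.eval, IExpr.eval_eq h.1, IExpr.eval_eq h.2.1, Option.bind_some, IExpr.val]
      exact if_pos h.2.2
  | div e f, h => by
      simp only [IExpr.eval, IExpr.eval_eq h.1, IExpr.eval_eq h.2, Option.bind_some, IExpr.val]
      exact if_pos (IExpr.val_lt (e := .div e f) h)

/-- The value of a real expression when no integer in it overflows. -/
noncomputable def RExpr.val (σ : State) : RExpr → ℝ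
  | lit c => c
  | var x => σ.rvar x
  | get a e => σ.rarr a (e.val σ)
  | add e f => e.val σ + f.val σ
  | sub e f => e.val σ - f.val σ
  | mul e f => e.val σ * f.val σ
  | div e f => e.val σ / f.val σ

def RExpr.ok (M : ℕ) (σ : State) : RExpr → Prop
  | lit _ => True
  | var _ => True
  | get _ e => e.ok M σ
  | add e f => e.ok M σ ∧ f.ok M σ
  | sub e f => e.ok M σ ∧ f.ok M σ
  | mul e f => e.ok M σ ∧ f.ok M σ
  | div e f => e.ok M σ ∧ f.ok M σ

theorem RExpr.eval_eq {M : ℕ} {σ : State} : ∀ {e : RExpr}, e.ok M σ → e.eval M σ = some (e.val σ)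
  | lit _, _ => rfl
  | var _, _ => rfl
  | get a e, h => by simp only [RExpr.eval, IExpr.eval_eq h, Option.bind_some, RExpr.val]
  | add _ _, h => by
      simp only [RExpr.eval, RExpr.eval_eq h.1, RExpr.eval_eq h.2, Option.bind_some, RExpr.val]
  | sub _ _, h => by
      simp only [RExpr.eval, RExpr.eval_eq h.1, RExpr.eval_eq h.2, Option.bind_some, RExpr.val]
  | mul _ _, h => by
      simp only [RExpr.eval, RExpr.eval_eq h.1, RExpr.eval_eq h.2, Option.bind_some, RExpr.val]
  | div _ _, h => by
      simp only [RExpr.eval, RExpr.eval_eq h.1, RExpr.eval_eq h.2, Option.bind_some, RExpr.val]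

/-- The truth value of a test when no integer in it overflows. -/
def BExpr.val (σ : State) : BExpr → Prop
  | ile e f => e.val σ ≤ f.val σ
  | rle e f => e.val σ ≤ f.val σ
  | not b => ¬ b.val σ
  | and b c => b.val σ ∧ c.val σ

def BExpr.ok (M : ℕ) (σ : State) : BExpr → Prop
  | ile e f => e.ok M σ ∧ f.ok M σ
  | rle e f => e.ok M σ ∧ f.ok M σ
  | not b => b.ok M σ
  | and b c => b.ok M σ ∧ c.ok M σ

open Classical in
theorem BExpr.eval_eq {M : ℕ} {σ : State} :
    ∀ {b : BExpr}, b.ok M σ → b.eval M σ = some (decide (b.val σ))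
  | ile _ _, h => by
      simp only [BExpr.eval, IExpr.eval_eq h.1, IExpr.eval_eq h.2, Option.bind_some, BExpr.val]
      congr
  | rle _ _, h => by
      simp only [BExpr.eval, RExpr.eval_eq h.1, RExpr.eval_eq h.2, Option.bind_some, BExpr.val]
      congr
  | not b, h => by
      simp only [BExpr.eval, BExpr.eval_eq (b := b) h, Option.bind_some, BExpr.val]
      by_cases hb : b.val σ <;> simp [hb]
  | and b c, h => by
      simp only [BExpr.eval, BExpr.eval_eq h.1, BExpr.eval_eq h.2, Option.bind_some, BExpr.val]
      by_cases hb : b.val σ <;> by_cases hc : c.val σ <;> simp [hb, hc]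

theorem BExpr.eval_true {M : ℕ} {σ : State} {b : BExpr} (h : b.ok M σ) (hb : b.val σ) :
    b.eval M σ = some true := by
  rw [BExpr.eval_eq h]; simp [hb]

theorem BExpr.eval_false {M : ℕ} {σ : State} {b : BExpr} (h : b.ok M σ) (hb : ¬ b.val σ) :
    b.eval M σ = some false := by
  rw [BExpr.eval_eq h]; simp [hb]

def State.setI (σ : State) (x v : ℕ) : State := { σ with ivar := Function.update σ.ivar x v }

def State.setR (σ : State) (x : ℕ) (v : ℝ) : State :=
  { σ with rvar := Function.update σ.rvar x v }

def State.putI (σ : State) (a i v : ℕ) : State :=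
  { σ with iarr := Function.update σ.iarr a (Function.update (σ.iarr a) i v) }

def State.putR (σ : State) (a i : ℕ) (v : ℝ) : State :=
  { σ with rarr := Function.update σ.rarr a (Function.update (σ.rarr a) i v) }

section
variable (σ : State) (x y v a b i : ℕ) (w : ℝ)

@[simp] theorem State.setI_ivar : (σ.setI x v).ivar y = if y = x then v else σ.ivar y := by
  simp [State.setI, Function.update_apply]
@[simp] theorem State.setI_rvar : (σ.setI x v).rvar = σ.rvar := rfl
@[simp] theorem State.setI_iarr : (σ.setI x v).iarr = σ.iarr := rfl
@[simp] theorem State.setI_rarr : (σ.setI x v).rarr = σ.rarr := rfl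
@[simp] theorem State.setR_ivar : (σ.setR x w).ivar = σ.ivar := rfl
@[simp] theorem State.setR_rvar : (σ.setR x w).rvar y = if y = x then w else σ.rvar y := by
  simp [State.setR, Function.update_apply]
@[simp] theorem State.setR_iarr : (σ.setR x w).iarr = σ.iarr := rfl
@[simp] theorem State.setR_rarr : (σ.setR x w).rarr = σ.rarr := rfl
@[simp] theorem State.putI_ivar : (σ.putI a i v).ivar = σ.ivar := rfl
@[simp] theorem State.putI_rvar : (σ.putI a i v).rvar = σ.rvar := rfl
@[simp] theorem State.putI_iarr :
    (σ.putI a i v).iarr b = if b = a then Function.update (σ.iarr a) i v else σ.iarr b := by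
  simp [State.putI, Function.update_apply]
@[simp] theorem State.putI_rarr : (σ.putI a i v).rarr = σ.rarr := rfl
@[simp] theorem State.putR_ivar : (σ.putR a i w).ivar = σ.ivar := rfl
@[simp] theorem State.putR_rvar : (σ.putR a i w).rvar = σ.rvar := rfl
@[simp] theorem State.putR_iarr : (σ.putR a i w).iarr = σ.iarr := rfl
@[simp] theorem State.putR_rarr :
    (σ.putR a i w).rarr b = if b = a then Function.update (σ.rarr a) i w else σ.rarr b := by
  simp [State.putR, Function.update_apply]
end

/-- The weakest precondition: started in `σ` at time `a`, the program halts without failing, at a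
time and in a state that satisfy `Q`. Only the loops are left to be handled by an invariant. -/
def wp (M : ℕ) : Cmd → State → ℕ → (ℕ → State → Prop) → Prop
  | .skip, σ, a, Q => Q (a + 1) σ
  | .setI x e, σ, a, Q => e.ok M σ ∧ Q (a + (e.cost + 1)) (σ.setI x (e.val σ))
  | .setR x e, σ, a, Q => e.ok M σ ∧ Q (a + (e.cost + 1)) (σ.setR x (e.val σ))
  | .putI b i e, σ, a, Q => i.ok M σ ∧ e.ok M σ ∧
      Q (a + (i.cost + e.cost + 1)) (σ.putI b (i.val σ) (e.val σ))
  | .putR b i e, σ, a, Q => i.ok M σ ∧ e.ok M σ ∧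
      Q (a + (i.cost + e.cost + 1)) (σ.putR b (i.val σ) (e.val σ))
  | .seq c d, σ, a, Q => wp M c σ a fun a' σ' => wp M d σ' a' Q
  | .ite b c d, σ, a, Q => b.ok M σ ∧ (b.val σ → wp M c σ (a + (b.cost + 1)) Q) ∧
      (¬ b.val σ → wp M d σ (a + (b.cost + 1)) Q)
  | .loop b c, σ, a, Q => ∃ σ' k, Exec M (.loop b c) σ σ' k ∧ Q (a + k) σ'

section
variable {M a : ℕ} {σ : State} {Q : ℕ → State → Prop}

theorem wp_skip : wp M .skip σ a Q = Q (a + 1) σ := rfl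
theorem wp_setI {x : ℕ} {e : IExpr} : wp M (.setI x e) σ a Q =
    (e.ok M σ ∧ Q (a + (e.cost + 1)) (σ.setI x (e.val σ))) := rfl
theorem wp_setR {x : ℕ} {e : RExpr} : wp M (.setR x e) σ a Q =
    (e.ok M σ ∧ Q (a + (e.cost + 1)) (σ.setR x (e.val σ))) := rfl
theorem wp_putI {b : ℕ} {i e : IExpr} : wp M (.putI b i e) σ a Q = (i.ok M σ ∧ e.ok M σ ∧
    Q (a + (i.cost + e.cost + 1)) (σ.putI b (i.val σ) (e.val σ))) := rfl
theorem wp_putR {b : ℕ} {i : IExpr} {e : RExpr} : wp M (.putR b i e) σ a Q =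
    (i.ok M σ ∧ e.ok M σ ∧
    Q (a + (i.cost + e.cost + 1)) (σ.putR b (i.val σ) (e.val σ))) := rfl
theorem wp_seq {c d : Cmd} : wp M (.seq c d) σ a Q =
    wp M c σ a fun a' σ' => wp M d σ' a' Q := rfl
theorem wp_ite {b : BExpr} {c d : Cmd} : wp M (.ite b c d) σ a Q =
    (b.ok M σ ∧ (b.val σ → wp M c σ (a + (b.cost + 1)) Q) ∧
      (¬ b.val σ → wp M d σ (a + (b.cost + 1)) Q)) := rfl
end

theorem wp_sound {M : ℕ} : ∀ {c : Cmd} {σ : State} {a : ℕ} {Q : ℕ → State → Prop},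
    wp M c σ a Q → ∃ σ' k, Exec M c σ σ' k ∧ Q (a + k) σ'
  | .skip, σ, _, _, h => ⟨σ, 1, .skip σ, h⟩
  | .setI _ _, _, _, _, h => ⟨_, _, .setI _ _ _ _ (IExpr.eval_eq h.1), h.2⟩
  | .setR _ _, _, _, _, h => ⟨_, _, .setR _ _ _ _ (RExpr.eval_eq h.1), h.2⟩
  | .putI _ _ _, _, _, _, h =>
      ⟨_, _, .putI _ _ _ _ _ _ (IExpr.eval_eq h.1) (IExpr.eval_eq h.2.1), h.2.2⟩
  | .putR _ _ _, _, _, _, h =>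
      ⟨_, _, .putR _ _ _ _ _ _ (IExpr.eval_eq h.1) (RExpr.eval_eq h.2.1), h.2.2⟩
  | .seq c d, _, _, _, h => by
      obtain ⟨σ₁, k₁, h₁, h⟩ := wp_sound (c := c) h
      obtain ⟨σ₂, k₂, h₂, h⟩ := wp_sound (c := d) h
      exact ⟨σ₂, _, .seq _ _ _ _ _ _ _ h₁ h₂, by rwa [← add_assoc]⟩
  | .ite b _ _, σ, _, _, h => by
      by_cases hb : b.val σ
      · obtain ⟨σ', k, h', hQ⟩ := wp_sound (h.2.1 hb)
        exact ⟨σ', _, .iteTrue _ _ _ _ _ _ (BExpr.eval_true h.1 hb) h', by rwa [← add_assoc]⟩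
      · obtain ⟨σ', k, h', hQ⟩ := wp_sound (h.2.2 hb)
        exact ⟨σ', _, .iteFalse _ _ _ _ _ _ (BExpr.eval_false h.1 hb) h', by rwa [← add_assoc]⟩
  | .loop _ _, _, _, _, h => h

/-- The loop rule: `I t σ` says that the loop, started in `σ`, has `t` steps left. What is left of them
at the end is passed on. -/
theorem wp_loop_credit {M : ℕ} {b : BExpr} {c : Cmd} (I P : ℕ → State → Prop)
    (hI : ∀ t σ, I t σ → b.ok M σ ∧
      (b.val σ → wp M c σ 0 fun k σ' => ∃ t', I t' σ' ∧ t' + k + (b.cost + 1) ≤ t) ∧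
      (¬ b.val σ → ∃ t', t' + (b.cost + 1) ≤ t ∧ P t' σ))
    {t a : ℕ} {σ : State} {Q : ℕ → State → Prop} (h : I t σ)
    (hQ : ∀ a' t' σ', a' + t' ≤ a + t → P t' σ' → Q a' σ') : wp M (.loop b c) σ a Q := by
  have key : ∀ t σ, I t σ → ∃ σ' k t', Exec M (.loop b c) σ σ' k ∧ k + t' ≤ t ∧ P t' σ' := by
    intro t
    -- Every iteration pays at least `b.cost + 1`, so the remaining credit strictly decreases; the
    -- time bound also proves termination.
    induction t using Nat.strong_induction_on with
    | _ t ih =>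
      intro σ h
      obtain ⟨h₀, h₁, h₂⟩ := hI t σ h
      by_cases hb : b.val σ
      · obtain ⟨σ₁, k₁, e₁, t', h', ht⟩ := wp_sound (h₁ hb)
        obtain ⟨σ₂, k₂, t'', e₂, hk, hP⟩ := ih t' (by omega) σ₁ h'
        exact ⟨σ₂, _, t'', .loopTrue _ _ _ _ _ _ _ (BExpr.eval_true h₀ hb) e₁ e₂, by omega, hP⟩
      · obtain ⟨t', ht, hP⟩ := h₂ hb
        exact ⟨σ, _, t', .loopFalse _ _ _ (BExpr.eval_false h₀ hb), by omega, hP⟩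
  obtain ⟨σ', k, t', e, hk, hP⟩ := key t σ h
  exact ⟨σ', k, e, hQ _ t' _ (by omega) hP⟩

theorem wp_loop {M : ℕ} {b : BExpr} {c : Cmd} (I : ℕ → State → Prop) (P : State → Prop)
    (hI : ∀ t σ, I t σ → b.ok M σ ∧
      (b.val σ → wp M c σ 0 fun k σ' => ∃ t', I t' σ' ∧ t' + k + (b.cost + 1) ≤ t) ∧
      (¬ b.val σ → b.cost + 1 ≤ t ∧ P σ))
    {t a : ℕ} {σ : State} {Q : ℕ → State → Prop} (h : I t σ)
    (hQ : ∀ a' σ', a' ≤ a + t → P σ' → Q a' σ') : wp M (.loop b c) σ a Q :=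
  wp_loop_credit I (fun _ => P)
    (fun t σ h => ⟨(hI t σ h).1, (hI t σ h).2.1, fun hb =>
      ⟨0, by have := ((hI t σ h).2.2 hb).1; omega, ((hI t σ h).2.2 hb).2⟩⟩) h
    fun a' t' σ' h' hP => hQ a' σ' (by omega) hP

/-! ## Staircases in a grid with rectangular obstacles

The lines through the sides of the rectangles cut the plane into columns `0, …, 2n` and rows
`0, …, 2n`. The number `RX i` is the first column of the `i`-th rectangle and `RX (n + i)` is the
first one behind it; `RY` does the same for rows. -/

/-- The cell in column `c` and row `k` lies in a rectangle. -/
def Blk (n : ℕ) (RX RY : ℕ → ℕ) (c k : ℕ) : Prop :=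
  ∃ i < n, RX i ≤ c ∧ c < RX (n + i) ∧ RY i ≤ k ∧ k < RY (n + i)

structure IsGrid (n : ℕ) (RX RY : ℕ → ℕ) : Prop where
  xpos : ∀ i < 2 * n, 1 ≤ RX i ∧ RX i ≤ 2 * n
  ypos : ∀ i < 2 * n, 1 ≤ RY i ∧ RY i ≤ 2 * n
  xinj : ∀ i < 2 * n, ∀ j < 2 * n, RX i = RX j → i = j
  yinj : ∀ i < 2 * n, ∀ j < 2 * n, RY i = RY j → i = j
  xlt : ∀ i < n, RX i < RX (n + i)
  ylt : ∀ i < n, RY i < RY (n + i)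
  disj : ∀ i < n, ∀ j < n, i ≠ j → RX (n + i) < RX j ∨ RX (n + j) < RX i ∨
    RY (n + i) < RY j ∨ RY (n + j) < RY i

/-- Row `k` is free from column `c` to column `c'`. -/
def HFree (n : ℕ) (RX RY : ℕ → ℕ) (k c c' : ℕ) : Prop :=
  c ≤ c' ∧ ∀ d, c ≤ d → d ≤ c' → ¬ Blk n RX RY d k

/-- Column `c` is free from row `j` to row `k`. -/
def VFree (n : ℕ) (RX RY : ℕ → ℕ) (c j k : ℕ) : Prop :=
  j ≤ k ∧ ∀ i, j ≤ i → i ≤ k → ¬ Blk n RX RY c i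

/-- `Reach d g c k`: some staircase from the cell `(cs, ps)` to `(c, k)` with `g` vertical runs
ends vertically (`d = true`) or horizontally. It starts horizontally if `r = 0` and vertically if
`r = 1`. Runs may have length zero. -/
inductive Reach (n : ℕ) (RX RY : ℕ → ℕ) (r cs ps : ℕ) : Bool → ℕ → ℕ → ℕ → Prop
  | startH : r = 0 → Reach n RX RY r cs ps false 0 cs ps
  | startV : r = 1 → Reach n RX RY r cs ps true 1 cs ps
  | right {d g c k} : Reach n RX RY r cs ps d g c k → ¬ Blk n RX RY (c + 1) k →
      Reach n RX RY r cs ps false g (c + 1) k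
  | turnH {g c k} : Reach n RX RY r cs ps true g c k → Reach n RX RY r cs ps false g c k
  | turnV {g c k} : Reach n RX RY r cs ps false g c k → Reach n RX RY r cs ps true (g + 1) c k
  | up {g c k} : Reach n RX RY r cs ps true g c k → ¬ Blk n RX RY c (k + 1) →
      Reach n RX RY r cs ps true g c (k + 1)

section
variable {n : ℕ} {RX RY : ℕ → ℕ}

/-! ### Free runs, and the change of the blocked cells at a side of a rectangle -/

theorem HFree.succ {k c c' : ℕ} (h : HFree n RX RY k c c') (hb : ¬ Blk n RX RY (c' + 1) k) :
    HFree n RX RY k c (c' + 1) := by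
  refine ⟨h.1.trans (Nat.le_succ _), fun d hd hd' => ?_⟩
  rcases Nat.lt_or_ge d (c' + 1) with h' | h'
  · exact h.2 d hd (by omega)
  · obtain rfl : d = c' + 1 := by omega
    exact hb

theorem HFree.refl {k c : ℕ} (hb : ¬ Blk n RX RY c k) : HFree n RX RY k c c := by
  refine ⟨le_rfl, fun d hd hd' => ?_⟩
  obtain rfl : d = c := by omega
  exact hb

theorem VFree.refl {k c : ℕ} (hb : ¬ Blk n RX RY c k) : VFree n RX RY c k k := by
  refine ⟨le_rfl, fun d hd hd' => ?_⟩
  obtain rfl : d = k := by omega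
  exact hb

theorem VFree.sub {c j k j' k' : ℕ} (h : VFree n RX RY c j k) (h₀ : j' ≤ k') (h₁ : j ≤ j')
    (h₂ : k' ≤ k) : VFree n RX RY c j' k' :=
  ⟨h₀, fun i hi hi' => h.2 i (h₁.trans hi) (hi'.trans h₂)⟩

theorem VFree.trans {c j k l : ℕ} (h : VFree n RX RY c j k) (h' : VFree n RX RY c k l) :
    VFree n RX RY c j l := by
  refine ⟨h.1.trans h'.1, fun i hi hi' => ?_⟩
  rcases Nat.le_total i k with h₁ | h₁
  · exact h.2 i hi h₁
  · exact h'.2 i h₁ hi'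

/-- All sides have different ranks, so at the left side of rectangle `i` no other rectangle starts
or ends: exactly the rows of `i` are added. -/
theorem blk_left (hG : IsGrid n RX RY) {i c : ℕ} (hi : i < n) (hc : RX i = c + 1) (k : ℕ) :
    Blk n RX RY (c + 1) k ↔ Blk n RX RY c k ∨ (RY i ≤ k ∧ k < RY (n + i)) := by
  constructor
  · rintro ⟨j, hj, h₁, h₂, h₃, h₄⟩
    by_cases hji : j = i
    · subst hji; exact Or.inr ⟨h₃, h₄⟩
    · have : RX j ≠ RX i := fun h => hji (hG.xinj j (by omega) i (by omega) h)
      exact Or.inl ⟨j, hj, by omega, by omega, h₃, h₄⟩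
  · rintro (⟨j, hj, h₁, h₂, h₃, h₄⟩ | ⟨h₃, h₄⟩)
    · have : RX (n + j) ≠ RX i := fun h => by
        have := hG.xinj (n + j) (by omega) i (by omega) h
        omega
      exact ⟨j, hj, by omega, by omega, h₃, h₄⟩
    · exact ⟨i, hi, by omega, by have := hG.xlt i hi; omega, h₃, h₄⟩

/-- Again only rectangle `i` changes its status. A second rectangle that blocked one of its rows in
the new column would start before that column and hence overlap `i`, against `disj`. -/
theorem blk_right (hG : IsGrid n RX RY) {i c : ℕ} (hi : i < n) (hc : RX (n + i) = c + 1) (k : ℕ) :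
    Blk n RX RY (c + 1) k ↔ Blk n RX RY c k ∧ ¬ (RY i ≤ k ∧ k < RY (n + i)) := by
  constructor
  · rintro ⟨j, hj, h₁, h₂, h₃, h₄⟩
    have hji : i ≠ j := by rintro rfl; omega
    have : RX j ≠ RX (n + i) := fun h => by
      have := hG.xinj j (by omega) (n + i) (by omega) h
      omega
    refine ⟨⟨j, hj, by omega, by omega, h₃, h₄⟩, fun h => ?_⟩
    have := hG.disj i hi j hj hji
    have := hG.xlt i hi
    omega
  · rintro ⟨⟨j, hj, h₁, h₂, h₃, h₄⟩, h⟩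
    have hji : i ≠ j := by rintro rfl; exact h ⟨h₃, h₄⟩
    have : RX (n + j) ≠ RX (n + i) := fun h => by
      have := hG.xinj (n + j) (by omega) (n + i) (by omega) h
      omega
    exact ⟨j, hj, by omega, by omega, h₃, h₄⟩

/-- The separation in `disj` is strict, so a rectangle that blocked one of these cells would overlap
or touch rectangle `i`. The rows just below and just above `i` are included; this makes the
boundaries of a newly blocked range visible as changes of value. -/
theorem not_blk_left (hG : IsGrid n RX RY) {i c k : ℕ} (hi : i < n) (hc : RX i = c + 1)
    (h₁ : RY i ≤ k + 1) (h₂ : k ≤ RY (n + i)) : ¬ Blk n RX RY c k := by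
  rintro ⟨j, hj, h₃, h₄, h₅, h₆⟩
  have hji : i ≠ j := by rintro rfl; omega
  have : RX (n + j) ≠ RX i := fun h => by
    have := hG.xinj (n + j) (by omega) i (by omega) h
    omega
  have := hG.disj i hi j hj hji
  have := hG.xlt i hi
  omega

/-- Strict separation leaves the cells just below and just above rectangle `i` free in its last
column. They are where a vertical run along the right side comes from and where it may go on. -/
theorem not_blk_right (hG : IsGrid n RX RY) {i c k : ℕ} (hi : i < n) (hc : RX (n + i) = c + 1)
    (h : k + 1 = RY i ∨ k = RY (n + i)) : ¬ Blk n RX RY c k := by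
  rintro ⟨j, hj, h₃, h₄, h₅, h₆⟩
  have hylt := hG.ylt i hi
  have hji : i ≠ j := by rintro rfl; omega
  have := hG.disj i hi j hj hji
  have := hG.xlt i hi
  omega

theorem blk_of_right (hG : IsGrid n RX RY) {i c k : ℕ} (hi : i < n) (hc : RX (n + i) = c + 1)
    (h₁ : RY i ≤ k) (h₂ : k < RY (n + i)) : Blk n RX RY c k :=
  ⟨i, hi, by have := hG.xlt i hi; omega, by omega, h₁, h₂⟩

/-! ### Columns of optimal values -/

/-- The function `v` with its values on `[b, e)` replaced by `x`. -/
def fill (b e x : ℕ) (v : ℕ → ℕ) (k : ℕ) : ℕ := if b ≤ k ∧ k < e then x else v k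

theorem fill_in {b e x k : ℕ} {v : ℕ → ℕ} (h₁ : b ≤ k) (h₂ : k < e) : fill b e x v k = x :=
  if_pos ⟨h₁, h₂⟩

theorem fill_lt {b e x k : ℕ} {v : ℕ → ℕ} (h : k < b) : fill b e x v k = v k :=
  if_neg (by omega)

theorem fill_ge {b e x k : ℕ} {v : ℕ → ℕ} (h : e ≤ k) : fill b e x v k = v k :=
  if_neg (by omega)

/-- What holds for the values `v k` of the cells `(c, k)` of a column: `v k` is `2n + 6` for a
blocked cell, `2n + 5` for one that no staircase reaches, and otherwise the
number of vertical runs with which it can be reached horizontally. -/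
structure Col (n : ℕ) (RX RY : ℕ → ℕ) (c : ℕ) (v : ℕ → ℕ) : Prop where
  blk : ∀ k ≤ 2 * n, v k = 2 * n + 6 ↔ Blk n RX RY c k
  le : ∀ k ≤ 2 * n, v k ≤ 2 * n + 6
  -- Vertical runs inside the column are already taken into account.
  clo : ∀ j k, k ≤ 2 * n → VFree n RX RY c j k → v k ≤ v j + 1
  -- Each column contributes at most one vertical run. So finite values stay well below the two
  -- special values, and adding one cannot produce a special value.
  fin : ∀ k ≤ 2 * n, v k ≤ c + 1 ∨ 2 * n + 5 ≤ v k

/-- A run that is free in the new column was free in the old one and avoids the newly blocked rows,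
so closure is inherited. -/
theorem Col.left (hG : IsGrid n RX RY) {i c : ℕ} {v : ℕ → ℕ} (hi : i < n) (hc : RX i = c + 1)
    (h : Col n RX RY c v) :
    Col n RX RY (c + 1) (fill (RY i) (RY (n + i)) (2 * n + 6) v) := by
  have hb := blk_left hG hi hc
  refine ⟨fun k hk => ?_, fun k hk => ?_, fun j k hk hf => ?_, fun k hk => ?_⟩
  · rw [hb k, fill]
    split_ifs with h'
    · simp [h']
    · rw [h.blk k hk]; simp [h']
  · rw [fill]; split_ifs
    · exact le_rfl
    · exact h.le k hk
  · have hf' : VFree n RX RY c j k :=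
      ⟨hf.1, fun l h₁ h₂ hl => hf.2 l h₁ h₂ ((hb l).2 (Or.inl hl))⟩
    have hout : ∀ l, j ≤ l → l ≤ k → ¬ (RY i ≤ l ∧ l < RY (n + i)) :=
      fun l h₁ h₂ hl => hf.2 l h₁ h₂ ((hb l).2 (Or.inr hl))
    rw [fill, fill, if_neg (hout k hf.1 le_rfl), if_neg (hout j le_rfl hf.1)]
    exact h.clo j k hk hf'
  · rw [fill]; split_ifs
    · right; omega
    · have := h.fin k hk; omega

/-- Here `m₀` bounds from below the values on the free run that ends just under the rectangle, and
the rows of `[b, e)` receive one more than that, capped at the value for unreached cells. Below the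
rectangle the covered rows had this value already; above it they had no smaller one. So values only
decrease, and closure has to be checked only for runs that enter or leave `[b, e)`. -/
theorem Col.right (hG : IsGrid n RX RY) {i c m₀ cv b e : ℕ} {v : ℕ → ℕ} (hi : i < n)
    (hc : RX (n + i) = c + 1) (h : Col n RX RY c v)
    (hm : ∀ j, VFree n RX RY c j (RY i - 1) → m₀ ≤ v j)
    (hfin : m₀ ≤ c + 1 ∨ 2 * n + 5 ≤ m₀) (hcv : cv = min (m₀ + 1) (2 * n + 5))
    (hb : b ≤ RY i) (hbv : ∀ k, b ≤ k → k < RY i → v k = cv)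
    (he : RY (n + i) ≤ e) (he' : e ≤ 2 * n + 1)
    (hev : ∀ k, RY (n + i) ≤ k → k < e → cv ≤ v k ∧ v k ≤ 2 * n + 5)
    (hend : e ≤ 2 * n → v e < cv ∨ v e = 2 * n + 6) :
    Col n RX RY (c + 1) (fill b e cv v) ∧
      ∀ k ≤ 2 * n, fill b e cv v k ≤ v k := by
  have hB := blk_right hG hi hc
  have hy := hG.ypos i (by omega)
  have hylt := hG.ylt i hi
  have hsame : ∀ k, k < RY i ∨ RY (n + i) ≤ k → ¬ Blk n RX RY (c + 1) k → ¬ Blk n RX RY c k :=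
    fun k hk h₁ h₂ => h₁ ((hB k).2 ⟨h₂, by omega⟩)
  have hfree : ∀ k, b ≤ k → k < e → ¬ Blk n RX RY (c + 1) k := by
    intro k h₁ h₂ hk
    obtain ⟨hk₁, hk₂⟩ := (hB k).1 hk
    rw [← h.blk k (by omega)] at hk₁
    rcases Nat.lt_or_ge k (RY i) with h₃ | h₃
    · have := hbv k h₁ h₃; omega
    · have := hev k (by omega) h₂; omega
  -- A run that enters the covered range from below continues to the row under the rectangle, so its
  -- start has value at least `m₀`.
  have hlow : ∀ j, j < b → VFree n RX RY (c + 1) j b → cv ≤ v j + 1 := by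
    intro j hj hf
    have : m₀ ≤ v j := by
      refine hm j ⟨by omega, fun l h₁ h₂ => hsame l (by omega) ?_⟩
      rcases Nat.lt_or_ge l b with h₃ | h₃
      · exact hf.2 l h₁ h₃.le
      · exact hfree l h₃ (by omega)
    omega
  refine ⟨⟨fun k hk => ?_, fun k hk => ?_, fun j k hk hf => ?_, fun k hk => ?_⟩, fun k hk => ?_⟩
  · rw [fill]
    split_ifs with h'
    · have := hfree k h'.1 h'.2
      simp only [this, iff_false]; omega
    · rw [h.blk k hk, hB k]
      exact ⟨fun h₁ => ⟨h₁, by omega⟩, fun h₁ => h₁.1⟩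
  · rw [fill]; split_ifs
    · omega
    · exact h.le k hk
  · have hjk := hf.1
    rcases Nat.lt_or_ge k b with h₁ | h₁
    · rw [fill_lt h₁, fill_lt (by omega)]
      exact h.clo j k hk ⟨hf.1, fun l h₂ h₃ => hsame l (by omega) (hf.2 l h₂ h₃)⟩
    rcases Nat.lt_or_ge k e with h₂ | h₂
    · rw [fill_in h₁ h₂]
      rcases Nat.lt_or_ge j b with h₃ | h₃
      · rw [fill_lt h₃]
        exact hlow j h₃ (hf.sub (by omega) le_rfl h₁)
      · rw [fill_in h₃ (by omega)]; omega
    · rw [fill_ge h₂]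
      rcases Nat.lt_or_ge j e with h₃ | h₃
      -- A free run that leaves the covered range at the top passes row `e`. There the covering
      -- stopped because of a smaller value, and closure from `e` upwards suffices.
      · have hve : v e < cv := by
          refine (hend (by omega)).resolve_right fun hve => ?_
          rw [h.blk e (by omega)] at hve
          exact hsame e (by omega) (hf.2 e h₃.le h₂) hve
        have : v k ≤ v e + 1 := h.clo e k hk
          ⟨h₂, fun l h₄ h₅ => hsame l (by omega) (hf.2 l (by omega) h₅)⟩
        rcases Nat.lt_or_ge j b with h₄ | h₄
        · rw [fill_lt h₄]
          have := hlow j h₄ (hf.sub (by omega) le_rfl (by omega))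
          omega
        · rw [fill_in h₄ h₃]; omega
      · rw [fill_ge h₃]
        exact h.clo j k hk ⟨hf.1, fun l h₄ h₅ => hsame l (by omega) (hf.2 l h₄ h₅)⟩
  · rw [fill]; split_ifs
    · omega
    · have := h.fin k hk; omega
  · rw [fill]
    split_ifs with h'
    · rcases Nat.lt_or_ge k (RY i) with h₁ | h₁
      · rw [hbv k h'.1 h₁]
      rcases Nat.lt_or_ge k (RY (n + i)) with h₂ | h₂
      · rw [(h.blk k hk).2 (blk_of_right hG hi hc h₁ h₂)]; omega
      · exact (hev k h₂ h'.2).1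
    · exact le_rfl

/-- The minimum over a free run below a cell is attained in the last piece or just below it. -/
theorem Col.min_le {c q k₀ : ℕ} {v : ℕ → ℕ} (h : Col n RX RY c v) (hc : c ≤ 2 * n)
    (hk₀ : k₀ ≤ 2 * n) (hq : q ≤ k₀) (hqv : ∀ l, q ≤ l → l ≤ k₀ → v l = v q)
    (hadj : 1 ≤ q → v q ≠ 2 * n + 5 → v (q - 1) ≠ v q) {j : ℕ} (hf : VFree n RX RY c j k₀) :
    min (v q) (v (q - 1)) ≤ v j := by
  have hjk := hf.1
  have h₁ := h.clo j k₀ hk₀ hf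
  rw [hqv k₀ hq le_rfl] at h₁
  -- If the run starts below `q`, closure bounds both `v q` and `v (q - 1)` by `v j + 1`; as these
  -- are different, the smaller one is at most `v j`. If `v q` is the value for unreached cells,
  -- `fin` leaves no finite value for `v j`.
  rcases Nat.lt_or_ge j q with h₂ | h₂
  · have h₃ := h.clo j (q - 1) (by omega) (hf.sub (by omega) le_rfl (by omega))
    have h₄ := h.fin j (by omega)
    have h₅ : v q ≠ 2 * n + 6 := by
      rw [Ne, h.blk q (by omega)]; exact hf.2 q h₂.le hq
    have h₆ := h.le q (by omega)
    have h₇ := hadj (by omega)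
    omega
  · rw [hqv j h₂ hjk]; omega

/-! ### Completeness of the values -/

theorem Reach.free {r cs ps : ℕ} (h₀ : ¬ Blk n RX RY cs ps) {d : Bool} {g c k : ℕ}
    (h : Reach n RX RY r cs ps d g c k) : ¬ Blk n RX RY c k := by
  induction h with
  | startH _ => exact h₀
  | startV _ => exact h₀
  | right _ hb _ => exact hb
  | turnH _ ih => exact ih
  | turnV _ ih => exact ih
  | up _ hb _ => exact hb

/-- The values of a column are lower bounds. -/
def Comp (n : ℕ) (RX RY : ℕ → ℕ) (r cs ps c : ℕ) (v : ℕ → ℕ) : Prop :=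
  ∀ d g k, k ≤ 2 * n → Reach n RX RY r cs ps d g c k →
    if d then (∀ l ≤ 2 * n, VFree n RX RY c k l → v l ≤ g ∧ v l < 2 * n + 5) ∧
      ((∃ j, VFree n RX RY c j k ∧ v j + 1 ≤ g) ∨ (r = 1 ∧ g = 1))
    else v k ≤ g ∧ v k < 2 * n + 5

/-- Completeness is inherited along a column. -/
theorem comp_of_arrivals {r cs ps c : ℕ} {v : ℕ → ℕ} (hv : Col n RX RY c v) (hc : c ≤ 2 * n)
    (h₀ : ¬ Blk n RX RY cs ps)
    (hH : r = 0 → c = cs → v ps = 0)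
    (hV : r = 1 → c = cs → ∀ l ≤ 2 * n, VFree n RX RY c ps l → v l ≤ 1)
    (harr : ∀ d g c' k, c' + 1 = c → k ≤ 2 * n → Reach n RX RY r cs ps d g c' k →
      ¬ Blk n RX RY c k → v k ≤ g ∧ v k < 2 * n + 5) :
    Comp n RX RY r cs ps c v := by
  -- Induction on the staircase. A vertical end carries two facts: all rows further up the run have
  -- value at most `g`, and the run either comes from a row with value below `g` or is the first run
  -- of a vertical start. The second fact is what bounds the cost of a path whose last link is
  -- vertical.
  suffices H : ∀ d g c' k, Reach n RX RY r cs ps d g c' k → c' = c → k ≤ 2 * n →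
      if d then (∀ l ≤ 2 * n, VFree n RX RY c k l → v l ≤ g ∧ v l < 2 * n + 5) ∧
        ((∃ j, VFree n RX RY c j k ∧ v j + 1 ≤ g) ∨ (r = 1 ∧ g = 1))
      else v k ≤ g ∧ v k < 2 * n + 5 from fun d g k hk hr => H d g c k hr rfl hk
  intro d g c' k hr
  induction hr with
  | startH hr =>
    intro hc' hk
    have := hH hr hc'.symm
    simp; omega
  | startV hr =>
    intro hc' hk
    simp only [if_true]
    exact ⟨fun l hl hf => by have := hV hr hc'.symm l hl hf; omega, Or.inr ⟨hr, trivial⟩⟩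
  | @right d g c' k hr hb _ =>
    intro hc' hk
    simp only [Bool.false_eq_true, if_false]
    subst hc'
    exact harr d g c' k rfl hk hr hb
  | @turnH g c' k hr ih =>
    intro hc' hk
    subst hc'
    simpa using (ih rfl hk).1 k hk (VFree.refl (hr.free h₀))
  | @turnV g c' k hr ih =>
    intro hc' hk
    subst hc'
    have ih := ih rfl hk
    simp only [Bool.false_eq_true, if_false] at ih
    simp only [if_true]
    refine ⟨fun l hl hf => ?_, Or.inl ⟨k, VFree.refl (hr.free h₀), by omega⟩⟩
    have h₁ := hv.clo k l hl hf
    have h₂ := hv.fin k hk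
    omega
  | @up g c' k hr hb ih =>
    intro hc' hk
    subst hc'
    have ih := ih rfl (by omega)
    simp only [if_true] at ih ⊢
    have hk' : VFree n RX RY c' k (k + 1) := by
      refine ⟨by omega, fun i h₁ h₂ => ?_⟩
      rcases Nat.lt_or_ge k i with h₃ | h₃
      · obtain rfl : i = k + 1 := by omega
        exact hb
      · obtain rfl : i = k := by omega
        exact hr.free h₀
    refine ⟨fun l hl hf => ih.1 l hl (hk'.trans hf), ?_⟩
    rcases ih.2 with ⟨j, hj, hj'⟩ | h
    · exact Or.inl ⟨j, hj.trans hk', hj'⟩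
    · exact Or.inr h

/-- A staircase enters the next column by a horizontal step, where values do not increase, and
vertical runs inside that column are absorbed by its closure. So only monotonicity on free cells has
to be known about the transition. -/
theorem Comp.next {r cs ps c : ℕ} {v v' : ℕ → ℕ} (h : Comp n RX RY r cs ps c v)
    (hv' : Col n RX RY (c + 1) v') (hc : c + 1 ≤ 2 * n) (hcs : cs ≤ c)
    (h₀ : ¬ Blk n RX RY cs ps)
    (hle : ∀ k ≤ 2 * n, ¬ Blk n RX RY (c + 1) k → v' k ≤ v k) :
    Comp n RX RY r cs ps (c + 1) v' := by
  refine comp_of_arrivals hv' hc h₀ (fun _ h => by omega) (fun _ h => by omega)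
    fun d g c' k hc' hk hr hb => ?_
  obtain rfl : c' = c := by omega
  have h₁ := h d g k hk hr
  have h₂ := hle k hk hb
  cases d with
  | false => simp only [Bool.false_eq_true, if_false] at h₁; omega
  | true =>
    simp only [if_true] at h₁
    have := h₁.1 k hk (VFree.refl (hr.free h₀))
    omega

/-! ### Witnesses for the values -/

/-- `Wit v e k c`: the recorded turns lead from the start to the cell `(c, k)`, with `v` vertical runs
and a horizontal end. The last vertical run is in column `e`; it has the abscissa `xv e` and comes
from the ordinate `yl e`, where the run before it was in column `stag e`. The label `2n + 1` stands
for the start. -/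
inductive Wit (n : ℕ) (RX RY : ℕ → ℕ) (r cs ps : ℕ) (s : ℝ × ℝ) (PX PY : ℝ → ℕ → Prop)
    (stag : ℕ → ℕ) (xv yl : ℕ → ℝ) : ℕ → ℕ → ℕ → ℕ → Prop
  | startH {c} : r = 0 → HFree n RX RY ps cs c →
      Wit n RX RY r cs ps s PX PY stag xv yl 0 (2 * n + 1) ps c
  | startV {k c} : r = 1 → cs ≤ 2 * n → PX (xv cs) cs → xv cs = s.1 → yl cs = s.2 →
      stag cs = 2 * n + 1 → VFree n RX RY cs ps k → HFree n RX RY k cs c →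
      Wit n RX RY r cs ps s PX PY stag xv yl 1 cs k c
  | step {v e j k c} : e ≤ 2 * n → PX (xv e) e → PY (yl e) j → j < k →
      Wit n RX RY r cs ps s PX PY stag xv yl v (stag e) j e →
      VFree n RX RY e j k → HFree n RX RY k e c →
      Wit n RX RY r cs ps s PX PY stag xv yl (v + 1) e k c

variable {r cs ps : ℕ} {s : ℝ × ℝ} {PX PY : ℝ → ℕ → Prop} {stag stag' : ℕ → ℕ} {xv xv' yl yl' : ℕ → ℝ}

theorem Wit.next {v e k c : ℕ} (h : Wit n RX RY r cs ps s PX PY stag xv yl v e k c)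
    (hb : ¬ Blk n RX RY (c + 1) k) : Wit n RX RY r cs ps s PX PY stag xv yl v e k (c + 1) := by
  cases h with
  | startH h₁ h₂ => exact .startH h₁ (h₂.succ hb)
  | startV h₁ h₀ h₂ h₃ h₄ h₅ h₆ h₇ => exact .startV h₁ h₀ h₂ h₃ h₄ h₅ h₆ (h₇.succ hb)
  | step h₁ h₂ h₃ h₄ h₅ h₆ h₇ => exact .step h₁ h₂ h₃ h₄ h₅ h₆ (h₇.succ hb)

/-- A witness for a cell in column `c` only consults records of columns up to `c`. Hence recording a
run in a later column does not spoil it. -/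
theorem Wit.congr {v e k c : ℕ} (h : Wit n RX RY r cs ps s PX PY stag xv yl v e k c)
    (hs : ∀ d ≤ c, stag' d = stag d) (hx : ∀ d ≤ c, xv' d = xv d) (hy : ∀ d ≤ c, yl' d = yl d) :
    Wit n RX RY r cs ps s PX PY stag' xv' yl' v e k c := by
  induction h with
  | startH h₁ h₂ => exact .startH h₁ h₂
  | @startV k c h₁ h₀ h₂ h₃ h₄ h₅ h₆ h₇ =>
    have := h₇.1
    refine .startV h₁ h₀ ?_ ?_ ?_ ?_ h₆ h₇
    · rwa [hx cs this]
    · rwa [hx cs this]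
    · rwa [hy cs this]
    · rwa [hs cs this]
  | @step v e j k c h₁ h₂ h₃ h₄ h₅ h₆ h₇ ih =>
    have := h₇.1
    refine .step h₁ ?_ ?_ h₄ ?_ h₆ h₇
    · rwa [hx e this]
    · rwa [hy e this]
    · rw [hs e this]
      exact ih (fun d hd => hs d (hd.trans this)) (fun d hd => hx d (hd.trans this))
        fun d hd => hy d (hd.trans this)

theorem Wit.label_le {v e k c : ℕ} (h : Wit n RX RY r cs ps s PX PY stag xv yl v e k c) :
    e ≤ 2 * n + 1 := by
  cases h <;> omega

theorem Wit.start_le {v e k c : ℕ} (h : Wit n RX RY r cs ps s PX PY stag xv yl v e k c) :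
    ps ≤ k := by
  induction h with
  | startH _ _ => exact le_rfl
  | startV _ _ _ _ _ _ h _ => exact h.1
  | step _ _ _ h _ _ _ ih => omega

/-- All finite values of a column have witnesses. -/
def Sound (n : ℕ) (RX RY : ℕ → ℕ) (r cs ps : ℕ) (s : ℝ × ℝ) (PX PY : ℝ → ℕ → Prop)
    (stag : ℕ → ℕ) (xv yl : ℕ → ℝ) (c : ℕ) (v tg : ℕ → ℕ) : Prop :=
  ∀ k ≤ 2 * n, v k < 2 * n + 5 → Wit n RX RY r cs ps s PX PY stag xv yl (v k) (tg k) k c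

theorem Sound.left (hG : IsGrid n RX RY) {i c : ℕ} {v tg tg' : ℕ → ℕ} (hi : i < n)
    (hc : RX i = c + 1) (hv : Col n RX RY c v)
    (h : Sound n RX RY r cs ps s PX PY stag xv yl c v tg)
    (htg : ∀ k, k < RY i ∨ RY (n + i) ≤ k → tg' k = tg k) :
    Sound n RX RY r cs ps s PX PY stag xv yl (c + 1)
      (fill (RY i) (RY (n + i)) (2 * n + 6) v) tg' := by
  intro k hk hlt
  have hk' : ¬ (RY i ≤ k ∧ k < RY (n + i)) := by
    intro h'
    rw [fill_in h'.1 h'.2] at hlt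
    omega
  rw [fill, if_neg hk'] at hlt ⊢
  rw [htg k (by omega)]
  refine (h k hk hlt).next ?_
  rw [blk_left hG hi hc, ← hv.blk k hk]
  omega

/-- The covered rows are reached by a vertical run in the new column that leaves row `src`. The
witness of `src` extends one column to the right, and its tag is stored as the predecessor of the
new run. Covered rows below the rectangle are retagged, which is harmless as their value is the
same. -/
theorem Sound.right (hG : IsGrid n RX RY) {i c cv b e src : ℕ} {v tg : ℕ → ℕ} (hi : i < n)
    (hc : RX (n + i) = c + 1) (hv : Col n RX RY c v)
    (hv' : Col n RX RY (c + 1) (fill b e cv v))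
    (h : Sound n RX RY r cs ps s PX PY stag xv yl c v tg)
    (hs : ∀ d ≤ c, stag' d = stag d) (hx : ∀ d ≤ c, xv' d = xv d) (hy : ∀ d ≤ c, yl' d = yl d)
    (hc2 : c + 1 ≤ 2 * n)
    (hcv : cv = min (v src + 1) (2 * n + 5))
    (hst : stag' (c + 1) = tg src)
    (hsrc : v src < 2 * n + 5 → src < b ∧ VFree n RX RY (c + 1) src b ∧ PX (xv' (c + 1)) (c + 1) ∧
      PY (yl' (c + 1)) src) :
    Sound n RX RY r cs ps s PX PY stag' xv' yl' (c + 1) (fill b e cv v)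
      (fill b e (c + 1) tg) := by
  intro k hk hlt
  by_cases hk' : b ≤ k ∧ k < e
  · rw [fill_in hk'.1 hk'.2] at hlt
    rw [fill_in hk'.1 hk'.2, fill_in hk'.1 hk'.2]
    have hbk : ∀ l, b ≤ l → l ≤ k → ¬ Blk n RX RY (c + 1) l := by
      intro l h₁ h₂
      rw [← hv'.blk l (by omega), fill_in h₁ (by omega)]
      omega
    have hlt' : v src < 2 * n + 5 := by omega
    obtain ⟨hsrc, hsf, hxv, hyl⟩ := hsrc hlt'
    rw [hcv, min_eq_left (by omega)]
    refine .step hc2 hxv hyl (by omega) ?_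
      (hsf.trans ⟨hk'.1, hbk⟩) (HFree.refl (hbk k hk'.1 le_rfl))
    rw [hst]
    have h₂ := (h src (by omega) hlt').congr hs hx hy
    exact h₂.next (hsf.2 src le_rfl hsrc.le)
  · rw [fill, if_neg hk'] at hlt
    rw [fill, fill, if_neg hk', if_neg hk']
    refine ((h k hk hlt).congr hs hx hy).next ?_
    rw [blk_right hG hi hc, ← hv.blk k hk]
    omega

/-! ### Reachable cells -/

theorem Reach.hfree {g c k : ℕ} (h : Reach n RX RY r cs ps false g c k) {c' : ℕ}
    (hf : HFree n RX RY k c c') : Reach n RX RY r cs ps false g c' k := by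
  obtain ⟨hc, hf⟩ := hf
  induction c', hc using Nat.le_induction with
  | base => exact h
  | succ c' hc ih => exact (ih fun d h₁ h₂ => hf d h₁ (by omega)).right (hf _ (by omega) le_rfl)

theorem Reach.vfree {g c k : ℕ} (h : Reach n RX RY r cs ps true g c k) {k' : ℕ}
    (hf : VFree n RX RY c k k') : Reach n RX RY r cs ps true g c k' := by
  obtain ⟨hc, hf⟩ := hf
  induction k', hc using Nat.le_induction with
  | base => exact h
  | succ k' hc ih => exact (ih fun d h₁ h₂ => hf d h₁ (by omega)).up (hf _ (by omega) le_rfl)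

/-- Some staircase leads to the cell. -/
def Reachable (n : ℕ) (RX RY : ℕ → ℕ) (r cs ps c k : ℕ) : Prop :=
  ∃ d g, Reach n RX RY r cs ps d g c k

theorem Reachable.hfree {c k c' : ℕ} (h : Reachable n RX RY r cs ps c k)
    (hf : HFree n RX RY k c c') : Reachable n RX RY r cs ps c' k := by
  obtain ⟨d, g, h⟩ := h
  cases d with
  | false => exact ⟨_, _, h.hfree hf⟩
  | true => exact ⟨_, _, h.turnH.hfree hf⟩

theorem Reachable.vfree {c k k' : ℕ} (h : Reachable n RX RY r cs ps c k)
    (hf : VFree n RX RY c k k') : Reachable n RX RY r cs ps c k' := by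
  obtain ⟨d, g, h⟩ := h
  cases d with
  | false => exact ⟨_, _, h.turnV.vfree hf⟩
  | true => exact ⟨_, _, h.vfree hf⟩

theorem Reach.bounds {d : Bool} {g c k : ℕ} (h : Reach n RX RY r cs ps d g c k) :
    cs ≤ c ∧ ps ≤ k := by
  induction h <;> omega

/-- A staircase meets every column on its way. -/
theorem Reach.column {d : Bool} {g c k : ℕ} (h : Reach n RX RY r cs ps d g c k) :
    ∀ c', cs ≤ c' → c' ≤ c → ∃ j ≤ k, Reachable n RX RY r cs ps c' j := by
  induction h with
  | startH hr =>
    intro c' h₁ h₂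
    obtain rfl : c' = cs := by omega
    exact ⟨ps, le_rfl, _, _, .startH hr⟩
  | startV hr =>
    intro c' h₁ h₂
    obtain rfl : c' = cs := by omega
    exact ⟨ps, le_rfl, _, _, .startV hr⟩
  | @right d g c k hr hb ih =>
    intro c' h₁ h₂
    rcases Nat.lt_or_ge c c' with h₃ | h₃
    · obtain rfl : c' = c + 1 := by omega
      exact ⟨k, le_rfl, _, _, hr.right hb⟩
    · exact ih c' h₁ h₃
  | turnH _ ih => exact ih
  | turnV _ ih => exact ih
  | up _ _ ih =>
    intro c' h₁ h₂
    obtain ⟨j, hj, h⟩ := ih c' h₁ h₂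
    exact ⟨j, by omega, h⟩

/-- A staircase meets every row on its way. -/
theorem Reach.row {d : Bool} {g c k : ℕ} (h : Reach n RX RY r cs ps d g c k) :
    ∀ k', ps ≤ k' → k' ≤ k → ∃ c' ≤ c, Reachable n RX RY r cs ps c' k' := by
  induction h with
  | startH hr =>
    intro k' h₁ h₂
    obtain rfl : k' = ps := by omega
    exact ⟨cs, le_rfl, _, _, .startH hr⟩
  | startV hr =>
    intro k' h₁ h₂
    obtain rfl : k' = ps := by omega
    exact ⟨cs, le_rfl, _, _, .startV hr⟩
  | right _ _ ih =>
    intro k' h₁ h₂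
    obtain ⟨j, hj, h⟩ := ih k' h₁ h₂
    exact ⟨j, by omega, h⟩
  | turnH _ ih => exact ih
  | turnV _ ih => exact ih
  | @up g c k hr hb ih =>
    intro k' h₁ h₂
    rcases Nat.lt_or_ge k k' with h₃ | h₃
    · obtain rfl : k' = k + 1 := by omega
      exact ⟨c, le_rfl, _, _, hr.up hb⟩
    · exact ih _ h₁ h₃

/-- A free cell above one reachable cell and to the right of another one is reachable. -/
theorem reachable_of_between (hG : IsGrid n RX RY) : ∀ (N c k : ℕ), c + k ≤ N →
    ¬ Blk n RX RY c k → (∃ k₀ ≤ k, Reachable n RX RY r cs ps c k₀) →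
    (∃ c₀ ≤ c, Reachable n RX RY r cs ps c₀ k) → Reachable n RX RY r cs ps c k := by
  intro N
  induction N with
  | zero =>
    rintro c k h - ⟨k₀, h₁, h₂⟩ -
    obtain rfl : k₀ = k := by omega
    exact h₂
  | succ N ih =>
    rintro c k h hb ⟨k₀, h₁, h₂⟩ ⟨c₀, h₃, h₄⟩
    rcases Nat.eq_or_lt_of_le h₁ with rfl | h₁
    · exact h₂
    rcases Nat.eq_or_lt_of_le h₃ with rfl | h₃
    · exact h₄
    obtain ⟨d, g, h₂'⟩ := id h₂
    obtain ⟨d', g', h₄'⟩ := id h₄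
    have hb₁ := h₂'.bounds
    have hb₂ := h₄'.bounds
    obtain ⟨c, rfl⟩ : ∃ e, c = e + 1 := ⟨c - 1, by omega⟩
    obtain ⟨k, rfl⟩ : ∃ e, k = e + 1 := ⟨k - 1, by omega⟩
    by_cases hd : Blk n RX RY (c + 1) k
    · by_cases hl : Blk n RX RY c (k + 1)
      -- If the lower and the left neighbour are both blocked while the cell is free, the two
      -- blocking rectangles end at this row and at this column, respectively. Both then contain the
      -- diagonal neighbour, against disjointness.
      · exfalso
        obtain ⟨i, hi, i₁, i₂, i₃, i₄⟩ := hd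
        obtain ⟨j, hj, j₁, j₂, j₃, j₄⟩ := hl
        have e₁ : RX (n + j) = c + 1 := by
          by_contra hne; exact hb ⟨j, hj, by omega, by omega, by omega, by omega⟩
        have e₂ : RY (n + i) = k + 1 := by
          by_contra hne; exact hb ⟨i, hi, by omega, by omega, by omega, by omega⟩
        have hij : i ≠ j := by rintro rfl; omega
        have n₁ : RX i ≠ RX (n + j) := fun h => by
          have := hG.xinj i (by omega) (n + j) (by omega) h
          omega
        have n₂ : RY j ≠ RY (n + i) := fun h => by
          have := hG.yinj j (by omega) (n + i) (by omega) h
          omega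
        have := hG.disj i hi j hj hij
        omega
      -- The left neighbour inherits both assumptions: the staircase to the cell below crosses its
      -- column at or below that row.
      · obtain ⟨j, hj, h⟩ := h₂'.column c (by omega) (by omega)
        obtain ⟨d, g, h⟩ := ih c (k + 1) (by omega) hl ⟨j, by omega, h⟩ ⟨c₀, by omega, h₄⟩
        exact ⟨_, _, h.right hb⟩
    · obtain ⟨j, hj, h⟩ := h₄'.row k (by omega) (by omega)
      refine (ih (c + 1) k (by omega) hd ⟨k₀, by omega, h₂⟩ ⟨j, by omega, h⟩).vfree
        ⟨by omega, fun i i₁ i₂ => ?_⟩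
      rcases Nat.lt_or_ge k i with h₃ | h₃
      · obtain rfl : i = k + 1 := by omega
        exact hb
      · obtain rfl : i = k := by omega
        exact hd

end

/-! ## Ranks and cells on a coordinate axis

The lower bounds of `n` intervals are `K 0, …, K (n - 1)`, and the upper ones are
`K n, …, K (2n - 1)`. -/

/-- The rank of `K j` among `K 0, …, K (m - 1)`, counted from `1`. -/
noncomputable def rank (K : ℕ → ℝ) (m j : ℕ) : ℕ :=
  1 + ((Finset.range m).filter fun i => K i < K j).card

/-- The cell of the axis that contains `x`. -/
noncomputable def cell (K : ℕ → ℝ) (n : ℕ) (x : ℝ) : ℕ :=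
  ((Finset.range n).filter fun i => K i < x).card +
    ((Finset.range n).filter fun i => K (n + i) ≤ x).card

structure Axis (n : ℕ) (K : ℕ → ℝ) : Prop where
  inj : ∀ i < 2 * n, ∀ j < 2 * n, K i = K j → i = j
  lt : ∀ i < n, K i < K (n + i)

/-- `x` lies in the cell `c`. -/
def InCell (n : ℕ) (K : ℕ → ℝ) (x : ℝ) (c : ℕ) : Prop :=
  ∀ i < n, (K i < x ↔ rank K (2 * n) i ≤ c) ∧ (K (n + i) ≤ x ↔ rank K (2 * n) (n + i) ≤ c)

section
variable {n : ℕ} {K : ℕ → ℝ}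

theorem rank_split (j : ℕ) : rank K (2 * n) j =
    1 + (((Finset.range n).filter fun i => K i < K j).card +
      ((Finset.range n).filter fun i => K (n + i) < K j).card) := by
  simp only [rank, Finset.card_filter, two_mul, Finset.sum_range_add]

theorem rank_lt_rank {i j m : ℕ} (hi : i < m) (h : K i < K j) : rank K m i < rank K m j := by
  refine Nat.add_lt_add_left (Finset.card_lt_card ?_) 1
  refine Finset.ssubset_iff_subset_ne.2 ⟨fun l hl => ?_, fun he => ?_⟩
  · simp only [Finset.mem_filter] at hl ⊢
    exact ⟨hl.1, hl.2.trans h⟩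
  · have : i ∈ (Finset.range m).filter fun l => K l < K j := by simp [hi, h]
    rw [← he] at this
    simp at this

theorem rank_le_rank_iff {i j m : ℕ} (hj : j < m) :
    rank K m i ≤ rank K m j ↔ K i ≤ K j := by
  constructor
  · intro h
    by_contra h'
    have := rank_lt_rank hj (not_le.1 h')
    omega
  · intro h
    refine Nat.add_le_add_left (Finset.card_le_card fun l hl => ?_) 1
    simp only [Finset.mem_filter] at hl ⊢
    exact ⟨hl.1, hl.2.trans_le h⟩

theorem rank_bounds {m j : ℕ} (hj : j < m) : 1 ≤ rank K m j ∧ rank K m j ≤ m := by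
  refine ⟨by simp [rank], ?_⟩
  have : ((Finset.range m).filter fun i => K i < K j).card < (Finset.range m).card := by
    refine Finset.card_lt_card (Finset.ssubset_iff_subset_ne.2 ⟨Finset.filter_subset _ _, ?_⟩)
    intro he
    have : j ∈ (Finset.range m).filter fun l => K l < K j := by rw [he]; simpa using hj
    simp at this
  rw [Finset.card_range] at this
  rw [rank]; omega

/-- Lower bounds are counted by a strict and upper bounds by a weak inequality. So the lower end of
an interval belongs to the cell before it and the upper end to the cell after it, and an open
interval is exactly a union of cells. Both equivalences compare the two counts of `cell` with those
of `rank_split`; injectivity excludes ties between lower and upper bounds. -/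
theorem inCell_cell (hK : Axis n K) (x : ℝ) : InCell n K x (cell K n x) := by
  intro i hi
  constructor
  · rw [rank_split, cell]
    constructor
    · intro h
      have h₁ : ((Finset.range n).filter fun j => K j < K i).card <
          ((Finset.range n).filter fun j => K j < x).card := by
        refine Finset.card_lt_card (Finset.ssubset_iff_subset_ne.2 ⟨fun l hl => ?_, fun he => ?_⟩)
        · simp only [Finset.mem_filter] at hl ⊢
          exact ⟨hl.1, hl.2.trans h⟩
        · have : i ∈ (Finset.range n).filter fun l => K l < x := by simp [hi, h]
          rw [← he] at this
          simp at this
      have h₂ : ((Finset.range n).filter fun j => K (n + j) < K i).card ≤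
          ((Finset.range n).filter fun j => K (n + j) ≤ x).card := by
        refine Finset.card_le_card fun l hl => ?_
        simp only [Finset.mem_filter] at hl ⊢
        exact ⟨hl.1, (hl.2.trans h).le⟩
      omega
    · intro h
      by_contra hx
      rw [not_lt] at hx
      have h₁ : ((Finset.range n).filter fun j => K j < x).card ≤
          ((Finset.range n).filter fun j => K j < K i).card := by
        refine Finset.card_le_card fun l hl => ?_
        simp only [Finset.mem_filter] at hl ⊢
        exact ⟨hl.1, hl.2.trans_le hx⟩
      have h₂ : ((Finset.range n).filter fun j => K (n + j) ≤ x).card ≤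
          ((Finset.range n).filter fun j => K (n + j) < K i).card := by
        refine Finset.card_le_card fun l hl => ?_
        simp only [Finset.mem_filter, Finset.mem_range] at hl ⊢
        refine ⟨hl.1, lt_of_le_of_ne (hl.2.trans hx) fun he => ?_⟩
        have := hK.inj (n + l) (by omega) i (by omega) he
        omega
      omega
  · rw [rank_split, cell]
    constructor
    · intro h
      have h₁ : ((Finset.range n).filter fun j => K j < K (n + i)).card ≤
          ((Finset.range n).filter fun j => K j < x).card := by
        refine Finset.card_le_card fun l hl => ?_
        simp only [Finset.mem_filter] at hl ⊢
        exact ⟨hl.1, hl.2.trans_le h⟩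
      have h₂ : ((Finset.range n).filter fun j => K (n + j) < K (n + i)).card <
          ((Finset.range n).filter fun j => K (n + j) ≤ x).card := by
        refine Finset.card_lt_card (Finset.ssubset_iff_subset_ne.2 ⟨fun l hl => ?_, fun he => ?_⟩)
        · simp only [Finset.mem_filter] at hl ⊢
          exact ⟨hl.1, hl.2.le.trans h⟩
        · have : i ∈ (Finset.range n).filter fun l => K (n + l) ≤ x := by simp [hi, h]
          rw [← he] at this
          simp at this
      omega
    · intro h
      by_contra hx
      rw [not_le] at hx
      have h₁ : ((Finset.range n).filter fun j => K j < x).card ≤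
          ((Finset.range n).filter fun j => K j < K (n + i)).card := by
        refine Finset.card_le_card fun l hl => ?_
        simp only [Finset.mem_filter] at hl ⊢
        exact ⟨hl.1, hl.2.trans hx⟩
      have h₂ : ((Finset.range n).filter fun j => K (n + j) ≤ x).card ≤
          ((Finset.range n).filter fun j => K (n + j) < K (n + i)).card := by
        refine Finset.card_le_card fun l hl => ?_
        simp only [Finset.mem_filter] at hl ⊢
        exact ⟨hl.1, hl.2.trans_lt hx⟩
      omega

theorem cell_mono {x y : ℝ} (h : x ≤ y) : cell K n x ≤ cell K n y := by
  refine Nat.add_le_add (Finset.card_le_card fun l hl => ?_) (Finset.card_le_card fun l hl => ?_)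
  · simp only [Finset.mem_filter] at hl ⊢
    exact ⟨hl.1, hl.2.trans_le h⟩
  · simp only [Finset.mem_filter] at hl ⊢
    exact ⟨hl.1, hl.2.trans h⟩

theorem cell_le (x : ℝ) : cell K n x ≤ 2 * n := by
  have h₁ := Finset.card_filter_le (Finset.range n) fun i => K i < x
  have h₂ := Finset.card_filter_le (Finset.range n) fun i => K (n + i) ≤ x
  rw [Finset.card_range] at h₁ h₂
  rw [cell]; omega

/-- Points of different cells are ordered as their cells, if every rank is taken. -/
theorem InCell.lt {x y : ℝ} {c d : ℕ} (hx : InCell n K x c) (hy : InCell n K y d) (h : c < d)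
    (hd : ∃ j < 2 * n, rank K (2 * n) j = d) : x < y := by
  obtain ⟨j, hj, hr⟩ := hd
  rcases Nat.lt_or_ge j n with h' | h'
  · have h₁ := (hx j h').1.not.2 (by omega)
    have h₂ := (hy j h').1.2 (by omega)
    linarith
  · obtain ⟨i, rfl⟩ := Nat.exists_eq_add_of_le h'
    have h₁ := (hx i (by omega)).2.not.2 (by omega)
    have h₂ := (hy i (by omega)).2.2 (by omega)
    linarith

/-- Between the values of rank `c` and `c + 1` is the cell `c`. -/
theorem inCell_of_between {x : ℝ} {c i j : ℕ} (hi : i < 2 * n)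
    (hri : rank K (2 * n) i = c) (hrj : rank K (2 * n) j = c + 1) (h₁ : K i < x) (h₂ : x < K j) :
    InCell n K x c := by
  have h : ∀ l < 2 * n, (K l < x ↔ rank K (2 * n) l ≤ c) ∧ (K l ≤ x ↔ rank K (2 * n) l ≤ c) := by
    intro l hl
    have hle : rank K (2 * n) l ≤ c → K l < x := fun h => by
      rw [← hri, rank_le_rank_iff hi] at h
      linarith
    have hge : ¬ rank K (2 * n) l ≤ c → x < K l := fun h => by
      have : rank K (2 * n) j ≤ rank K (2 * n) l := by omega
      rw [rank_le_rank_iff hl] at this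
      linarith
    refine ⟨⟨fun h => ?_, hle⟩, ⟨fun h => ?_, fun h => (hle h).le⟩⟩
    · by_contra h'; linarith [hge h']
    · by_contra h'; linarith [hge h']
  exact fun l hl => ⟨(h l (by omega)).1, (h (n + l) (by omega)).2⟩

/-- A value `K (n + i)` is the least point of its cell. -/
theorem inCell_upper (hK : Axis n K) {i : ℕ} (hi : i < n) :
    InCell n K (K (n + i)) (rank K (2 * n) (n + i)) := by
  intro j hj
  refine ⟨?_, (rank_le_rank_iff (by omega)).symm⟩
  rw [rank_le_rank_iff (by omega)]
  refine ⟨le_of_lt, fun h => lt_of_le_of_ne h fun he => ?_⟩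
  have := hK.inj j (by omega) (n + i) (by omega) he
  omega

end

/-! ## The grid of a rectangular domain -/

/-- The `x`-coordinates of the left sides, followed by those of the right sides. -/
noncomputable def keyX {n : ℕ} (R : Fin n → Rect) (i : ℕ) : ℝ :=
  if h : i < n then (R ⟨i, h⟩).x₁ else if h : i - n < n then (R ⟨i - n, h⟩).x₂ else 0

/-- The `y`-coordinates of the bottom sides, followed by those of the top sides. -/
noncomputable def keyY {n : ℕ} (R : Fin n → Rect) (i : ℕ) : ℝ :=
  if h : i < n then (R ⟨i, h⟩).y₁ else if h : i - n < n then (R ⟨i - n, h⟩).y₂ else 0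

noncomputable def gridX {n : ℕ} (R : Fin n → Rect) : ℕ → ℕ := rank (keyX R) (2 * n)

noncomputable def gridY {n : ℕ} (R : Fin n → Rect) : ℕ → ℕ := rank (keyY R) (2 * n)

noncomputable def cellX {n : ℕ} (R : Fin n → Rect) : ℝ → ℕ := cell (keyX R) n

noncomputable def cellY {n : ℕ} (R : Fin n → Rect) : ℝ → ℕ := cell (keyY R) n

section
variable {n : ℕ} {R : Fin n → Rect}

theorem keyX_low (i : Fin n) : keyX R i = (R i).x₁ := by simp [keyX]
theorem keyX_high (i : Fin n) : keyX R (n + i) = (R i).x₂ := by simp [keyX]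
theorem keyY_low (i : Fin n) : keyY R i = (R i).y₁ := by simp [keyY]
theorem keyY_high (i : Fin n) : keyY R (n + i) = (R i).y₂ := by simp [keyY]

theorem axisX (hgp : GeneralPosition R) : Axis n (keyX R) := by
  refine ⟨fun i hi j hj he => ?_, fun i hi => ?_⟩
  · have hcase : ∀ l < 2 * n, (∃ a : Fin n, l = a) ∨ ∃ a : Fin n, l = n + a := fun l hl => by
      rcases Nat.lt_or_ge l n with h | h
      · exact Or.inl ⟨⟨l, h⟩, rfl⟩
      · exact Or.inr ⟨⟨l - n, by omega⟩, by simp; omega⟩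
    rcases hcase i hi with ⟨a, rfl⟩ | ⟨a, rfl⟩ <;> rcases hcase j hj with ⟨b, rfl⟩ | ⟨b, rfl⟩ <;>
      simp only [keyX_low, keyX_high] at he <;> by_cases hab : a = b
    · rw [hab]
    · exact absurd he (hgp a b hab).1.1
    · subst hab; exact absurd he (R a).hx.ne
    · exact absurd he (hgp a b hab).1.2.1
    · subst hab; exact absurd he (R a).hx.ne'
    · exact absurd he (hgp a b hab).1.2.2.1
    · rw [hab]
    · exact absurd he (hgp a b hab).1.2.2.2
  · have := (R ⟨i, hi⟩).hx
    rwa [← keyX_low, ← keyX_high] at this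

theorem axisY (hgp : GeneralPosition R) : Axis n (keyY R) := by
  refine ⟨fun i hi j hj he => ?_, fun i hi => ?_⟩
  · have hcase : ∀ l < 2 * n, (∃ a : Fin n, l = a) ∨ ∃ a : Fin n, l = n + a := fun l hl => by
      rcases Nat.lt_or_ge l n with h | h
      · exact Or.inl ⟨⟨l, h⟩, rfl⟩
      · exact Or.inr ⟨⟨l - n, by omega⟩, by simp; omega⟩
    rcases hcase i hi with ⟨a, rfl⟩ | ⟨a, rfl⟩ <;> rcases hcase j hj with ⟨b, rfl⟩ | ⟨b, rfl⟩ <;>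
      simp only [keyY_low, keyY_high] at he <;> by_cases hab : a = b
    · rw [hab]
    · exact absurd he (hgp a b hab).2.1
    · subst hab; exact absurd he (R a).hy.ne
    · exact absurd he (hgp a b hab).2.2.1
    · subst hab; exact absurd he (R a).hy.ne'
    · exact absurd he (hgp a b hab).2.2.2.1
    · rw [hab]
    · exact absurd he (hgp a b hab).2.2.2.2
  · have := (R ⟨i, hi⟩).hy
    rwa [← keyY_low, ← keyY_high] at this

/-- Otherwise a point between the larger lower bounds and the smaller upper bounds lies in both
rectangles. -/
theorem Rect.separated {a b : Rect} (h : Disjoint a.toSet b.toSet) :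
    a.x₂ ≤ b.x₁ ∨ b.x₂ ≤ a.x₁ ∨ a.y₂ ≤ b.y₁ ∨ b.y₂ ≤ a.y₁ := by
  by_contra hc
  push Not at hc
  obtain ⟨h₁, h₂, h₃, h₄⟩ := hc
  obtain ⟨u, hu₁, hu₂⟩ := exists_between (a₁ := max a.x₁ b.x₁) (a₂ := min a.x₂ b.x₂)
    (by simp [a.hx, b.hx, h₁, h₂])
  obtain ⟨w, hw₁, hw₂⟩ := exists_between (a₁ := max a.y₁ b.y₁) (a₂ := min a.y₂ b.y₂)
    (by simp [a.hy, b.hy, h₃, h₄])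
  simp only [max_lt_iff, lt_min_iff] at hu₁ hu₂ hw₁ hw₂
  exact Set.disjoint_left.1 h (show (u, w) ∈ a.toSet from
    ⟨⟨hu₁.1, hu₂.1⟩, ⟨hw₁.1, hw₂.1⟩⟩) ⟨⟨hu₁.2, hu₂.2⟩, ⟨hw₁.2, hw₂.2⟩⟩

/-- Disjoint open rectangles may touch, but general position makes the separation strict, and strict
inequalities of coordinates pass to their ranks. -/
theorem isGrid (hd : ∀ i j, i ≠ j → Disjoint (R i).toSet (R j).toSet)
    (hgp : GeneralPosition R) : IsGrid n (gridX R) (gridY R) := by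
  have hX := axisX hgp
  have hY := axisY hgp
  have hinj : ∀ {K : ℕ → ℝ}, Axis n K → ∀ i < 2 * n, ∀ j < 2 * n,
      rank K (2 * n) i = rank K (2 * n) j → i = j := fun hK i hi j hj h =>
    hK.inj i hi j hj (le_antisymm ((rank_le_rank_iff hj).1 h.le) ((rank_le_rank_iff hi).1 h.ge))
  refine ⟨fun i hi => rank_bounds hi, fun i hi => rank_bounds hi, hinj hX, hinj hY,
    fun i hi => rank_lt_rank (by omega) (hX.lt i hi),
    fun i hi => rank_lt_rank (by omega) (hY.lt i hi), fun i hi j hj hij => ?_⟩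
  have hij' : (⟨i, hi⟩ : Fin n) ≠ ⟨j, hj⟩ := fun h => hij (by simpa using h)
  have hg := hgp _ _ hij'
  have hx : ∀ {a b : ℕ}, a < n → keyX R (n + a) < keyX R b → gridX R (n + a) < gridX R b :=
    fun ha h => rank_lt_rank (by omega) h
  have hy : ∀ {a b : ℕ}, a < n → keyY R (n + a) < keyY R b → gridY R (n + a) < gridY R b :=
    fun ha h => rank_lt_rank (by omega) h
  rcases Rect.separated (hd _ _ hij') with h | h | h | h
  · refine Or.inl (hx hi ?_)
    rw [keyX_high ⟨i, hi⟩, keyX_low ⟨j, hj⟩]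
    exact lt_of_le_of_ne h hg.1.2.2.1
  · refine Or.inr (Or.inl (hx hj ?_))
    rw [keyX_high ⟨j, hj⟩, keyX_low ⟨i, hi⟩]
    exact lt_of_le_of_ne h hg.1.2.1.symm
  · refine Or.inr (Or.inr (Or.inl (hy hi ?_)))
    rw [keyY_high ⟨i, hi⟩, keyY_low ⟨j, hj⟩]
    exact lt_of_le_of_ne h hg.2.2.2.1
  · refine Or.inr (Or.inr (Or.inr (hy hj ?_)))
    rw [keyY_high ⟨j, hj⟩, keyY_low ⟨i, hi⟩]
    exact lt_of_le_of_ne h hg.2.2.1.symm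

theorem mem_domain {p : ℝ × ℝ} : p ∈ domain R ↔
    ∀ i, ¬ ((R i).x₁ < p.1 ∧ p.1 < (R i).x₂ ∧ (R i).y₁ < p.2 ∧ p.2 < (R i).y₂) := by
  simp only [domain, Set.mem_compl_iff, Set.mem_iUnion, not_exists, Rect.toSet, Set.mem_prod,
    Set.mem_Ioo, and_assoc]

theorem InCell.lowX {x : ℝ} {c : ℕ} (h : InCell n (keyX R) x c) (i : Fin n) :
    (R i).x₁ < x ↔ gridX R i ≤ c := by rw [← keyX_low]; exact (h i i.2).1
theorem InCell.highX {x : ℝ} {c : ℕ} (h : InCell n (keyX R) x c) (i : Fin n) :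
    x < (R i).x₂ ↔ c < gridX R (n + i) := by
  rw [← keyX_high, ← not_le, ← not_le, not_iff_not]; exact (h i i.2).2
theorem InCell.lowY {x : ℝ} {c : ℕ} (h : InCell n (keyY R) x c) (i : Fin n) :
    (R i).y₁ < x ↔ gridY R i ≤ c := by rw [← keyY_low]; exact (h i i.2).1
theorem InCell.highY {x : ℝ} {c : ℕ} (h : InCell n (keyY R) x c) (i : Fin n) :
    x < (R i).y₂ ↔ c < gridY R (n + i) := by
  rw [← keyY_high, ← not_le, ← not_le, not_iff_not]; exact (h i i.2).2

theorem mem_domain_iff_not_blk {x y : ℝ} {c k : ℕ} (hx : InCell n (keyX R) x c)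
    (hy : InCell n (keyY R) y k) : (x, y) ∈ domain R ↔ ¬ Blk n (gridX R) (gridY R) c k := by
  rw [mem_domain, Blk]
  simp only [hx.lowX, hx.highX, hy.lowY, hy.highY]
  constructor
  · rintro h ⟨i, hi, h'⟩; exact h ⟨i, hi⟩ h'
  · intro h i h'; exact h ⟨i, i.2, h'⟩

/-! ### Segments in the domain and free runs of cells -/

theorem segment_horizontal {x x' y : ℝ} (h : x ≤ x') {D : Set (ℝ × ℝ)} :
    segment ℝ (x, y) (x', y) ⊆ D ↔ ∀ u, x ≤ u → u ≤ x' → (u, y) ∈ D := by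
  rw [← Prod.image_mk_segment_left, segment_eq_Icc h, Set.image_subset_iff]
  exact ⟨fun h u h₁ h₂ => h ⟨h₁, h₂⟩, fun h u hu => h u hu.1 hu.2⟩

theorem segment_vertical {x y y' : ℝ} (h : y ≤ y') {D : Set (ℝ × ℝ)} :
    segment ℝ (x, y) (x, y') ⊆ D ↔ ∀ u, y ≤ u → u ≤ y' → (x, u) ∈ D := by
  rw [← Prod.image_mk_segment_right, segment_eq_Icc h, Set.image_subset_iff]
  exact ⟨fun h u h₁ h₂ => h ⟨h₁, h₂⟩, fun h u hu => h u hu.1 hu.2⟩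

/-- A rectangle that meets the segment blocks a cell of the run: its own first column if that lies
in the run, and the first column of the run otherwise. -/
theorem HFree.mem_domain {x x' y u : ℝ} {c c' k : ℕ} (h : HFree n (gridX R) (gridY R) k c c')
    (hx : InCell n (keyX R) x c) (hx' : InCell n (keyX R) x' c') (hy : InCell n (keyY R) y k)
    (h₁ : x ≤ u) (h₂ : u ≤ x') : (u, y) ∈ domain R := by
  rw [MinLinkPath.mem_domain]
  rintro i ⟨i₁, i₂, i₃, i₄⟩
  simp only at i₁ i₂ i₃ i₄
  have e₁ := (hx'.lowX i).1 (by linarith)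
  have e₂ := (hx.highX i).1 (by linarith)
  rw [hy.lowY] at i₃
  rw [hy.highY] at i₄
  have := h.1
  rcases le_total c (gridX R i) with h' | h'
  · have hlt : gridX R i < gridX R (n + i) := rank_lt_rank (by omega) (by
      rw [keyX_low, keyX_high]; exact (R i).hx)
    exact h.2 (gridX R i) h' e₁ ⟨i, i.2, le_rfl, hlt, i₃, i₄⟩
  · exact h.2 c le_rfl this ⟨i, i.2, h', e₂, i₃, i₄⟩

theorem VFree.mem_domain {x y y' u : ℝ} {c k k' : ℕ} (h : VFree n (gridX R) (gridY R) c k k')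
    (hx : InCell n (keyX R) x c) (hy : InCell n (keyY R) y k) (hy' : InCell n (keyY R) y' k')
    (h₁ : y ≤ u) (h₂ : u ≤ y') : (x, u) ∈ domain R := by
  rw [MinLinkPath.mem_domain]
  rintro i ⟨i₁, i₂, i₃, i₄⟩
  simp only at i₁ i₂ i₃ i₄
  have e₁ := (hy'.lowY i).1 (by linarith)
  have e₂ := (hy.highY i).1 (by linarith)
  rw [hx.lowX] at i₁
  rw [hx.highX] at i₂
  have := h.1
  rcases le_total k (gridY R i) with h' | h'
  · have hlt : gridY R i < gridY R (n + i) := rank_lt_rank (by omega) (by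
      rw [keyY_low, keyY_high]; exact (R i).hy)
    exact h.2 (gridY R i) h' e₁ ⟨i, i.2, i₁, i₂, le_rfl, hlt⟩
  · exact h.2 k le_rfl this ⟨i, i.2, i₁, i₂, h', e₂⟩

theorem exists_between_of_overlap {a b x x' : ℝ} (hab : a < b) (h : x ≤ x') (h₁ : a < x')
    (h₂ : x < b) : ∃ u, x ≤ u ∧ u ≤ x' ∧ a < u ∧ u < b := by
  rcases lt_or_ge a x with h' | h'
  · exact ⟨x, le_rfl, h, h', h₂⟩
  · obtain ⟨u, h₃, h₄⟩ := exists_between (a₁ := a) (a₂ := min x' b) (by simp [h₁, hab])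
    rw [lt_min_iff] at h₄
    exact ⟨u, by linarith, h₄.1.le, h₃, h₄.2⟩

/-- A blocked cell of the run gives a rectangle whose open x-range overlaps `[x, x']`, possibly
without containing an end; `exists_between_of_overlap` supplies a point of the segment inside it. -/
theorem hfree_of_mem_domain (hgp : GeneralPosition R) {x x' y : ℝ} (h : x ≤ x')
    (hD : ∀ u, x ≤ u → u ≤ x' → (u, y) ∈ domain R) :
    HFree n (gridX R) (gridY R) (cellY R y) (cellX R x) (cellX R x') := by
  refine ⟨cell_mono h, ?_⟩
  rintro d h₁ h₂ ⟨i, hi, i₁, i₂, i₃, i₄⟩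
  have hx := inCell_cell (axisX hgp) x
  have hx' := inCell_cell (axisX hgp) x'
  have hy := inCell_cell (axisY hgp) y
  obtain ⟨u, u₁, u₂, u₃, u₄⟩ := exists_between_of_overlap (R ⟨i, hi⟩).hx h
    ((hx'.lowX ⟨i, hi⟩).2 (i₁.trans h₂)) ((hx.highX ⟨i, hi⟩).2 (h₁.trans_lt i₂))
  exact mem_domain.1 (hD u u₁ u₂) ⟨i, hi⟩
    ⟨u₃, u₄, (hy.lowY ⟨i, hi⟩).2 i₃, (hy.highY ⟨i, hi⟩).2 i₄⟩

theorem vfree_of_mem_domain (hgp : GeneralPosition R) {x y y' : ℝ} (h : y ≤ y')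
    (hD : ∀ u, y ≤ u → u ≤ y' → (x, u) ∈ domain R) :
    VFree n (gridX R) (gridY R) (cellX R x) (cellY R y) (cellY R y') := by
  refine ⟨cell_mono h, ?_⟩
  rintro d h₁ h₂ ⟨i, hi, i₁, i₂, i₃, i₄⟩
  have hx := inCell_cell (axisX hgp) x
  have hy := inCell_cell (axisY hgp) y
  have hy' := inCell_cell (axisY hgp) y'
  obtain ⟨u, u₁, u₂, u₃, u₄⟩ := exists_between_of_overlap (R ⟨i, hi⟩).hy h
    ((hy'.lowY ⟨i, hi⟩).2 (i₃.trans h₂)) ((hy.highY ⟨i, hi⟩).2 (h₁.trans_lt i₄))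
  exact mem_domain.1 (hD u u₁ u₂) ⟨i, hi⟩
    ⟨(hx.lowX ⟨i, hi⟩).2 i₁, (hx.highX ⟨i, hi⟩).2 i₂, u₃, u₄⟩

/-! ## Points of `D_xy` are reachable -/

/-- A rightward piece is a free run by definition. The piece upwards along the left side of `R i` is
free since a rectangle containing one of its points in its interior would overlap `R i`. Hence cells
along the whole path are reachable, and the path never goes left or down. -/
theorem StartRU.reachable (hd : ∀ i j, i ≠ j → Disjoint (R i).toSet (R j).toSet)
    (hgp : GeneralPosition R) {r cs ps : ℕ} {s : ℝ × ℝ}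
    (hs : Reachable n (gridX R) (gridY R) r cs ps (cellX R s.1) (cellY R s.2)) {z : ℝ × ℝ}
    (hz : z ∈ pathRU R s) :
    s.1 ≤ z.1 ∧ s.2 ≤ z.2 ∧
      Reachable n (gridX R) (gridY R) r cs ps (cellX R z.1) (cellY R z.2) := by
  have hstep : ∀ q : ℝ × ℝ, ∀ i, HitsRight R q i → ∀ y, q.2 ≤ y → y ≤ (R i).y₂ →
      Reachable n (gridX R) (gridY R) r cs ps (cellX R q.1) (cellY R q.2) →
      Reachable n (gridX R) (gridY R) r cs ps (cellX R (R i).x₁) (cellY R y) := by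
    rintro ⟨qx, qy⟩ i ⟨⟨h₁, h₂⟩, h₃, h₄⟩ y hy₁ hy₂ h
    simp only at h₁ h₂ h₃ hy₁
    refine (h.hfree (hfree_of_mem_domain hgp h₃ ((segment_horizontal h₃).1 h₄))).vfree
      (vfree_of_mem_domain hgp hy₁ fun u hu₁ hu₂ => mem_domain.2 ?_)
    rintro j ⟨j₁, j₂, j₃, j₄⟩
    simp only at j₁ j₂ j₃ j₄
    have hij : i ≠ j := by rintro rfl; exact lt_irrefl _ j₁
    have := (R i).hx
    rcases Rect.separated (hd i j hij) with h | h | h | h <;> linarith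
  have hstart : ∀ q, StartRU R s q → s.1 ≤ q.1 ∧ s.2 ≤ q.2 ∧
      Reachable n (gridX R) (gridY R) r cs ps (cellX R q.1) (cellY R q.2) := by
    intro q hq
    induction hq with
    | first => exact ⟨le_rfl, le_rfl, hs⟩
    | next q i _ hh ih =>
      have h₁ := hh.1.2.le
      exact ⟨ih.1.trans hh.2.1, ih.2.1.trans h₁, hstep q i hh _ h₁ le_rfl ih.2.2⟩
  obtain ⟨q, hq, ⟨h₁, h₂, h₃⟩ | ⟨i, hh, h₁, h₂, h₃⟩⟩ := hz
  · obtain ⟨e₁, e₂, e₃⟩ := hstart q hq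
    refine ⟨e₁.trans h₂, h₁ ▸ e₂, ?_⟩
    obtain ⟨zx, zy⟩ := z
    obtain ⟨qx, qy⟩ := q
    simp only at h₁ h₂ e₃ ⊢
    subst h₁
    exact e₃.hfree (hfree_of_mem_domain hgp h₂ ((segment_horizontal h₂).1 h₃))
  · obtain ⟨e₁, e₂, e₃⟩ := hstart q hq
    refine ⟨h₁ ▸ e₁.trans hh.2.1, e₂.trans h₂, ?_⟩
    rw [h₁]
    exact hstep q i hh _ h₂ h₃ e₃

theorem StartUR.reachable (hd : ∀ i j, i ≠ j → Disjoint (R i).toSet (R j).toSet)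
    (hgp : GeneralPosition R) {r cs ps : ℕ} {s : ℝ × ℝ}
    (hs : Reachable n (gridX R) (gridY R) r cs ps (cellX R s.1) (cellY R s.2)) {z : ℝ × ℝ}
    (hz : z ∈ pathUR R s) :
    Reachable n (gridX R) (gridY R) r cs ps (cellX R z.1) (cellY R z.2) := by
  have hstep : ∀ q : ℝ × ℝ, ∀ i, HitsUp R q i → ∀ x, q.1 ≤ x → x ≤ (R i).x₂ →
      Reachable n (gridX R) (gridY R) r cs ps (cellX R q.1) (cellY R q.2) →
      Reachable n (gridX R) (gridY R) r cs ps (cellX R x) (cellY R (R i).y₁) := by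
    rintro ⟨qx, qy⟩ i ⟨⟨h₁, h₂⟩, h₃, h₄⟩ x hx₁ hx₂ h
    simp only at h₁ h₂ h₃ hx₁
    refine (h.vfree (vfree_of_mem_domain hgp h₃ ((segment_vertical h₃).1 h₄))).hfree
      (hfree_of_mem_domain hgp hx₁ fun u hu₁ hu₂ => mem_domain.2 ?_)
    rintro j ⟨j₁, j₂, j₃, j₄⟩
    simp only at j₁ j₂ j₃ j₄
    have hij : i ≠ j := by rintro rfl; exact lt_irrefl _ j₃
    have := (R i).hy
    rcases Rect.separated (hd i j hij) with h | h | h | h <;> linarith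
  have hstart : ∀ q, StartUR R s q →
      Reachable n (gridX R) (gridY R) r cs ps (cellX R q.1) (cellY R q.2) := by
    intro q hq
    induction hq with
    | first => exact hs
    | next q i _ hh ih => exact hstep q i hh _ hh.1.2.le le_rfl ih
  obtain ⟨q, hq, ⟨h₁, h₂, h₃⟩ | ⟨i, hh, h₁, h₂, h₃⟩⟩ := hz
  · have e₃ := hstart q hq
    obtain ⟨zx, zy⟩ := z
    obtain ⟨qx, qy⟩ := q
    simp only at h₁ h₂ e₃ ⊢
    subst h₁
    exact e₃.vfree (vfree_of_mem_domain hgp h₂ ((segment_vertical h₂).1 h₃))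
  · rw [h₁]
    exact hstep q i hh _ h₂ h₃ (hstart q hq)

/-- By definition of `Dxy`, a point of the one path is below `t` and a point of the other is to the
left of it. Both are reachable, and `reachable_of_between` fills the region between. Either
direction of the first run is possible because runs may have length zero. -/
theorem reachable_of_mem_Dxy (hd : ∀ i j, i ≠ j → Disjoint (R i).toSet (R j).toSet)
    (hgp : GeneralPosition R) {S : VSeg} {t : ℝ × ℝ} (ht : t ∈ Dxy R S) {r : ℕ} (hr : r ≤ 1) :
    S.x ≤ t.1 ∧ S.y₂ ≤ t.2 ∧ Reachable n (gridX R) (gridY R) r (cellX R S.x) (cellY R S.y₂)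
      (cellX R t.1) (cellY R t.2) := by
  have hs : Reachable n (gridX R) (gridY R) r (cellX R S.x) (cellY R S.y₂)
      (cellX R S.top.1) (cellY R S.top.2) := by
    rcases Nat.le_one_iff_eq_zero_or_eq_one.1 hr with rfl | rfl
    · exact ⟨_, _, .startH rfl⟩
    · exact ⟨_, _, .startV rfl⟩
  obtain ⟨h₁, ⟨z, hz, hz₁, hz₂⟩, ⟨z', hz', hz₁', hz₂'⟩⟩ := ht
  obtain ⟨e₁, e₂, e₃⟩ := StartRU.reachable hd hgp hs hz
  have hur := StartUR.reachable hd hgp hs hz'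
  refine ⟨hz₁ ▸ e₁, e₂.trans hz₂, ?_⟩
  rw [hz₁] at e₃
  rw [hz₁'] at hur
  exact reachable_of_between (isGrid hd hgp) _ _ _ le_rfl
    ((mem_domain_iff_not_blk (inCell_cell (axisX hgp) _) (inCell_cell (axisY hgp) _)).1 h₁)
    ⟨_, cell_mono hz₂, e₃⟩ ⟨_, cell_mono hz₂', hur⟩

/-! ## Shortest paths are staircases -/

/-- A link that leads rightwards or upwards. -/
def Link (D : Set (ℝ × ℝ)) (p q : ℝ × ℝ) : Prop :=
  (p.1 = q.1 ∨ p.2 = q.2) ∧ segment ℝ p q ⊆ D ∧ p.1 ≤ q.1 ∧ p.2 ≤ q.2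

/-- A rectilinear path that leads rightwards and upwards. -/
def Stair (D : Set (ℝ × ℝ)) (s t : ℝ × ℝ) (π : List (ℝ × ℝ)) : Prop :=
  π.head? = some s ∧ π.getLast? = some t ∧ (∀ p ∈ π, p ∈ D) ∧ π.IsChain (Link D)

theorem dist_le_pathLength {t : ℝ × ℝ} : ∀ (l : List (ℝ × ℝ)) (p : ℝ × ℝ),
    (p :: l).getLast? = some t → |t.1 - p.1| + |t.2 - p.2| ≤ pathLength (p :: l)
  | [], p, h => by
    simp only [List.getLast?_singleton, Option.some.injEq] at h
    subst h; simp [pathLength]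
  | q :: l, p, h => by
    rw [List.getLast?_cons_cons] at h
    have h₁ := dist_le_pathLength l q h
    have h₂ := abs_sub_le t.1 q.1 p.1
    have h₃ := abs_sub_le t.2 q.2 p.2
    rw [pathLength]
    linarith

theorem pathLength_of_chain {D : Set (ℝ × ℝ)} {t : ℝ × ℝ} : ∀ (l : List (ℝ × ℝ)) (p : ℝ × ℝ),
    (p :: l).getLast? = some t → (p :: l).IsChain (Link D) →
    pathLength (p :: l) = (t.1 - p.1) + (t.2 - p.2)
  | [], p, h, _ => by
    simp only [List.getLast?_singleton, Option.some.injEq] at h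
    subst h; simp [pathLength]
  | q :: l, p, h, hc => by
    rw [List.getLast?_cons_cons] at h
    rw [List.isChain_cons_cons] at hc
    have h₁ := pathLength_of_chain l q h hc.2
    rw [pathLength, h₁, abs_of_nonneg (by linarith [hc.1.2.2.1]),
      abs_of_nonneg (by linarith [hc.1.2.2.2])]
    ring

/-- The triangle inequality applied to the rest of the path leaves no room for a link leading
leftwards or downwards. -/
theorem chain_of_pathLength {D : Set (ℝ × ℝ)} {t : ℝ × ℝ} : ∀ (l : List (ℝ × ℝ)) (p : ℝ × ℝ),
    (p :: l).getLast? = some t →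
    (p :: l).IsChain (fun p q => (p.1 = q.1 ∨ p.2 = q.2) ∧ segment ℝ p q ⊆ D) →
    pathLength (p :: l) ≤ (t.1 - p.1) + (t.2 - p.2) → (p :: l).IsChain (Link D)
  | [], p, _, _, _ => List.isChain_singleton p
  | q :: l, p, h, hc, hl => by
    rw [List.getLast?_cons_cons] at h
    rw [List.isChain_cons_cons] at hc ⊢
    have h₁ := dist_le_pathLength l q h
    have h₂ := le_abs_self (t.1 - q.1)
    have h₃ := le_abs_self (t.2 - q.2)
    have h₄ := le_abs_self (q.1 - p.1)
    have h₅ := le_abs_self (q.2 - p.2)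
    have h₆ := abs_nonneg (q.1 - p.1)
    have h₇ := abs_nonneg (q.2 - p.2)
    rw [pathLength] at hl
    exact ⟨⟨hc.1.1, hc.1.2, by linarith, by linarith⟩,
      chain_of_pathLength l q h hc.2 (by linarith)⟩

/-- All of `S` lies on one vertical line, and its top is the point nearest to `t` in the L1 metric.
So staircases from the top attain the lower bound for the length, and a path that attains it must
start at the top and be a staircase. Shortest paths are thus exactly staircases, and only links
remain to be compared. -/
theorem isMinLinkShortestPath_of_stair {D : Set (ℝ × ℝ)} {S : VSeg} {t : ℝ × ℝ}
    (h₁ : S.x ≤ t.1) (h₂ : S.y₂ ≤ t.2) {π : List (ℝ × ℝ)} (hπ : Stair D S.top t π)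
    (hmin : ∀ π', Stair D S.top t π' → links π ≤ links π') :
    IsMinLinkShortestPath D S.toSet {t} π := by
  have hlen : pathLength π = (t.1 - S.x) + (t.2 - S.y₂) := by
    obtain ⟨e₁, e₂, e₃, e₄⟩ := hπ
    match π, e₁ with
    | p :: l, e₁ =>
      obtain rfl : p = S.top := by simpa using e₁
      exact pathLength_of_chain l S.top e₂ e₄
  have htop : S.top ∈ S.toSet := by simp [VSeg.top, VSeg.toSet, S.hy.le]
  have hpath : IsRectPath D S.toSet {t} π :=
    ⟨⟨_, htop, hπ.1⟩, ⟨t, rfl, hπ.2.1⟩, hπ.2.2.1, hπ.2.2.2.imp fun _ _ h => ⟨h.1, h.2.1⟩⟩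
  refine ⟨⟨hpath, ?_⟩, ?_⟩
  · rintro π' ⟨⟨p, hp, hh⟩, ⟨q, rfl, hq⟩, -, -⟩
    match π', hh with
    | p' :: l, hh =>
      obtain rfl : p' = p := by simpa using hh
      have h₃ := dist_le_pathLength l p' hq
      have h₄ := le_abs_self (q.1 - p'.1)
      have h₅ := le_abs_self (q.2 - p'.2)
      have h₆ : p'.1 = S.x := hp.1
      have h₇ : p'.2 ≤ S.y₂ := hp.2.2
      rw [hlen]
      linarith
  · rintro π' ⟨⟨⟨p, hp, hh⟩, ⟨q, rfl, hq⟩, hD, hc⟩, hs⟩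
    refine hmin π' ?_
    have hle := hs π hpath
    match π', hh with
    | p' :: l, hh =>
      obtain rfl : p' = p := by simpa using hh
      have h₃ := dist_le_pathLength l p' hq
      have h₄ := le_abs_self (q.1 - p'.1)
      have h₅ := le_abs_self (q.2 - p'.2)
      have h₆ : p'.1 = S.x := hp.1
      have h₇ : p'.2 ≤ S.y₂ := hp.2.2
      have h₈ : p' = S.top := Prod.ext h₆ (by simp only [VSeg.top]; linarith)
      refine ⟨by simp [h₈], hq, hD, chain_of_pathLength l p' hq hc ?_⟩
      rw [h₈] at hle ⊢
      exact hle.trans hlen.le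

/-! ## Staircases and reachable cells -/

/-- The number of links of a staircase with `g` vertical runs. -/
def linkCount (r : ℕ) (d : Bool) (g : ℕ) : ℕ := if d then 2 * g - r else 2 * g + 1 - r

/-- The staircase has arrived at `p`. -/
def Arrived (R : Fin n → Rect) (s p : ℝ × ℝ) (r : ℕ) (d : Bool) (g : ℕ) : Prop :=
  Reach n (gridX R) (gridY R) r (cellX R s.1) (cellY R s.2) d g (cellX R p.1) (cellY R p.2) ∧
    r ≤ 1 ∧ r ≤ g ∧ (d = true → 1 ≤ g ∧ (r = 1 → g = 1 → p.1 = s.1))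

theorem Arrived.horizontal (hgp : GeneralPosition R) {s p q : ℝ × ℝ} {r g : ℕ} {d : Bool}
    (h : Arrived R s p r d g) (hl : Link (domain R) p q) (hy : p.2 = q.2) :
    Arrived R s q r false g := by
  obtain ⟨px, py⟩ := p
  obtain ⟨qx, qy⟩ := q
  simp only at hy
  subst hy
  have hx : px ≤ qx := hl.2.2.1
  have hf := hfree_of_mem_domain hgp hx ((segment_horizontal hx).1 hl.2.1)
  refine ⟨?_, h.2.1, h.2.2.1, by simp⟩
  cases d with
  | false => exact h.1.hfree hf
  | true => exact h.1.turnH.hfree hf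

theorem Arrived.vertical (hgp : GeneralPosition R) {s p q : ℝ × ℝ} {r g : ℕ} {d : Bool}
    (h : Arrived R s p r d g) (hl : Link (domain R) p q) (hx : p.1 = q.1) :
    Arrived R s q r true (if d then g else g + 1) := by
  obtain ⟨px, py⟩ := p
  obtain ⟨qx, qy⟩ := q
  simp only at hx
  subst hx
  have hy : py ≤ qy := hl.2.2.2
  have hf := vfree_of_mem_domain hgp hy ((segment_vertical hy).1 hl.2.1)
  cases d with
  | false => exact ⟨h.1.turnV.vfree hf, h.2.1, by have := h.2.2.1; simp; omega,
      fun _ => ⟨by simp, fun h₁ h₂ => by have := h.2.2.1; simp at h₂; omega⟩⟩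
  | true => exact ⟨h.1.vfree hf, h.2⟩

/-- A link that continues the current direction does not raise `linkCount`, and one that turns
raises it by one. So the count never exceeds the number of links used, even if successive links are
parallel. -/
theorem Arrived.chain (hgp : GeneralPosition R) {s t : ℝ × ℝ} {r : ℕ} :
    ∀ (l : List (ℝ × ℝ)) (p : ℝ × ℝ) (d : Bool) (g : ℕ), (p :: l).getLast? = some t →
    (p :: l).IsChain (Link (domain R)) → Arrived R s p r d g →
    ∃ d' g', Arrived R s t r d' g' ∧ linkCount r d' g' ≤ linkCount r d g + l.length
  | [], p, d, g, h, _, ha => by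
    simp only [List.getLast?_singleton, Option.some.injEq] at h
    subst h; exact ⟨d, g, ha, by simp⟩
  | q :: l, p, d, g, h, hc, ha => by
    rw [List.getLast?_cons_cons] at h
    rw [List.isChain_cons_cons] at hc
    have hr := ha.2.2.1
    have hr' := ha.2.1
    have hg := ha.2.2.2
    rcases hc.1.1 with hx | hy
    · obtain ⟨d', g', h₁, h₂⟩ := Arrived.chain hgp l q _ _ h hc.2 (ha.vertical hgp hc.1 hx)
      refine ⟨d', g', h₁, h₂.trans ?_⟩
      cases d <;> simp [linkCount] <;> omega
    · obtain ⟨d', g', h₁, h₂⟩ := Arrived.chain hgp l q _ _ h hc.2 (ha.horizontal hgp hc.1 hy)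
      refine ⟨d', g', h₁, h₂.trans ?_⟩
      cases d <;> simp [linkCount] <;> omega

/-- The first link decides `r`. After it the count is one: no vertical run and a horizontal end, or
one vertical run and a vertical end. -/
theorem Stair.arrived (hgp : GeneralPosition R) {s t : ℝ × ℝ} (hst : s ≠ t) {π : List (ℝ × ℝ)}
    (hπ : Stair (domain R) s t π) :
    ∃ r d g, Arrived R s t r d g ∧ linkCount r d g ≤ links π := by
  obtain ⟨h₁, h₂, -, h₄⟩ := hπ
  match π, h₁ with
  | p :: [], h₁ =>
    exact absurd (by simpa using h₁.symm.trans h₂) hst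
  | p :: q :: l, h₁ =>
    obtain rfl : p = s := by simpa using h₁
    rw [List.getLast?_cons_cons] at h₂
    rw [List.isChain_cons_cons] at h₄
    rcases h₄.1.1 with hx | hy
    · have ha : Arrived R p p 1 true 1 := ⟨.startV rfl, le_rfl, le_rfl, by simp⟩
      obtain ⟨d', g', h₅, h₆⟩ := Arrived.chain hgp l q _ _ h₂ h₄.2 (ha.vertical hgp h₄.1 hx)
      exact ⟨1, d', g', h₅, h₆.trans (by simp [linkCount, links]; omega)⟩
    · have ha : Arrived R p p 0 false 0 := ⟨.startH rfl, by simp, le_rfl, by simp⟩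
      obtain ⟨d', g', h₅, h₆⟩ := Arrived.chain hgp l q _ _ h₂ h₄.2 (ha.horizontal hgp h₄.1 hy)
      exact ⟨0, d', g', h₅, h₆.trans (by simp [linkCount, links]; omega)⟩

end

end MinLinkPath

set_option linter.unusedSimpArgs false

namespace MinLinkPath

/-! ## Tournament trees -/

/-- The leaf of `q` is a descendant of the node `v` in a tree with `N` leaves. -/
def Under (N v q : ℕ) : Prop := ∃ j, (q + N) / 2 ^ j = v

/-- `x` is `0` if nothing has the property `A`, and otherwise one more than an element with the
property `A` whose key is least. -/
def Best (K : ℕ → ℝ) (A : ℕ → Prop) (x : ℕ) : Prop :=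
  (x = 0 ∧ ∀ q, ¬ A q) ∨ ∃ q, A q ∧ x = q + 1 ∧ ∀ p, A p → K q ≤ K p

/-- The nodes `T 1, …, T (2N - 1)` hold the winners of their subtrees among the elements of `S`. -/
def TreeRep (T : ℕ → ℕ) (K : ℕ → ℝ) (N : ℕ) (S : Finset ℕ) : Prop :=
  (∀ q ∈ S, q < N) ∧ ∀ v, 1 ≤ v → v < 2 * N → Best K (fun q => q ∈ S ∧ Under N v q) (T v)

theorem under_leaf {N p q : ℕ} (hq : q < N) : Under N (p + N) q ↔ q = p := by
  constructor
  · rintro ⟨j, hj⟩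
    rcases Nat.eq_zero_or_pos j with rfl | h
    · simp at hj; omega
    · have : (q + N) / 2 ^ j ≤ (q + N) / 2 ^ 1 :=
        Nat.div_le_div_left (Nat.pow_le_pow_right (by norm_num) h) (by norm_num)
      omega
  · rintro rfl; exact ⟨0, by simp⟩

theorem under_node {N v q : ℕ} (hv : v < N) :
    Under N v q ↔ Under N (2 * v) q ∨ Under N (2 * v + 1) q := by
  constructor
  · rintro ⟨j, hj⟩
    rcases j with _ | j
    · simp at hj; omega
    · rw [pow_succ, ← Nat.div_div_eq_div_mul] at hj
      rcases Nat.mod_two_eq_zero_or_one ((q + N) / 2 ^ j) with h | h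
      · exact Or.inl ⟨j, by omega⟩
      · exact Or.inr ⟨j, by omega⟩
  · rintro (⟨j, hj⟩ | ⟨j, hj⟩) <;>
      exact ⟨j + 1, by rw [pow_succ, ← Nat.div_div_eq_div_mul, hj]; omega⟩

theorem under_root {N q : ℕ} (hN : 1 ≤ N) : Under N 1 q := by
  refine ⟨Nat.log 2 (q + N), Nat.div_eq_of_lt_le ?_ ?_⟩
  · rw [one_mul]; exact Nat.pow_log_le_self 2 (by omega)
  · have := Nat.lt_pow_succ_log_self (b := 2) (by norm_num) (q + N)
    rw [pow_succ] at this; omega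

theorem under_parent {N v q : ℕ} (h : Under N v q) : Under N (v / 2) q := by
  obtain ⟨j, hj⟩ := h
  exact ⟨j + 1, by rw [pow_succ, ← Nat.div_div_eq_div_mul, hj]⟩

/-- The ancestors of a leaf form a chain under halving, so one that is smaller than `w` is at most
the parent of `w`. -/
theorem Under.le_half {N v w q : ℕ} (hv : Under N v q) (hw : Under N w q) (h : v < w) :
    v ≤ w / 2 := by
  obtain ⟨i, hi⟩ := hv
  obtain ⟨j, hj⟩ := hw
  rcases lt_or_ge j i with h' | h'
  · rw [← hi, ← hj, Nat.div_div_eq_div_mul, ← pow_succ]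
    exact Nat.div_le_div_left (Nat.pow_le_pow_right (by norm_num) h') (by positivity)
  · have : (q + N) / 2 ^ j ≤ (q + N) / 2 ^ i :=
      Nat.div_le_div_left (Nat.pow_le_pow_right (by norm_num) h') (by positivity)
    omega

/-- With a power of two as the number of leaves, all leaves have the same depth. Two siblings are
then reached from their leaves by equally many halvings, and the order of the siblings is that of
the leaves. -/
theorem Under.lt_of_sibling {h i a b : ℕ} (ha : a < 2 ^ h) (hb : b < 2 ^ h) (hi : 1 ≤ i)
    (ua : Under (2 ^ h) (2 * i) a) (ub : Under (2 ^ h) (2 * i + 1) b) : a < b := by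
  obtain ⟨j, hj⟩ := ua
  obtain ⟨l, hl⟩ := ub
  have hlog : ∀ x < 2 ^ h, Nat.log 2 (x + 2 ^ h) = h := fun x hx =>
    (Nat.log_eq_iff (Or.inr ⟨by norm_num, by omega⟩)).2 ⟨by omega, by rw [pow_succ]; omega⟩
  have hdep : ∀ x < 2 ^ h, ∀ j, 1 ≤ (x + 2 ^ h) / 2 ^ j →
      Nat.log 2 ((x + 2 ^ h) / 2 ^ j) + j = h := by
    intro x hx j h1
    rw [Nat.log_div_base_pow, hlog x hx]
    have h2 : 2 ^ j ≤ x + 2 ^ h := by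
      by_contra hc
      rw [Nat.div_eq_of_lt (by omega)] at h1
      omega
    have h3 : 2 ^ j < 2 ^ (h + 1) := by rw [pow_succ]; omega
    have := (Nat.pow_lt_pow_iff_right (by norm_num : 1 < 2)).1 h3
    omega
  have h1 := hdep a ha j (by omega)
  have h2 := hdep b hb l (by omega)
  rw [hj] at h1
  rw [hl] at h2
  have h3 := Nat.log_div_base 2 (2 * i)
  have h4 := Nat.log_div_base 2 (2 * i + 1)
  have h5 : Nat.log 2 (2 * i) ≥ 1 := Nat.log_pos (by norm_num) (by omega)
  have h6 : Nat.log 2 (2 * i + 1) ≥ 1 := Nat.log_pos (by norm_num) (by omega)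
  rw [show 2 * i / 2 = i by omega] at h3
  rw [show (2 * i + 1) / 2 = i by omega] at h4
  obtain rfl : j = l := by omega
  by_contra hc
  have := Nat.div_le_div_right (c := 2 ^ j) (show b + 2 ^ h ≤ a + 2 ^ h by omega)
  omega

/-- The winner of a node from those of its children; an empty child, marked by `0`, loses. -/
theorem Best.or {K : ℕ → ℝ} {A B : ℕ → Prop} {l r : ℕ} (hl : Best K A l) (hr : Best K B r) :
    (l = 0 → Best K (fun q => A q ∨ B q) r) ∧ (r = 0 → Best K (fun q => A q ∨ B q) l) ∧
    (l ≠ 0 → r ≠ 0 → (K (l - 1) ≤ K (r - 1) → Best K (fun q => A q ∨ B q) l) ∧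
      (¬ K (l - 1) ≤ K (r - 1) → Best K (fun q => A q ∨ B q) r)) := by
  rcases hl with ⟨rfl, hl⟩ | ⟨q, hq, rfl, hl⟩ <;> rcases hr with ⟨rfl, hr⟩ | ⟨p, hp, rfl, hr⟩
  · simp [Best, hl, hr]
  · refine ⟨fun _ => Or.inr ⟨p, Or.inr hp, rfl, ?_⟩, fun h => by omega, fun h => by omega⟩
    rintro q' (h | h)
    · exact absurd h (hl q')
    · exact hr q' h
  · refine ⟨fun h => by omega, fun _ => Or.inr ⟨q, Or.inl hq, rfl, ?_⟩, fun _ h => by omega⟩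
    rintro q' (h | h)
    · exact hl q' h
    · exact absurd h (hr q')
  · refine ⟨fun h => by omega, fun h => by omega, fun _ _ => ⟨fun h' => ?_, fun h' => ?_⟩⟩
    · refine Or.inr ⟨q, Or.inl hq, rfl, ?_⟩
      simp only [Nat.add_sub_cancel] at h'
      rintro q' (h | h)
      · exact hl q' h
      · exact h'.trans (hr q' h)
    · refine Or.inr ⟨p, Or.inr hp, rfl, ?_⟩
      simp only [Nat.add_sub_cancel, not_le] at h'
      rintro q' (h | h)
      · exact h'.le.trans (hl q' h)
      · exact hr q' h

theorem Best.congr {K : ℕ → ℝ} {A B : ℕ → Prop} {x : ℕ} (h : Best K A x) (hAB : ∀ q, A q ↔ B q) :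
    Best K B x := by
  have : A = B := funext fun q => propext (hAB q)
  rwa [← this]

theorem treeRep_empty {T : ℕ → ℕ} {K : ℕ → ℝ} {N : ℕ} :
    TreeRep T K N ∅ ↔ ∀ v, 1 ≤ v → v < 2 * N → T v = 0 := by
  simp [TreeRep, Best]

/-- Recomputes the current node (variable `32`) of the tree (array `0`) from its children. -/
def pullC : Cmd :=
  .seq (.setI 33 (.get 0 (.mul (.lit 2) (.var 32)))) <|
  .seq (.setI 34 (.get 0 (.add (.mul (.lit 2) (.var 32)) (.lit 1)))) <|
  .ite (.ile (.var 33) (.lit 0)) (.putI 0 (.var 32) (.var 34))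
    (.ite (.ile (.var 34) (.lit 0)) (.putI 0 (.var 32) (.var 33))
      (.ite (.rle (.get 6 (.sub (.var 33) (.lit 1))) (.get 6 (.sub (.var 34) (.lit 1))))
        (.putI 0 (.var 32) (.var 33)) (.putI 0 (.var 32) (.var 34))))

/-- Sets the leaf of the element in variable `30` to the value of variable `31`; the number of leaves
is in variable `2`, and the keys are in the real array `6`. -/
def updC : Cmd :=
  .seq (.setI 32 (.add (.var 30) (.var 2))) <|
  .seq (.putI 0 (.var 32) (.var 31)) <|
  .loop (.ile (.lit 2) (.var 32)) (.seq (.setI 32 (.div (.var 32) (.lit 2))) <| pullC)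

/-- The states agree up to the tree and the variables from `30` on. -/
structure Frame (σ σ' : State) : Prop where
  ivar : ∀ x < 30, σ'.ivar x = σ.ivar x
  rvar : σ'.rvar = σ.rvar
  iarr : ∀ b, b ≠ 0 → σ'.iarr b = σ.iarr b
  rarr : σ'.rarr = σ.rarr

theorem Frame.trans {σ σ' σ'' : State} (h : Frame σ σ') (h' : Frame σ' σ'') : Frame σ σ'' :=
  ⟨fun x hx => (h'.ivar x hx).trans (h.ivar x hx), h'.rvar.trans h.rvar,
    fun b hb => (h'.iarr b hb).trans (h.iarr b hb), h'.rarr.trans h.rarr⟩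

theorem wp_pullC {M N i : ℕ} {K : ℕ → ℝ} {A B : ℕ → Prop} {σ : State} {a : ℕ}
    {Q : ℕ → State → Prop} (hM : 2 * N + 3 ≤ M) (hi : σ.ivar 32 = i) (hiN : i < N)
    (hK : σ.rarr 6 = K) (hl : Best K A (σ.iarr 0 (2 * i))) (hr : Best K B (σ.iarr 0 (2 * i + 1)))
    (hl' : σ.iarr 0 (2 * i) ≤ N) (hr' : σ.iarr 0 (2 * i + 1) ≤ N)
    (hQ : ∀ a' σ', a' ≤ a + 50 → Frame σ σ' → σ'.ivar 32 = i →
      (∃ x, σ'.iarr 0 = Function.update (σ.iarr 0) i x ∧ x ≤ N ∧ Best K (fun q => A q ∨ B q) x) →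
      Q a' σ') : wp M pullC σ a Q := by
  obtain ⟨h₁, h₂, h₃⟩ := hl.or hr
  have hfr : ∀ x y z, Frame σ (((σ.setI 33 x).setI 34 y).putI 0 i z) := fun x y z =>
    ⟨fun u hu => by simp [show u ≠ 33 by omega, show u ≠ 34 by omega], rfl,
      fun b hb => by simp [hb], rfl⟩
  simp only [pullC, wp_skip, wp_setI, wp_setR, wp_putI, wp_putR, wp_seq, wp_ite, IExpr.ok, IExpr.val, BExpr.ok, BExpr.val, RExpr.ok, RExpr.val,
    IExpr.cost, BExpr.cost, RExpr.cost, State.setI_ivar, State.setI_iarr, State.setI_rarr,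
    Nat.reduceEqDiff, if_true, if_false, Nat.le_zero, hi, hK]
  refine ⟨by omega, by omega, by omega, fun h => ⟨by omega, by omega, ?_⟩,
    fun h => ⟨by omega, fun h' => ⟨by omega, by omega, ?_⟩,
      fun h' => ⟨by omega, fun h'' => ⟨by omega, by omega, ?_⟩,
        fun h'' => ⟨by omega, by omega, ?_⟩⟩⟩⟩
  · exact hQ _ _ (by omega) (hfr _ _ _) (by simp [hi]) ⟨_, by simp, hr', h₁ h⟩
  · exact hQ _ _ (by omega) (hfr _ _ _) (by simp [hi]) ⟨_, by simp, hl', h₂ h'⟩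
  · exact hQ _ _ (by omega) (hfr _ _ _) (by simp [hi]) ⟨_, by simp, hl', (h₃ h h').1 h''⟩
  · exact hQ _ _ (by omega) (hfr _ _ _) (by simp [hi])
      ⟨_, by simp, hr', (h₃ h h').2 h''⟩

theorem TreeRep.le {T : ℕ → ℕ} {K : ℕ → ℝ} {N : ℕ} {S : Finset ℕ} (h : TreeRep T K N S) {v : ℕ}
    (h₁ : 1 ≤ v) (h₂ : v < 2 * N) : T v ≤ N := by
  rcases h.2 v h₁ h₂ with ⟨h₀, -⟩ | ⟨q, hq, h₀, -⟩
  · omega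
  · have := h.1 q hq.1
    omega

/-- Setting a leaf and recomputing its ancestors. -/
theorem wp_updC {M h N p x : ℕ} {S S' : Finset ℕ} {σ : State} {a : ℕ} {Q : ℕ → State → Prop}
    (hN : N = 2 ^ h) (hM : 2 * N + 3 ≤ M) (h2 : σ.ivar 2 = N) (hp : σ.ivar 30 = p) (hpN : p < N)
    (hx : σ.ivar 31 = x) (hT : TreeRep (σ.iarr 0) (σ.rarr 6) N S)
    (hS : ∀ q, q ≠ p → (q ∈ S' ↔ q ∈ S))
    (hxp : (x = 0 ∧ p ∉ S') ∨ (x = p + 1 ∧ p ∈ S'))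
    (hQ : ∀ a' σ', a' ≤ a + (60 * h + 20) → Frame σ σ' → TreeRep (σ'.iarr 0) (σ.rarr 6) N S' →
      Q a' σ') : wp M updC σ a Q := by
  have hxN : x ≤ N := by omega
  have hS'N : ∀ q ∈ S', q < N := fun q hq => by
    by_cases hqp : q = p
    · omega
    · exact hT.1 q ((hS q hqp).1 hq)
  simp only [updC, wp_skip, wp_setI, wp_setR, wp_putI, wp_putR, wp_seq, wp_ite, IExpr.ok, IExpr.val, IExpr.cost, State.setI_ivar, State.setI_iarr,
    Nat.reduceEqDiff, if_true, if_false, h2, hp, hx]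
  refine ⟨by omega, by omega, by omega, ?_⟩
  -- The time left is proportional to the depth of the current node `i`. All nodes are correct
  -- except the ancestors of the leaf that are still to be visited, which are those with an index
  -- below `i`.
  refine wp_loop (t := 60 * Nat.log 2 (p + N) + 4)
    (fun t τ => ∃ i, τ.ivar 32 = i ∧ 1 ≤ i ∧ i < 2 * N ∧ Under N i p ∧ Frame σ τ ∧
      t = 60 * Nat.log 2 i + 4 ∧ (∀ v, 1 ≤ v → v < 2 * N → τ.iarr 0 v ≤ N) ∧
      ∀ v, 1 ≤ v → v < 2 * N → ¬ (Under N v p ∧ v < i) →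
        Best (σ.rarr 6) (fun q => q ∈ S' ∧ Under N v q) (τ.iarr 0 v))
    (fun τ => Frame σ τ ∧ TreeRep (τ.iarr 0) (σ.rarr 6) N S') ?_ ?_ ?_
  · rintro t τ ⟨i, h32, hi1, hi2, hu, hf, rfl, hle, hB⟩
    simp only [BExpr.ok, IExpr.ok, BExpr.val, IExpr.val, BExpr.cost, IExpr.cost, h32]
    refine ⟨by omega, fun hi => ?_, fun hi => ⟨by omega, hf, hS'N, fun v hv1 hv2 =>
      hB v hv1 hv2 (by omega)⟩⟩
    simp only [wp_skip, wp_setI, wp_setR, wp_putI, wp_putR, wp_seq, wp_ite, IExpr.ok, IExpr.val, IExpr.cost, h32]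
    refine ⟨by omega, ?_⟩
    have hsib : ∀ w, w < 2 * N → (w = 2 * (i / 2) ∨ w = 2 * (i / 2) + 1) →
        Best (σ.rarr 6) (fun q => q ∈ S' ∧ Under N w q) (τ.iarr 0 w) := by
      intro w hw hw'
      refine hB w (by omega) hw fun ⟨h₁, h₂⟩ => ?_
      have := h₁.le_half hu h₂
      omega
    refine wp_pullC (i := i / 2) (K := σ.rarr 6) hM (by simp) (by omega)
      (by simp [hf.rarr]) (hsib _ (by omega) (Or.inl rfl)) (hsib _ (by omega) (Or.inr rfl))
      (hle _ (by omega) (by omega)) (hle _ (by omega) (by omega)) ?_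
    rintro a' τ' ha' hf' h32' ⟨y, hy, hyN, hyB⟩
    simp only [State.setI_iarr] at hy
    have hlog := Nat.log_div_base 2 i
    have hlog' : 1 ≤ Nat.log 2 i := Nat.log_pos (by norm_num) (by omega)
    refine ⟨60 * Nat.log 2 (i / 2) + 4, ⟨i / 2, h32', by omega, by omega, under_parent hu,
      hf.trans ⟨fun u hu => ?_, hf'.rvar, hf'.iarr, hf'.rarr⟩, rfl, fun v hv1 hv2 => ?_,
      fun v hv1 hv2 hv => ?_⟩, by omega⟩
    · rw [hf'.ivar u hu]; simp [show u ≠ 32 by omega]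
    · rw [hy, Function.update_apply]
      split_ifs
      · exact hyN
      · exact hle v hv1 hv2
    · rw [hy, Function.update_apply]
      split_ifs with hvi
      · refine hyB.congr fun q => ?_
        rw [hvi, under_node (v := i / 2) (by omega)]
        tauto
      · refine hB v hv1 hv2 fun ⟨h₁, h₂⟩ => ?_
        have := h₁.le_half hu h₂
        exact hv ⟨h₁, by omega⟩
  · refine ⟨p + N, by simp, by omega, by omega, ⟨0, by simp⟩,
      ⟨fun u hu => by simp [show u ≠ 32 by omega], rfl, fun b hb => by simp [hb], rfl⟩, rfl,
      fun v hv1 hv2 => ?_, fun v hv1 hv2 hv => ?_⟩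
    · simp only [State.putI_iarr, if_true, State.setI_iarr, Function.update_apply]
      split_ifs
      · exact hxN
      · exact hT.le hv1 hv2
    · simp only [State.putI_iarr, if_true, State.setI_iarr, Function.update_apply]
      split_ifs with hvp
      · rcases hxp with ⟨h₀, h₁⟩ | ⟨h₀, h₁⟩
        · refine Or.inl ⟨h₀, fun q hq => ?_⟩
          rw [hvp, under_leaf (hS'N q hq.1)] at hq
          exact h₁ (hq.2 ▸ hq.1)
        · refine Or.inr ⟨p, ⟨h₁, 0, by simp [hvp]⟩, h₀, fun q hq => ?_⟩
          rw [hvp, under_leaf (hS'N q hq.1)] at hq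
          rw [hq.2]
      · refine (hT.2 v hv1 hv2).congr fun q => ?_
        by_cases hqp : q = p
        · have : ¬ Under N v p := fun hu => hv ⟨hu, by
            by_contra hc
            have h0 : Under N (p + N) p := ⟨0, by simp⟩
            have := h0.le_half hu (by omega)
            obtain ⟨j, hj⟩ := hu
            have := Nat.div_le_self (p + N) (2 ^ j)
            omega⟩
          subst hqp
          simp [this]
        · rw [hS q hqp]
  · rintro a' τ ha' ⟨hf, hT'⟩
    refine hQ a' τ ?_ hf hT'
    have : Nat.log 2 (p + N) ≤ h := by
      have := Nat.log_lt_of_lt_pow (b := 2) (x := h + 1) (y := p + N) (by omega)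
        (by rw [pow_succ]; omega)
      omega
    omega

/-- Puts into variable `34` one more than the greatest element that is at most variable `30`. -/
def predC : Cmd :=
  .seq (.setI 32 (.add (.var 30) (.var 2))) <|
  .seq (.setI 34 (.get 0 (.var 32))) <|
  .loop (.ile (.lit 2) (.var 32))
    (.seq (.ite (.and (.ile (.var 34) (.lit 0))
        (.ile (.lit 1) (.sub (.var 32) (.mul (.lit 2) (.div (.var 32) (.lit 2))))))
      (.setI 34 (.get 0 (.sub (.var 32) (.lit 1)))) .skip) <|
    .setI 32 (.div (.var 32) (.lit 2)))

/-- `q` is the greatest element of `S` that is at most `p`. -/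
def IsPred (S : Finset ℕ) (p q : ℕ) : Prop := q ∈ S ∧ q ≤ p ∧ ∀ q' ∈ S, q' ≤ p → q' ≤ q

/-- The search climbs from the leaf of `p` and keeps the greatest element at most `p` below the
current node. Keys decrease with the position, so the winner of a subtree is its greatest element.
That `0` belongs to the set guarantees an answer at the root. -/
theorem wp_predC {M h N p : ℕ} {K : ℕ → ℝ} {S : Finset ℕ} {σ : State} {a : ℕ}
    {Q : ℕ → State → Prop} (hN : N = 2 ^ h) (hM : 2 * N + 3 ≤ M) (h2 : σ.ivar 2 = N)
    (hp : σ.ivar 30 = p) (hpN : p < N) (hT : TreeRep (σ.iarr 0) K N S)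
    (hK : ∀ q ∈ S, ∀ q' ∈ S, K q ≤ K q' → q' ≤ q) (h0 : 0 ∈ S)
    (hQ : ∀ a' σ' q, a' ≤ a + (60 * h + 20) → Frame σ σ' → σ'.iarr 0 = σ.iarr 0 →
      IsPred S p q → σ'.ivar 34 = q + 1 → Q a' σ') : wp M predC σ a Q := by
  have hle : ∀ v, 1 ≤ v → v < 2 * N → σ.iarr 0 v ≤ N := fun v => hT.le
  simp only [predC, wp_skip, wp_setI, wp_setR, wp_putI, wp_putR, wp_seq, wp_ite, IExpr.ok, IExpr.val, IExpr.cost, State.setI_ivar, State.setI_iarr,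
    Nat.reduceEqDiff, if_true, if_false, h2, hp]
  have := hle (p + N) (by omega) (by omega)
  refine ⟨by omega, by omega, ?_⟩
  refine wp_loop (t := 60 * Nat.log 2 (p + N) + 4)
    (fun t τ => ∃ i, τ.ivar 32 = i ∧ 1 ≤ i ∧ i < 2 * N ∧ Under N i p ∧ Frame σ τ ∧
      τ.iarr 0 = σ.iarr 0 ∧ t = 60 * Nat.log 2 i + 4 ∧
      ((τ.ivar 34 = 0 ∧ ∀ q ∈ S, q ≤ p → ¬ Under N i q) ∨
        ∃ q ∈ S, q ≤ p ∧ Under N i q ∧ τ.ivar 34 = q + 1 ∧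
          ∀ q' ∈ S, q' ≤ p → Under N i q' → q' ≤ q))
    (fun τ => Frame σ τ ∧ τ.iarr 0 = σ.iarr 0 ∧ ∃ q, IsPred S p q ∧ τ.ivar 34 = q + 1) ?_ ?_ ?_
  · rintro t τ ⟨i, h32, hi1, hi2, hu, hf, hfT, rfl, hB⟩
    simp only [BExpr.ok, IExpr.ok, BExpr.val, IExpr.val, BExpr.cost, IExpr.cost, h32]
    refine ⟨by omega, fun hi => ?_, fun hi => ⟨by omega, hf, hfT, ?_⟩⟩
    · have hlog := Nat.log_div_base 2 i
      have hlog' : 1 ≤ Nat.log 2 i := Nat.log_pos (by norm_num) (by omega)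
      have h34 : τ.ivar 34 ≤ N := by
        rcases hB with ⟨h', -⟩ | ⟨q, hq, -, -, h', -⟩
        · omega
        · have := hT.1 q hq; omega
      have hchild : ∀ q, Under N (i / 2) q ↔ Under N (2 * (i / 2)) q ∨ Under N (2 * (i / 2) + 1) q :=
        fun q => under_node (by omega)
      have hord : ∀ a b, a < N → b < N → Under N (2 * (i / 2)) a → Under N (2 * (i / 2) + 1) b →
          a < b := fun a b ha hb ua ub => by
        subst hN
        exact Under.lt_of_sibling ha hb (by omega) ua ub
      simp only [wp_skip, wp_setI, wp_setR, wp_putI, wp_putR, wp_seq, wp_ite, IExpr.ok, IExpr.val, IExpr.cost, BExpr.ok, BExpr.val, BExpr.cost,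
        State.setI_ivar, Nat.reduceEqDiff, if_true, if_false, h32, Nat.le_zero]
      have hl := hle (i - 1) (by omega) (by omega)
      refine ⟨by omega, fun hc => ⟨by rw [hfT]; omega, by omega, ?_⟩, fun hc => ⟨by omega, ?_⟩⟩
      -- Nothing is found below a right child: every leaf of its left sibling is smaller than `p`,
      -- so the winner of the sibling is the answer for the parent.
      · have hi' : i = 2 * (i / 2) + 1 := by omega
        rcases hB with ⟨h', hB⟩ | ⟨q, -, -, -, h', -⟩
        swap
        · omega
        rw [hi'] at hB hu
        refine ⟨60 * Nat.log 2 (i / 2) + 4, ⟨i / 2, by simp, by omega, by omega,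
          (hchild p).2 (Or.inr hu),
          hf.trans ⟨fun u hu => by simp [show u ≠ 32 by omega, show u ≠ 34 by omega], rfl,
            fun _ _ => rfl, rfl⟩, hfT, rfl, ?_⟩, by omega⟩
        rcases hT.2 (i - 1) (by omega) (by omega) with ⟨h₁, h₂⟩ | ⟨q, ⟨hq, hqu⟩, h₁, h₂⟩
        · refine Or.inl ⟨by simp [hfT, h₁], fun q hq hqp hqu => ?_⟩
          rcases (hchild q).1 hqu with h₃ | h₃
          · exact h₂ q ⟨hq, by rwa [show i - 1 = 2 * (i / 2) by omega]⟩
          · exact hB q hq hqp h₃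
        · rw [show i - 1 = 2 * (i / 2) by omega] at hqu
          refine Or.inr ⟨q, hq, (hord q p (hT.1 q hq) hpN hqu hu).le, (hchild q).2 (Or.inl hqu),
            by simp [hfT, h₁], fun q' hq' hqp hqu' => ?_⟩
          rcases (hchild q').1 hqu' with h₃ | h₃
          · exact hK q hq q' hq' (h₂ q' ⟨hq', by rwa [show i - 1 = 2 * (i / 2) by omega]⟩)
          · exact absurd h₃ (hB q' hq' hqp)
      · refine ⟨60 * Nat.log 2 (i / 2) + 4, ⟨i / 2, by simp, by omega, by omega, under_parent hu,
          hf.trans ⟨fun u hu => by simp [show u ≠ 32 by omega], rfl, fun _ _ => rfl, rfl⟩, hfT,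
          rfl, ?_⟩, by omega⟩
        have hcase : i = 2 * (i / 2) ∨ i = 2 * (i / 2) + 1 := by omega
        rcases hB with ⟨h', hB⟩ | ⟨q, hq, hqp, hqu, h', hB⟩
        · have hi' : i = 2 * (i / 2) := by omega
          rw [hi'] at hB hu
          refine Or.inl ⟨by simp [h'], fun q hq hqp hqu => ?_⟩
          rcases (hchild q).1 hqu with h₃ | h₃
          · exact hB q hq hqp h₃
          · have := hord p q hpN (hT.1 q hq) hu h₃; omega
        · refine Or.inr ⟨q, hq, hqp, under_parent hqu, by simp [h'], fun q' hq' hqp' hqu' => ?_⟩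
          rcases hcase with hi' | hi' <;> rw [hi'] at hB hqu hu <;>
            rcases (hchild q').1 hqu' with h₃ | h₃
          · exact hB q' hq' hqp' h₃
          · have := hord p q' hpN (hT.1 q' hq') hu h₃; omega
          · have := hord q' q (hT.1 q' hq') (hT.1 q hq) h₃ hqu; omega
          · exact hB q' hq' hqp' h₃
    · obtain rfl : i = 1 := by omega
      have hr : ∀ q, Under N 1 q := fun q => under_root (by omega)
      rcases hB with ⟨-, hB⟩ | ⟨q, hq, hqp, -, h', hB⟩
      · exact absurd (hr 0) (hB 0 h0 (Nat.zero_le _))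
      · exact ⟨q, ⟨hq, hqp, fun q' hq' hqp' => hB q' hq' hqp' (hr q')⟩, h'⟩
  · refine ⟨p + N, by simp, by omega, by omega, ⟨0, by simp⟩,
      ⟨fun u hu => by simp [show u ≠ 32 by omega, show u ≠ 34 by omega], rfl, fun _ _ => rfl, rfl⟩,
      rfl, rfl, ?_⟩
    rcases hT.2 (p + N) (by omega) (by omega) with ⟨h₁, h₂⟩ | ⟨q, ⟨hq, hqu⟩, h₁, h₂⟩
    · exact Or.inl ⟨by simp [h₁], fun q hq _ hqu => h₂ q ⟨hq, hqu⟩⟩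
    · refine Or.inr ⟨q, hq, ((under_leaf (hT.1 q hq)).1 hqu).le, hqu, by simp [h₁],
        fun q' hq' h₃ h₄ => ?_⟩
      rw [(under_leaf (hT.1 q' hq')).1 h₄, (under_leaf (hT.1 q hq)).1 hqu]
  · rintro a' τ ha' ⟨hf, hT', q, hq, hq'⟩
    refine hQ a' τ q ?_ hf hT' hq hq'
    have : Nat.log 2 (p + N) ≤ h := by
      have := Nat.log_lt_of_lt_pow (b := 2) (x := h + 1) (y := p + N) (by omega)
        (by rw [pow_succ]; omega)
      omega
    omega

/-- Inserts the value of an expression into the set that the tree represents. -/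
def insertC (e : IExpr) : Cmd := .seq (.setI 30 e) <| .seq (.setI 31 (.add (.var 30) (.lit 1))) <| updC

/-- Removes the value of an expression from the set that the tree represents. -/
def removeC (e : IExpr) : Cmd := .seq (.setI 30 e) <| .seq (.setI 31 (.lit 0)) <| updC

theorem wp_insertC {M h N x p : ℕ} {S : Finset ℕ} {σ : State} {a : ℕ} {Q : ℕ → State → Prop}
    (hN : N = 2 ^ h) (hM : 2 * N + 3 ≤ M) (h2 : σ.ivar 2 = N) (hp : σ.ivar x = p) (hpN : p < N)
    (hT : TreeRep (σ.iarr 0) (σ.rarr 6) N S)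
    (hQ : ∀ a' σ', a' ≤ a + (60 * h + 40) → Frame σ σ' →
      TreeRep (σ'.iarr 0) (σ.rarr 6) N (insert p S) → Q a' σ') : wp M (insertC (.var x)) σ a Q := by
  simp only [insertC, wp_skip, wp_setI, wp_setR, wp_putI, wp_putR, wp_seq, wp_ite, IExpr.ok, IExpr.val, IExpr.cost, State.setI_ivar, if_true, hp]
  refine ⟨by omega, by omega, ?_⟩
  refine wp_updC (S := S) (S' := insert p S) hN hM (by simp [h2]) (by simp) hpN (by simp)
    hT (fun q hq => by simp [hq]) (Or.inr ⟨rfl, by simp⟩) fun a' σ' ha' hf hT' => ?_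
  refine hQ a' σ' (by omega) ⟨fun u hu => ?_, hf.rvar, hf.iarr, hf.rarr⟩ hT'
  rw [hf.ivar u hu]; simp [show u ≠ 30 by omega, show u ≠ 31 by omega]

theorem wp_removeC {M h N x p : ℕ} {S : Finset ℕ} {σ : State} {a : ℕ} {Q : ℕ → State → Prop}
    (hN : N = 2 ^ h) (hM : 2 * N + 3 ≤ M) (h2 : σ.ivar 2 = N) (hp : σ.ivar x = p) (hpN : p < N)
    (hT : TreeRep (σ.iarr 0) (σ.rarr 6) N S)
    (hQ : ∀ a' σ', a' ≤ a + (60 * h + 40) → Frame σ σ' →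
      TreeRep (σ'.iarr 0) (σ.rarr 6) N (S.erase p) → Q a' σ') : wp M (removeC (.var x)) σ a Q := by
  simp only [removeC, wp_skip, wp_setI, wp_setR, wp_putI, wp_putR, wp_seq, wp_ite, IExpr.ok, IExpr.val, IExpr.cost, State.setI_ivar, if_true, hp]
  refine ⟨by omega, by omega, ?_⟩
  refine wp_updC (S := S) (S' := S.erase p) hN hM (by simp [h2]) (by simp) hpN (by simp)
    hT (fun q hq => by simp [hq]) (Or.inl ⟨rfl, by simp⟩) fun a' σ' ha' hf hT' => ?_
  refine hQ a' σ' (by omega) ⟨fun u hu => ?_, hf.rvar, hf.iarr, hf.rarr⟩ hT'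
  rw [hf.ivar u hu]; simp [show u ≠ 30 by omega, show u ≠ 31 by omega]

/-! ## Sorting -/

/-- Sorts the keys `0, …, m - 1` in the real array `6`, where `m` is in variable `3`: the ranks go to
the array `rk`, the sorted indices to the array `ord`, and the sorted keys to the real array `sv`. -/
def sortC (rk ord sv : ℕ) : Cmd :=
  .seq (.setI 10 (.lit 0)) <|
  .seq (.loop (.not (.ile (.var 3) (.var 10)))
    (.seq (insertC (.var 10)) <| .setI 10 (.add (.var 10) (.lit 1)))) <|
  .seq (.setI 10 (.lit 0)) <|
  .loop (.not (.ile (.var 3) (.var 10)))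
    (.seq (.setI 11 (.sub (.get 0 (.lit 1)) (.lit 1))) <|
    .seq (.putI ord (.var 10) (.var 11)) <|
    .seq (.putI rk (.var 11) (.add (.var 10) (.lit 1))) <|
    .seq (.putR sv (.var 10) (.get 6 (.var 11))) <|
    .seq (removeC (.var 11)) <| .setI 10 (.add (.var 10) (.lit 1)))

/-- What sorting achieves. -/
structure Sorted (K : ℕ → ℝ) (m : ℕ) (rk ord : ℕ → ℕ) (sv : ℕ → ℝ) : Prop where
  rk_eq : ∀ i < m, rk i = rank K m i
  ord_lt : ∀ i < m, ord i < m
  rank_ord : ∀ i < m, rank K m (ord i) = i + 1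
  sv_eq : ∀ i < m, sv i = K (ord i)

/-- `S` holds the elements not yet extracted. Those below its least element are exactly the
extracted ones. -/
theorem rank_eq_of_least {K : ℕ → ℝ} {m q : ℕ} {S : Finset ℕ}
    (hS : S ⊆ Finset.range m) (hq : q ∈ S)
    (hmin : ∀ q' ∈ S, K q ≤ K q') (hout : ∀ i < m, i ∉ S → ∀ q' ∈ S, K i < K q') :
    rank K m q = m - S.card + 1 := by
  have : (Finset.range m).filter (fun i => K i < K q) = Finset.range m \ S := by
    ext i
    simp only [Finset.mem_filter, Finset.mem_range, Finset.mem_sdiff]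
    refine and_congr_right fun hi => ⟨fun h h' => ?_, fun h => hout i hi h q hq⟩
    exact absurd h (not_lt.2 (hmin i h'))
  rw [rank, this, Finset.card_sdiff_of_subset hS, Finset.card_range, add_comm]

/-- Tournament sort: all elements are inserted, and the root is extracted repeatedly. The tree is
empty again at the end and can be used for the next task. -/
theorem wp_sortC {M h N m rk ord sv : ℕ} {σ : State} {a : ℕ} {Q : ℕ → State → Prop}
    (hN : N = 2 ^ h) (hM : 2 * N + 3 ≤ M) (h2 : σ.ivar 2 = N) (h3 : σ.ivar 3 = m) (hm : m < N)
    (hinj : ∀ i < m, ∀ j < m, σ.rarr 6 i = σ.rarr 6 j → i = j)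
    (hT : ∀ v, 1 ≤ v → v < 2 * N → σ.iarr 0 v = 0)
    (hrk : rk ≠ 0) (hord : ord ≠ 0) (hro : rk ≠ ord) (hsv : sv ≠ 6)
    (hQ : ∀ a' σ', a' ≤ a + (m * (120 * h + 200) + 40) →
      (∀ x < 10, σ'.ivar x = σ.ivar x) → σ'.rvar = σ.rvar →
      (∀ b, b ≠ 0 → b ≠ rk → b ≠ ord → σ'.iarr b = σ.iarr b) →
      (∀ b, b ≠ sv → σ'.rarr b = σ.rarr b) →
      (∀ v, 1 ≤ v → v < 2 * N → σ'.iarr 0 v = 0) →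
      Sorted (σ.rarr 6) m (σ'.iarr rk) (σ'.iarr ord) (σ'.rarr sv) → Q a' σ') :
    wp M (sortC rk ord sv) σ a Q := by
  set K := σ.rarr 6 with hK
  simp only [sortC, wp_skip, wp_setI, wp_setR, wp_putI, wp_putR, wp_seq, wp_ite, IExpr.ok, IExpr.val, IExpr.cost]
  refine ⟨by omega, ?_⟩
  refine wp_loop (t := m * (60 * h + 60) + 10)
    (fun t τ => ∃ j, τ.ivar 10 = j ∧ j ≤ m ∧ t = (m - j) * (60 * h + 60) + 10 ∧
      (∀ x < 10, τ.ivar x = σ.ivar x) ∧ τ.rvar = σ.rvar ∧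
      (∀ b, b ≠ 0 → τ.iarr b = σ.iarr b) ∧ τ.rarr = σ.rarr ∧
      TreeRep (τ.iarr 0) K N (Finset.range j))
    (fun τ => (∀ x < 10, τ.ivar x = σ.ivar x) ∧ τ.rvar = σ.rvar ∧
      (∀ b, b ≠ 0 → τ.iarr b = σ.iarr b) ∧ τ.rarr = σ.rarr ∧
      TreeRep (τ.iarr 0) K N (Finset.range m)) ?_ ?_ ?_
  · rintro t τ ⟨j, h10, hj, rfl, f1, f2, f3, f4, hTj⟩
    have h3' : τ.ivar 3 = m := (f1 3 (by omega)).trans h3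
    simp only [BExpr.ok, IExpr.ok, BExpr.val, IExpr.val, BExpr.cost, IExpr.cost, h10, h3']
    refine ⟨by omega, fun hjm => ?_, fun hjm => ⟨by omega, f1, f2, f3, f4, ?_⟩⟩
    · simp only [wp_skip, wp_setI, wp_setR, wp_putI, wp_putR, wp_seq, wp_ite, IExpr.ok, IExpr.val, IExpr.cost]
      refine wp_insertC (S := Finset.range j) hN hM ((f1 2 (by omega)).trans h2) h10 (by omega)
        (by rw [f4]; exact hTj) fun a' τ' ha' hf hT' => ?_
      have h10' : τ'.ivar 10 = j := (hf.ivar 10 (by omega)).trans h10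
      simp only [h10']
      obtain ⟨d, hd⟩ : ∃ d, m - j = d + 1 := ⟨m - j - 1, by omega⟩
      refine ⟨by omega, (m - (j + 1)) * (60 * h + 60) + 10,
        ⟨j + 1, by simp, by omega, rfl, fun x hx => ?_, hf.rvar.trans f2,
          fun b hb => (hf.iarr b hb).trans (f3 b hb), hf.rarr.trans f4, ?_⟩, ?_⟩
      · rw [State.setI_ivar, if_neg (by omega), hf.ivar x (by omega), f1 x hx]
      · rw [Finset.range_add_one]; rw [f4] at hT'; exact hT'
      · rw [hd, show m - (j + 1) = d by omega, add_mul]; omega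
    · obtain rfl : j = m := by omega
      exact hTj
  · refine ⟨0, by simp, by omega, rfl, fun x hx => ?_, rfl, fun _ _ => rfl, rfl, ?_⟩
    · rw [State.setI_ivar, if_neg (by omega)]
    · rw [Finset.range_zero, treeRep_empty]; exact hT
  rintro a₁ τ₁ ha₁ ⟨f1, f2, f3, f4, hTm⟩
  refine ⟨by omega, ?_⟩
  refine wp_loop (t := m * (60 * h + 100) + 10)
    (fun t τ => ∃ j S, τ.ivar 10 = j ∧ j ≤ m ∧ t = (m - j) * (60 * h + 100) + 10 ∧
      (∀ x < 10, τ.ivar x = σ.ivar x) ∧ τ.rvar = σ.rvar ∧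
      (∀ b, b ≠ 0 → b ≠ rk → b ≠ ord → τ.iarr b = σ.iarr b) ∧
      (∀ b, b ≠ sv → τ.rarr b = σ.rarr b) ∧
      TreeRep (τ.iarr 0) K N S ∧ S ⊆ Finset.range m ∧ S.card = m - j ∧
      (∀ i < m, i ∉ S → (∀ q ∈ S, K i < K q) ∧ τ.iarr rk i = rank K m i) ∧
      (∀ i < j, τ.iarr ord i < m ∧ rank K m (τ.iarr ord i) = i + 1 ∧
        τ.rarr sv i = K (τ.iarr ord i)))
    (fun τ => (∀ x < 10, τ.ivar x = σ.ivar x) ∧ τ.rvar = σ.rvar ∧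
      (∀ b, b ≠ 0 → b ≠ rk → b ≠ ord → τ.iarr b = σ.iarr b) ∧
      (∀ b, b ≠ sv → τ.rarr b = σ.rarr b) ∧
      (∀ v, 1 ≤ v → v < 2 * N → τ.iarr 0 v = 0) ∧
      Sorted K m (τ.iarr rk) (τ.iarr ord) (τ.rarr sv)) ?_ ?_ ?_
  · rintro t τ ⟨j, S, h10, hj, rfl, g1, g2, g3, g4, hTS, hSm, hcard, hrkS, hordj⟩
    have h3' : τ.ivar 3 = m := (g1 3 (by omega)).trans h3
    simp only [BExpr.ok, IExpr.ok, BExpr.val, IExpr.val, BExpr.cost, IExpr.cost, h10, h3']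
    refine ⟨by omega, fun hjm => ?_, fun hjm => ?_⟩
    · have hroot := hTS.2 1 le_rfl (by omega)
      obtain ⟨q, ⟨hqS, -⟩, hq1, hqmin⟩ : ∃ q, (q ∈ S ∧ Under N 1 q) ∧ τ.iarr 0 1 = q + 1 ∧
          ∀ q', q' ∈ S ∧ Under N 1 q' → K q ≤ K q' := by
        rcases hroot with ⟨-, h'⟩ | h'
        · obtain ⟨q, hq⟩ := Finset.card_pos.1 (show 0 < S.card by omega)
          exact absurd ⟨hq, under_root (by omega)⟩ (h' q)
        · exact h'
      have hqm : q < m := Finset.mem_range.1 (hSm hqS)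
      have hqmin' : ∀ q' ∈ S, K q ≤ K q' := fun q' h' => hqmin q' ⟨h', under_root (by omega)⟩
      have hrank : rank K m q = j + 1 := by
        rw [rank_eq_of_least hSm hqS hqmin' fun i hi hiS => (hrkS i hi hiS).1, hcard]
        omega
      have h6 : τ.rarr 6 = K := g4 6 hsv.symm
      simp only [wp_skip, wp_setI, wp_setR, wp_putI, wp_putR, wp_seq, wp_ite, IExpr.ok, IExpr.val, IExpr.cost, RExpr.ok, RExpr.val, RExpr.cost,
        State.setI_ivar, State.setI_iarr, State.putI_ivar, State.setI_rarr, State.putI_rarr,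
        State.putR_ivar, if_true, Nat.reduceEqDiff, if_false, h10, hq1, h6, Nat.add_sub_cancel]
      refine ⟨by omega, by omega, by omega, by omega, by omega, by omega, by omega, ?_⟩
      refine wp_removeC (S := S) hN hM ?_ ?_ (show q < N by omega) ?_ ?_
      · simp [g1 2, h2]
      · simp
      · simpa [hrk.symm, hord.symm, hsv.symm, h6] using hTS
      · intro a' τ' ha' hf hT'
        have e10 : τ'.ivar 10 = j := by
          have := hf.ivar 10 (by omega)
          simpa [h10] using this
        have erk : τ'.iarr rk = Function.update (τ.iarr rk) q (j + 1) := by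
          have := hf.iarr rk hrk
          simpa [hro] using this
        have eord : τ'.iarr ord = Function.update (τ.iarr ord) j q := by
          have := hf.iarr ord hord
          simpa [hro.symm] using this
        have esv : τ'.rarr sv = Function.update (τ.rarr sv) j (K q) := by
          rw [hf.rarr]; simp
        simp only [e10]
        obtain ⟨d, hd⟩ : ∃ d, m - j = d + 1 := ⟨m - j - 1, by omega⟩
        refine ⟨by omega, (m - (j + 1)) * (60 * h + 100) + 10, ⟨j + 1, S.erase q, by simp, by omega,
          rfl, fun x hx => ?_, ?_, fun b hb hb' hb'' => ?_, fun b hb => ?_, ?_,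
          (Finset.erase_subset _ _).trans hSm, ?_, fun i hi hiS => ?_, fun i hi => ?_⟩, ?_⟩
        · rw [if_neg (by omega), hf.ivar x (by omega)]
          simp [show x ≠ 11 by omega, g1 x hx]
        · rw [State.setI_rvar, hf.rvar]; simpa using g2
        · rw [hf.iarr b hb]
          simp [hb', hb'', g3 b hb hb' hb'']
        · rw [hf.rarr]
          simp [hb, g4 b hb]
        · simpa [hsv.symm, h6] using hT'
        · rw [Finset.card_erase_of_mem hqS]; omega
        · rw [erk, Function.update_apply]
          by_cases hiq : i = q
          · subst hiq
            refine ⟨fun q' hq' => ?_, by simp [hrank]⟩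
            rw [Finset.mem_erase] at hq'
            refine lt_of_le_of_ne (hqmin' q' hq'.2) fun he => hq'.1 ?_
            exact (hinj _ hi _ (Finset.mem_range.1 (hSm hq'.2)) he).symm
          · have hiS' : i ∉ S := fun h' => hiS (Finset.mem_erase.2 ⟨hiq, h'⟩)
            rw [if_neg hiq]
            exact ⟨fun q' hq' => (hrkS i hi hiS').1 q' (Finset.mem_of_mem_erase hq'),
              (hrkS i hi hiS').2⟩
        · rw [eord, esv, Function.update_apply,
            Function.update_apply]
          by_cases hij : i = j
          · subst hij; simp [hqm, hrank]
          · rw [if_neg hij, if_neg hij]; exact hordj i (by omega)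
        · rw [hd, show m - (j + 1) = d by omega, add_mul]; omega
    · obtain rfl : j = m := by omega
      have hS0 : S = ∅ := Finset.card_eq_zero.1 (by omega)
      subst hS0
      refine ⟨by omega, g1, g2, g3, g4, treeRep_empty.1 hTS, fun i hi => ?_, fun i hi => ?_,
        fun i hi => ?_, fun i hi => ?_⟩
      · exact (hrkS i hi (by simp)).2
      · exact (hordj i hi).1
      · exact (hordj i hi).2.1
      · exact (hordj i hi).2.2
  · refine ⟨0, Finset.range m, by simp, by omega, rfl, fun x hx => ?_, f2, fun b hb _ _ => f3 b hb,
      fun b _ => by rw [State.setI_rarr, f4], hTm, subset_rfl, by simp, fun i hi hiS => ?_,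
      fun i hi => by omega⟩
    · rw [State.setI_ivar, if_neg (by omega), f1 x hx]
    · exact absurd (Finset.mem_range.2 hi) hiS
  · rintro a₂ τ₂ ha₂ ⟨g1, g2, g3, g4, g5, g6⟩
    refine hQ a₂ τ₂ ?_ g1 g2 g3 g4 g5 g6
    have : m * (60 * h + 60) + m * (60 * h + 100) ≤ m * (120 * h + 200) := by
      rw [← mul_add]; exact Nat.mul_le_mul_left _ (by omega)
    omega

/-! ## Piecewise constant functions as linked lists -/

/-- The functions `v` and `tg` on `0, …, 2n` are constant on the pieces that start at the elements of
`S`; `nxt`, `val` and `tag` give the next start and the values. The element `2n + 1` of `S` is a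
sentinel. -/
structure Rep (n : ℕ) (S : Finset ℕ) (nxt val tag v tg : ℕ → ℕ) : Prop where
  zero : 0 ∈ S
  last : 2 * n + 1 ∈ S
  le : ∀ p ∈ S, p ≤ 2 * n + 1
  nxt_mem : ∀ p ∈ S, p ≤ 2 * n → nxt p ∈ S
  lt_nxt : ∀ p ∈ S, p ≤ 2 * n → p < nxt p
  nxt_le : ∀ p ∈ S, ∀ q ∈ S, p < q → nxt p ≤ q
  cell : ∀ p ∈ S, p ≤ 2 * n → ∀ k, p ≤ k → k < nxt p → v k = val p ∧ tg k = tag p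
  val_last : val (2 * n + 1) = 2 * n + 6
  v_last : v (2 * n + 1) = 2 * n + 6
  val_le : ∀ p ∈ S, val p ≤ 2 * n + 6
  tag_le : ∀ p ∈ S, tag p ≤ 2 * n + 1

section
variable {n : ℕ} {S : Finset ℕ} {nxt val tag v tg : ℕ → ℕ}

theorem Rep.nxt_le_last (h : Rep n S nxt val tag v tg) {p : ℕ} (hp : p ∈ S) (hp' : p ≤ 2 * n) :
    nxt p ≤ 2 * n + 1 := h.nxt_le p hp _ h.last (by omega)

theorem Rep.val_eq (h : Rep n S nxt val tag v tg) {p : ℕ} (hp : p ∈ S) : v p = val p := by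
  have := h.le p hp
  rcases Nat.lt_or_ge (2 * n) p with h' | h'
  · obtain rfl : p = 2 * n + 1 := by omega
    rw [h.v_last, h.val_last]
  · exact (h.cell p hp h' p le_rfl (h.lt_nxt p hp h')).1

theorem Rep.tag_eq (h : Rep n S nxt val tag v tg) {p : ℕ} (hp : p ∈ S) (h' : p ≤ 2 * n) :
    tg p = tag p := (h.cell p hp h' p le_rfl (h.lt_nxt p hp h')).2

theorem Rep.lt_nxt_of_isPred (h : Rep n S nxt val tag v tg) {p k : ℕ} (hp : IsPred S k p)
    (hk : k ≤ 2 * n) : k < nxt p := by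
  have h₁ := hp.2.1
  by_contra hc
  have := hp.2.2 _ (h.nxt_mem p hp.1 (by omega)) (by omega)
  have := h.lt_nxt p hp.1 (by omega)
  omega

theorem Rep.cell_of_isPred (h : Rep n S nxt val tag v tg) {p k : ℕ} (hp : IsPred S k p)
    (hk : k ≤ 2 * n) {l : ℕ} (h₁ : p ≤ l) (h₂ : l ≤ k) : v l = v p ∧ tg l = tg p := by
  have h₃ := hp.2.1
  have h₄ := h.cell p hp.1 (by omega) l h₁ (by have := h.lt_nxt_of_isPred hp hk; omega)
  have h₅ := h.tag_eq hp.1 (by omega)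
  rw [h.val_eq hp.1, h₅]
  exact h₄

theorem Rep.split (h : Rep n S nxt val tag v tg) {p x : ℕ} (hp : IsPred S x p) (hpx : p < x)
    (hx : x ≤ 2 * n) :
    Rep n (insert x S) (Function.update (Function.update nxt x (nxt p)) p x)
      (Function.update val x (val p)) (Function.update tag x (tag p)) v tg := by
  have hxS : x ∉ S := fun hx => by have := hp.2.2 x hx le_rfl; omega
  have hpn : p ≤ 2 * n := by omega
  have hxn := h.lt_nxt_of_isPred hp hx
  have hne : ∀ q ∈ S, q ≠ x := fun q hq he => hxS (he ▸ hq)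
  have hnx : ∀ q ∈ S, q ≠ p → Function.update (Function.update nxt x (nxt p)) p x q = nxt q :=
    fun q hq hqp => by simp [Function.update_apply, hqp, hne q hq]
  have hnp : Function.update (Function.update nxt x (nxt p)) p x p = x := by simp
  have hnX : Function.update (Function.update nxt x (nxt p)) p x x = nxt p := by
    simp [Function.update_apply, hpx.ne']
  refine ⟨by simp [h.zero], by simp [h.last], ?_, ?_, ?_, ?_, ?_, ?_, h.v_last, ?_, ?_⟩
  · intro q hq
    rcases Finset.mem_insert.1 hq with rfl | hq
    · omega
    · exact h.le q hq
  · intro q hq hq'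
    rcases Finset.mem_insert.1 hq with rfl | hq
    · rw [hnX]; exact Finset.mem_insert_of_mem (h.nxt_mem p hp.1 hpn)
    by_cases hqp : q = p
    · rw [hqp, hnp]; simp
    · rw [hnx q hq hqp]; exact Finset.mem_insert_of_mem (h.nxt_mem q hq hq')
  · intro q hq hq'
    rcases Finset.mem_insert.1 hq with rfl | hq
    · rw [hnX]; exact hxn
    by_cases hqp : q = p
    · rw [hqp, hnp]; exact hpx
    · rw [hnx q hq hqp]; exact h.lt_nxt q hq hq'
  · intro q hq q' hq' hlt
    rcases Finset.mem_insert.1 hq with rfl | hq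
    · rcases Finset.mem_insert.1 hq' with rfl | hq'
      · omega
      · rw [hnX]; exact h.nxt_le p hp.1 q' hq' (by omega)
    by_cases hqp : q = p
    · rw [hqp, hnp]
      rcases Finset.mem_insert.1 hq' with rfl | hq'
      · exact le_rfl
      · have := h.nxt_le p hp.1 q' hq' (by omega)
        omega
    · rw [hnx q hq hqp]
      rcases Finset.mem_insert.1 hq' with he | hq'
      · have h₁ := hp.2.2 q hq (by omega)
        have h₂ := h.nxt_le q hq p hp.1 (by omega)
        omega
      · exact h.nxt_le q hq q' hq' hlt
  · intro q hq hq' k h₁ h₂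
    rcases Finset.mem_insert.1 hq with rfl | hq
    · rw [hnX] at h₂
      simpa using h.cell p hp.1 hpn k (by omega) h₂
    rw [Function.update_of_ne (hne q hq), Function.update_of_ne (hne q hq)]
    by_cases hqp : q = p
    · subst hqp
      rw [hnp] at h₂
      exact h.cell q hq hq' k h₁ (by omega)
    · rw [hnx q hq hqp] at h₂
      exact h.cell q hq hq' k h₁ h₂
  · rw [Function.update_of_ne (by omega)]; exact h.val_last
  · intro q hq
    rcases Finset.mem_insert.1 hq with rfl | hq
    · simpa using h.val_le p hp.1
    · rw [Function.update_of_ne (hne q hq)]; exact h.val_le q hq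
  · intro q hq
    rcases Finset.mem_insert.1 hq with rfl | hq
    · simpa using h.tag_le p hp.1
    · rw [Function.update_of_ne (hne q hq)]; exact h.tag_le q hq

theorem Rep.set (h : Rep n S nxt val tag v tg) {b x y : ℕ} (hb : b ∈ S) (hb' : b ≤ 2 * n)
    (hx : x ≤ 2 * n + 6) (hy : y ≤ 2 * n + 1) :
    Rep n S nxt (Function.update val b x) (Function.update tag b y)
      (fill b (nxt b) x v) (fill b (nxt b) y tg) := by
  have hnl := h.nxt_le_last hb hb'
  refine ⟨h.zero, h.last, h.le, h.nxt_mem, h.lt_nxt, h.nxt_le, ?_, ?_, ?_, ?_, ?_⟩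
  · intro p hp hp' k h₁ h₂
    by_cases hpb : p = b
    · subst hpb
      rw [fill_in h₁ h₂, fill_in h₁ h₂]; simp
    · have : k < b ∨ nxt b ≤ k := by
        rcases Nat.lt_or_ge p b with h' | h'
        · have := h.nxt_le p hp b hb h'
          omega
        · have := h.nxt_le b hb p hp (by omega)
          omega
      rw [fill, fill, if_neg (by omega), if_neg (by omega), Function.update_of_ne hpb,
        Function.update_of_ne hpb]
      exact h.cell p hp hp' k h₁ h₂
  · rw [Function.update_of_ne (by omega)]; exact h.val_last
  · rw [fill_ge (by omega)]; exact h.v_last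
  · intro p hp
    rw [Function.update_apply]; split_ifs
    · exact hx
    · exact h.val_le p hp
  · intro p hp
    rw [Function.update_apply]; split_ifs
    · exact hy
    · exact h.tag_le p hp

theorem Rep.absorb (h : Rep n S nxt val tag v tg) {b : ℕ} (hb : b ∈ S) (hb' : b ≤ 2 * n)
    (hq : nxt b ≤ 2 * n) :
    Rep n (S.erase (nxt b)) (Function.update nxt b (nxt (nxt b))) val tag
      (fill b (nxt (nxt b)) (val b) v) (fill b (nxt (nxt b)) (tag b) tg) := by
  set q := nxt b with hqdef
  have hqS : q ∈ S := h.nxt_mem b hb hb'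
  have hbq : b < q := h.lt_nxt b hb hb'
  have hqq := h.lt_nxt q hqS hq
  have hql := h.nxt_le_last hqS hq
  refine ⟨?_, ?_, fun p hp => h.le p (Finset.mem_of_mem_erase hp), ?_, ?_, ?_, ?_, h.val_last, ?_,
    fun p hp => h.val_le p (Finset.mem_of_mem_erase hp),
    fun p hp => h.tag_le p (Finset.mem_of_mem_erase hp)⟩
  · exact Finset.mem_erase.2 ⟨by omega, h.zero⟩
  · exact Finset.mem_erase.2 ⟨by omega, h.last⟩
  · intro p hp hp'
    obtain ⟨hpq, hp⟩ := Finset.mem_erase.1 hp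
    rw [Function.update_apply]
    split_ifs with hpb
    · exact Finset.mem_erase.2 ⟨hqq.ne', h.nxt_mem q hqS hq⟩
    · refine Finset.mem_erase.2 ⟨fun he => ?_, h.nxt_mem p hp hp'⟩
      rcases Nat.lt_or_ge p b with h' | h'
      · have := h.nxt_le p hp b hb h'
        omega
      · have := h.nxt_le b hb p hp (by omega)
        have := h.lt_nxt p hp hp'
        omega
  · intro p hp hp'
    obtain ⟨hpq, hp⟩ := Finset.mem_erase.1 hp
    rw [Function.update_apply]
    split_ifs with hpb
    · omega
    · exact h.lt_nxt p hp hp'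
  · intro p hp p' hp' hlt
    obtain ⟨hpq, hp⟩ := Finset.mem_erase.1 hp
    obtain ⟨hpq', hp'⟩ := Finset.mem_erase.1 hp'
    rw [Function.update_apply]
    split_ifs with hpb
    · have := h.nxt_le b hb p' hp' (by omega)
      exact h.nxt_le q hqS p' hp' (by omega)
    · exact h.nxt_le p hp p' hp' hlt
  · intro p hp hp' k h₁ h₂
    obtain ⟨hpq, hp⟩ := Finset.mem_erase.1 hp
    rw [Function.update_apply] at h₂
    split_ifs at h₂ with hpb
    · subst hpb
      rw [fill_in h₁ h₂, fill_in h₁ h₂]; simp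
    · have : k < b ∨ nxt q ≤ k := by
        rcases Nat.lt_or_ge p b with h' | h'
        · have := h.nxt_le p hp b hb h'
          omega
        · have h₃ := h.nxt_le b hb p hp (by omega)
          have := h.nxt_le q hqS p hp (by omega)
          omega
      rw [fill, fill, if_neg (by omega), if_neg (by omega)]
      exact h.cell p hp hp' k h₁ h₂
  · rw [fill_ge (by omega)]; exact h.v_last

end

/-- The list of pieces in the arrays `5`, `6`, `7` together with the tree of their starts. -/
structure Pieces (n N : ℕ) (σ : State) (S : Finset ℕ) (v tg : ℕ → ℕ) : Prop where
  tree : TreeRep (σ.iarr 0) (σ.rarr 6) N S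
  rep : Rep n S (σ.iarr 5) (σ.iarr 6) (σ.iarr 7) v tg
  key : ∀ q ≤ 2 * n + 1, σ.rarr 6 q = -(q : ℝ)

/-- The states agree up to the list of pieces and the variables from `26` on. -/
structure LFrame (σ σ' : State) : Prop where
  ivar : ∀ x < 26, σ'.ivar x = σ.ivar x
  rvar : σ'.rvar = σ.rvar
  iarr : ∀ b, b ≠ 0 → b ≠ 5 → b ≠ 6 → b ≠ 7 → σ'.iarr b = σ.iarr b
  rarr : σ'.rarr = σ.rarr

theorem LFrame.refl (σ : State) : LFrame σ σ := ⟨fun _ _ => rfl, rfl, fun _ _ _ _ _ => rfl, rfl⟩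

theorem LFrame.trans {σ σ' σ'' : State} (h : LFrame σ σ') (h' : LFrame σ' σ'') : LFrame σ σ'' :=
  ⟨fun x hx => (h'.ivar x hx).trans (h.ivar x hx), h'.rvar.trans h.rvar,
    fun b h₁ h₂ h₃ h₄ => (h'.iarr b h₁ h₂ h₃ h₄).trans (h.iarr b h₁ h₂ h₃ h₄),
    h'.rarr.trans h.rarr⟩

/-- Keys are negated positions, so a tournament for the least key finds the greatest start, as the
predecessor search requires. -/
theorem Pieces.key_le {n N : ℕ} {σ : State} {S : Finset ℕ} {v tg : ℕ → ℕ}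
    (h : Pieces n N σ S v tg) : ∀ q ∈ S, ∀ q' ∈ S, σ.rarr 6 q ≤ σ.rarr 6 q' → q' ≤ q := by
  intro q hq q' hq' hle
  rw [h.key q (h.rep.le q hq), h.key q' (h.rep.le q' hq')] at hle
  exact_mod_cast neg_le_neg_iff.1 hle

theorem Pieces.of_frame {n N : ℕ} {σ σ' : State} {S : Finset ℕ} {v tg : ℕ → ℕ}
    (h : Pieces n N σ S v tg) (h0 : σ'.iarr 0 = σ.iarr 0) (h5 : σ'.iarr 5 = σ.iarr 5)
    (h6 : σ'.iarr 6 = σ.iarr 6) (h7 : σ'.iarr 7 = σ.iarr 7) (hr : σ'.rarr 6 = σ.rarr 6) :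
    Pieces n N σ' S v tg := by
  obtain ⟨h₁, h₂, h₃⟩ := h
  rw [← h0, ← hr] at h₁
  rw [← h5, ← h6, ← h7] at h₂
  rw [← hr] at h₃
  exact ⟨h₁, h₂, h₃⟩

/-- Starts a new piece at the value of variable `14`, unless one starts there. -/
def splitC : Cmd :=
  .seq (.setI 30 (.var 14)) <| .seq predC <| .seq (.setI 26 (.sub (.var 34) (.lit 1))) <|
  .ite (.ile (.var 14) (.var 26)) .skip
    (.seq (.putI 5 (.var 14) (.get 5 (.var 26))) <| .seq (.putI 5 (.var 26) (.var 14)) <|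
    .seq (.putI 6 (.var 14) (.get 6 (.var 26))) <| .seq (.putI 7 (.var 14) (.get 7 (.var 26))) <|
    insertC (.var 14))

theorem wp_splitC {M h n N x : ℕ} {S : Finset ℕ} {v tg : ℕ → ℕ} {σ : State} {a : ℕ}
    {Q : ℕ → State → Prop} (hN : N = 2 ^ h) (hn : 2 * n + 1 < N) (hM : 2 * N + 20 ≤ M)
    (h2 : σ.ivar 2 = N) (h14 : σ.ivar 14 = x) (hx : x ≤ 2 * n + 1) (hP : Pieces n N σ S v tg)
    (hQ : ∀ a' σ', a' ≤ a + (120 * h + 120) → LFrame σ σ' →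
      Pieces n N σ' (insert x S) v tg → Q a' σ') : wp M splitC σ a Q := by
  simp only [splitC, wp_seq, wp_setI, IExpr.ok, IExpr.val, IExpr.cost, h14]
  refine ⟨by omega, ?_⟩
  refine wp_predC (S := S) (p := x) (K := σ.rarr 6) hN (by omega) (by simpa using h2) (by simp)
    (by omega) hP.tree hP.key_le hP.rep.zero fun a₁ σ₁ p ha₁ hf hT hp h34 => ?_
  have hps := hp.2.1
  have h14' : σ₁.ivar 14 = x := by rw [hf.ivar 14 (by omega)]; simpa using h14
  have e5 : σ₁.iarr 5 = σ.iarr 5 := hf.iarr 5 (by omega)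
  have e6 : σ₁.iarr 6 = σ.iarr 6 := hf.iarr 6 (by omega)
  have e7 : σ₁.iarr 7 = σ.iarr 7 := hf.iarr 7 (by omega)
  have er : σ₁.rarr = σ.rarr := hf.rarr
  have hLF : LFrame σ σ₁ :=
    ⟨fun u hu => by rw [hf.ivar u (by omega)]; simp [show u ≠ 30 by omega], hf.rvar,
      fun b h₁ _ _ _ => hf.iarr b h₁, hf.rarr⟩
  simp only [wp_ite, wp_skip, wp_putI, wp_seq, IExpr.ok, IExpr.val, IExpr.cost, BExpr.ok, BExpr.val,
    BExpr.cost, State.setI_ivar, State.setI_iarr, State.putI_ivar, State.putI_iarr, h34, h14',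
    Nat.add_sub_cancel, if_true, if_false, Nat.reduceEqDiff, e5, e6, e7]
  refine ⟨by omega, by omega, fun hle => ?_, fun hlt => ?_⟩
  · obtain rfl : p = x := by omega
    refine hQ _ _ (by omega) (hLF.trans ⟨fun u hu => by simp [show u ≠ 26 by omega], rfl,
      fun _ _ _ _ _ => rfl, rfl⟩) ?_
    rw [Finset.insert_eq_of_mem hp.1]
    exact hP.of_frame hT e5 e6 e7 (by simp [er])
  · have hpn : p ≤ 2 * n := by omega
    have hxn : x ≤ 2 * n := by
      -- The sentinel is itself a start, so it would be its own predecessor.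
      by_contra hc
      obtain rfl : x = 2 * n + 1 := by omega
      have := hp.2.2 _ hP.rep.last le_rfl
      omega
    have b5 := hP.rep.nxt_le_last hp.1 hpn
    have b6 := hP.rep.val_le p hp.1
    have b7 := hP.rep.tag_le p hp.1
    refine ⟨by omega, by omega, by omega, by omega, by omega, by omega, by omega, by omega, ?_⟩
    refine wp_insertC (S := S) (p := x) hN (by omega) ?_ ?_ (by omega) ?_ ?_
    · simp [hf.ivar 2, h2]
    · simp [h14']
    · simpa [hT, er] using hP.tree
    · intro a₂ σ₂ ha₂ hf₂ hT₂
      have g5 := hf₂.iarr 5 (by omega)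
      have g6 := hf₂.iarr 6 (by omega)
      have g7 := hf₂.iarr 7 (by omega)
      have gr : σ₂.rarr = σ.rarr := by rw [hf₂.rarr]; simpa using er
      simp only [State.putI_iarr, State.setI_iarr, if_true, if_false, Nat.reduceEqDiff, e5, e6, e7]
        at g5 g6 g7
      refine hQ _ _ (by omega) (hLF.trans ⟨fun u hu => ?_, ?_, fun b h₁ h₂ h₃ h₄ => ?_, ?_⟩)
        ⟨?_, ?_, ?_⟩
      · rw [hf₂.ivar u (by omega)]; simp [show u ≠ 26 by omega]
      · rw [hf₂.rvar]; rfl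
      · rw [hf₂.iarr b h₁]; simp [h₂, h₃, h₄]
      · rw [hf₂.rarr]; rfl
      · rw [gr]; simpa [er] using hT₂
      · rw [g5, g6, g7]; exact hP.rep.split hp (by omega) hxn
      · rw [gr]; exact hP.key

/-- Merges the piece that starts at the value of variable `20` with the next one. -/
def absorbC : Cmd :=
  .seq (.setI 27 (.get 5 (.var 20))) <| .seq (.putI 5 (.var 20) (.get 5 (.var 27))) <| removeC (.var 27)

theorem wp_absorbC {M h n N b q : ℕ} {S : Finset ℕ} {v tg : ℕ → ℕ} {σ : State} {a : ℕ}
    {Q : ℕ → State → Prop} (hN : N = 2 ^ h) (hn : 2 * n + 1 < N) (hM : 2 * N + 20 ≤ M)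
    (h2 : σ.ivar 2 = N) (h20 : σ.ivar 20 = b) (hP : Pieces n N σ S v tg) (hb : b ∈ S)
    (hb' : b ≤ 2 * n) (hq : σ.iarr 5 b = q) (hq' : q ≤ 2 * n)
    (hQ : ∀ a' σ' e, a' ≤ a + (60 * h + 60) → LFrame σ σ' → σ'.iarr 6 = σ.iarr 6 →
      σ'.iarr 7 = σ.iarr 7 → σ'.iarr 5 b = e → q < e → (∀ q' ∈ S, q < q' → e ≤ q') → e ∈ S →
      Pieces n N σ' (S.erase q) (fill b e (σ.iarr 6 b) v) (fill b e (σ.iarr 7 b) tg) → Q a' σ') :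
    wp M absorbC σ a Q := by
  have hqS : q ∈ S := hq ▸ hP.rep.nxt_mem b hb hb'
  have hqq := hP.rep.lt_nxt q hqS hq'
  have hql := hP.rep.nxt_le_last hqS hq'
  simp only [absorbC, wp_seq, wp_setI, wp_putI, IExpr.ok, IExpr.val, IExpr.cost, State.setI_ivar,
    State.setI_iarr, if_true, if_false, Nat.reduceEqDiff, h20, hq]
  refine ⟨by omega, by omega, by omega, ?_⟩
  refine wp_removeC (S := S) (p := q) hN (by omega) ?_ ?_ (by omega) ?_ ?_
  · simp [h2]
  · simp
  · simpa using hP.tree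
  · intro a₂ σ₂ ha₂ hf hT
    have g5 := hf.iarr 5 (by omega)
    have g6 := hf.iarr 6 (by omega)
    have g7 := hf.iarr 7 (by omega)
    simp only [State.putI_iarr, State.setI_iarr, if_true, if_false, Nat.reduceEqDiff] at g5 g6 g7
    have gr : σ₂.rarr = σ.rarr := hf.rarr
    have hrep := hP.rep.absorb hb hb' (by omega)
    rw [hq] at hrep
    refine hQ a₂ σ₂ (σ.iarr 5 q) (by omega)
      ⟨fun u hu => ?_, hf.rvar, fun b h₁ h₂ h₃ h₄ => ?_, hf.rarr⟩ g6 g7 (by simp [g5]) hqq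
      (fun q' hq' hlt => hP.rep.nxt_le q hqS q' hq' hlt) (hP.rep.nxt_mem q hqS hq') ⟨?_, ?_, ?_⟩
    · rw [hf.ivar u (by omega)]; simp [show u ≠ 27 by omega]
    · rw [hf.iarr b h₁]; simp [h₂]
    · rw [gr]; simpa using hT
    · rw [g5, g6, g7]; exact hrep
    · rw [gr]; exact hP.key

/-- The starts that remain when the pieces after `b` and before `e` are merged with that of `b`. -/
def keep (S : Finset ℕ) (b e : ℕ) : Finset ℕ := S.filter fun q => q ≤ b ∨ e ≤ q

/-- Merging pieces while a test holds for the next one. The credit `60h + 100` that each start carries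
pays for its removal. -/
theorem wp_absorb_loop {M h n N b : ℕ} {S : Finset ℕ} {v tg : ℕ → ℕ} {σ : State} {a : ℕ}
    {Q : ℕ → State → Prop} {c : BExpr} (P : ℕ → ℕ → Prop) (hN : N = 2 ^ h) (hn : 2 * n + 1 < N)
    (hM : 2 * N + 20 ≤ M) (h2 : σ.ivar 2 = N) (h20 : σ.ivar 20 = b) (hP : Pieces n N σ S v tg)
    (hb : b ∈ S) (hb' : b ≤ 2 * n) (hPlast : ¬ P (2 * n + 1) (2 * n + 6)) (hcost : c.cost ≤ 30)
    (hc : ∀ τ, LFrame σ τ → τ.iarr 6 = σ.iarr 6 → τ.iarr 5 b ≤ 2 * n + 1 →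
      σ.iarr 6 (τ.iarr 5 b) ≤ 2 * n + 6 →
      c.ok M τ ∧ (c.val τ ↔ P (τ.iarr 5 b) (σ.iarr 6 (τ.iarr 5 b))))
    (hQ : ∀ a' σ' e, a' + (60 * h + 100) * (keep S b e).card ≤
        a + (60 * h + 100) * S.card + 31 →
      LFrame σ σ' → σ'.iarr 6 = σ.iarr 6 → σ'.iarr 7 = σ.iarr 7 → b < e → e ∈ S →
      (∀ q ∈ S, b < q → q < e → P q (v q)) → ¬ P e (v e) →
      Pieces n N σ' (keep S b e) (fill b e (v b) v) (fill b e (tg b) tg) → Q a' σ') :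
    wp M (.loop c absorbC) σ a Q := by
  have hvb := hP.rep.val_eq hb
  have htb := hP.rep.tag_eq hb hb'
  refine wp_loop_credit (t := (60 * h + 100) * S.card + 31)
    (fun t τ => ∃ e, LFrame σ τ ∧ τ.iarr 6 = σ.iarr 6 ∧ τ.iarr 7 = σ.iarr 7 ∧ τ.iarr 5 b = e ∧
      b < e ∧ e ∈ S ∧ (∀ q ∈ S, b < q → q < e → P q (v q)) ∧
      Pieces n N τ (keep S b e) (fill b e (v b) v) (fill b e (tg b) tg) ∧
      t = (60 * h + 100) * (keep S b e).card + 31)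
    (fun t τ => ∃ e, LFrame σ τ ∧ τ.iarr 6 = σ.iarr 6 ∧ τ.iarr 7 = σ.iarr 7 ∧
      b < e ∧ e ∈ S ∧ (∀ q ∈ S, b < q → q < e → P q (v q)) ∧ ¬ P e (v e) ∧
      Pieces n N τ (keep S b e) (fill b e (v b) v) (fill b e (tg b) tg) ∧
      t = (60 * h + 100) * (keep S b e).card) ?_ ?_ ?_
  · rintro t τ ⟨e, hf, e6, e7, e5, hbe, heS, hall, hPτ, rfl⟩
    have hel := hP.rep.le e heS
    have hve := hP.rep.val_eq heS
    have hle6 := hP.rep.val_le e heS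
    obtain ⟨hok, hval⟩ := hc τ hf e6 (by omega) (by rw [e5]; exact hle6)
    rw [e5, ← hve] at hval
    refine ⟨hok, fun hcv => ?_, fun hcv => ⟨_, ?_, e, hf, e6, e7, hbe, heS, hall,
      fun h' => hcv (hval.2 h'), hPτ, rfl⟩⟩
    · have hPe := hval.1 hcv
      -- The sentinel fails the test, so the next start belongs to a genuine piece.
      have hen : e ≤ 2 * n := by
        by_contra hcon
        obtain rfl : e = 2 * n + 1 := by omega
        rw [hP.rep.v_last] at hPe
        exact hPlast hPe
      have hbk : b ∈ keep S b e := Finset.mem_filter.2 ⟨hb, Or.inl le_rfl⟩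
      have hek : e ∈ keep S b e := Finset.mem_filter.2 ⟨heS, Or.inr le_rfl⟩
      refine wp_absorbC (S := keep S b e) hN hn hM ((hf.ivar 2 (by omega)).trans h2)
        ((hf.ivar 20 (by omega)).trans h20) hPτ hbk hb' e5 hen ?_
      intro a' τ' e' ha' hf' e6' e7' e5' hee' hmin he' hP'
      have hkeep : keep S b e' = (keep S b e).erase e := by
        ext q
        simp only [keep, Finset.mem_filter, Finset.mem_erase]
        refine ⟨fun ⟨h₁, h₂⟩ => ⟨by omega, h₁, by omega⟩, fun ⟨h₁, h₂, h₃⟩ => ⟨h₂, ?_⟩⟩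
        rcases h₃ with h₃ | h₃
        · exact Or.inl h₃
        · exact Or.inr (hmin q (Finset.mem_filter.2 ⟨h₂, Or.inr h₃⟩) (by omega))
      have hcard : (keep S b e').card + 1 = (keep S b e).card := by
        rw [hkeep]; exact Finset.card_erase_add_one hek
      have hfill : ∀ (x : ℕ) (w : ℕ → ℕ), fill b e' x (fill b e x w) = fill b e' x w := by
        intro x w
        funext k
        simp only [fill]
        split_ifs <;> first | rfl | omega
      refine ⟨_, ⟨e', hf.trans hf', e6'.trans e6, e7'.trans e7, e5', by omega,
        (Finset.mem_filter.1 he').1, fun q hq h₁ h₂ => ?_, ?_, rfl⟩, ?_⟩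
      · rcases lt_trichotomy q e with h₃ | h₃ | h₃
        · exact hall q hq h₁ h₃
        · rw [h₃]; exact hPe
        · have := hmin q (Finset.mem_filter.2 ⟨hq, Or.inr h₃.le⟩) h₃
          omega
      · rw [hkeep]
        rw [e6, e7, ← hvb, ← htb, hfill, hfill] at hP'
        exact hP'
      -- The iteration removes exactly the start `e`. Its credit `60 * h + 100` covers the `60 * h +
      -- 60` steps of the merge and at most 31 for the test.
      · rw [← hcard, mul_add]; omega
    · omega
  · have hlt := hP.rep.lt_nxt b hb hb'
    have hmem := hP.rep.nxt_mem b hb hb'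
    have hkeep : keep S b (σ.iarr 5 b) = S := by
      refine Finset.filter_true_of_mem fun q hq => ?_
      rcases Nat.lt_or_ge b q with h' | h'
      · exact Or.inr (hP.rep.nxt_le b hb q hq h')
      · exact Or.inl h'
    have hfill : fill b (σ.iarr 5 b) (v b) v = v := by
      funext k
      rw [fill]; split_ifs with h'
      · rw [hvb]; exact (hP.rep.cell b hb hb' k h'.1 h'.2).1.symm
      · rfl
    have hfill' : fill b (σ.iarr 5 b) (tg b) tg = tg := by
      funext k
      rw [fill]; split_ifs with h'
      · rw [htb]; exact (hP.rep.cell b hb hb' k h'.1 h'.2).2.symm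
      · rfl
    refine ⟨σ.iarr 5 b, LFrame.refl σ, rfl, rfl, rfl, hlt, hmem, fun q hq h₁ h₂ => ?_, ?_, ?_⟩
    · have := hP.rep.nxt_le b hb q hq h₁
      omega
    · rw [hkeep, hfill, hfill']; exact hP
    · rw [hkeep]
  · rintro a' t' σ' hle ⟨e, h₁, h₂, h₃, h₄, h₅, h₆, h₇, h₈, rfl⟩
    exact hQ a' σ' e (by omega) h₁ h₂ h₃ h₄ h₅ h₆ h₇ h₈

/-- For the cell in variable `21`, puts the start of its piece into variable `22`, and into variable
`23` that of the piece, among this one and the one before it, that has the least value. -/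
def minC : Cmd :=
  .seq (.setI 30 (.var 21)) <| .seq predC <| .seq (.setI 22 (.sub (.var 34) (.lit 1))) <| .seq (.setI 23 (.var 22)) <|
  .ite (.ile (.lit 1) (.var 22))
    (.seq (.setI 30 (.sub (.var 22) (.lit 1))) <| .seq predC <| .seq (.setI 24 (.sub (.var 34) (.lit 1))) <|
    .ite (.ile (.get 6 (.var 22)) (.get 6 (.var 24))) .skip (.setI 23 (.var 24))) .skip

/-- Two predecessor searches: one for the row `k`, and one for the row just before its piece. A tie
is decided for the upper piece, so `src ≠ q` means that the lower piece is strictly better. -/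
theorem wp_minC {M h n N k : ℕ} {S : Finset ℕ} {v tg : ℕ → ℕ} {σ : State} {a : ℕ}
    {Q : ℕ → State → Prop} (hN : N = 2 ^ h) (hn : 2 * n + 1 < N) (hM : 2 * N + 20 ≤ M)
    (h2 : σ.ivar 2 = N) (h21 : σ.ivar 21 = k) (hk : k ≤ 2 * n) (hP : Pieces n N σ S v tg)
    (hQ : ∀ a' σ' q src, a' ≤ a + (120 * h + 120) → (∀ x < 22, σ'.ivar x = σ.ivar x) →
      σ'.rvar = σ.rvar → σ'.iarr = σ.iarr → σ'.rarr = σ.rarr →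
      σ'.ivar 22 = q → σ'.ivar 23 = src → IsPred S k q → src ∈ S → src ≤ q →
      v src = min (v q) (v (q - 1)) → (src ≠ q → v src < v q) →
      (∀ l, src ≤ l → l < q → v l = v src) → Q a' σ') : wp M minC σ a Q := by
  simp only [minC, wp_seq, wp_setI, IExpr.ok, IExpr.val, IExpr.cost, h21]
  refine ⟨by omega, ?_⟩
  refine wp_predC (S := S) (p := k) (K := σ.rarr 6) hN (by omega) (by simpa using h2) (by simp)
    (by omega) hP.tree hP.key_le hP.rep.zero fun a₁ σ₁ q ha₁ hf hT hq h34 => ?_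
  have harr : σ₁.iarr = σ.iarr := by
    funext b
    by_cases hb : b = 0
    · rw [hb]; exact hT
    · exact hf.iarr b hb
  have hqk := hq.2.1
  have hvar : ∀ x < 22, σ₁.ivar x = σ.ivar x := fun x hx => by
    rw [hf.ivar x (by omega)]; simp [show x ≠ 30 by omega]
  have hrv : σ₁.rvar = σ.rvar := hf.rvar
  have hra : σ₁.rarr = σ.rarr := hf.rarr
  simp only [wp_ite, wp_skip, wp_setI, wp_seq, IExpr.ok, IExpr.val, IExpr.cost, BExpr.ok, BExpr.val,
    BExpr.cost, State.setI_ivar, State.setI_iarr, h34, Nat.add_sub_cancel, if_true, if_false,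
    Nat.reduceEqDiff, harr]
  refine ⟨by omega, by omega, by omega, fun h1 => ⟨by omega, ?_⟩, fun h1 => ?_⟩
  · refine wp_predC (S := S) (p := q - 1) (K := σ.rarr 6) hN (by omega) ?_ (by simp)
      (by omega) ?_ hP.key_le hP.rep.zero fun a₂ σ₂ q₂ ha₂ hf₂ hT₂ hq₂ h34₂ => ?_
    · simp [hvar 2, h2]
    · simpa [hT] using hP.tree
    have h22 : σ₂.ivar 22 = q := by rw [hf₂.ivar 22 (by omega)]; simp
    have h23 : σ₂.ivar 23 = q := by rw [hf₂.ivar 23 (by omega)]; simp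
    have harr₂ : σ₂.iarr = σ.iarr := by
      funext b
      by_cases hb : b = 0
      · rw [hb, hT₂]; exact congrFun harr 0
      · rw [hf₂.iarr b hb]; exact congrFun harr b
    have hvar₂ : ∀ x < 22, σ₂.ivar x = σ.ivar x := fun x hx => by
      rw [hf₂.ivar x (by omega)]
      simp [show x ≠ 30 by omega, show x ≠ 22 by omega, show x ≠ 23 by omega, hvar x hx]
    have hrv₂ : σ₂.rvar = σ.rvar := hf₂.rvar.trans hrv
    have hra₂ : σ₂.rarr = σ.rarr := hf₂.rarr.trans hra
    have hv1 := hP.rep.val_eq hq.1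
    have hv2 := hP.rep.val_eq hq₂.1
    have hle := hq₂.2.1
    have hcell := hP.rep.cell_of_isPred hq₂ (by omega) hle le_rfl
    have b1 := hP.rep.val_le q hq.1
    have b2 := hP.rep.val_le q₂ hq₂.1
    simp only [State.setI_ivar, State.setI_iarr, h34₂, h22, harr₂, Nat.add_sub_cancel, if_true,
      if_false, Nat.reduceEqDiff]
    refine ⟨by omega, by omega, fun hc => ?_, fun hc => ⟨by omega, ?_⟩⟩
    · exact hQ _ _ q q (by omega)
        (fun x hx => by simp [show x ≠ 24 by omega, hvar₂ x hx])
        (by simp [hrv₂]) (by simp [harr₂]) (by simp [hra₂]) (by simp [h22]) (by simp [h23]) hq hq.1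
        le_rfl (by omega) (fun h' => absurd rfl h') fun l h₁ h₂ => by omega
    · exact hQ _ _ q q₂ (by omega)
        (fun x hx => by simp [show x ≠ 24 by omega, show x ≠ 23 by omega, hvar₂ x hx])
        (by simp [hrv₂]) (by simp [harr₂]) (by simp [hra₂]) (by simp [h22]) (by simp) hq hq₂.1
        (by omega) (by omega) (fun _ => by omega)
        fun l h₁ h₂ => (hP.rep.cell_of_isPred hq₂ (by omega) h₁ (by omega)).1
  -- There is no piece below; truncated subtraction makes `q - 1` equal to `q`, so the minimum is
  -- still correct.
  · obtain rfl : q = 0 := by omega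
    exact hQ _ _ 0 0 (by omega)
      (fun x hx => by simp [show x ≠ 23 by omega, show x ≠ 22 by omega, hvar x hx])
      (by simp [hrv]) (by simp [harr]) (by simp [hra]) (by simp) (by simp) hq hq.1
      le_rfl (by simp) (fun h' => absurd rfl h') fun l h₁ h₂ => by omega

/-! ## Sweeping over the columns -/

/-- The standing assumptions of the sweep: `KX` and `KY` are the coordinates of the sides, and the
start `s` is in the free cell `(cs, ps)`. -/
structure Ctx (n h N M cs ps : ℕ) (KX KY : ℕ → ℝ) (s : ℝ × ℝ) : Prop where
  hN : N = 2 ^ h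
  hn : 2 * n + 1 < N
  hM : 2 * N + 20 ≤ M
  axX : Axis n KX
  grid : IsGrid n (rank KX (2 * n)) (rank KY (2 * n))
  cs_le : cs ≤ 2 * n
  ps_le : ps ≤ 2 * n
  inX : InCell n KX s.1 cs
  inY : InCell n KY s.2 ps
  free : ¬ Blk n (rank KX (2 * n)) (rank KY (2 * n)) cs ps

/-- What the sweep reads. -/
structure Data (n N cs ps : ℕ) (KX KY : ℕ → ℝ) (s : ℝ × ℝ) (σ : State) : Prop where
  v0 : σ.ivar 0 = n
  v2 : σ.ivar 2 = N
  v4 : σ.ivar 4 = cs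
  v6 : σ.ivar 6 = ps
  v9 : σ.ivar 9 = 2 * n + 5
  r0 : σ.rvar 0 = s.1
  r2 : σ.rvar 2 = s.2
  sortY : Sorted KY (2 * n) (σ.iarr 1) (σ.iarr 2) (σ.rarr 7)
  sortX : Sorted KX (2 * n) (σ.iarr 3) (σ.iarr 4) (σ.rarr 8)

/-- What the sweep leaves unchanged. -/
structure EFrame (σ σ' : State) : Prop where
  ivar : ∀ x < 13, σ'.ivar x = σ.ivar x
  rvar : ∀ x < 5, σ'.rvar x = σ.rvar x
  iarr : ∀ b, 1 ≤ b → b ≤ 4 → σ'.iarr b = σ.iarr b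
  rarr : ∀ b < 9, σ'.rarr b = σ.rarr b

theorem EFrame.trans {σ σ' σ'' : State} (h : EFrame σ σ') (h' : EFrame σ' σ'') : EFrame σ σ'' :=
  ⟨fun x hx => (h'.ivar x hx).trans (h.ivar x hx), fun x hx => (h'.rvar x hx).trans (h.rvar x hx),
    fun b h₁ h₂ => (h'.iarr b h₁ h₂).trans (h.iarr b h₁ h₂),
    fun b hb => (h'.rarr b hb).trans (h.rarr b hb)⟩

theorem Data.of_frame {n N cs ps : ℕ} {KX KY : ℕ → ℝ} {s : ℝ × ℝ} {σ σ' : State}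
    (h : Data n N cs ps KX KY s σ) (hf : EFrame σ σ') : Data n N cs ps KX KY s σ' := by
  obtain ⟨h₀, h₁, h₂, h₃, h₄, h₅, h₆, h₇, h₈⟩ := h
  rw [← hf.iarr 1 (by omega) (by omega), ← hf.iarr 2 (by omega) (by omega),
    ← hf.rarr 7 (by omega)] at h₇
  rw [← hf.iarr 3 (by omega) (by omega), ← hf.iarr 4 (by omega) (by omega),
    ← hf.rarr 8 (by omega)] at h₈
  exact ⟨(hf.ivar 0 (by omega)).trans h₀, (hf.ivar 2 (by omega)).trans h₁,
    (hf.ivar 4 (by omega)).trans h₂, (hf.ivar 6 (by omega)).trans h₃,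
    (hf.ivar 9 (by omega)).trans h₄, (hf.rvar 0 (by omega)).trans h₅,
    (hf.rvar 2 (by omega)).trans h₆, h₇, h₈⟩

/-- `x` is the abscissa of a vertical run in column `e`: the least one right of the start. -/
def TurnX (n : ℕ) (KX : ℕ → ℝ) (sx x : ℝ) (e : ℕ) : Prop :=
  InCell n KX x e ∧ sx ≤ x ∧ ∀ z c', sx ≤ z → InCell n KX z c' → e ≤ c' → x ≤ z

/-- `y` is the ordinate of a horizontal run in row `j`. -/
def LevelY (n : ℕ) (KY : ℕ → ℝ) (ps : ℕ) (sy y : ℝ) (j : ℕ) : Prop :=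
  InCell n KY y j ∧ (j = ps → y = sy)

/-- The invariant of the sweep at column `c`. -/
structure Inv (n N r cs ps : ℕ) (KX KY : ℕ → ℝ) (s : ℝ × ℝ) (c : ℕ) (σ : State) (S : Finset ℕ)
    (v tg : ℕ → ℕ) : Prop where
  pieces : Pieces n N σ S v tg
  col : Col n (rank KX (2 * n)) (rank KY (2 * n)) c v
  sound : Sound n (rank KX (2 * n)) (rank KY (2 * n)) r cs ps s (TurnX n KX s.1)
    (LevelY n KY ps s.2) (σ.iarr 8) (σ.rarr 9) (σ.rarr 10) c v tg
  -- The hypothesis of `Col.min_le`, which treats the exempted value for unreached cells separately.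
  adj : ∀ p ∈ S, 1 ≤ p → p ≤ 2 * n → v p ≠ 2 * n + 5 → v (p - 1) ≠ v p

/-- Gives the value in variable `19` and the tag in variable `12` to the piece that starts at the
value of variable `20`, and extends it up to the row in variable `15` and on over
free pieces that have no smaller value. -/
def coverC : Cmd :=
  .seq (.putI 6 (.var 20) (.var 19)) <| .seq (.putI 7 (.var 20) (.var 12)) <|
  .loop (.not (.and (.ile (.var 15) (.get 5 (.var 20)))
    (.not (.and (.ile (.var 19) (.get 6 (.get 5 (.var 20))))
      (.ile (.get 6 (.get 5 (.var 20))) (.var 9)))))) absorbC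

/-- The loop absorbs the next piece while it starts below `hi`, or while it is free and its value is
at least `cv`. It stops at `hi` or later, at a blocked piece or a smaller value, which is the
condition on the upper end in `Col.right`. -/
theorem wp_coverC {M h n N b hi cv c : ℕ} {S : Finset ℕ} {v tg : ℕ → ℕ} {σ : State} {a : ℕ}
    {Q : ℕ → State → Prop} (hN : N = 2 ^ h) (hn : 2 * n + 1 < N) (hM : 2 * N + 20 ≤ M)
    (h2 : σ.ivar 2 = N) (h9 : σ.ivar 9 = 2 * n + 5) (h12 : σ.ivar 12 = c) (h15 : σ.ivar 15 = hi)
    (h19 : σ.ivar 19 = cv) (h20 : σ.ivar 20 = b) (hP : Pieces n N σ S v tg) (hb : b ∈ S)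
    (hb' : b ≤ 2 * n) (hhi : hi ≤ 2 * n) (hcv : cv ≤ 2 * n + 6) (hc : c ≤ 2 * n + 1)
    (hQ : ∀ a' σ' e, a' + (60 * h + 100) * (keep S b e).card ≤
        a + (60 * h + 100) * S.card + 50 → LFrame σ σ' → b < e → e ∈ S → hi ≤ e →
      (∀ q ∈ S, b < q → q < e → q < hi ∨ (cv ≤ v q ∧ v q ≤ 2 * n + 5)) →
      (v e < cv ∨ v e = 2 * n + 6) →
      Pieces n N σ' (keep S b e) (fill b e cv v) (fill b e c tg) → Q a' σ') :
    wp M coverC σ a Q := by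
  have hlt := hP.rep.lt_nxt b hb hb'
  have hnS := hP.rep.nxt_mem b hb hb'
  simp only [coverC, wp_seq, wp_putI, IExpr.ok, IExpr.val, IExpr.cost, State.putI_ivar, h12, h19,
    h20]
  refine ⟨by omega, by omega, by omega, by omega, ?_⟩
  have hP' : Pieces n N ((σ.putI 6 b cv).putI 7 b c) S (fill b (σ.iarr 5 b) cv v)
      (fill b (σ.iarr 5 b) c tg) :=
    ⟨by simpa using hP.tree, by simpa using hP.rep.set hb hb' hcv hc, by simpa using hP.key⟩
  have hv1 : ∀ q ∈ S, b < q → fill b (σ.iarr 5 b) cv v q = v q := fun q hq h' =>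
    fill_ge (hP.rep.nxt_le b hb q hq h')
  refine wp_absorb_loop (b := b) (S := S) (fun q x => q < hi ∨ (cv ≤ x ∧ x ≤ 2 * n + 5)) hN hn hM
    (by simp [h2]) (by simp [h20]) hP' hb hb' (by omega) (by simp [BExpr.cost, IExpr.cost]) ?_ ?_
  · intro τ hf e6 h5 hval
    have g9 := hf.ivar 9 (by omega)
    have g15 := hf.ivar 15 (by omega)
    have g19 := hf.ivar 19 (by omega)
    have g20 := hf.ivar 20 (by omega)
    rw [← e6] at hval ⊢
    simp only [State.putI_ivar, h9, h15, h19, h20] at g9 g15 g19 g20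
    simp only [BExpr.ok, BExpr.val, IExpr.ok, IExpr.val, g9, g15, g19, g20]
    omega
  · intro a' σ' e ha hf e6 e7 hbe heS hall hend hPs
    have hne := hP.rep.nxt_le b hb e heS hbe
    rw [hv1 e heS hbe] at hend
    have hle := hP.rep.val_le e heS
    rw [← hP.rep.val_eq heS] at hle
    rw [fill_in le_rfl hlt, fill_in le_rfl hlt] at hPs
    have hff : ∀ (x : ℕ) (w : ℕ → ℕ), fill b e x (fill b (σ.iarr 5 b) x w) = fill b e x w := by
      intro x w
      funext k
      simp only [fill]
      split_ifs <;> first | rfl | omega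
    rw [hff, hff] at hPs
    refine hQ a' σ' e (by omega) ⟨fun x hx => ?_, ?_, fun b h₁ h₂ h₃ h₄ => ?_, ?_⟩ hbe heS
      (by omega) (fun q hq h₁ h₂ => ?_) (by omega) hPs
    · rw [hf.ivar x hx]; simp
    · rw [hf.rvar]; simp
    · rw [hf.iarr b h₁ h₂ h₃ h₄]; simp [h₃, h₄]
    · rw [hf.rarr]; simp
    · have := hall q hq h₁ h₂
      rwa [hv1 q hq h₁] at this

theorem Rep.exists_isPred {n : ℕ} {S : Finset ℕ} {nxt val tag v tg : ℕ → ℕ}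
    (h : Rep n S nxt val tag v tg) (k : ℕ) : ∃ p, IsPred S k p := by
  have hne : (S.filter (· ≤ k)).Nonempty := ⟨0, by simp [h.zero]⟩
  refine ⟨(S.filter (· ≤ k)).max' hne, ?_, ?_, fun q hq hqk => ?_⟩
  · exact (Finset.mem_filter.1 (Finset.max'_mem _ hne)).1
  · exact (Finset.mem_filter.1 (Finset.max'_mem _ hne)).2
  · exact Finset.le_max' _ _ (by simp [hq, hqk])

/-- The values in a covered range. -/
theorem Rep.between {n b e hi cv : ℕ} {S : Finset ℕ} {nxt val tag v tg : ℕ → ℕ}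
    (h : Rep n S nxt val tag v tg) (he : e ≤ 2 * n + 1) (hhi : hi ∈ S) (hb : b < hi)
    (hall : ∀ q ∈ S, b < q → q < e → q < hi ∨ (cv ≤ v q ∧ v q ≤ 2 * n + 5)) {k : ℕ}
    (h₁ : hi ≤ k) (h₂ : k < e) : cv ≤ v k ∧ v k ≤ 2 * n + 5 := by
  obtain ⟨p, hp⟩ := h.exists_isPred k
  have h₃ := hp.2.1
  have h₄ := hp.2.2 hi hhi h₁
  have h₅ := hall p hp.1 (by omega) (by omega)
  rw [(h.cell_of_isPred hp (by omega) h₃ le_rfl).1]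
  omega

/-- A piece starts where the value changes. -/
theorem Rep.mem_of_ne {n : ℕ} {S : Finset ℕ} {nxt val tag v tg : ℕ → ℕ}
    (h : Rep n S nxt val tag v tg) {k : ℕ} (h₁ : 1 ≤ k) (hk : k ≤ 2 * n) (hne : v (k - 1) ≠ v k) :
    k ∈ S := by
  by_contra hkS
  obtain ⟨p, hp⟩ := h.exists_isPred k
  have h₃ := hp.2.1
  have h₄ : p ≠ k := fun he => hkS (he ▸ hp.1)
  rw [(h.cell_of_isPred hp hk h₃ le_rfl).1,
    (h.cell_of_isPred hp hk (l := k - 1) (by omega) (by omega)).1] at hne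
  exact hne rfl

/-- The ordinate of row `23`, in the real variable `5`. -/
def levelC : Cmd :=
  .ite (.ile (.var 23) (.var 6)) (.setR 5 (.var 2))
    (.setR 5 (.div (.add (.get 7 (.sub (.var 23) (.lit 1))) (.get 7 (.var 23))) (.lit 2)))

/-- In the row of the start the ordinate must be that of the start, since the path may have no
vertical link before it. Any row strictly between the start row and the top row is represented by
the midpoint of its two bounds; the top row has no upper bound and is excluded. -/
theorem wp_levelC {M h n N cs ps src : ℕ} {KX KY : ℕ → ℝ} {s : ℝ × ℝ} {σ : State} {a : ℕ}
    {Q : ℕ → State → Prop} (hC : Ctx n h N M cs ps KX KY s) (hD : Data n N cs ps KX KY s σ)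
    (h23 : σ.ivar 23 = src) (hsrc : src ≤ 2 * n)
    (hQ : ∀ a' y, a' ≤ a + 20 → (ps ≤ src → src < 2 * n → LevelY n KY ps s.2 y src) →
      Q a' (σ.setR 5 y)) : wp M levelC σ a Q := by
  have := hC.hn
  have := hC.hM
  have := hC.ps_le
  simp only [levelC, wp_ite, wp_setR, IExpr.ok, IExpr.val, IExpr.cost, BExpr.ok, BExpr.val,
    BExpr.cost, RExpr.ok, RExpr.val, RExpr.cost, h23, hD.v6, hD.r2]
  refine ⟨by omega, fun hle => ⟨trivial, hQ _ _ (by omega) fun h₁ h₂ => ?_⟩,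
    fun hlt => ⟨⟨by omega, trivial⟩, hQ _ _ (by omega) fun h₁ h₂ => ?_⟩⟩
  · obtain rfl : src = ps := by omega
    exact ⟨hC.inY, fun _ => rfl⟩
  · refine ⟨?_, fun h' => by omega⟩
    have r₁ := hD.sortY.rank_ord (src - 1) (by omega)
    have r₂ := hD.sortY.rank_ord src h₂
    have l₁ := hD.sortY.ord_lt (src - 1) (by omega)
    have hKlt : KY (σ.iarr 2 (src - 1)) < KY (σ.iarr 2 src) := by
      by_contra hc
      have := (rank_le_rank_iff (m := 2 * n) l₁).2 (not_lt.1 hc)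
      omega
    rw [hD.sortY.sv_eq (src - 1) (by omega), hD.sortY.sv_eq src h₂]
    push_cast
    exact inCell_of_between l₁ (by omega) r₂ (by linarith) (by linarith)

/-- The sweep passes the left side of rectangle `13`. -/
def leftC : Cmd :=
  .seq (.setI 15 (.get 1 (.add (.var 0) (.var 13)))) <| .seq (.setI 14 (.var 15)) <| .seq splitC <|
  .seq (.setI 14 (.get 1 (.var 13))) <| .seq splitC <|
  .seq (.setI 20 (.var 14)) <| .seq (.setI 19 (.add (.var 9) (.lit 1))) <| coverC

theorem wp_leftC {M h n N r cs ps i c : ℕ} {KX KY : ℕ → ℝ} {s : ℝ × ℝ} {S : Finset ℕ}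
    {v tg : ℕ → ℕ} {σ : State} {a : ℕ}
    {Q : ℕ → State → Prop} (hC : Ctx n h N M cs ps KX KY s) (hD : Data n N cs ps KX KY s σ)
    (h13 : σ.ivar 13 = i) (hi : i < n) (hc : rank KX (2 * n) i = c + 1) (h12 : σ.ivar 12 = c + 1)
    (hI : Inv n N r cs ps KX KY s c σ S v tg)
    (hQ : ∀ a' σ' S' v' tg', a' + (60 * h + 100) * S'.card ≤
        a + (60 * h + 100) * S.card + (360 * h + 600) → EFrame σ σ' →
      Inv n N r cs ps KX KY s (c + 1) σ' S' v' tg' →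
      (∀ k ≤ 2 * n, ¬ Blk n (rank KX (2 * n)) (rank KY (2 * n)) (c + 1) k → v' k ≤ v k) →
      ((∀ k ≤ 2 * n, 2 * n + 5 ≤ v k) → ∀ k ≤ 2 * n, 2 * n + 5 ≤ v' k) → Q a' σ') :
    wp M leftC σ a Q := by
  have hN := hC.hN
  have hn := hC.hn
  have hM := hC.hM
  have hxp := hC.grid.xpos i (by omega)
  have hlo := hC.grid.ypos i (by omega)
  have hhi := hC.grid.ypos (n + i) (by omega)
  have hlh := hC.grid.ylt i hi
  set lo := rank KY (2 * n) i with hlodef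
  set hi' := rank KY (2 * n) (n + i) with hidef
  have e1 : σ.iarr 1 i = lo := hD.sortY.rk_eq i (by omega)
  have e2 : σ.iarr 1 (n + i) = hi' := hD.sortY.rk_eq (n + i) (by omega)
  simp only [leftC, wp_seq, wp_setI, IExpr.ok, IExpr.val, IExpr.cost, State.setI_ivar,
    State.setI_iarr, if_true, if_false, Nat.reduceEqDiff, h13, hD.v0, e2]
  refine ⟨by omega, by omega, ?_⟩
  refine wp_splitC (x := hi') (S := S) (v := v) (tg := tg) hN hn hM (by simp [hD.v2]) (by simp)
    (by omega) (hI.pieces.of_frame rfl rfl rfl rfl rfl) fun a₁ σ₁ ha₁ hf₁ hP₁ => ?_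
  have k1 : σ₁.iarr 1 = σ.iarr 1 := hf₁.iarr 1 (by omega) (by omega) (by omega) (by omega)
  have k13 : σ₁.ivar 13 = i := by rw [hf₁.ivar 13 (by omega)]; simp [h13]
  have k15 : σ₁.ivar 15 = hi' := by rw [hf₁.ivar 15 (by omega)]; simp
  have k2 : σ₁.ivar 2 = N := by rw [hf₁.ivar 2 (by omega)]; simp [hD.v2]
  have k9 : σ₁.ivar 9 = 2 * n + 5 := by rw [hf₁.ivar 9 (by omega)]; simp [hD.v9]
  have k12 : σ₁.ivar 12 = c + 1 := by rw [hf₁.ivar 12 (by omega)]; simp [h12]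
  simp only [k13, k1, e1]
  refine ⟨by omega, ?_⟩
  refine wp_splitC (x := lo) (S := insert hi' S) (v := v) (tg := tg) hN hn hM (by simp [k2])
    (by simp) (by omega) (hP₁.of_frame rfl rfl rfl rfl rfl) fun a₂ σ₂ ha₂ hf₂ hP₂ => ?_
  have j2 : σ₂.ivar 2 = N := by rw [hf₂.ivar 2 (by omega)]; simp [k2]
  have j9 : σ₂.ivar 9 = 2 * n + 5 := by rw [hf₂.ivar 9 (by omega)]; simp [k9]
  have j12 : σ₂.ivar 12 = c + 1 := by rw [hf₂.ivar 12 (by omega)]; simp [k12]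
  have j14 : σ₂.ivar 14 = lo := by rw [hf₂.ivar 14 (by omega)]; simp
  have j15 : σ₂.ivar 15 = hi' := by rw [hf₂.ivar 15 (by omega)]; simp [k15]
  simp only [j9, j14]
  refine ⟨by omega, by omega, ?_⟩
  set T := insert lo (insert hi' S) with hT
  refine wp_coverC (b := lo) (hi := hi') (cv := 2 * n + 6) (c := c + 1) (S := T) (v := v) (tg := tg)
    hN hn hM (by simp [j2]) (by simp [j9]) (by simp [j12]) (by simp [j15]) (by simp) (by simp)
    (hP₂.of_frame rfl rfl rfl rfl rfl) (by simp [hT]) (by omega) (by omega) (by omega) (by omega)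
    fun a₃ σ₃ e ha₃ hf₃ hbe heT hhe hall hend hP₃ => ?_
  -- Two splits create at most two starts. Their time `2 * (120 * h + 120)` and their credits `2 *
  -- (60 * h + 100)` make up the main part of the bound.
  have hcard : T.card ≤ S.card + 2 := by
    have h₁ := Finset.card_insert_le lo (insert hi' S)
    have h₂ := Finset.card_insert_le hi' S
    rw [hT]; omega
  have hmul : (60 * h + 100) * T.card ≤ (60 * h + 100) * S.card + 2 * (60 * h + 100) := by
    calc _ ≤ (60 * h + 100) * (S.card + 2) := Nat.mul_le_mul_left _ hcard
      _ = _ := by ring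
  -- No value lies between `2 * n + 6` and `2 * n + 5`, so the covering stops at the top of the
  -- rectangle.
  have hee : e = hi' := by
    by_contra hne
    have := hall hi' (by simp [hT]) (by omega) (by omega)
    omega
  have hEF : EFrame σ σ₃ := by
    refine ⟨fun x hx => ?_, fun x hx => ?_, fun b h₁ h₂ => ?_, fun b hb => ?_⟩
    · rw [hf₃.ivar x (by omega)]
      simp only [State.setI_ivar, show x ≠ 19 by omega, show x ≠ 20 by omega, if_false]
      rw [hf₂.ivar x (by omega)]
      simp only [State.setI_ivar, show x ≠ 14 by omega, if_false]
      rw [hf₁.ivar x (by omega)]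
      simp [show x ≠ 14 by omega, show x ≠ 15 by omega]
    · rw [hf₃.rvar, State.setI_rvar, State.setI_rvar, hf₂.rvar, State.setI_rvar, hf₁.rvar]; simp
    · rw [hf₃.iarr b (by omega) (by omega) (by omega) (by omega), State.setI_iarr,
        State.setI_iarr, hf₂.iarr b (by omega) (by omega) (by omega) (by omega), State.setI_iarr,
        hf₁.iarr b (by omega) (by omega) (by omega) (by omega)]; simp
    · rw [hf₃.rarr, State.setI_rarr, State.setI_rarr, hf₂.rarr, State.setI_rarr, hf₁.rarr]; simp
  have hi8 : σ₃.iarr 8 = σ.iarr 8 := by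
    rw [hf₃.iarr 8 (by omega) (by omega) (by omega) (by omega), State.setI_iarr,
        State.setI_iarr, hf₂.iarr 8 (by omega) (by omega) (by omega) (by omega), State.setI_iarr,
        hf₁.iarr 8 (by omega) (by omega) (by omega) (by omega)]; simp
  have hrr : σ₃.rarr = σ.rarr := by
    rw [hf₃.rarr, State.setI_rarr, State.setI_rarr, hf₂.rarr, State.setI_rarr, hf₁.rarr]; simp
  subst hee
  have hcol := Col.left hC.grid hi hc hI.col
  refine hQ a₃ σ₃ _ _ _ (by omega) hEF ⟨hP₃, hcol, ?_, ?_⟩ (fun k hk hb => ?_)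
    fun hinf k hk => ?_
  · rw [hi8, hrr]
    exact Sound.left hC.grid hi hc hI.col hI.sound fun k hk => by
      rw [fill, if_neg (by omega)]
  · intro p hp h₁ h₂ hne
    obtain ⟨hpT, hout⟩ := Finset.mem_filter.1 hp
    -- By general position the rows just below and just above the rectangle are free, so the two new
    -- boundaries separate different values.
    have hb₁ := not_blk_left hC.grid hi hc (k := lo - 1) (by omega) (by omega)
    have hb₂ := not_blk_left hC.grid hi hc (k := hi') (by omega) (by omega)
    rw [← hI.col.blk _ (by omega)] at hb₁ hb₂
    rcases Nat.lt_trichotomy p lo with h' | h' | h'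
    · have hpS : p ∈ S := by
        simp only [hT, Finset.mem_insert] at hpT
        rcases hpT with h'' | h'' | h''
        · omega
        · omega
        · exact h''
      rw [fill_lt h'] at hne ⊢
      rw [fill_lt (by omega)]
      exact hI.adj p hpS h₁ h₂ hne
    · rw [h', fill_lt (by omega), fill_in le_rfl hbe]
      exact hb₁
    · rcases Nat.eq_or_lt_of_le (show hi' ≤ p by omega) with h'' | h''
      · rw [← h'', fill_in (by omega) (by omega), fill_ge le_rfl]
        exact Ne.symm hb₂
      · have hpS : p ∈ S := by
          simp only [hT, Finset.mem_insert] at hpT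
          rcases hpT with h'' | h'' | h''
          · omega
          · omega
          · exact h''
        rw [fill_ge (by omega)] at hne ⊢
        rw [fill_ge (by omega)]
        exact hI.adj p hpS h₁ h₂ hne
  · rw [← hcol.blk k hk] at hb
    have := hI.col.le k hk
    rw [fill] at hb ⊢
    split_ifs at hb ⊢
    · omega
    · exact le_rfl
  · rw [fill]; split_ifs
    · omega
    · exact hinf k hk

/-- Records the vertical run in the column in variable `12`, from the row in variable `23`, and covers
the rows that it reaches. -/
def raiseC : Cmd :=
  .seq (.putI 8 (.var 12) (.get 7 (.var 23))) <|
  .seq (.putR 9 (.var 12) (.get 8 (.sub (.var 12) (.lit 1)))) <| .seq (.putR 10 (.var 12) (.var 5)) <|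
  .seq (.ite (.ile (.var 19) (.get 6 (.var 22))) (.setI 20 (.var 22)) (.setI 20 (.var 14))) <| coverC

-- The combinatorial heart of the sweep. `q` is the start of the piece just under the rectangle, and
-- `src` the start of the piece with the least value on the free run there. The new vertical run
-- leaves row `src`, and its value `cv` covers the freed rows and those above that it does not
-- worsen. The invariant is restored by `Col.right` and `Sound.right`. The alternative in `hcs` says
-- that either the column of the start has been passed or nothing is reached yet.
set_option maxHeartbeats 1000000 in
theorem wp_raiseC {M h n N r cs ps i c q src cv : ℕ} {KX KY : ℕ → ℝ} {s : ℝ × ℝ} {S : Finset ℕ}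
    {v tg : ℕ → ℕ} {σ : State} {a : ℕ}
    {Q : ℕ → State → Prop} (hC : Ctx n h N M cs ps KX KY s)
    (h2 : σ.ivar 2 = N) (h9 : σ.ivar 9 = 2 * n + 5)
    (hi : i < n) (hc : rank KX (2 * n) (n + i) = c + 1)
    (h12 : σ.ivar 12 = c + 1) (hsv : σ.rarr 8 c = KX (n + i))
    (h14 : σ.ivar 14 = rank KY (2 * n) i) (h15 : σ.ivar 15 = rank KY (2 * n) (n + i))
    (h19 : σ.ivar 19 = cv) (h22 : σ.ivar 22 = q) (h23 : σ.ivar 23 = src)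
    (hcv : cv = min (v src + 1) (2 * n + 5))
    (hq : IsPred S (rank KY (2 * n) i - 1) q) (hsrcS : src ∈ S) (hsq : src ≤ q)
    (hvsrc : v src = min (v q) (v (q - 1))) (hlt : src ≠ q → v src < v q)
    (hsame : ∀ l, src ≤ l → l < q → v l = v src)
    (hy : ps ≤ src → src < 2 * n → LevelY n KY ps s.2 (σ.rvar 5) src)
    (hcs : cs ≤ c ∨ ∀ k ≤ 2 * n, 2 * n + 5 ≤ v k)
    (hI : Inv n N r cs ps KX KY s c σ S v tg)
    (hQ : ∀ a' σ' S' v' tg', a' + (60 * h + 100) * S'.card ≤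
        a + (60 * h + 100) * S.card + 120 → EFrame σ σ' →
      Inv n N r cs ps KX KY s (c + 1) σ' S' v' tg' →
      (∀ k ≤ 2 * n, ¬ Blk n (rank KX (2 * n)) (rank KY (2 * n)) (c + 1) k → v' k ≤ v k) →
      ((∀ k ≤ 2 * n, 2 * n + 5 ≤ v k) → ∀ k ≤ 2 * n, 2 * n + 5 ≤ v' k) → Q a' σ') :
    wp M raiseC σ a Q := by
  have hN := hC.hN
  have hn := hC.hn
  have hM := hC.hM
  have hG := hC.grid
  have hxp := hG.xpos (n + i) (by omega)
  have hlo := hG.ypos i (by omega)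
  have hhi := hG.ypos (n + i) (by omega)
  have hlh := hG.ylt i hi
  have hPτ := hI.pieces
  set lo := rank KY (2 * n) i with hlodef
  set hi' := rank KY (2 * n) (n + i) with hidef
  have hb₁ := not_blk_right hG hi hc (k := lo - 1) (Or.inl (by omega))
  have hb₂ := not_blk_right hG hi hc (k := hi') (Or.inr rfl)
  have hbin : ∀ k, lo ≤ k → k < hi' → v k = 2 * n + 6 := fun k h₁ h₂ =>
    (hI.col.blk k (by omega)).2 (blk_of_right hG hi hc h₁ h₂)
  rw [← hI.col.blk _ (by omega)] at hb₁ hb₂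
  -- No splitting is needed: the value changes at both ends of the blocked range, so pieces start
  -- there.
  have hloS : lo ∈ S := hPτ.rep.mem_of_ne (by omega) (by omega) (by
    rw [hbin lo le_rfl hlh]; exact hb₁)
  have hhiS : hi' ∈ S := hPτ.rep.mem_of_ne (by omega) (by omega) (by
    rw [hbin (hi' - 1) (by omega) (by omega)]; exact Ne.symm hb₂)
  have hql := hq.2.1
  have l6q : σ.iarr 6 q = v q := (hPτ.rep.val_eq hq.1).symm
  have l7 : σ.iarr 7 src = tg src := (hPτ.rep.tag_eq hsrcS (by omega)).symm
  have t7 := hPτ.rep.tag_le src hsrcS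
  rw [l7] at t7
  have hvqlo : v q = v (lo - 1) := (hPτ.rep.cell_of_isPred hq (by omega) hql le_rfl).1.symm
  have hvq5 : v q ≤ 2 * n + 5 := by
    have := hI.col.le (lo - 1) (by omega)
    omega
  have hqfree : ∀ k, q ≤ k → k < lo → v k = v q := fun k h₁ h₂ =>
    (hPτ.rep.cell_of_isPred hq (by omega) h₁ (by omega)).1
  have hvs5 : v src ≤ 2 * n + 5 := by omega
  simp only [raiseC, wp_ite, wp_putI, wp_putR, wp_setI, wp_seq, IExpr.ok, IExpr.val, IExpr.cost,
    BExpr.ok, BExpr.val, BExpr.cost, RExpr.ok, RExpr.val, RExpr.cost, State.putR_ivar,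
    State.putR_iarr, State.putI_rarr, State.putI_ivar, State.putI_iarr, State.putI_rvar,
    State.putR_rvar, if_true, if_false, Nat.reduceEqDiff, h12, h23, h22, h14, h19, l7,
    l6q, Nat.add_sub_cancel, hsv]
  refine ⟨by omega, by omega, by omega, by omega, by omega, trivial, by omega, ?_⟩
  -- If the piece under the rectangle already has the value `cv`, the covering begins with that
  -- piece, for otherwise two neighbouring pieces would have equal values. If its value is smaller,
  -- the covering begins at the bottom of the rectangle.
  suffices H : ∀ (a₄ b : ℕ), a₄ ≤ a + 50 → b ∈ S → b ≤ lo → (b = q ∨ b = lo) →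
      (cv ≤ v q ↔ b = q) →
      wp M coverC ((((σ.putI 8 (c + 1) (tg src)).putR 9 (c + 1) (KX (n + i))).putR 10 (c + 1)
        (σ.rvar 5)).setI 20 b) a₄ Q by
    refine ⟨fun h' => ⟨by omega, H _ q (by omega) hq.1 (by omega) (Or.inl rfl) (by simp [h'])⟩,
      fun h' => ⟨by omega, H _ lo (by omega) hloS le_rfl (Or.inr rfl) ?_⟩⟩
    exact ⟨fun h'' => absurd h'' h', fun h'' => by omega⟩
  intro a₄ b ha₄ hbS hblo hbq hbiff
  refine wp_coverC (b := b) (hi := hi') (cv := cv) (c := c + 1) (S := S) (v := v) (tg := tg)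
    hN hn hM (by simp [h2]) (by simp [h9]) (by simp [h12]) (by simp [h15]) (by simp [h19])
    (by simp) (hPτ.of_frame (by simp) (by simp) (by simp) (by simp) (by simp)) hbS (by omega)
    (by omega) (by omega) (by omega) fun a₅ σ₅ e ha₅ hf₅ hbe heS hhe hall hend hP₅ => ?_
  have hel := hPτ.rep.le e heS
  have hev : ∀ k, hi' ≤ k → k < e → cv ≤ v k ∧ v k ≤ 2 * n + 5 := fun k h₁ h₂ =>
    hPτ.rep.between hel hhiS (by omega) hall h₁ h₂
  -- Closure across the boundary between the two pieces. With `v src < v q` it makes `v q` exactly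
  -- `v src + 1`.
  have hclo : src ≠ q → v q ≤ v src + 1 := fun hne => by
    have h₁ := hlt hne
    have h₂ : v (q - 1) = v src := hsame (q - 1) (by omega) (by omega)
    have := hI.col.clo (q - 1) q (by omega) ⟨by omega, fun k h₃ h₄ => by
      rw [← hI.col.blk k (by omega)]
      rcases (show k = q - 1 ∨ k = q by omega) with rfl | rfl <;> omega⟩
    omega
  have hbv : ∀ k, b ≤ k → k < lo → v k = cv := fun k h₁ h₂ => by
    have hbq' : b = q := by omega
    have h₃ := hbiff.2 hbq'
    have h₄ := hqfree k (by omega) h₂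
    by_cases hsq' : src = q
    · rw [hsq'] at hcv; omega
    · have := hclo hsq'
      omega
  -- The bound `m₀` is `v src`; it holds on the whole run below because its minimum lies in the last
  -- two pieces.
  obtain ⟨hcol, hmono⟩ := Col.right hG hi hc hI.col (m₀ := v src) (cv := cv) (b := b) (e := e)
    (fun j hj => by
      rw [hvsrc]
      exact hI.col.min_le (by omega) (by omega) hql (fun l h₁ h₂ => hqfree l h₁ (by omega))
        (fun h₁ h₂ => hI.adj q hq.1 h₁ (by omega) h₂) hj)
    (hI.col.fin src (by omega)) hcv hblo hbv hhe hel hev fun _ => hend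
  have hEF₅ : EFrame σ σ₅ := by
    refine ⟨fun x hx => ?_, fun x hx => ?_, fun b h₁ h₂ => ?_, fun b hb => ?_⟩
    · rw [hf₅.ivar x (by omega)]
      simp [show x ≠ 20 by omega]
    · rw [hf₅.rvar]; simp [show x ≠ 5 by omega]
    · rw [hf₅.iarr b (by omega) (by omega) (by omega) (by omega)]
      simp [show b ≠ 8 by omega]
    · rw [hf₅.rarr]; simp [show b ≠ 9 by omega, show b ≠ 10 by omega]
  have s8 : σ₅.iarr 8 = Function.update (σ.iarr 8) (c + 1) (tg src) := by
    rw [hf₅.iarr 8 (by omega) (by omega) (by omega) (by omega)]; simp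
  have s9 : σ₅.rarr 9 = Function.update (σ.rarr 9) (c + 1) (KX (n + i)) := by
    rw [hf₅.rarr]; simp
  have s10 : σ₅.rarr 10 = Function.update (σ.rarr 10) (c + 1) (σ.rvar 5) := by
    rw [hf₅.rarr]; simp
  refine hQ a₅ σ₅ (keep S b e) (fill b e cv v) (fill b e (c + 1) tg) (by omega) hEF₅
    ⟨hP₅, hcol, ?_, ?_⟩ (fun k hk _ => hmono k hk) fun hinf k hk => ?_
  · refine Sound.right hG hi hc hI.col hcol hI.sound (src := src) (fun d hd => ?_) (fun d hd => ?_)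
      (fun d hd => ?_) (by omega) hcv ?_ fun hfin => ⟨?_, ?_, ?_, ?_⟩
    · rw [s8, Function.update_of_ne (by omega)]
    · rw [s9, Function.update_of_ne (by omega)]
    · rw [s10, Function.update_of_ne (by omega)]
    · rw [s8]; simp
    · rcases hbq with rfl | rfl
      · by_contra hc'
        obtain rfl : src = b := by omega
        have := hbiff.2 rfl
        omega
      · omega
    · refine ⟨by omega, fun k h₁ h₂ => ?_⟩
      rw [← hcol.blk k (by omega)]
      rcases Nat.lt_or_ge k b with h₃ | h₃
      · rw [fill_lt h₃]
        rcases Nat.lt_or_ge k q with h₄ | h₄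
        · rw [hsame k h₁ h₄]; omega
        · rw [hqfree k h₄ (by omega)]; omega
      · rw [fill_in h₃ (by omega)]; omega
    · rw [s9, Function.update_self]
      -- The right side of the rectangle belongs to the column behind it and is its least abscissa,
      -- so a run on it is left of every point of this and all later columns.
      have hup := inCell_upper hC.axX hi
      rw [hc] at hup
      refine ⟨hup, ?_, fun x' c' _ hx' hle => ?_⟩
      · rcases hcs with hcs | hcs
        · exact (hC.inX.lt hup (by omega) ⟨n + i, by omega, hc⟩).le
        · have := hcs src (by omega)
          omega
      · exact (hx' i hi).2.2 (by omega)
    · rw [s10, Function.update_self]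
      exact hy (hI.sound src (by omega) hfin).start_le (by omega)
  · intro p hp h₁ h₂ hne
    obtain ⟨hpS, hout⟩ := Finset.mem_filter.1 hp
    rcases Nat.lt_trichotomy p b with h' | h' | h'
    · rw [fill_lt h'] at hne ⊢
      rw [fill_lt (by omega)]
      exact hI.adj p hpS h₁ h₂ hne
    · subst h'
      rw [fill_in le_rfl hbe] at hne ⊢
      rw [fill_lt (by omega)]
      rcases hbq with rfl | rfl
      · have h₃ := hbv p le_rfl (by omega)
        have := hI.adj p hpS h₁ h₂ (by omega)
        omega
      · have h₃ : ¬ cv ≤ v q := fun h' => by have := hbiff.1 h'; omega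
        omega
    · rcases Nat.eq_or_lt_of_le (show e ≤ p by omega) with h'' | h''
      · rw [← h'', fill_in (by omega) (by omega), fill_ge le_rfl]
        omega
      · rw [fill_ge (by omega)] at hne ⊢
        rw [fill_ge (by omega)]
        exact hI.adj p hpS h₁ h₂ hne
  · rw [fill]; split_ifs
    · have := hinf src (by omega)
      omega
    · exact hinf k hk

/-- The sweep passes the right side of rectangle `13 - n`. -/
def rightC : Cmd :=
  .seq (.setI 14 (.get 1 (.sub (.var 13) (.var 0)))) <| .seq (.setI 15 (.get 1 (.var 13))) <|
  .seq (.setI 21 (.sub (.var 14) (.lit 1))) <| .seq minC <| .seq levelC <|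
  .seq (.setI 19 (.add (.get 6 (.var 23)) (.lit 1))) <|
  .seq (.ite (.ile (.var 19) (.var 9)) .skip (.setI 19 (.var 9))) <| raiseC

/-- The value of the new run is one more than the least value below, capped at `2 * n + 5`, so that
an unreached run below yields unreached rows. Setting up the run costs two predecessor searches and
creates no piece. -/
theorem wp_rightC {M h n N r cs ps i c : ℕ} {KX KY : ℕ → ℝ} {s : ℝ × ℝ} {S : Finset ℕ}
    {v tg : ℕ → ℕ} {σ : State} {a : ℕ}
    {Q : ℕ → State → Prop} (hC : Ctx n h N M cs ps KX KY s) (hD : Data n N cs ps KX KY s σ)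
    (h13 : σ.ivar 13 = n + i) (hi : i < n) (hc : rank KX (2 * n) (n + i) = c + 1)
    (h12 : σ.ivar 12 = c + 1) (hsv : σ.rarr 8 c = KX (n + i))
    (hcs : cs ≤ c ∨ ∀ k ≤ 2 * n, 2 * n + 5 ≤ v k)
    (hI : Inv n N r cs ps KX KY s c σ S v tg)
    (hQ : ∀ a' σ' S' v' tg', a' + (60 * h + 100) * S'.card ≤
        a + (60 * h + 100) * S.card + (360 * h + 600) → EFrame σ σ' →
      Inv n N r cs ps KX KY s (c + 1) σ' S' v' tg' →
      (∀ k ≤ 2 * n, ¬ Blk n (rank KX (2 * n)) (rank KY (2 * n)) (c + 1) k → v' k ≤ v k) →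
      ((∀ k ≤ 2 * n, 2 * n + 5 ≤ v k) → ∀ k ≤ 2 * n, 2 * n + 5 ≤ v' k) → Q a' σ') :
    wp M rightC σ a Q := by
  have hN := hC.hN
  have hn := hC.hn
  have hM := hC.hM
  have hG := hC.grid
  have hxp := hG.xpos (n + i) (by omega)
  have hlo := hG.ypos i (by omega)
  have hhi := hG.ypos (n + i) (by omega)
  have hlh := hG.ylt i hi
  set lo := rank KY (2 * n) i with hlodef
  set hi' := rank KY (2 * n) (n + i) with hidef
  have e1 : σ.iarr 1 i = lo := hD.sortY.rk_eq i (by omega)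
  have e2 : σ.iarr 1 (n + i) = hi' := hD.sortY.rk_eq (n + i) (by omega)
  simp only [rightC, wp_seq, wp_setI, IExpr.ok, IExpr.val, IExpr.cost, State.setI_ivar,
    State.setI_iarr, if_true, if_false, Nat.reduceEqDiff, h13, hD.v0, e2, Nat.add_sub_cancel_left,
    e1]
  refine ⟨by omega, by omega, by omega, ?_⟩
  refine wp_minC (k := lo - 1) (S := S) (v := v) (tg := tg) hN hn hM (by simp [hD.v2]) (by simp)
    (by omega) (hI.pieces.of_frame rfl rfl rfl rfl rfl)
    fun a₁ σ₁ q src ha₁ hv₁ hrv₁ hia₁ hra₁ h22 h23 hq hsrcS hsq hvsrc hlt hsame => ?_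
  have hql := hq.2.1
  have hEF₁ : EFrame σ σ₁ := ⟨fun x hx => by
    rw [hv₁ x (by omega)]
    simp [show x ≠ 14 by omega, show x ≠ 15 by omega, show x ≠ 21 by omega],
    fun x _ => by rw [hrv₁]; simp, fun b _ _ => by rw [hia₁]; simp, fun b _ => by rw [hra₁]; simp⟩
  have k14 : σ₁.ivar 14 = lo := by rw [hv₁ 14 (by omega)]; simp
  have k15 : σ₁.ivar 15 = hi' := by rw [hv₁ 15 (by omega)]; simp
  have hD₁ := hD.of_frame hEF₁
  refine wp_levelC hC hD₁ h23 (by omega) fun a₂ y ha₂ hy => ?_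
  have k12 : σ₁.ivar 12 = c + 1 := (hEF₁.ivar 12 (by omega)).trans h12
  have l6 : σ₁.iarr 6 src = v src := by
    rw [hia₁]; exact (hI.pieces.rep.val_eq hsrcS).symm
  have b6 := hI.pieces.rep.val_le src hsrcS
  rw [← hI.pieces.rep.val_eq hsrcS] at b6
  have hsv₁ : σ₁.rarr 8 c = KX (n + i) := by rw [hEF₁.rarr 8 (by omega)]; exact hsv
  simp only [wp_ite, wp_skip, wp_setI, IExpr.ok, IExpr.val, IExpr.cost, BExpr.ok,
    BExpr.val, BExpr.cost, State.setR_ivar, State.setR_iarr,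
    State.setI_ivar, State.setI_iarr, if_true, if_false, Nat.reduceEqDiff, h23, l6, hD₁.v9]
  refine ⟨by omega, by omega, ?_⟩
  suffices H : ∀ (τ : State) (a₃ cv : ℕ), a₃ ≤ a₂ + 20 → cv = min (v src + 1) (2 * n + 5) →
      (∀ x, x ≠ 19 → τ.ivar x = σ₁.ivar x) → τ.ivar 19 = cv → τ.iarr = σ₁.iarr →
      τ.rarr = σ₁.rarr → τ.rvar = (σ₁.setR 5 y).rvar → wp M raiseC τ a₃ Q by
    refine ⟨fun h' => ?_, fun h' => ⟨by omega, ?_⟩⟩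
    · exact H _ _ (v src + 1) (by omega) (by omega) (fun x hx => by simp [hx]) (by simp) rfl rfl rfl
    · exact H _ _ (2 * n + 5) (by omega) (by omega) (fun x hx => by simp [hx]) (by simp) rfl rfl rfl
  intro τ a₃ cv ha₃ hcv hτv hτ19 hτi hτr hτrv
  have hiτ : τ.iarr = σ.iarr := by rw [hτi, hia₁]; simp
  have hrτ : τ.rarr = σ.rarr := by rw [hτr, hra₁]; simp
  have hEF₂ : EFrame σ₁ τ := ⟨fun x hx => hτv x (by omega), fun x hx => by
    rw [hτrv]; simp [show x ≠ 5 by omega], fun b _ _ => by rw [hτi], fun b _ => by rw [hτr]⟩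
  have hIτ : Inv n N r cs ps KX KY s c τ S v tg :=
    ⟨hI.pieces.of_frame (by rw [hiτ]) (by rw [hiτ]) (by rw [hiτ]) (by rw [hiτ]) (by rw [hrτ]),
      hI.col, by rw [hiτ, hrτ]; exact hI.sound, hI.adj⟩
  refine wp_raiseC hC ((hτv 2 (by omega)).trans hD₁.v2) ((hτv 9 (by omega)).trans hD₁.v9) hi hc
    ((hτv 12 (by omega)).trans k12) (by rw [hτr]; exact hsv₁) ((hτv 14 (by omega)).trans k14)
    ((hτv 15 (by omega)).trans k15) hτ19 ((hτv 22 (by omega)).trans h22)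
    ((hτv 23 (by omega)).trans h23) hcv hq hsrcS hsq hvsrc hlt hsame
    (by rw [hτrv]; simpa using hy) hcs hIτ fun a' σ' S' v' tg' ha' hf => ?_
  exact hQ a' σ' S' v' tg' (by omega) ((hEF₁.trans hEF₂).trans hf)

/-- The sweep enters the column in variable `12`. -/
def eventC : Cmd :=
  .seq (.setI 13 (.get 4 (.sub (.var 12) (.lit 1)))) <| .ite (.ile (.var 0) (.var 13)) rightC leftC

theorem wp_eventC {M h n N r cs ps c : ℕ} {KX KY : ℕ → ℝ} {s : ℝ × ℝ} {S : Finset ℕ}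
    {v tg : ℕ → ℕ} {σ : State} {a : ℕ}
    {Q : ℕ → State → Prop} (hC : Ctx n h N M cs ps KX KY s) (hD : Data n N cs ps KX KY s σ)
    (h12 : σ.ivar 12 = c + 1) (hc : c < 2 * n)
    (hcs : cs ≤ c ∨ ∀ k ≤ 2 * n, 2 * n + 5 ≤ v k)
    (hI : Inv n N r cs ps KX KY s c σ S v tg)
    (hQ : ∀ a' σ' S' v' tg', a' + (60 * h + 100) * S'.card ≤
        a + (60 * h + 100) * S.card + (360 * h + 620) → EFrame σ σ' →
      Inv n N r cs ps KX KY s (c + 1) σ' S' v' tg' →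
      (∀ k ≤ 2 * n, ¬ Blk n (rank KX (2 * n)) (rank KY (2 * n)) (c + 1) k → v' k ≤ v k) →
      ((∀ k ≤ 2 * n, 2 * n + 5 ≤ v k) → ∀ k ≤ 2 * n, 2 * n + 5 ≤ v' k) → Q a' σ') :
    wp M eventC σ a Q := by
  have hn := hC.hn
  have hM := hC.hM
  have h₁ := hD.sortX.ord_lt c hc
  have h₂ := hD.sortX.rank_ord c hc
  have h₃ := hD.sortX.sv_eq c hc
  set i := σ.iarr 4 c with hi
  simp only [eventC, wp_seq, wp_setI, wp_ite, IExpr.ok, IExpr.val, IExpr.cost, BExpr.ok, BExpr.val,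
    BExpr.cost, State.setI_ivar, State.setI_iarr, if_true, if_false, Nat.reduceEqDiff, h12, hD.v0,
    Nat.add_sub_cancel, ← hi]
  have hEF : EFrame σ (σ.setI 13 i) :=
    ⟨fun x hx => by simp [show x ≠ 13 by omega], fun _ _ => rfl, fun _ _ _ => rfl, fun _ _ => rfl⟩
  have hI' : Inv n N r cs ps KX KY s c (σ.setI 13 i) S v tg :=
    ⟨hI.pieces.of_frame rfl rfl rfl rfl rfl, hI.col, hI.sound, hI.adj⟩
  refine ⟨by omega, by omega, fun hle => ?_, fun hlt => ?_⟩
  · obtain ⟨j, hj⟩ := Nat.exists_eq_add_of_le hle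
    rw [hj] at h₂ h₃ h₁
    refine wp_rightC (i := j) hC (hD.of_frame hEF) (by simp [hj]) (by omega) h₂ (by simp [h12])
      (by simpa using h₃) hcs hI' fun a' σ' S' v' tg' ha' hf => ?_
    refine hQ a' σ' S' v' tg' ?_ (hEF.trans hf)
    linarith
  · refine wp_leftC (i := i) hC (hD.of_frame hEF) (by simp) (by omega) h₂ (by simp [h12])
      hI' fun a' σ' S' v' tg' ha' hf => ?_
    refine hQ a' σ' S' v' tg' ?_ (hEF.trans hf)
    linarith

/-! ### The column of the start -/

section
variable {n r cs ps e : ℕ} {RX RY : ℕ → ℕ} {v v' : ℕ → ℕ}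

/-- The values in the column of the start. -/
theorem start_col (hr : r ≤ 1) (hcs : cs ≤ 2 * n) (hv : Col n RX RY cs v)
    (hinf : ∀ k ≤ 2 * n, 2 * n + 5 ≤ v k) (hps : ps < e) (he : e ≤ 2 * n + 1)
    (hin : ∀ k, ps ≤ k → k < e → v k ≤ 2 * n + 5) (hend : v e = 2 * n + 6) (h₀ : v' ps = r)
    (h₁ : ∀ k, ps < k → k < e → v' k = 1) (h₂ : ∀ k, k < ps ∨ e ≤ k → v' k = v k) :
    Col n RX RY cs v' ∧ Comp n RX RY r cs ps cs v' := by
  have hcase : ∀ k ≤ 2 * n, (ps ≤ k ∧ k < e ∧ v' k ≤ 1 ∧ v k ≤ 2 * n + 5) ∨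
      ((k < ps ∨ e ≤ k) ∧ v' k = v k ∧ 2 * n + 5 ≤ v k) := by
    intro k hk
    by_cases hk' : ps ≤ k ∧ k < e
    · left
      refine ⟨hk'.1, hk'.2, ?_, hin k hk'.1 hk'.2⟩
      rcases Nat.eq_or_lt_of_le hk'.1 with h | h
      · rw [← h, h₀]; exact hr
      · rw [h₁ k h hk'.2]
    · exact Or.inr ⟨by omega, h₂ k (by omega), hinf k hk⟩
  have hcol : Col n RX RY cs v' := by
    refine ⟨fun k hk => ?_, fun k hk => ?_, fun j k hk hf => ?_, fun k hk => ?_⟩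
    · rw [← hv.blk k hk]
      rcases hcase k hk with h | h <;> omega
    · have := hv.le k hk
      rcases hcase k hk with h | h <;> omega
    · have hjk := hf.1
      have hk6 : v k ≠ 2 * n + 6 := by
        rw [Ne, hv.blk k hk]; exact hf.2 k hjk le_rfl
      have hle := hv.le k hk
      have hek : ¬ (j ≤ e ∧ e ≤ k) := fun h => by
        have : ¬ v e = 2 * n + 6 := by
          rw [hv.blk e (by omega)]; exact hf.2 e h.1 h.2
        exact this hend
      rcases hcase k hk with h | h
      · rcases Nat.eq_or_lt_of_le h.1 with h' | h'
        · omega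
        · omega
      · rcases hcase j (by omega) with h' | h'
        · omega
        · omega
    · rcases hcase k hk with h | h <;> omega
  refine ⟨hcol, comp_of_arrivals hcol hcs ?_ (fun hr _ => h₀.trans hr) (fun hr _ l hl hf => ?_)
    fun d g c' k hc' hk hreach _ => ?_⟩
  · rw [← hcol.blk ps (by omega)]; omega
  · have hek : l < e := by
      by_contra hc
      have : ¬ v e = 2 * n + 6 := by
        rw [hv.blk e (by omega)]; exact hf.2 e (by omega) (by omega)
      exact this hend
    have hpl := hf.1
    rcases hcase l hl with h | h <;> omega
  · have := hreach.bounds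
    omega

/-- All these cells use a single recorded run on the line of the start. For `r = 0` it is preceded
by a horizontal run of length zero, and the start row itself is reached without any vertical run. -/
theorem start_sound {s : ℝ × ℝ} {PX PY : ℝ → ℕ → Prop} {stag : ℕ → ℕ} {xv yl : ℕ → ℝ} {tg' : ℕ → ℕ}
    (hr : r ≤ 1) (hcs : cs ≤ 2 * n) (hv : Col n RX RY cs v')
    (hinf : ∀ k ≤ 2 * n, k < ps ∨ e ≤ k → 2 * n + 5 ≤ v' k)
    (h₀ : v' ps = r) (h₁ : ∀ k, ps < k → k < e → v' k = 1)
    (ht₀ : tg' ps = if r = 0 then 2 * n + 1 else cs) (ht₁ : ∀ k, ps < k → k < e → tg' k = cs)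
    (hPX : PX (xv cs) cs) (hPY : PY (yl cs) ps) (hx : xv cs = s.1) (hy : yl cs = s.2)
    (hst : stag cs = 2 * n + 1) : Sound n RX RY r cs ps s PX PY stag xv yl cs v' tg' := by
  intro k hk hlt
  have hk' : ps ≤ k ∧ k < e := by
    by_contra h'
    have := hinf k hk (by omega)
    omega
  have hfree : ∀ l, ps ≤ l → l ≤ k → ¬ Blk n RX RY cs l := fun l h₂ h₃ => by
    rw [← hv.blk l (by omega)]
    rcases Nat.eq_or_lt_of_le h₂ with h | h
    · rw [← h, h₀]; omega
    · rw [h₁ l h (by omega)]; omega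
  have hH := HFree.refl (hfree k hk'.1 le_rfl)
  have hHp := HFree.refl (hfree ps le_rfl hk'.1)
  rcases Nat.eq_or_lt_of_le hk'.1 with h | h
  · subst h
    rw [h₀, ht₀]
    rcases (show r = 0 ∨ r = 1 by omega) with h' | h'
    · subst h'
      exact .startH rfl hH
    · subst h'
      exact .startV rfl hcs hPX hx hy hst ⟨le_rfl, hfree⟩ hH
  · rw [h₁ k h hk'.2, ht₁ k h hk'.2]
    rcases (show r = 0 ∨ r = 1 by omega) with h' | h'
    · refine .step (v := 0) hcs hPX hPY h ?_ ⟨h.le, hfree⟩ hH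
      rw [hst]
      exact .startH h' hHp
    · exact .startV h' hcs hPX hx hy hst ⟨h.le, hfree⟩ hH

end

/-- Puts the start into its column. -/
def startC : Cmd :=
  .seq (.setI 14 (.var 6)) <| .seq splitC <| .seq (.setI 20 (.var 6)) <| .seq (.setI 15 (.lit 0)) <| .seq (.setI 19 (.lit 1)) <|
  .seq (.putI 8 (.var 12) (.sub (.var 9) (.lit 4))) <| .seq (.putR 9 (.var 12) (.var 0)) <|
  .seq (.putR 10 (.var 12) (.var 2)) <| .seq coverC <|
  .ite (.ile (.lit 1) (.var 8)) .skip
    (.seq (.setI 14 (.add (.var 6) (.lit 1))) <| .seq splitC <| .seq (.putI 6 (.var 6) (.lit 0)) <|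
    .putI 7 (.var 6) (.sub (.var 9) (.lit 4)))

set_option maxHeartbeats 1000000 in
theorem wp_startC {M h n N r cs ps : ℕ} {KX KY : ℕ → ℝ} {s : ℝ × ℝ} {S : Finset ℕ}
    {v tg : ℕ → ℕ} {σ : State} {a : ℕ}
    {Q : ℕ → State → Prop} (hC : Ctx n h N M cs ps KX KY s) (hD : Data n N cs ps KX KY s σ)
    (h8 : σ.ivar 8 = r) (hr : r ≤ 1) (h12 : σ.ivar 12 = cs)
    (hinf : ∀ k ≤ 2 * n, 2 * n + 5 ≤ v k) (hI : Inv n N r cs ps KX KY s cs σ S v tg)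
    (hQ : ∀ a' σ' S' v' tg', a' + (60 * h + 100) * S'.card ≤
        a + (60 * h + 100) * S.card + (360 * h + 600) → EFrame σ σ' →
      Inv n N r cs ps KX KY s cs σ' S' v' tg' →
      Comp n (rank KX (2 * n)) (rank KY (2 * n)) r cs ps cs v' → Q a' σ') :
    wp M startC σ a Q := by
  have hN := hC.hN
  have hn := hC.hn
  have hM := hC.hM
  have hps := hC.ps_le
  have hcs := hC.cs_le
  simp only [startC, wp_seq, wp_setI, IExpr.ok, IExpr.val, IExpr.cost, hD.v6]
  refine ⟨by omega, ?_⟩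
  refine wp_splitC (x := ps) (S := S) (v := v) (tg := tg) hN hn hM (by simp [hD.v2]) (by simp)
    (by omega) (hI.pieces.of_frame rfl rfl rfl rfl rfl) fun a₁ σ₁ ha₁ hf₁ hP₁ => ?_
  have hEF₁ : EFrame σ σ₁ := by
    refine ⟨fun x hx => ?_, fun x hx => ?_, fun b h₁ h₂ => ?_, fun b hb => ?_⟩
    · rw [hf₁.ivar x (by omega)]; simp [show x ≠ 14 by omega]
    · rw [hf₁.rvar]; simp
    · rw [hf₁.iarr b (by omega) (by omega) (by omega) (by omega)]; simp
    · rw [hf₁.rarr]; simp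
  have hD₁ := hD.of_frame hEF₁
  have k12 : σ₁.ivar 12 = cs := (hEF₁.ivar 12 (by omega)).trans h12
  have k8 : σ₁.ivar 8 = r := (hEF₁.ivar 8 (by omega)).trans h8
  simp only [wp_putI, wp_putR, wp_setI, IExpr.ok, IExpr.val, IExpr.cost, RExpr.ok, RExpr.val,
    RExpr.cost, State.setI_ivar, State.setI_rvar, State.putI_ivar, State.putR_ivar, State.putI_rvar,
    State.putR_rvar, if_true, if_false, Nat.reduceEqDiff, hD₁.v6, hD₁.v9, k12, hD₁.r0, hD₁.r2]
  refine ⟨by omega, by omega, by omega, by omega, by omega, by omega, trivial, by omega, trivial, ?_⟩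
  set T := insert ps S with hT
  have hpsT : ps ∈ T := by simp [hT]
  refine wp_coverC (b := ps) (hi := 0) (cv := 1) (c := cs) (S := T) (v := v) (tg := tg)
    hN hn hM (by simp [hD₁.v2]) (by simp [hD₁.v9]) (by simp [k12]) (by simp) (by simp) (by simp)
    (hP₁.of_frame (by simp) (by simp) (by simp) (by simp) (by simp)) hpsT hps (by omega) (by omega)
    (by omega) fun a₂ σ₂ e ha₂ hf₂ hbe heT hhe hall hend hP₂ => ?_
  have hel := hP₁.rep.le e heT
  have hin : ∀ k, ps ≤ k → k < e → v k ≤ 2 * n + 5 := by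
    intro k h₁ h₂
    obtain ⟨p, hp⟩ := hP₁.rep.exists_isPred k
    have h₃ := hp.2.1
    have h₄ := hp.2.2 ps hpsT h₁
    rw [(hP₁.rep.cell_of_isPred hp (by omega) h₃ le_rfl).1]
    rcases Nat.eq_or_lt_of_le h₄ with h₅ | h₅
    · have h₆ := hI.col.le p (by omega)
      have h₇ : v p ≠ 2 * n + 6 := by
        rw [Ne, hI.col.blk p (by omega), ← h₅]; exact hC.free
      omega
    · have := hall p hp.1 h₅ (by omega)
      omega
  -- No value is below 1 yet, so only a blocked row or the sentinel can have stopped the covering.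
  have hend' : v e = 2 * n + 6 := by
    rcases Nat.eq_or_lt_of_le hel with h | h
    · rw [h]; exact hP₁.rep.v_last
    · have := hinf e (by omega)
      omega
  have hcard : T.card ≤ S.card + 1 := by rw [hT]; exact Finset.card_insert_le _ _
  have hmul : (60 * h + 100) * T.card ≤ (60 * h + 100) * S.card + (60 * h + 100) := by
    calc _ ≤ (60 * h + 100) * (S.card + 1) := Nat.mul_le_mul_left _ hcard
      _ = _ := by ring
  have hEF₂ : EFrame σ σ₂ := by
    refine hEF₁.trans ⟨fun x hx => ?_, fun x hx => ?_, fun b h₁ h₂ => ?_, fun b hb => ?_⟩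
    · rw [hf₂.ivar x (by omega)]
      simp [show x ≠ 20 by omega, show x ≠ 15 by omega, show x ≠ 19 by omega]
    · rw [hf₂.rvar]; simp
    · rw [hf₂.iarr b (by omega) (by omega) (by omega) (by omega)]
      simp [show b ≠ 8 by omega]
    · rw [hf₂.rarr]; simp [show b ≠ 9 by omega, show b ≠ 10 by omega]
  have s8 : σ₂.iarr 8 cs = 2 * n + 1 := by
    rw [hf₂.iarr 8 (by omega) (by omega) (by omega) (by omega)]; simp
  have s9 : σ₂.rarr 9 cs = s.1 := by rw [hf₂.rarr]; simp
  have s10 : σ₂.rarr 10 cs = s.2 := by rw [hf₂.rarr]; simp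
  have hTX : TurnX n KX s.1 s.1 cs := ⟨hC.inX, le_rfl, fun x' c' hx' _ _ => hx'⟩
  have hLY : LevelY n KY ps s.2 s.2 ps := ⟨hC.inY, fun _ => rfl⟩
  have hmemS : ∀ p ∈ T, p ≠ ps → p ∈ S := fun p hp hne => by
    rcases Finset.mem_insert.1 (hT ▸ hp) with h' | h'
    · exact absurd h' hne
    · exact h'
  have hD₂ := hD.of_frame hEF₂
  have j8 : σ₂.ivar 8 = r := (hEF₂.ivar 8 (by omega)).trans h8
  simp only [wp_ite, wp_skip, wp_setI, wp_seq, IExpr.ok, IExpr.val, IExpr.cost, BExpr.ok, BExpr.val,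
    BExpr.cost, hD₂.v6, j8]
  refine ⟨by omega, fun h1 => ?_, fun h0 => ⟨by omega, ?_⟩⟩
  · obtain rfl : r = 1 := by omega
    have f₀ : fill ps e 1 v ps = 1 := fill_in le_rfl hbe
    have f₁ : ∀ k, ps < k → k < e → fill ps e 1 v k = 1 := fun k h₁ h₂ => fill_in h₁.le h₂
    have f₂ : ∀ k, k < ps ∨ e ≤ k → fill ps e 1 v k = v k := fun k hk => by
      rw [fill, if_neg (by omega)]
    obtain ⟨hcol, hcomp⟩ := start_col hr hcs hI.col hinf hbe hel hin hend' f₀ f₁ f₂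
    refine hQ _ σ₂ _ _ _ (by omega) hEF₂ ⟨hP₂, hcol, ?_, ?_⟩ hcomp
    · refine start_sound hr hcs hcol (fun k hk h' => by rw [f₂ k h']; exact hinf k hk) f₀ f₁
        (by simp [fill_in le_rfl hbe]) (fun k h₁ h₂ => fill_in h₁.le h₂) (by rw [s9]; exact hTX)
        (by rw [s10]; exact hLY) s9 s10 s8
    · intro p hp h₁ h₂ hne
      obtain ⟨hpT, hout⟩ := Finset.mem_filter.1 hp
      rcases Nat.lt_trichotomy p ps with h' | h' | h'
      · rw [f₂ p (by omega)] at hne ⊢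
        rw [f₂ (p - 1) (by omega)]
        exact hI.adj p (hmemS p hpT (by omega)) h₁ h₂ hne
      · subst h'
        have := hinf (p - 1) (by omega)
        rw [f₀, f₂ (p - 1) (by omega)]
        omega
      · rcases Nat.eq_or_lt_of_le (show e ≤ p by omega) with h'' | h''
        · rw [f₂ p (by omega), fill_in (by omega) (by omega), ← h'', hend']
          omega
        · rw [f₂ p (by omega)] at hne ⊢
          rw [f₂ (p - 1) (by omega)]
          exact hI.adj p (hmemS p hpT (by omega)) h₁ h₂ hne
  · obtain rfl : r = 0 := by omega
    -- A horizontal start needs no vertical run in its own row. This row is cut off as a separate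
    -- piece with value 0 and the label `2 * n + 1`, which is variable `9` minus 4.
    refine wp_splitC (x := ps + 1) (S := keep T ps e) (v := fill ps e 1 v) (tg := fill ps e cs tg)
      hN hn hM (by simp [hD₂.v2]) (by simp) (by omega) (hP₂.of_frame rfl rfl rfl rfl rfl)
      fun a₃ σ₃ ha₃ hf₃ hP₃ => ?_
    have hEF₃ : EFrame σ σ₃ := by
      refine hEF₂.trans ⟨fun x hx => ?_, fun x hx => ?_, fun b h₁ h₂ => ?_, fun b hb => ?_⟩
      · rw [hf₃.ivar x (by omega)]; simp [show x ≠ 14 by omega]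
      · rw [hf₃.rvar]; simp
      · rw [hf₃.iarr b (by omega) (by omega) (by omega) (by omega)]; simp
      · rw [hf₃.rarr]; simp
    have hD₃ := hD.of_frame hEF₃
    simp only [wp_putI, IExpr.ok, IExpr.val, IExpr.cost, State.putI_ivar, hD₃.v6, hD₃.v9]
    refine ⟨by omega, by omega, by omega, by omega, ?_⟩
    set T' := insert (ps + 1) (keep T ps e) with hT'
    have hpk : ps ∈ keep T ps e := Finset.mem_filter.2 ⟨hpsT, Or.inl le_rfl⟩
    have hpT' : ps ∈ T' := by simp [hT', hpk]
    have hnx : σ₃.iarr 5 ps = ps + 1 := by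
      have h₁ := hP₃.rep.lt_nxt ps hpT' hps
      have h₂ := hP₃.rep.nxt_le ps hpT' (ps + 1) (by simp [hT']) (by omega)
      omega
    have hset := hP₃.rep.set hpT' hps (x := 0) (y := 2 * n + 1) (by omega) (by omega)
    rw [hnx] at hset
    have f₀ : fill ps (ps + 1) 0 (fill ps e 1 v) ps = 0 := fill_in le_rfl (by omega)
    have f₁ : ∀ k, ps < k → k < e → fill ps (ps + 1) 0 (fill ps e 1 v) k = 1 := fun k h₁ h₂ => by
      rw [fill_ge (by omega), fill_in h₁.le h₂]
    have f₂ : ∀ k, k < ps ∨ e ≤ k → fill ps (ps + 1) 0 (fill ps e 1 v) k = v k := fun k hk => by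
      rw [fill, if_neg (by omega), fill, if_neg (by omega)]
    obtain ⟨hcol, hcomp⟩ := start_col hr hcs hI.col hinf hbe hel hin hend' f₀ f₁ f₂
    have s8' : σ₃.iarr 8 cs = 2 * n + 1 := by
      rw [hf₃.iarr 8 (by omega) (by omega) (by omega) (by omega)]; simpa using s8
    have s9' : σ₃.rarr 9 cs = s.1 := by rw [hf₃.rarr]; simpa using s9
    have s10' : σ₃.rarr 10 cs = s.2 := by rw [hf₃.rarr]; simpa using s10
    have hcard' : T'.card ≤ (keep T ps e).card + 1 := by
      rw [hT']; exact Finset.card_insert_le _ _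
    have hmul' : (60 * h + 100) * T'.card ≤
        (60 * h + 100) * (keep T ps e).card + (60 * h + 100) := by
      calc _ ≤ (60 * h + 100) * ((keep T ps e).card + 1) := Nat.mul_le_mul_left _ hcard'
        _ = _ := by ring
    refine hQ _ _ T' _ _ (by omega) (hEF₃.trans ⟨fun _ _ => rfl, fun _ _ => rfl, fun b h₁ h₂ => ?_,
      fun _ _ => rfl⟩) ⟨⟨by simpa using hP₃.tree, by simpa using hset, by simpa using hP₃.key⟩,
      hcol, ?_, ?_⟩ hcomp
    · simp [show b ≠ 7 by omega, show b ≠ 6 by omega]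
    · refine start_sound hr hcs hcol (fun k hk h' => by rw [f₂ k h']; exact hinf k hk) f₀ f₁
        (by rw [fill_in le_rfl (by omega)]; simp) (fun k h₁ h₂ => ?_) (by simpa [s9'] using hTX)
        (by simpa [s10'] using hLY) (by simpa using s9') (by simpa using s10') (by simpa using s8')
      rw [fill_ge (by omega), fill_in h₁.le h₂]
    · intro p hp h₁ h₂ hne
      by_cases hp1 : p = ps + 1
      · subst hp1
        rw [Nat.add_sub_cancel, f₀]
        rcases Nat.eq_or_lt_of_le (show ps + 1 ≤ e by omega) with h'' | h''
        · rw [f₂ _ (by omega), h'', hend']; omega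
        · rw [f₁ _ (by omega) h'']; omega
      have hpk' : p ∈ keep T ps e := by
        rcases Finset.mem_insert.1 (hT' ▸ hp) with h' | h'
        · exact absurd h' hp1
        · exact h'
      obtain ⟨hpT, hout⟩ := Finset.mem_filter.1 hpk'
      rcases Nat.lt_trichotomy p ps with h' | h' | h'
      · rw [f₂ p (by omega)] at hne ⊢
        rw [f₂ (p - 1) (by omega)]
        exact hI.adj p (hmemS p hpT (by omega)) h₁ h₂ hne
      · subst h'
        have := hinf (p - 1) (by omega)
        rw [f₀, f₂ (p - 1) (by omega)]
        omega
      · rcases Nat.eq_or_lt_of_le (show e ≤ p by omega) with h'' | h''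
        · rw [f₂ p (by omega), f₁ (p - 1) (by omega) (by omega), ← h'', hend']
          omega
        · rw [f₂ p (by omega)] at hne ⊢
          rw [f₂ (p - 1) (by omega)]
          exact hI.adj p (hmemS p hpT (by omega)) h₁ h₂ hne

theorem Data.setI {n N cs ps x d : ℕ} {KX KY : ℕ → ℝ} {s : ℝ × ℝ} {σ : State}
    (h : Data n N cs ps KX KY s σ) (hx : 10 ≤ x) : Data n N cs ps KX KY s (σ.setI x d) := by
  obtain ⟨h₀, h₁, h₂, h₃, h₄, h₅, h₆, h₇, h₈⟩ := h
  exact ⟨by rw [State.setI_ivar, if_neg (by omega), h₀],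
    by rw [State.setI_ivar, if_neg (by omega), h₁], by rw [State.setI_ivar, if_neg (by omega), h₂],
    by rw [State.setI_ivar, if_neg (by omega), h₃], by rw [State.setI_ivar, if_neg (by omega), h₄],
    h₅, h₆, h₇, h₈⟩

/-- Sweeps up to the column in variable `x`. -/
def sweepC (x : ℕ) : Cmd :=
  .loop (.not (.ile (.var x) (.var 12))) (.seq (.setI 12 (.add (.var 12) (.lit 1))) <| eventC)

/-- `G` is a property of the values that each transition preserves. Up to the start column it says
that nothing is reached, and from there on that the values are complete. Credits of the pieces left
at the end are handed on to the caller. -/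
theorem wp_sweepC {M h n N r cs ps x c₀ d : ℕ} {KX KY : ℕ → ℝ} {s : ℝ × ℝ} {S : Finset ℕ}
    {v tg : ℕ → ℕ} {σ : State} {a : ℕ} {Q : ℕ → State → Prop} (G : ℕ → (ℕ → ℕ) → Prop)
    (hC : Ctx n h N M cs ps KX KY s) (hD : Data n N cs ps KX KY s σ)
    (hx : x < 12) (hxd : σ.ivar x = d) (hd : d ≤ 2 * n) (h12 : σ.ivar 12 = c₀) (hc₀ : c₀ ≤ d)
    (hG₀ : G c₀ v) (hGcs : ∀ c v, G c v → cs ≤ c ∨ ∀ k ≤ 2 * n, 2 * n + 5 ≤ v k)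
    (hG : ∀ c v v', c + 1 ≤ 2 * n → G c v →
      Col n (rank KX (2 * n)) (rank KY (2 * n)) (c + 1) v' →
      (∀ k ≤ 2 * n, ¬ Blk n (rank KX (2 * n)) (rank KY (2 * n)) (c + 1) k → v' k ≤ v k) →
      ((∀ k ≤ 2 * n, 2 * n + 5 ≤ v k) → ∀ k ≤ 2 * n, 2 * n + 5 ≤ v' k) → G (c + 1) v')
    (hI : Inv n N r cs ps KX KY s c₀ σ S v tg)
    (hQ : ∀ a' σ' S' v' tg', a' + (60 * h + 100) * S'.card ≤
        a + (60 * h + 100) * S.card + ((d - c₀) * (360 * h + 640) + 10) →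
      EFrame (σ.setI 12 d) σ' → Inv n N r cs ps KX KY s d σ' S' v' tg' → G d v' → Q a' σ') :
    wp M (sweepC x) σ a Q := by
  have hn := hC.hn
  have hM := hC.hM
  refine wp_loop_credit (t := (60 * h + 100) * S.card + ((d - c₀) * (360 * h + 640) + 10))
    (fun t τ => ∃ c S v tg, c ≤ d ∧ EFrame (σ.setI 12 c) τ ∧ Inv n N r cs ps KX KY s c τ S v tg ∧
      G c v ∧ t = (60 * h + 100) * S.card + ((d - c) * (360 * h + 640) + 10))
    (fun t τ => ∃ S v tg, EFrame (σ.setI 12 d) τ ∧ Inv n N r cs ps KX KY s d τ S v tg ∧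
      G d v ∧ t = (60 * h + 100) * S.card) ?_ ?_ ?_
  · rintro t τ ⟨c, S, v, tg, hcd, hf, hI, hGv, rfl⟩
    have e12 : τ.ivar 12 = c := by rw [hf.ivar 12 (by omega)]; simp
    have ex : τ.ivar x = d := by
      rw [hf.ivar x (by omega)]; simp [show x ≠ 12 by omega, hxd]
    simp only [wp_seq, wp_setI, IExpr.ok, IExpr.val, IExpr.cost, BExpr.ok, BExpr.val, BExpr.cost,
      e12, ex]
    refine ⟨by omega, fun hlt => ⟨by omega, ?_⟩, fun hge => ?_⟩
    · have hfd : EFrame (σ.setI 12 (c + 1)) (τ.setI 12 (c + 1)) := by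
        refine ⟨fun y hy => ?_, fun y hy => ?_, fun b h₁ h₂ => ?_, fun b hb => ?_⟩
        · by_cases hy12 : y = 12
          · simp [hy12]
          · have := hf.ivar y hy
            simpa [hy12] using this
        · exact hf.rvar y hy
        · exact hf.iarr b h₁ h₂
        · exact hf.rarr b hb
      have hD' : Data n N cs ps KX KY s (τ.setI 12 (c + 1)) := by
        exact (hD.setI (by omega)).of_frame hfd
      refine wp_eventC hC hD' (by simp) (by omega) (hGcs c v hGv)
        ⟨hI.pieces.of_frame rfl rfl rfl rfl rfl, hI.col, hI.sound, hI.adj⟩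
        fun a' σ' S' v' tg' ha' hf' hI' hmono hpres => ?_
      refine ⟨_, ⟨c + 1, S', v', tg', by omega, hfd.trans hf', hI',
        hG c v v' (by omega) hGv hI'.col hmono hpres, rfl⟩, ?_⟩
      have hmul : (d - c) * (360 * h + 640) = (d - (c + 1)) * (360 * h + 640) + (360 * h + 640) := by
        rw [show d - c = (d - (c + 1)) + 1 by omega]; ring
      rw [hmul]
      generalize (d - (c + 1)) * (360 * h + 640) = A
      linarith
    · obtain rfl : c = d := by omega
      exact ⟨_, by simp, S, v, tg, hf, hI, hGv, rfl⟩
  · refine ⟨c₀, S, v, tg, hc₀, ⟨fun y hy => ?_, fun _ _ => rfl, fun _ _ _ => rfl, fun _ _ => rfl⟩,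
      hI, hG₀, rfl⟩
    by_cases hy12 : y = 12
    · simp [hy12, h12]
    · simp [hy12]
  · rintro a' t' σ' hle ⟨S', v', tg', hf, hI', hGv, rfl⟩
    exact hQ a' σ' S' v' tg' (by omega) hf hI' hGv

/-- The pieces of an empty column. -/
def clearC : Cmd :=
  .seq (.setI 10 (.lit 0)) <|
  .seq (.loop (.not (.ile (.mul (.lit 2) (.var 2)) (.var 10)))
    (.seq (.putI 0 (.var 10) (.lit 0)) <| .setI 10 (.add (.var 10) (.lit 1)))) <|
  .seq (.setI 10 (.lit 0)) <| .seq (insertC (.var 10)) <|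
  .seq (.setI 10 (.sub (.var 9) (.lit 4))) <| .seq (insertC (.var 10)) <|
  .seq (.putI 5 (.lit 0) (.var 10)) <| .seq (.putI 6 (.lit 0) (.var 9)) <| .seq (.putI 7 (.lit 0) (.lit 0)) <|
  .seq (.putI 6 (.var 10) (.add (.var 9) (.lit 1))) <| .seq (.putI 7 (.var 10) (.lit 0)) <| .setI 12 (.lit 0)

/-- Sides have ranks at least 1, so column 0 has no blocked cell. It is a single unreached piece,
followed by the sentinel. -/
theorem wp_clearC {M h n N r cs ps : ℕ} {KX KY : ℕ → ℝ} {s : ℝ × ℝ} {σ : State} {a : ℕ}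
    {Q : ℕ → State → Prop} (hC : Ctx n h N M cs ps KX KY s) (hD : Data n N cs ps KX KY s σ)
    (hkey : ∀ q ≤ 2 * n + 1, σ.rarr 6 q = -(q : ℝ))
    (hQ : ∀ a' σ' tg, a' ≤ a + (30 * N + 120 * h + 200) →
      (∀ x < 10, σ'.ivar x = σ.ivar x) → (∀ x < 5, σ'.rvar x = σ.rvar x) →
      (∀ b, 1 ≤ b → b ≤ 4 → σ'.iarr b = σ.iarr b) → σ'.rarr = σ.rarr → σ'.ivar 12 = 0 →
      Inv n N r cs ps KX KY s 0 σ' {2 * n + 1, 0}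
        (fun k => if k ≤ 2 * n then 2 * n + 5 else 2 * n + 6) tg → Q a' σ') :
    wp M clearC σ a Q := by
  have hN := hC.hN
  have hn := hC.hn
  have hM := hC.hM
  simp only [clearC, wp_seq, wp_setI, IExpr.ok, IExpr.val, IExpr.cost]
  refine ⟨by omega, ?_⟩
  refine wp_loop (t := 2 * N * 15 + 10)
    (fun t τ => ∃ j, τ.ivar 10 = j ∧ j ≤ 2 * N ∧ t = (2 * N - j) * 15 + 10 ∧
      (∀ x < 10, τ.ivar x = σ.ivar x) ∧ τ.rvar = σ.rvar ∧
      (∀ b, b ≠ 0 → τ.iarr b = σ.iarr b) ∧ τ.rarr = σ.rarr ∧ ∀ i < j, τ.iarr 0 i = 0)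
    (fun τ => (∀ x < 10, τ.ivar x = σ.ivar x) ∧ τ.rvar = σ.rvar ∧
      (∀ b, b ≠ 0 → τ.iarr b = σ.iarr b) ∧ τ.rarr = σ.rarr ∧ ∀ i < 2 * N, τ.iarr 0 i = 0) ?_ ?_ ?_
  · rintro t τ ⟨j, h10, hj, rfl, hiv, hrv, hia, hra, hz⟩
    have e2 : τ.ivar 2 = N := (hiv 2 (by omega)).trans hD.v2
    simp only [wp_seq, wp_setI, wp_putI, IExpr.ok, IExpr.val, IExpr.cost, BExpr.ok, BExpr.val,
      BExpr.cost, State.putI_ivar, e2, h10]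
    refine ⟨by omega, fun hlt => ⟨by omega, by omega, by omega, _, ⟨j + 1, by simp, by omega, rfl,
      fun x hx => ?_, hrv, fun b hb => ?_, hra, fun i hi => ?_⟩, by omega⟩, fun hge => ⟨by omega, hiv,
      hrv, hia, hra, fun i hi => hz i (by omega)⟩⟩
    · simp [show x ≠ 10 by omega, hiv x hx]
    · simp [hb, hia b hb]
    · simp only [State.setI_iarr, State.putI_iarr, if_true, Function.update_apply]
      split_ifs with h'
      · rfl
      · exact hz i (by omega)
  · exact ⟨0, by simp, by omega, by simp, fun x hx => by simp [show x ≠ 10 by omega], rfl,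
      fun _ _ => rfl, rfl, fun i hi => by omega⟩
  · rintro a₁ σ₁ ha₁ ⟨hiv, hrv, hia, hra, hz⟩
    have e2 : σ₁.ivar 2 = N := (hiv 2 (by omega)).trans hD.v2
    have e9 : σ₁.ivar 9 = 2 * n + 5 := (hiv 9 (by omega)).trans hD.v9
    refine ⟨by omega, ?_⟩
    refine wp_insertC (S := ∅) (p := 0) hN (by omega) (by simp [e2]) (by simp) (by omega)
      (treeRep_empty.2 fun v _ hv => by simpa using hz v hv) fun a₂ σ₂ ha₂ hf₂ hT₂ => ?_
    have j2 : σ₂.ivar 2 = N := by rw [hf₂.ivar 2 (by omega)]; simp [e2]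
    have j9 : σ₂.ivar 9 = 2 * n + 5 := by rw [hf₂.ivar 9 (by omega)]; simp [e9]
    have hr₂ : σ₂.rarr = σ₁.rarr := hf₂.rarr
    simp only [j9]
    refine ⟨by omega, ?_⟩
    refine wp_insertC (S := insert 0 ∅) (p := 2 * n + 1) hN (by omega) (by simp [j2]) (by simp)
      (by omega) (by simpa [hr₂] using hT₂) fun a₃ σ₃ ha₃ hf₃ hT₃ => ?_
    have i10 : σ₃.ivar 10 = 2 * n + 1 := by rw [hf₃.ivar 10 (by omega)]; simp
    have i9 : σ₃.ivar 9 = 2 * n + 5 := by rw [hf₃.ivar 9 (by omega)]; simp [j9]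
    have hr₃ : σ₃.rarr = σ.rarr := by
      rw [hf₃.rarr, State.setI_rarr, hr₂, hra]
    simp only [wp_putI, wp_setI, IExpr.ok, IExpr.val, IExpr.cost, State.putI_ivar, i10, i9]
    refine ⟨by omega, by omega, by omega, by omega, by omega, by omega, by omega, by omega, by omega,
      by omega, by omega, ?_⟩
    refine hQ _ _ (fun _ => 0) (by omega) (fun x hx => ?_) (fun x hx => ?_) (fun b h₁ h₂ => ?_)
      (by simpa using hr₃) (by simp) ⟨⟨?_, ?_, ?_⟩, ?_, ?_, ?_⟩
    · simp only [State.setI_ivar, State.putI_ivar, show x ≠ 12 by omega, if_false]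
      rw [hf₃.ivar x (by omega)]
      simp only [State.setI_ivar, show x ≠ 10 by omega, if_false]
      rw [hf₂.ivar x (by omega)]
      simp [show x ≠ 10 by omega, hiv x hx]
    · simp only [State.setI_rvar, State.putI_rvar]
      rw [hf₃.rvar, State.setI_rvar, hf₂.rvar, State.setI_rvar, hrv]
    · simp only [State.setI_iarr, State.putI_iarr, show b ≠ 5 by omega, show b ≠ 6 by omega,
        show b ≠ 7 by omega, if_false]
      rw [hf₃.iarr b (by omega), State.setI_iarr, hf₂.iarr b (by omega), State.setI_iarr,
        hia b (by omega)]
    · have : ({2 * n + 1, 0} : Finset ℕ) = insert (2 * n + 1) (insert 0 ∅) := rfl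
      rw [this]
      simpa [hf₃.rarr] using hT₃
    · refine ⟨by simp, by simp, ?_, ?_, ?_, ?_, ?_, by simp, by simp, ?_, ?_⟩
      · intro p hp
        simp only [Finset.mem_insert, Finset.mem_singleton] at hp
        omega
      · intro p hp hp'
        simp only [Finset.mem_insert, Finset.mem_singleton] at hp
        obtain rfl : p = 0 := by omega
        simp
      · intro p hp hp'
        simp only [Finset.mem_insert, Finset.mem_singleton] at hp
        obtain rfl : p = 0 := by omega
        simp
      · intro p hp q hq hlt
        simp only [Finset.mem_insert, Finset.mem_singleton] at hp hq
        obtain rfl : p = 0 := by omega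
        simp; omega
      · intro p hp hp' k h₁ h₂
        simp only [Finset.mem_insert, Finset.mem_singleton] at hp
        obtain rfl : p = 0 := by omega
        simp at h₂
        simp [show k ≤ 2 * n by omega, Function.update_apply]
      · intro p hp
        simp only [Finset.mem_insert, Finset.mem_singleton] at hp
        rcases hp with rfl | rfl <;> simp [Function.update_apply]
      · intro p hp
        simp only [Finset.mem_insert, Finset.mem_singleton] at hp
        rcases hp with rfl | rfl <;> simp [Function.update_apply]
    · simpa [hr₃] using hkey
    · have hB : ∀ k, ¬ Blk n (rank KX (2 * n)) (rank KY (2 * n)) 0 k := by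
        rintro k ⟨i, hi, h₁, _⟩
        have := hC.grid.xpos i (by omega)
        omega
      refine ⟨fun k hk => ?_, fun k hk => ?_, fun j k hk hf => ?_, fun k hk => ?_⟩
      · simp [hk, hB k]
      · simp [hk]
      · simp [hk, hf.1.trans hk]
      · simp [hk]
    · intro k hk hlt
      simp [hk] at hlt
    · intro p hp h₁ h₂ hne
      simp [h₂] at hne

/-- Fills the column of the target. -/
def fieldC : Cmd := .seq clearC <| .seq (sweepC 4) <| .seq startC <| sweepC 5

theorem wp_fieldC {M h n N r cs ps ct : ℕ} {KX KY : ℕ → ℝ} {s : ℝ × ℝ} {σ : State} {a : ℕ}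
    {Q : ℕ → State → Prop} (hC : Ctx n h N M cs ps KX KY s) (hD : Data n N cs ps KX KY s σ)
    (hkey : ∀ q ≤ 2 * n + 1, σ.rarr 6 q = -(q : ℝ)) (h5 : σ.ivar 5 = ct) (h8 : σ.ivar 8 = r)
    (hr : r ≤ 1) (hct : cs ≤ ct) (hct' : ct ≤ 2 * n)
    (hQ : ∀ a' σ' S v tg, a' ≤ a + (30 * N + (2 * n + 2) * (600 * h + 1200)) →
      (∀ x < 10, σ'.ivar x = σ.ivar x) → (∀ x < 5, σ'.rvar x = σ.rvar x) →
      (∀ b, 1 ≤ b → b ≤ 4 → σ'.iarr b = σ.iarr b) → (∀ b < 9, σ'.rarr b = σ.rarr b) →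
      Inv n N r cs ps KX KY s ct σ' S v tg →
      Comp n (rank KX (2 * n)) (rank KY (2 * n)) r cs ps ct v → Q a' σ') :
    wp M fieldC σ a Q := by
  simp only [fieldC, wp_seq]
  refine wp_clearC (r := r) hC hD hkey fun a₁ σ₁ tg₁ ha₁ hi₁ hr₁ hia₁ hra₁ h12 hI₁ => ?_
  have hD₁ : Data n N cs ps KX KY s σ₁ := by
    obtain ⟨h₀, h₁, h₂, h₃, h₄, h₅, h₆, h₇, h₈⟩ := hD
    rw [← hia₁ 1 (by omega) (by omega), ← hia₁ 2 (by omega) (by omega), ← hra₁] at h₇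
    rw [← hia₁ 3 (by omega) (by omega), ← hia₁ 4 (by omega) (by omega), ← hra₁] at h₈
    exact ⟨(hi₁ 0 (by omega)).trans h₀, (hi₁ 2 (by omega)).trans h₁,
      (hi₁ 4 (by omega)).trans h₂, (hi₁ 6 (by omega)).trans h₃,
      (hi₁ 9 (by omega)).trans h₄, (hr₁ 0 (by omega)).trans h₅,
      (hr₁ 2 (by omega)).trans h₆, h₇, h₈⟩
  refine wp_sweepC (fun _ v => ∀ k ≤ 2 * n, 2 * n + 5 ≤ v k) hC hD₁ (by omega) hD₁.v4 hC.cs_le h12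
    (Nat.zero_le _) (fun k hk => by simp [hk]) (fun c v hv => Or.inr hv)
    (fun c v v' _ hv _ _ hp => hp hv) hI₁ fun a₂ σ₂ S₂ v₂ tg₂ ha₂ hf₂ hI₂ hinf => ?_
  have hD₂ := (hD₁.setI (by omega)).of_frame hf₂
  have k8 : σ₂.ivar 8 = r := by
    rw [hf₂.ivar 8 (by omega)]; simpa [hi₁ 8] using h8
  refine wp_startC hC hD₂ k8 hr (by rw [hf₂.ivar 12 (by omega)]; simp) hinf hI₂
    fun a₃ σ₃ S₃ v₃ tg₃ ha₃ hf₃ hI₃ hcomp => ?_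
  have hf₂₃ := hf₂.trans hf₃
  have hD₃ := hD₂.of_frame hf₃
  have k5 : σ₃.ivar 5 = ct := by
    rw [hf₂₃.ivar 5 (by omega)]; simpa [hi₁ 5] using h5
  refine wp_sweepC (fun c v => cs ≤ c ∧ Comp n (rank KX (2 * n)) (rank KY (2 * n)) r cs ps c v) hC
    hD₃ (by omega) k5 hct' (by rw [hf₂₃.ivar 12 (by omega)]; simp) hct ⟨le_rfl, hcomp⟩
    (fun c v hv => Or.inl hv.1) (fun c v v' hc hv hcol hm _ => ⟨by omega,
      hv.2.next hcol hc hv.1 hC.free hm⟩) hI₃ fun a₄ σ₄ S₄ v₄ tg₄ ha₄ hf₄ hI₄ hG => ?_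
  have hcs := hC.cs_le
  refine hQ a₄ σ₄ S₄ v₄ tg₄ ?_ (fun x hx => ?_) (fun x hx => ?_) (fun b h₁ h₂ => ?_) (fun b hb => ?_)
    hI₄ hG.2
  -- The credits of the pieces telescope over the phases. What remains are the credits of the first
  -- two starts, the fixed costs of the phases, and at most `2 * n` columns at `360 * h + 640` each.
  · have hcard : ({2 * n + 1, 0} : Finset ℕ).card ≤ 2 := Finset.card_le_two
    have h₁ : (60 * h + 100) * ({2 * n + 1, 0} : Finset ℕ).card ≤ (60 * h + 100) * 2 :=
      Nat.mul_le_mul_left _ hcard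
    have h₂ : (cs - 0) * (360 * h + 640) + (ct - cs) * (360 * h + 640) ≤
        2 * n * (360 * h + 640) := by
      rw [← Nat.add_mul]; exact Nat.mul_le_mul_right _ (by omega)
    have h₃ : 2 * n * (360 * h + 640) ≤ 2 * n * (600 * h + 1200) :=
      Nat.mul_le_mul_left _ (by omega)
    rw [Nat.add_mul (2 * n) 2]
    clear * - ha₁ ha₂ ha₃ ha₄ h₁ h₂ h₃
    linarith [Nat.zero_le ((60 * h + 100) * S₄.card)]
  · rw [hf₄.ivar x (by omega), State.setI_ivar, if_neg (by omega), hf₂₃.ivar x (by omega),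
      State.setI_ivar, if_neg (by omega), hi₁ x hx]
  · rw [hf₄.rvar x hx, State.setI_rvar, hf₂₃.rvar x hx, State.setI_rvar, hr₁ x hx]
  · rw [hf₄.iarr b h₁ h₂, State.setI_iarr, hf₂₃.iarr b h₁ h₂, State.setI_iarr, hia₁ b h₁ h₂]
  · rw [hf₄.rarr b hb, State.setI_rarr, hf₂₃.rarr b hb, State.setI_rarr, hra₁]

/-! ## Reporting a path -/

/-- Vertices lie in the domain as ends of links, so at least one link is required. -/
theorem stair_of_fun {D : Set (ℝ × ℝ)} {s t : ℝ × ℝ} {L : ℕ} {f : ℕ → ℝ × ℝ} (hL : 2 ≤ L)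
    (h₀ : f 0 = s) (h₁ : f (L - 1) = t) (hl : ∀ i, i + 1 < L → Link D (f i) (f (i + 1))) :
    Stair D s t ((List.range L).map f) := by
  refine ⟨?_, ?_, ?_, ?_⟩
  · rw [List.head?_map, List.head?_range, if_neg (by omega)]; simp [h₀]
  · rw [List.getLast?_map, List.getLast?_range, if_neg (by omega)]; simp [h₁]
  · intro p hp
    obtain ⟨i, hi, rfl⟩ := List.mem_map.1 hp
    rw [List.mem_range] at hi
    rcases Nat.lt_or_ge (i + 1) L with h | h
    · exact (hl i h).2.1 (left_mem_segment ℝ _ _)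
    · have := (hl (i - 1) (by omega)).2.1 (right_mem_segment ℝ _ _)
      rwa [show i - 1 + 1 = i by omega] at this
  · rw [List.isChain_iff_getElem]
    intro i hi
    simp only [List.length_map, List.length_range] at hi
    simpa using hl i hi

section
variable {n : ℕ} {R : Fin n → Rect}

theorem HFree.link {x x' y : ℝ} {c c' k : ℕ}
    (h : HFree n (rank (keyX R) (2 * n)) (rank (keyY R) (2 * n)) k c c')
    (hx : InCell n (keyX R) x c) (hx' : InCell n (keyX R) x' c') (hy : InCell n (keyY R) y k)
    (hle : x ≤ x') : Link (domain R) (x, y) (x', y) :=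
  ⟨Or.inr rfl, (segment_horizontal hle).2 fun _ h₁ h₂ => HFree.mem_domain h hx hx' hy h₁ h₂, hle,
    le_rfl⟩

theorem VFree.link {x y y' : ℝ} {c k k' : ℕ}
    (h : VFree n (rank (keyX R) (2 * n)) (rank (keyY R) (2 * n)) c k k')
    (hx : InCell n (keyX R) x c) (hy : InCell n (keyY R) y k) (hy' : InCell n (keyY R) y' k')
    (hle : y ≤ y') : Link (domain R) (x, y) (x, y') :=
  ⟨Or.inl rfl, (segment_vertical hle).2 fun _ h₁ h₂ => VFree.mem_domain h hx hy hy' h₁ h₂, le_rfl,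
    hle⟩

end

/-- The `i`-th vertex in the output arrays. -/
def vertex (σ : State) (i : ℕ) : ℝ × ℝ := (σ.rarr 4 i, σ.rarr 5 i)

/-- What writing a path leaves unchanged. -/
structure WFrame (σ σ' : State) : Prop where
  ivar : ∀ x < 10, x ≠ 1 → σ'.ivar x = σ.ivar x
  rvar : ∀ x < 5, σ'.rvar x = σ.rvar x
  iarr : σ'.iarr = σ.iarr
  rarr : ∀ b, b ≠ 4 → b ≠ 5 → σ'.rarr b = σ.rarr b

theorem WFrame.trans {σ σ' σ'' : State} (h : WFrame σ σ') (h' : WFrame σ' σ'') : WFrame σ σ'' :=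
  ⟨fun x h₁ h₂ => (h'.ivar x h₁ h₂).trans (h.ivar x h₁ h₂),
    fun x hx => (h'.rvar x hx).trans (h.rvar x hx), h'.iarr.trans h.iarr,
    fun b h₁ h₂ => (h'.rarr b h₁ h₂).trans (h.rarr b h₁ h₂)⟩

/-- Follows the recorded vertical runs from column `11` backwards. -/
def traceC : Cmd :=
  .loop (.ile (.var 11) (.sub (.var 9) (.lit 5)))
    (.seq (.putR 4 (.sub (.var 10) (.lit 1)) (.get 9 (.var 11))) <|
    .seq (.putR 5 (.sub (.var 10) (.lit 1)) (.var 5)) <|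
    .seq (.putR 4 (.sub (.var 10) (.lit 2)) (.get 9 (.var 11))) <|
    .seq (.putR 5 (.sub (.var 10) (.lit 2)) (.get 10 (.var 11))) <|
    .seq (.setR 5 (.get 10 (.var 11))) <| .seq (.setI 11 (.get 8 (.var 11))) <|
    .setI 10 (.sub (.var 10) (.lit 2)))

/-- The path is written from its end. Each vertical run contributes two vertices, so a cell with `m`
runs has its horizontal end at vertex `2 * m + 1 - r`, and following one tag lowers the index by
two. The label `2 * n + 1` ends the walk: at index 1 for a horizontal start, whose vertex 0 is
written later, and at index 0 for a vertical one. -/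
theorem wp_traceC {M h n N r cs ps L m e k c idx : ℕ} {R : Fin n → Rect} {s t : ℝ × ℝ} {σ : State}
    {a : ℕ} {Q : ℕ → State → Prop} (hC : Ctx n h N M cs ps (keyX R) (keyY R) s)
    (hY : Sorted (keyY R) (2 * n) (σ.iarr 1) (σ.iarr 2) (σ.rarr 7)) (hr : r ≤ 1)
    (h9 : σ.ivar 9 = 2 * n + 5) (h10 : σ.ivar 10 = idx) (h11 : σ.ivar 11 = e)
    (hW : Wit n (rank (keyX R) (2 * n)) (rank (keyY R) (2 * n)) r cs ps s (TurnX n (keyX R) s.1)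
      (LevelY n (keyY R) ps s.2) (σ.iarr 8) (σ.rarr 9) (σ.rarr 10) m e k c)
    (hidx : idx = 2 * m + 1 - r) (hLM : L ≤ M) (hk : k ≤ 2 * n)
    (hy : LevelY n (keyY R) ps s.2 (σ.rvar 5) k)
    (hx : InCell n (keyX R) (σ.rarr 4 idx) c) (hsx : s.1 ≤ σ.rarr 4 idx)
    (hxy : σ.rarr 5 idx = σ.rvar 5) (hL : idx < L) (hlast : vertex σ (L - 1) = t)
    (hlink : ∀ i, idx ≤ i → i + 1 < L → Link (domain R) (vertex σ i) (vertex σ (i + 1)))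
    (hQ : ∀ a' σ', a' ≤ a + (50 * m + 20) → WFrame σ σ' → σ'.ivar 1 = σ.ivar 1 →
      vertex σ' (L - 1) = t →
      (∀ i, 1 ≤ i → i + 1 < L → Link (domain R) (vertex σ' i) (vertex σ' (i + 1))) →
      (r = 0 → 1 < L ∧ Link (domain R) s (vertex σ' 1)) →
      (r = 1 → vertex σ' 0 = s ∧ (1 < L → Link (domain R) (vertex σ' 0) (vertex σ' 1))) → Q a' σ') :
    wp M traceC σ a Q := by
  have hn := hC.hn
  have hM := hC.hM
  have hcsl := hC.cs_le
  have hranks : ∀ l, 1 ≤ l → l ≤ 2 * n → ∃ j < 2 * n, rank (keyY R) (2 * n) j = l := fun l h₁ h₂ =>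
    ⟨σ.iarr 2 (l - 1), hY.ord_lt _ (by omega), by rw [hY.rank_ord _ (by omega)]; omega⟩
  refine wp_loop (t := 50 * m + 20)
    (fun u τ => WFrame σ τ ∧ τ.ivar 1 = σ.ivar 1 ∧ ∃ idx e, τ.ivar 10 = idx ∧ τ.ivar 11 = e ∧
      idx < L ∧ vertex τ (L - 1) = t ∧
      (∀ i, idx ≤ i → i + 1 < L → Link (domain R) (vertex τ i) (vertex τ (i + 1))) ∧
      ((∃ m k c, Wit n (rank (keyX R) (2 * n)) (rank (keyY R) (2 * n)) r cs ps s
          (TurnX n (keyX R) s.1) (LevelY n (keyY R) ps s.2) (σ.iarr 8) (σ.rarr 9) (σ.rarr 10) m e k c ∧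
        idx = 2 * m + 1 - r ∧ k ≤ 2 * n ∧ LevelY n (keyY R) ps s.2 (τ.rvar 5) k ∧
        InCell n (keyX R) (τ.rarr 4 idx) c ∧ s.1 ≤ τ.rarr 4 idx ∧ τ.rarr 5 idx = τ.rvar 5 ∧
        u = 50 * m + 20) ∨
      (r = 1 ∧ e = 2 * n + 1 ∧ idx = 0 ∧ vertex τ 0 = s ∧ u = 20)))
    (fun τ => WFrame σ τ ∧ τ.ivar 1 = σ.ivar 1 ∧ vertex τ (L - 1) = t ∧
      (∀ i, 1 ≤ i → i + 1 < L → Link (domain R) (vertex τ i) (vertex τ (i + 1))) ∧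
      (r = 0 → 1 < L ∧ Link (domain R) s (vertex τ 1)) ∧
      (r = 1 → vertex τ 0 = s ∧ (1 < L → Link (domain R) (vertex τ 0) (vertex τ 1)))) ?_ ?_ ?_
  · rintro u τ ⟨hf, h1, idx, e, h10, h11, hidxL, hlast, hlink, hcase⟩
    have e9 : τ.ivar 9 = 2 * n + 5 := (hf.ivar 9 (by omega) (by omega)).trans h9
    have g8 : τ.iarr 8 = σ.iarr 8 := by rw [hf.iarr]
    have g9 : τ.rarr 9 = σ.rarr 9 := hf.rarr 9 (by omega) (by omega)
    have g10 : τ.rarr 10 = σ.rarr 10 := hf.rarr 10 (by omega) (by omega)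
    have hcost : 10 ≤ u := by
      rcases hcase with ⟨m, k, c, -, -, -, -, -, -, -, hu⟩ | ⟨-, -, -, -, hu⟩ <;> omega
    have hel : e ≤ 2 * n + 1 := by
      rcases hcase with ⟨m, k, c, hW, -⟩ | ⟨-, he, -⟩
      · exact hW.label_le
      · omega
    simp only [wp_seq, wp_setI, wp_setR, wp_putR, IExpr.ok, IExpr.val, IExpr.cost, RExpr.ok,
      RExpr.val, RExpr.cost, BExpr.ok, BExpr.val, BExpr.cost, State.putR_ivar, State.putR_iarr,
      State.putR_rvar, State.setR_ivar, State.setR_iarr, State.setI_ivar, State.setI_iarr,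
      State.putR_rarr, State.setR_rarr, if_true, if_false, Nat.reduceEqDiff, e9, h10, h11, g8, g9,
      g10, Nat.reduceAdd, Nat.add_sub_cancel]
    refine ⟨by omega, fun he => ?_, fun he => ⟨by omega, hf, h1, hlast, fun i hi hi' => ?_, fun hr0 => ?_,
      fun hr1 => ?_⟩⟩
    · rcases hcase with ⟨m, k, c, hW, hidx, hk, hy, hx, hsx, hxy, rfl⟩ | ⟨_, he', _⟩
      swap
      · omega
      -- A label that is not the start stands for a vertical run, so the two indices below `idx`
      -- exist.
      have h2 : 2 ≤ idx := by
        cases hW with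
        | startH => omega
        | startV => omega
        | step => omega
      have hst : σ.iarr 8 e < M := by
        cases hW with
        | startH => omega
        | startV h₁ _ _ _ _ h₅ => omega
        | step _ _ _ _ h₅ => have := h₅.label_le; omega
      refine ⟨by omega, by omega, by omega, trivial, by omega, by omega, by omega, by omega, by omega,
        by omega, by omega, ?_⟩
      have hTX : TurnX n (keyX R) s.1 (σ.rarr 9 e) e := by
        cases hW with
        | startH => omega
        | startV _ _ h => exact h
        | step _ h => exact h
      have hHF : HFree n (rank (keyX R) (2 * n)) (rank (keyY R) (2 * n)) k e c := by
        cases hW with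
        | startH => omega
        | startV _ _ _ _ _ _ _ h => exact h
        | step _ _ _ _ _ _ h => exact h
      -- The abscissa of a recorded run is the least one in its column or later that is not left of
      -- the start, so the horizontal link really leads rightwards. This covers runs and targets in
      -- the same column.
      have hlH : Link (domain R) (σ.rarr 9 e, τ.rvar 5) (τ.rarr 4 idx, τ.rvar 5) :=
        hHF.link hTX.1 hx hy.1 (hTX.2.2 _ _ hsx hx hHF.1)
      obtain ⟨v1, hv1⟩ : ∃ τ', τ' = ((((((τ.putR 4 (idx - 1) (σ.rarr 9 e)).putR 5 (idx - 1)
        (τ.rvar 5)).putR 4 (idx - 2) (σ.rarr 9 e)).putR 5 (idx - 2) (σ.rarr 10 e)).setR 5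
        (σ.rarr 10 e)).setI 11 (σ.iarr 8 e)).setI 10 (idx - 2) := ⟨_, rfl⟩
      have hge : ∀ i, idx ≤ i → vertex v1 i = vertex τ i := fun i hi => by
        simp [hv1, vertex, Function.update_apply, show i ≠ idx - 1 by omega,
          show i ≠ idx - 2 by omega]
      have hm1 : vertex v1 (idx - 1) = (σ.rarr 9 e, τ.rvar 5) := by
        simp [hv1, vertex, Function.update_apply, show idx - 1 ≠ idx - 2 by omega]
      have hm2 : vertex v1 (idx - 2) = (σ.rarr 9 e, σ.rarr 10 e) := by
        simp [hv1, vertex, Function.update_apply]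
      have hm0 : vertex τ idx = (τ.rarr 4 idx, τ.rvar 5) := by rw [vertex, hxy]
      have hv5 : v1.rvar 5 = σ.rarr 10 e := by simp [hv1]
      have hf' : WFrame σ v1 := hf.trans ⟨fun x h₁ h₂ => by
        simp [hv1, show x ≠ 10 by omega, show x ≠ 11 by omega], fun x h₁ => by
        simp [hv1, show x ≠ 5 by omega], by simp [hv1], fun b h₁ h₂ => by simp [hv1, h₁, h₂]⟩
      have hlinks : Link (domain R) (σ.rarr 9 e, σ.rarr 10 e) (σ.rarr 9 e, τ.rvar 5) →
          ∀ i, idx - 2 ≤ i → i + 1 < L → Link (domain R) (vertex v1 i) (vertex v1 (i + 1)) := by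
        intro hlV i hi hi'
        rcases (show i = idx - 2 ∨ i = idx - 1 ∨ idx ≤ i by omega) with h' | h' | h'
        · rw [h', show idx - 2 + 1 = idx - 1 by omega, hm2, hm1]; exact hlV
        · rw [h', show idx - 1 + 1 = idx by omega, hm1, hge idx le_rfl, hm0]; exact hlH
        · rw [hge i h', hge (i + 1) (by omega)]; exact hlink i h' hi'
      have hlast' : vertex v1 (L - 1) = t := by rw [hge _ (by omega)]; exact hlast
      -- Ordinates of different rows are ordered as the rows; equal rows occur only for the start
      -- row, whose ordinate is fixed.
      have hle : ∀ j y, LevelY n (keyY R) ps s.2 y j → j ≤ k → (j = k → j = ps) → y ≤ τ.rvar 5 := by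
        intro j y hyj hjk hjp
        rcases Nat.eq_or_lt_of_le hjk with h' | h'
        · rw [hyj.2 (hjp h'), hy.2 (h' ▸ hjp h')]
        · exact (hyj.1.lt hy.1 h' (hranks k (by omega) hk)).le
      rw [← hv1]
      have hv4 : v1.rarr 4 (idx - 2) = σ.rarr 9 e := congrArg Prod.fst hm2
      have hv5' : v1.rarr 5 (idx - 2) = σ.rarr 10 e := congrArg Prod.snd hm2
      cases hW with
      | startH => omega
      | startV hr₁ h₀ h₁ h₂ h₃ h₄ h₅ h₆ =>
        have hLs : LevelY n (keyY R) ps s.2 (σ.rarr 10 cs) ps := by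
          rw [h₃]; exact ⟨hC.inY, fun _ => rfl⟩
        refine ⟨20, ⟨hf', h1, idx - 2, _, rfl, rfl, by omega, hlast', hlinks ?_,
          Or.inr ⟨hr₁, h₄, by omega, ?_, rfl⟩⟩, by omega⟩
        · exact h₅.link hTX.1 hLs.1 hy.1 (hle ps _ hLs h₅.1 fun _ => rfl)
        · rw [show 0 = idx - 2 by omega, hm2, h₂, h₃]
      | @step m' _ j _ _ h₀ h₁ h₂ h₃ h₄ h₅ h₆ =>
        refine ⟨_, ⟨hf', h1, idx - 2, _, rfl, rfl, by omega, hlast', hlinks ?_,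
          Or.inl ⟨m', j, e, h₄, by omega, by omega, ?_, ?_, ?_, ?_, rfl⟩⟩, by omega⟩
        · exact h₅.link hTX.1 h₂.1 hy.1 (hle j _ h₂ h₃.le fun h => by omega)
        · rw [hv5]; exact h₂
        · rw [hv4]; exact h₁.1
        · rw [hv4]; exact h₁.2.1
        · rw [hv5, hv5']
    · rcases hcase with ⟨m, k, c, hW, hidx, -⟩ | ⟨_, _, hidx, _⟩
      · refine hlink i ?_ hi'
        cases hW with
        | startH => omega
        | startV => omega
        | step => omega
      · exact hlink i (by omega) hi'
    · rcases hcase with ⟨m, k, c, hW, hidx, hk, hy, hx, hsx, hxy, rfl⟩ | ⟨hr₁, _⟩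
      · cases hW with
        | startH h₁ h₂ =>
          obtain rfl : idx = 1 := by omega
          have hy' := hy.2 rfl
          have hv : vertex τ 1 = (τ.rarr 4 1, s.2) := by rw [vertex, hxy, hy']
          rw [hv]
          exact ⟨hidxL, h₂.link hC.inX hx hC.inY hsx⟩
        | startV => omega
        | step => omega
      · omega
    · rcases hcase with ⟨m, k, c, hW, hidx, hk, hy, hx, hsx, hxy, rfl⟩ | ⟨hr₁, _, hidx, hv, _⟩
      · cases hW with
        | startH => omega
        | startV => omega
        | step => omega
      · exact ⟨hv, fun h' => hlink 0 (by omega) (by omega)⟩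
  · exact ⟨⟨fun _ _ _ => rfl, fun _ _ => rfl, rfl, fun _ _ _ => rfl⟩, rfl, idx, e, h10, h11, hL, hlast,
      hlink, Or.inl ⟨m, k, c, hW, hidx, hk, hy, hx, hsx, hxy, rfl⟩⟩
  · rintro a' σ' ha' ⟨h₁, h₂, h₃, h₄, h₅, h₆⟩
    exact hQ a' σ' ha' h₁ h₂ h₃ h₄ h₅ h₆

theorem Wit.le_two_mul {n r cs ps v e k c : ℕ} {RX RY stag : ℕ → ℕ} {s : ℝ × ℝ}
    {PX PY : ℝ → ℕ → Prop} {xv yl : ℕ → ℝ} (hr : r ≤ 1)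
    (h : Wit n RX RY r cs ps s PX PY stag xv yl v e k c) : r ≤ 2 * v := by
  cases h <;> omega

/-- Writes the path with `11` vertices whose horizontal end is the vertex `10`. -/
def writeC : Cmd :=
  .seq (.setI 1 (.var 11)) <| .seq (.putR 4 (.var 10) (.var 3)) <| .seq (.putR 5 (.var 10) (.var 5)) <|
  .seq (.putR 4 (.sub (.var 11) (.lit 1)) (.var 3)) <| .seq (.putR 5 (.sub (.var 11) (.lit 1)) (.var 4)) <|
  .seq (.setI 11 (.get 7 (.var 23))) <| .seq traceC <|
  .ite (.ile (.lit 1) (.var 8)) .skip (.seq (.putR 4 (.lit 0) (.var 0)) <| .putR 5 (.lit 0) (.var 2))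

/-- Vertex `idx` is the right end of the last horizontal link, below or at the target. If it is the
target, the path has `idx + 1` vertices; otherwise one vertical link is added. For a horizontal
start the missing vertex 0 is filled in after the trace. -/
theorem wp_writeC {M h n N r cs ps L m k c idx src : ℕ} {R : Fin n → Rect} {s t : ℝ × ℝ}
    {σ : State} {a : ℕ} {Q : ℕ → State → Prop} (hC : Ctx n h N M cs ps (keyX R) (keyY R) s)
    (hD : Data n N cs ps (keyX R) (keyY R) s σ) (hr : r ≤ 1) (h8 : σ.ivar 8 = r)
    (h10 : σ.ivar 10 = idx) (h11 : σ.ivar 11 = L) (h23 : σ.ivar 23 = src) (hsrc : src ≤ 2 * n)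
    (ht₁ : σ.rvar 3 = t.1) (ht₂ : σ.rvar 4 = t.2)
    (hW : Wit n (rank (keyX R) (2 * n)) (rank (keyY R) (2 * n)) r cs ps s (TurnX n (keyX R) s.1)
      (LevelY n (keyY R) ps s.2) (σ.iarr 8) (σ.rarr 9) (σ.rarr 10) m (σ.iarr 7 src) k c)
    (hm : m ≤ 2 * n + 4)
    (hidx : idx = 2 * m + 1 - r) (hk : k ≤ 2 * n) (hy : LevelY n (keyY R) ps s.2 (σ.rvar 5) k)
    (hx : InCell n (keyX R) t.1 c) (hsx : s.1 ≤ t.1)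
    (hend : (L = idx + 1 ∧ σ.rvar 5 = t.2) ∨
      (L = idx + 2 ∧ Link (domain R) (t.1, σ.rvar 5) t))
    (hQ : ∀ a' σ', a' ≤ a + (100 * n + 300) → WFrame σ σ' → σ'.ivar 1 = L →
      Stair (domain R) s t (outputPath σ') → Q a' σ') : wp M writeC σ a Q := by
  have hn := hC.hn
  have hM := hC.hM
  have hlab := hW.label_le
  have hL2 : 2 ≤ L := by
    have := hW.le_two_mul hr
    omega
  simp only [writeC, wp_seq, wp_setI, wp_putR, IExpr.ok, IExpr.val, IExpr.cost, RExpr.ok,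
      RExpr.val, RExpr.cost, State.putR_ivar, State.putR_iarr, State.putR_rvar, State.setI_ivar,
      State.setI_iarr, State.setI_rvar, if_true, if_false, Nat.reduceEqDiff, h10, h11, h23, ht₁, ht₂]
  refine ⟨by omega, by omega, trivial, by omega, trivial, by omega, trivial, by omega, trivial,
    by omega, ?_⟩
  obtain ⟨τ, hτ⟩ : ∃ τ, τ = (((((σ.setI 1 L).putR 4 idx t.1).putR 5 idx (σ.rvar 5)).putR 4 (L - 1)
    t.1).putR 5 (L - 1) t.2).setI 11 (σ.iarr 7 src) := ⟨_, rfl⟩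
  rw [← hτ]
  have hfτ : WFrame σ τ := ⟨fun x h₁ h₂ => by simp [hτ, h₂, show x ≠ 11 by omega],
    fun x _ => by simp [hτ], by simp [hτ], fun b h₁ h₂ => by simp [hτ, h₁, h₂]⟩
  have e4 : τ.rarr 4 idx = t.1 := by simp [hτ, Function.update_apply]
  have e5 : τ.rarr 5 idx = σ.rvar 5 := by
    simp only [hτ, State.setI_rarr, State.putR_rarr, if_true, if_false, Nat.reduceEqDiff,
      Function.update_apply]
    rcases hend with ⟨h₁, h₂⟩ | ⟨h₁, _⟩
    · simp [show idx = L - 1 by omega, h₂]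
    · simp [show idx ≠ L - 1 by omega]
  have elast : vertex τ (L - 1) = t := by simp [vertex, hτ]
  have er5 : τ.rvar 5 = σ.rvar 5 := by simp [hτ]
  have hsY := hD.sortY
  rw [← hfτ.iarr, ← hfτ.rarr 7 (by omega) (by omega)] at hsY
  rw [← hfτ.rarr 9 (by omega) (by omega), ← hfτ.rarr 10 (by omega) (by omega), ← hfτ.iarr] at hW
  refine wp_traceC (L := L) (t := t) (e := τ.iarr 7 src) hC hsY hr
    ((hfτ.ivar 9 (by omega) (by omega)).trans hD.v9) (by simp [hτ, h10]) (by simp [hτ]) hW hidx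
    (by omega) hk (by rw [er5]; exact hy) (by rw [e4]; exact hx) (by rw [e4]; exact hsx)
    (by rw [e5, er5]) (by omega) elast (fun i h₁ h₂ => ?_) ?_
  · rcases hend with ⟨h₃, _⟩ | ⟨h₃, h₄⟩
    · omega
    · obtain rfl : i = idx := by omega
      rw [show i + 1 = L - 1 by omega, elast, vertex, e4, e5]
      exact h₄
  · intro a' σ' ha' hf' h1 hlast hlinks hr0 hr1
    have hfσ := hfτ.trans hf'
    have k8 : σ'.ivar 8 = r := (hfσ.ivar 8 (by omega) (by omega)).trans h8
    have k1 : σ'.ivar 1 = L := by rw [h1]; simp [hτ]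
    have k0 : σ'.rvar 0 = s.1 := (hfσ.rvar 0 (by omega)).trans hD.r0
    have k2 : σ'.rvar 2 = s.2 := (hfσ.rvar 2 (by omega)).trans hD.r2
    simp only [wp_ite, wp_skip, wp_putR, wp_seq, IExpr.ok, IExpr.val, IExpr.cost, RExpr.ok,
      RExpr.val, RExpr.cost, BExpr.ok, BExpr.val, BExpr.cost, State.putR_rvar, k8, k0, k2]
    refine ⟨by omega, fun h' => hQ _ _ (by omega) hfσ k1 ?_,
      fun h' => ⟨by omega, trivial, by omega, trivial, hQ _ _ (by omega) (hfσ.trans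
        ⟨fun _ _ _ => rfl, fun _ _ => rfl, rfl, fun b h₁ h₂ => by simp [h₁, h₂]⟩) (by simp [k1]) ?_⟩⟩
    · obtain ⟨h₁, h₂⟩ := hr1 (by omega)
      rw [outputPath, k1]
      refine stair_of_fun (f := vertex σ') hL2 h₁ hlast fun i hi => ?_
      rcases Nat.eq_zero_or_pos i with h' | h'
      · rw [h']; exact h₂ (by omega)
      · exact hlinks i h' hi
    · obtain ⟨h₁, h₂⟩ := hr0 (by omega)
      obtain ⟨ω, hω⟩ : ∃ ω, ω = (σ'.putR 4 0 s.1).putR 5 0 s.2 := ⟨_, rfl⟩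
      have hge : ∀ i, 1 ≤ i → vertex ω i = vertex σ' i := fun i hi => by
        simp [vertex, hω, Function.update_apply, show i ≠ 0 by omega]
      have h0 : vertex ω 0 = s := by simp [vertex, hω]
      rw [← hω, outputPath, show ω.ivar 1 = L by simp [hω, k1]]
      refine stair_of_fun (f := vertex ω) hL2 h0 (by rw [hge _ (by omega)]; exact hlast)
        fun i hi => ?_
      rcases Nat.eq_zero_or_pos i with hi₀ | hi₀
      · rw [hi₀, h0, hge (0 + 1) le_rfl]; exact h₂
      · rw [hge i hi₀, hge (i + 1) (by omega)]; exact hlinks i hi₀ hi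

/-- Reads off a best path to the target, and writes it if it is shorter than the one at hand. -/
def reportC : Cmd :=
  .seq (.setI 21 (.var 7)) <| .seq minC <| .seq levelC <|
  .seq (.setI 10 (.sub (.add (.mul (.lit 2) (.get 6 (.var 23))) (.lit 1)) (.var 8))) <|
  .seq (.setI 11 (.add (.var 10) (.lit 1))) <|
  .seq (.ite (.ile (.var 22) (.var 23)) (.setR 5 (.var 4)) (.setI 11 (.add (.var 11) (.lit 1)))) <|
  .ite (.ile (.var 1) (.var 11)) .skip writeC

/-- The target is best reached horizontally with `v q` runs, or vertically with one run more than
the minimum over the free run below it. If the minimum is in the piece of the target, the horizontal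
end is best; otherwise `v src < v q`, and a final vertical link from row `src` saves a link.
Excluded from the comparison is a first vertical run that ends at the target. -/
theorem wp_reportC {M h n N r cs ps ct pt : ℕ} {R : Fin n → Rect} {s t : ℝ × ℝ} {S : Finset ℕ}
    {v tg : ℕ → ℕ} {σ : State} {a : ℕ} {Q : ℕ → State → Prop}
    (hC : Ctx n h N M cs ps (keyX R) (keyY R) s)
    (hD : Data n N cs ps (keyX R) (keyY R) s σ) (hr : r ≤ 1) (h8 : σ.ivar 8 = r)
    (h7 : σ.ivar 7 = pt) (h1 : σ.ivar 1 < M) (ht₁ : σ.rvar 3 = t.1) (ht₂ : σ.rvar 4 = t.2)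
    (hpt : pt ≤ 2 * n) (hct : ct ≤ 2 * n) (hps : ps < pt)
    (hx : InCell n (keyX R) t.1 ct) (hy : InCell n (keyY R) t.2 pt) (hsx : s.1 ≤ t.1)
    (hreach : Reachable n (rank (keyX R) (2 * n)) (rank (keyY R) (2 * n)) r cs ps ct pt)
    (hI : Inv n N r cs ps (keyX R) (keyY R) s ct σ S v tg)
    (hcomp : Comp n (rank (keyX R) (2 * n)) (rank (keyY R) (2 * n)) r cs ps ct v)
    (hQ : ∀ a' σ', a' ≤ a + (120 * h + 100 * n + 600) → WFrame σ σ' → σ'.ivar 1 ≤ 4 * n + 12 →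
      ((σ'.ivar 1 = σ.ivar 1 ∧ ∀ i, vertex σ' i = vertex σ i) ∨
        (σ'.ivar 1 ≤ σ.ivar 1 ∧ Stair (domain R) s t (outputPath σ'))) →
      (∀ d g, Reach n (rank (keyX R) (2 * n)) (rank (keyY R) (2 * n)) r cs ps d g ct pt →
        ¬ (d = true ∧ r = 1 ∧ g = 1) → σ'.ivar 1 ≤ linkCount r d g + 1) → Q a' σ') :
    wp M reportC σ a Q := by
  have hN := hC.hN
  have hn := hC.hn
  have hM := hC.hM
  simp only [reportC, wp_seq, wp_setI, IExpr.ok, IExpr.val, IExpr.cost, h7]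
  refine ⟨by omega, ?_⟩
  refine wp_minC (k := pt) (S := S) (v := v) (tg := tg) hN hn hM (by simp [hD.v2]) (by simp)
    hpt (hI.pieces.of_frame rfl rfl rfl rfl rfl)
    fun a₁ σ₁ q src ha₁ hv₁ hrv₁ hia₁ hra₁ h22 h23 hq hsrcS hsq hvsrc hlt hsame => ?_
  have hql := hq.2.1
  have hEF₁ : EFrame σ σ₁ := ⟨fun x hx => by
    rw [hv₁ x (by omega)]
    simp [show x ≠ 21 by omega],
    fun x _ => by rw [hrv₁]; simp, fun b _ _ => by rw [hia₁]; simp, fun b _ => by rw [hra₁]; simp⟩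
  have hD₁ := hD.of_frame hEF₁
  refine wp_levelC hC hD₁ h23 (by omega) fun a₂ y ha₂ hylev => ?_
  have hqv : ∀ l, q ≤ l → l ≤ pt → v l = v q := fun l h₁ h₂ =>
    (hI.pieces.rep.cell_of_isPred hq hpt h₁ h₂).1
  have hvpt : v pt < 2 * n + 5 := by
    obtain ⟨d, g, hg⟩ := hreach
    have := hcomp d g pt hpt hg
    cases d with
    | false => simp only [Bool.false_eq_true, if_false] at this; exact this.2
    | true =>
      simp only [if_true] at this
      exact (this.1 pt hpt (VFree.refl (hg.free hC.free))).2
  have hvq : v q < 2 * n + 5 := by rw [← hqv pt hql le_rfl]; exact hvpt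
  have hvs : v src ≤ v q := by rw [hvsrc]; exact min_le_left _ _
  have hmin : ∀ j, VFree n (rank (keyX R) (2 * n)) (rank (keyY R) (2 * n)) ct j pt → v src ≤ v j :=
    fun j hj => by
      rw [hvsrc]
      exact hI.col.min_le hct hpt hql hqv (fun h₁ h₂ => hI.adj q hq.1 h₁ (by omega) h₂) hj
  have l6 : σ₁.iarr 6 src = v src := by
    rw [hia₁]; exact (hI.pieces.rep.val_eq hsrcS).symm
  have l7 : σ₁.iarr 7 src = tg src := by
    rw [hia₁]; exact (hI.pieces.rep.tag_eq hsrcS (by omega)).symm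
  have k8 : σ₁.ivar 8 = r := (hEF₁.ivar 8 (by omega)).trans h8
  have k1 : σ₁.ivar 1 = σ.ivar 1 := hEF₁.ivar 1 (by omega)
  have k4 : σ₁.rvar 4 = t.2 := (hEF₁.rvar 4 (by omega)).trans ht₂
  have k3 : σ₁.rvar 3 = t.1 := (hEF₁.rvar 3 (by omega)).trans ht₁
  have hWs := hI.sound src (by omega) (by omega)
  -- The lower bound for competitors. A horizontal end needs at least `v q` runs. A vertical end
  -- comes from a row of the free run below, whose value is at least `v src`, and so needs at least
  -- `v src + 1` runs.
  have hlow : ∀ L, (L = 2 * v src + 2 - r ∧ src = q) ∨ (L = 2 * v src + 3 - r ∧ src ≠ q) →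
      ∀ d g, Reach n (rank (keyX R) (2 * n)) (rank (keyY R) (2 * n)) r cs ps d g ct pt →
        ¬ (d = true ∧ r = 1 ∧ g = 1) → L ≤ linkCount r d g + 1 := by
    intro L hL d g hg hne
    have hc := hcomp d g pt hpt hg
    cases d with
    | false =>
      simp only [Bool.false_eq_true, if_false] at hc
      rw [hqv pt hql le_rfl] at hc
      simp only [linkCount, Bool.false_eq_true, if_false]
      rcases hL with ⟨h₁, h₂⟩ | ⟨h₁, h₂⟩
      · omega
      · have := hlt h₂
        omega
    | true =>
      simp only [if_true] at hc
      simp only [linkCount, if_true]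
      rcases hc.2 with ⟨j, hj, hj'⟩ | h'
      · have := hmin j hj
        rcases hL with ⟨h₁, h₂⟩ | ⟨h₁, h₂⟩ <;> omega
      · exact absurd ⟨rfl, h'.1, h'.2⟩ hne
  simp only [wp_ite, wp_skip, wp_setI, wp_setR, IExpr.ok, IExpr.val, IExpr.cost, BExpr.ok,
    BExpr.val, BExpr.cost, RExpr.ok, RExpr.val, RExpr.cost, State.setR_ivar, State.setR_iarr,
    State.setI_ivar, State.setI_iarr, State.setI_rvar, State.setR_rvar, if_true, if_false,
    Nat.reduceEqDiff, h23, h22, l6, k8, k1, k4]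
  have hwrite : ∀ (τ : State) (a₃ L : ℕ), a₃ ≤ a₂ + 40 →
      ((L = 2 * v src + 2 - r ∧ src = q ∧ τ.rvar 5 = t.2) ∨
        (L = 2 * v src + 3 - r ∧ src ≠ q ∧ τ.rvar 5 = y)) →
      (∀ x, x ≠ 10 → x ≠ 11 → τ.ivar x = σ₁.ivar x) → (∀ x < 5, τ.rvar x = σ₁.rvar x) →
      τ.iarr = σ₁.iarr → τ.rarr = σ₁.rarr → τ.ivar 10 = 2 * v src + 1 - r → τ.ivar 11 = L →
      (σ.ivar 1 ≤ L → Q (a₃ + 1) τ) ∧ (¬ σ.ivar 1 ≤ L → wp M writeC τ a₃ Q) := by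
    intro τ a₃ L ha₃ hL hτi hτr hτia hτra h10 h11
    have hiτ : τ.iarr = σ.iarr := by rw [hτia, hia₁]; simp
    have hrτ : τ.rarr = σ.rarr := by rw [hτra, hra₁]; simp
    have hWF : WFrame σ τ := ⟨fun x h₁ h₂ => by
      rw [hτi x (by omega) (by omega)]; exact hEF₁.ivar x (by omega), fun x hx => by
      rw [hτr x hx]; exact hEF₁.rvar x hx, hiτ, fun b _ _ => by rw [hrτ]⟩
    have hL' := hlow L (by
      rcases hL with ⟨h₁, h₂, _⟩ | ⟨h₁, h₂, _⟩
      · exact Or.inl ⟨h₁, h₂⟩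
      · exact Or.inr ⟨h₁, h₂⟩)
    have e1 : τ.ivar 1 = σ.ivar 1 := (hτi 1 (by omega) (by omega)).trans k1
    refine ⟨fun hle => ?_, fun hgt => ?_⟩
    · refine hQ _ _ (by omega) hWF (by omega) (Or.inl ⟨e1, fun i => by rw [vertex, vertex, hrτ]⟩)
        fun d g hg hne => ?_
      rw [e1]
      exact hle.trans (hL' d g hg hne)
    · have hEF₂ : EFrame σ₁ (τ.setI 10 (σ₁.ivar 10) |>.setI 11 (σ₁.ivar 11)) := by
        refine ⟨fun x hx => ?_, fun x hx => hτr x hx, fun b _ _ => by simp [hτia],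
          fun b _ => by simp [hτra]⟩
        by_cases h₁ : x = 11
        · simp [h₁]
        by_cases h₂ : x = 10
        · simp [h₂]
        simp [h₁, h₂, hτi x h₂ h₁]
      have hDτ : Data n N cs ps (keyX R) (keyY R) s τ := by
        obtain ⟨h₀, h₁, h₂, h₃, h₄, h₅, h₆, h₇, h₈⟩ := hD₁.of_frame hEF₂
        exact ⟨by simpa using h₀, by simpa using h₁, by simpa using h₂, by simpa using h₃,
          by simpa using h₄, h₅, h₆, h₇, h₈⟩
      have hWτ := hWs
      have htag : τ.iarr 7 src = tg src := by rw [hτia, l7]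
      rw [← htag, ← hiτ, ← hrτ] at hWτ
      obtain ⟨k, hk, hWk, hlev, hend⟩ : ∃ k ≤ 2 * n, Wit n (rank (keyX R) (2 * n))
          (rank (keyY R) (2 * n)) r cs ps s (TurnX n (keyX R) s.1) (LevelY n (keyY R) ps s.2)
          (τ.iarr 8) (τ.rarr 9) (τ.rarr 10) (v src) (τ.iarr 7 src) k ct ∧
          LevelY n (keyY R) ps s.2 (τ.rvar 5) k ∧ ((L = 2 * v src + 1 - r + 1 ∧ τ.rvar 5 = t.2) ∨
          (L = 2 * v src + 1 - r + 2 ∧ Link (domain R) (t.1, τ.rvar 5) t)) := by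
        rcases hL with ⟨h₁, h₂, h₃⟩ | ⟨h₁, h₂, h₃⟩
        · refine ⟨pt, hpt, ?_, ?_, Or.inl ⟨by omega, h₃⟩⟩
          · have hp := hI.sound pt hpt (by omega)
            have hcell := hI.pieces.rep.cell_of_isPred hq hpt hql le_rfl
            rw [hcell.1, hcell.2, ← h₂, ← htag, ← hiτ, ← hrτ] at hp
            exact hp
          · rw [h₃]; exact ⟨hy, fun h' => by omega⟩
        · have hlev := hylev hWs.start_le (by omega)
          rw [h₃]
          refine ⟨src, by omega, hWτ, hlev, Or.inr ⟨by omega, ?_⟩⟩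
          have hVF : VFree n (rank (keyX R) (2 * n)) (rank (keyY R) (2 * n)) ct src pt := by
            refine ⟨by omega, fun l h₄ h₅ => ?_⟩
            rw [← hI.col.blk l (by omega)]
            rcases Nat.lt_or_ge l q with h₆ | h₆
            · rw [hsame l h₄ h₆]; omega
            · rw [hqv l h₆ h₅]; omega
          refine hVF.link hx hlev.1 hy (hlev.1.lt hy (by omega) ⟨σ.iarr 2 (pt - 1),
            hD.sortY.ord_lt _ (by omega), ?_⟩).le
          rw [hD.sortY.rank_ord _ (by omega)]; omega
      refine wp_writeC (t := t) (m := v src) hC hDτ hr ((hτi 8 (by omega) (by omega)).trans k8) h10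
        h11 ((hτi 23 (by omega) (by omega)).trans h23) (by omega)
        ((hτr 3 (by omega)).trans k3) ((hτr 4 (by omega)).trans k4) hWk (by omega) rfl hk hlev hx hsx
        hend fun a' σ' ha' hf hL1 hst => ?_
      exact hQ a' σ' (by linarith) (hWF.trans hf) (by omega) (Or.inr ⟨by omega, hst⟩) (by rw [hL1]; exact hL')
  refine ⟨by omega, by omega, by omega, fun hle => ⟨trivial, by omega, ?_⟩,
    fun hgt => ⟨by omega, by omega, ?_⟩⟩
  · have hsq' : src = q := by omega
    refine hwrite _ _ (2 * v src + 1 - r + 1) (by omega) (Or.inl ⟨by omega, hsq', by simp⟩)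
      (fun x h₁ h₂ => by simp [h₁, h₂]) (fun x hx => by simp [show x ≠ 5 by omega]) rfl rfl (by simp)
      (by simp)
  · refine hwrite _ _ (2 * v src + 1 - r + 1 + 1) (by omega) (Or.inr ⟨by omega, by omega, by simp⟩)
      (fun x h₁ h₂ => by simp [h₁, h₂]) (fun x hx => by simp [show x ≠ 5 by omega]) rfl rfl (by simp)
      (by simp)

/-- The algorithm for paths whose first link has the direction given by variable `8`. -/
def runC : Cmd := .seq fieldC <| reportC

theorem wp_runC {M h n N r cs ps ct pt : ℕ} {R : Fin n → Rect} {s t : ℝ × ℝ}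
    {σ : State} {a : ℕ} {Q : ℕ → State → Prop}
    (hC : Ctx n h N M cs ps (keyX R) (keyY R) s)
    (hD : Data n N cs ps (keyX R) (keyY R) s σ) (hr : r ≤ 1) (h8 : σ.ivar 8 = r)
    (hkey : ∀ q ≤ 2 * n + 1, σ.rarr 6 q = -(q : ℝ)) (h5 : σ.ivar 5 = ct)
    (h7 : σ.ivar 7 = pt) (h1 : σ.ivar 1 < M) (ht₁ : σ.rvar 3 = t.1) (ht₂ : σ.rvar 4 = t.2)
    (hpt : pt ≤ 2 * n) (hct : ct ≤ 2 * n) (hps : ps < pt)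
    (hx : InCell n (keyX R) t.1 ct) (hy : InCell n (keyY R) t.2 pt) (hsx : s.1 ≤ t.1)
    (hreach : Reachable n (rank (keyX R) (2 * n)) (rank (keyY R) (2 * n)) r cs ps ct pt)
    (hQ : ∀ a' σ', a' ≤ a + (30 * N + (2 * n + 2) * (700 * h + 1600)) →
      (∀ x < 10, x ≠ 1 → σ'.ivar x = σ.ivar x) → (∀ x < 5, σ'.rvar x = σ.rvar x) →
      (∀ b, 1 ≤ b → b ≤ 4 → σ'.iarr b = σ.iarr b) →
      (∀ b, b < 9 → b ≠ 4 → b ≠ 5 → σ'.rarr b = σ.rarr b) → σ'.ivar 1 ≤ 4 * n + 12 →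
      ((σ'.ivar 1 = σ.ivar 1 ∧ ∀ i, vertex σ' i = vertex σ i) ∨
        (σ'.ivar 1 ≤ σ.ivar 1 ∧ Stair (domain R) s t (outputPath σ'))) →
      (∀ d g, Reach n (rank (keyX R) (2 * n)) (rank (keyY R) (2 * n)) r cs ps d g ct pt →
        ¬ (d = true ∧ r = 1 ∧ g = 1) → σ'.ivar 1 ≤ linkCount r d g + 1) → Q a' σ') :
    wp M runC σ a Q := by
  have hcsct : cs ≤ ct := by
    obtain ⟨d, g, hg⟩ := hreach
    exact hg.bounds.1
  simp only [runC, wp_seq]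
  refine wp_fieldC hC hD hkey h5 h8 hr hcsct hct
    fun a₁ σ₁ S v tg ha₁ hi₁ hr₁ hia₁ hra₁ hI hcomp => ?_
  have hD₁ : Data n N cs ps (keyX R) (keyY R) s σ₁ := by
    obtain ⟨h₀, h₁, h₂, h₃, h₄, h₅, h₆, h₇, h₈⟩ := hD
    rw [← hia₁ 1 (by omega) (by omega), ← hia₁ 2 (by omega) (by omega),
      ← hra₁ 7 (by omega)] at h₇
    rw [← hia₁ 3 (by omega) (by omega), ← hia₁ 4 (by omega) (by omega),
      ← hra₁ 8 (by omega)] at h₈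
    exact ⟨(hi₁ 0 (by omega)).trans h₀, (hi₁ 2 (by omega)).trans h₁,
      (hi₁ 4 (by omega)).trans h₂, (hi₁ 6 (by omega)).trans h₃,
      (hi₁ 9 (by omega)).trans h₄, (hr₁ 0 (by omega)).trans h₅,
      (hr₁ 2 (by omega)).trans h₆, h₇, h₈⟩
  have k1 : σ₁.ivar 1 = σ.ivar 1 := hi₁ 1 (by omega)
  have hv : ∀ i, vertex σ₁ i = vertex σ i := fun i => by
    rw [vertex, vertex, hra₁ 4 (by omega), hra₁ 5 (by omega)]
  refine wp_reportC hC hD₁ hr ((hi₁ 8 (by omega)).trans h8) ((hi₁ 7 (by omega)).trans h7)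
    (by omega) ((hr₁ 3 (by omega)).trans ht₁) ((hr₁ 4 (by omega)).trans ht₂) hpt hct hps hx hy hsx
    hreach hI hcomp fun a₂ σ₂ ha₂ hf hle hst hlow => ?_
  refine hQ a₂ σ₂ ?_ (fun x h₁ h₂ => (hf.ivar x h₁ h₂).trans (hi₁ x h₁))
    (fun x hx => (hf.rvar x hx).trans (hr₁ x hx)) (fun b h₁ h₂ => ?_)
    (fun b h₁ h₂ h₃ => (hf.rarr b h₂ h₃).trans (hra₁ b h₁)) hle ?_ hlow
  · have e₁ : (2 * n + 2) * (700 * h + 1600) =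
        (2 * n + 2) * (600 * h + 1200) + (2 * n * (100 * h) + 200 * h + 800 * n + 800) := by ring
    rw [e₁]
    clear * - ha₁ ha₂
    linarith [Nat.zero_le (2 * n * (100 * h))]
  · rw [hf.iarr]; exact hia₁ b h₁ h₂
  · rcases hst with ⟨h₁, h₂⟩ | ⟨h₁, h₂⟩
    · exact Or.inl ⟨h₁.trans k1, fun i => (h₂ i).trans (hv i)⟩
    · exact Or.inr ⟨by omega, h₂⟩

/-! ## The algorithm -/

/-- Tries both directions for the first link. -/
def solveC : Cmd := .seq (.setI 8 (.lit 0)) <| .seq runC <| .seq (.setI 8 (.lit 1)) <| runC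

/-- The second run overwrites the output only with a path that has fewer vertices. The final number
of vertices is therefore at most the bound for either direction of the first link. -/
theorem wp_solveC {M h n N cs ps ct pt : ℕ} {R : Fin n → Rect} {s t : ℝ × ℝ}
    {σ : State} {a : ℕ} {Q : ℕ → State → Prop}
    (hC : Ctx n h N M cs ps (keyX R) (keyY R) s)
    (hD : Data n N cs ps (keyX R) (keyY R) s σ)
    (hkey : ∀ q ≤ 2 * n + 1, σ.rarr 6 q = -(q : ℝ)) (h5 : σ.ivar 5 = ct)
    (h7 : σ.ivar 7 = pt) (h1 : σ.ivar 1 = 4 * n + 20) (ht₁ : σ.rvar 3 = t.1) (ht₂ : σ.rvar 4 = t.2)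
    (hpt : pt ≤ 2 * n) (hct : ct ≤ 2 * n) (hps : ps < pt)
    (hx : InCell n (keyX R) t.1 ct) (hy : InCell n (keyY R) t.2 pt) (hsx : s.1 ≤ t.1)
    (hreach : ∀ r ≤ 1, Reachable n (rank (keyX R) (2 * n)) (rank (keyY R) (2 * n)) r cs ps ct pt)
    (hQ : ∀ a' σ', a' ≤ a + (60 * N + (2 * n + 2) * (1400 * h + 3600)) →
      Stair (domain R) s t (outputPath σ') →
      (∀ r ≤ 1, ∀ d g, Reach n (rank (keyX R) (2 * n)) (rank (keyY R) (2 * n)) r cs ps d g ct pt →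
        ¬ (d = true ∧ r = 1 ∧ g = 1) → σ'.ivar 1 ≤ linkCount r d g + 1) → Q a' σ') :
    wp M solveC σ a Q := by
  have hn := hC.hn
  have hM := hC.hM
  have hset : ∀ (τ : State) (d : ℕ), Data n N cs ps (keyX R) (keyY R) s τ →
      Data n N cs ps (keyX R) (keyY R) s (τ.setI 8 d) :=
    fun τ d ⟨h₀, h₁, h₂, h₃, h₄, h₅, h₆, h₇, h₈⟩ => ⟨by simpa using h₀, by simpa using h₁,
      by simpa using h₂, by simpa using h₃, by simpa using h₄, h₅, h₆, h₇, h₈⟩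
  simp only [solveC, wp_seq, wp_setI, IExpr.ok, IExpr.val, IExpr.cost]
  refine ⟨by omega, ?_⟩
  refine wp_runC (r := 0) hC (hset σ 0 hD) (by omega) (by simp) hkey (by simpa using h5)
    (by simpa using h7) (by simp [h1]; omega) ht₁ ht₂ hpt hct hps hx hy hsx (hreach 0 (by omega))
    fun a₁ σ₁ ha₁ hi₁ hr₁ hia₁ hra₁ hle₁ hst₁ hlow₁ => ?_
  refine ⟨by omega, ?_⟩
  -- The vertex count is initially `4 * n + 20`, more than any reported path has, so the first run
  -- certainly writes a path.
  have hst : Stair (domain R) s t (outputPath σ₁) := by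
    rcases hst₁ with ⟨h', _⟩ | ⟨_, h'⟩
    · simp [h1] at h'; omega
    · exact h'
  have hD₁ : Data n N cs ps (keyX R) (keyY R) s σ₁ := by
    obtain ⟨h₀, h₁, h₂, h₃, h₄, h₅, h₆, h₇, h₈⟩ := hset σ 0 hD
    rw [← hia₁ 1 (by omega) (by omega), ← hia₁ 2 (by omega) (by omega),
      ← hra₁ 7 (by omega) (by omega) (by omega)] at h₇
    rw [← hia₁ 3 (by omega) (by omega), ← hia₁ 4 (by omega) (by omega),
      ← hra₁ 8 (by omega) (by omega) (by omega)] at h₈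
    exact ⟨(hi₁ 0 (by omega) (by omega)).trans h₀, (hi₁ 2 (by omega) (by omega)).trans h₁,
      (hi₁ 4 (by omega) (by omega)).trans h₂, (hi₁ 6 (by omega) (by omega)).trans h₃,
      (hi₁ 9 (by omega) (by omega)).trans h₄, (hr₁ 0 (by omega)).trans h₅,
      (hr₁ 2 (by omega)).trans h₆, h₇, h₈⟩
  refine wp_runC (r := 1) (t := t) hC (hset σ₁ 1 hD₁) (by omega) (by simp)
    (fun q hq => ?_) ?_ ?_ ?_ ?_ ?_ hpt hct hps hx hy hsx (hreach 1 (by omega))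
    fun a₂ σ₂ ha₂ hi₂ hr₂ hia₂ hra₂ hle₂ hst₂ hlow₂ => ?_
  · rw [State.setI_rarr, hra₁ 6 (by omega) (by omega) (by omega)]; exact hkey q hq
  · simpa [hi₁ 5] using h5
  · simpa [hi₁ 7] using h7
  · simp; omega
  · rw [State.setI_rvar, hr₁ 3 (by omega)]; exact ht₁
  · rw [State.setI_rvar, hr₁ 4 (by omega)]; exact ht₂
  have h12 : σ₂.ivar 1 ≤ σ₁.ivar 1 := by
    rcases hst₂ with ⟨h', _⟩ | ⟨h', _⟩ <;> simp at h' <;> omega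
  refine hQ a₂ σ₂ ?_ ?_ fun r hr d g hg hne => ?_
  · have e₁ : (2 * n + 2) * (1400 * h + 3600) = (2 * n + 2) * (700 * h + 1600) +
        (2 * n + 2) * (700 * h + 1600) + (2 * n + 2) * 400 := by ring
    rw [e₁]
    clear * - ha₁ ha₂
    linarith
  · rcases hst₂ with ⟨h', hv⟩ | ⟨_, h'⟩
    · have : outputPath σ₂ = outputPath σ₁ := by
        have h'' : σ₂.ivar 1 = σ₁.ivar 1 := by simpa using h'
        rw [outputPath, outputPath, h'']
        exact congrArg (fun f => List.map f _) (funext fun i => hv i)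
      rw [this]; exact hst
    · exact h'
  · rcases (show r = 0 ∨ r = 1 by omega) with rfl | rfl
    · exact h12.trans (hlow₁ d g hg hne)
    · exact hlow₂ d g hg hne

/-! ### Preprocessing: size of the tree, cells of start and target, keys -/

/-- Puts the least power of two that is at least `3 + 2` into variable `2`, where `3` is the value of
that variable. -/
def powerC : Cmd :=
  .seq (.setI 2 (.lit 1)) <|
  .loop (.not (.ile (.add (.var 3) (.lit 2)) (.var 2))) (.setI 2 (.mul (.lit 2) (.var 2)))

theorem wp_powerC {M m : ℕ} {σ : State} {a : ℕ} {Q : ℕ → State → Prop} (h3 : σ.ivar 3 = m)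
    (hM : 2 * m + 5 ≤ M)
    (hQ : ∀ a' h, a' ≤ a + (12 * h + 10) → m + 1 < 2 ^ h → 2 ^ h ≤ 2 * m + 2 →
      Q a' (σ.setI 2 (2 ^ h))) : wp M powerC σ a Q := by
  simp only [powerC, wp_seq, wp_setI, IExpr.ok, IExpr.val, IExpr.cost]
  refine ⟨by omega, ?_⟩
  have hset : ∀ x y, (σ.setI 2 x).setI 2 y = σ.setI 2 y := fun x y => by simp [State.setI]
  have hlt : ∃ H, m + 2 ≤ 2 ^ H := ⟨m + 2, Nat.lt_two_pow_self.le⟩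
  classical
  set H := Nat.find hlt with hH
  have hHs := Nat.find_spec hlt
  rw [← hH] at hHs
  have hHm : ∀ j < H, 2 ^ j < m + 2 := fun j hj => not_le.1 (Nat.find_min hlt hj)
  refine wp_loop (t := 12 * H + 7)
    (fun t τ => ∃ j ≤ H, τ = σ.setI 2 (2 ^ j) ∧ t = 12 * (H - j) + 7)
    (fun τ => τ = σ.setI 2 (2 ^ H)) ?_ ?_ ?_
  · rintro t τ ⟨j, hj, rfl, rfl⟩
    have hjM : 2 ^ j ≤ 2 * m + 2 := by
      rcases Nat.eq_zero_or_pos j with h' | h'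
      · subst h'; simp
      · have := hHm (j - 1) (by omega)
        rw [show j = (j - 1) + 1 by omega, pow_succ]; omega
    simp only [wp_setI, IExpr.ok, IExpr.val, IExpr.cost, BExpr.ok, BExpr.val, BExpr.cost,
      State.setI_ivar, if_true, if_false, Nat.reduceEqDiff, h3, hset]
    refine ⟨by omega, fun hc => ?_, fun hc => ⟨by omega, ?_⟩⟩
    · have hjH : j < H := by
        rcases Nat.lt_or_ge j H with h' | h'
        · exact h'
        · obtain rfl : j = H := by omega
          omega
      refine ⟨by omega, _, ⟨j + 1, hjH, ?_, rfl⟩, by omega⟩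
      rw [pow_succ, mul_comm]
    · obtain rfl : j = H := by
        by_contra hne
        have := hHm j (by omega)
        omega
      rfl
  · exact ⟨0, by omega, by simp, by simp⟩
  · rintro a' σ' ha' rfl
    refine hQ a' H (by omega) (by omega) ?_
    rcases Nat.eq_zero_or_pos H with h' | h'
    · rw [h']; omega
    · have := hHm (H - 1) (by omega)
      rw [show H = (H - 1) + 1 by omega, pow_succ]; omega

/-- Puts the cell of the real variable `y` on the axis with the bounds in the real arrays `b` and `c`
into variable `x`. -/
def countC (x b c y : ℕ) : Cmd :=
  .seq (.setI x (.lit 0)) <| .seq (.setI 10 (.lit 0)) <|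
  .loop (.not (.ile (.var 0) (.var 10)))
    (.seq (.ite (.rle (.var y) (.get b (.var 10))) .skip (.setI x (.add (.var x) (.lit 1)))) <|
    .seq (.ite (.rle (.get c (.var 10)) (.var y)) (.setI x (.add (.var x) (.lit 1))) .skip) <|
    .setI 10 (.add (.var 10) (.lit 1)))

theorem wp_countC {M n x b c y : ℕ} {K : ℕ → ℝ} {σ : State} {a : ℕ} {Q : ℕ → State → Prop}
    (hx : 0 < x) (hx' : x < 10) (h0 : σ.ivar 0 = n) (hM : 2 * n + 5 ≤ M)
    (hb : ∀ i < n, σ.rarr b i = K i) (hc : ∀ i < n, σ.rarr c i = K (n + i))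
    (hQ : ∀ a' w, a' ≤ a + (40 * n + 20) →
      Q a' ((σ.setI x (cell K n (σ.rvar y))).setI 10 w)) :
    wp M (countC x b c y) σ a Q := by
  simp only [countC, wp_seq, wp_setI, IExpr.ok, IExpr.val, IExpr.cost]
  refine ⟨by omega, by omega, ?_⟩
  have hx0 : (0 : ℕ) ≠ x := by omega
  have hx10 : (10 : ℕ) ≠ x := by omega
  have hx10' : x ≠ 10 := by omega
  have hset : ∀ u w u' w', (((σ.setI x u).setI 10 w).setI x u').setI 10 w' =
      (σ.setI x u').setI 10 w' := fun u w u' w' => by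
    simp only [State.setI, State.mk.injEq, and_true]
    funext z
    simp only [Function.update_apply]
    split_ifs <;> rfl
  have hset' : ∀ u w u' u'' w', ((((σ.setI x u).setI 10 w).setI x u').setI x u'').setI 10 w' =
      (σ.setI x u'').setI 10 w' := fun u w u' u'' w' => by
    simp only [State.setI, State.mk.injEq, and_true]
    funext z
    simp only [Function.update_apply]
    split_ifs <;> rfl
  have hset'' : ∀ u w w', ((σ.setI x u).setI 10 w).setI 10 w' =
      (σ.setI x u).setI 10 w' := fun u w w' => by
    simp only [State.setI, State.mk.injEq, and_true]
    funext z
    simp only [Function.update_apply]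
    split_ifs <;> rfl
  set z := σ.rvar y with hz
  set A : ℕ → ℕ := fun j => ((Finset.range j).filter fun i => K i < z).card with hA
  set B : ℕ → ℕ := fun j => ((Finset.range j).filter fun i => K (n + i) ≤ z).card with hB
  have hAs : ∀ j, A (j + 1) = if K j < z then A j + 1 else A j := fun j => by
    simp only [hA, Finset.range_add_one, Finset.filter_insert]
    split_ifs
    · rw [Finset.card_insert_of_notMem (by simp)]
    · rfl
  have hBs : ∀ j, B (j + 1) = if K (n + j) ≤ z then B j + 1 else B j := fun j => by
    simp only [hB, Finset.range_add_one, Finset.filter_insert]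
    split_ifs
    · rw [Finset.card_insert_of_notMem (by simp)]
    · rfl
  have hAl : ∀ j, A j ≤ j := fun j =>
    (Finset.card_filter_le _ _).trans_eq (Finset.card_range j)
  have hBl : ∀ j, B j ≤ j := fun j =>
    (Finset.card_filter_le _ _).trans_eq (Finset.card_range j)
  refine wp_loop (t := 40 * n + 10)
    (fun t τ => ∃ j ≤ n, τ = (σ.setI x (A j + B j)).setI 10 j ∧ t = 40 * (n - j) + 10)
    (fun τ => τ = (σ.setI x (A n + B n)).setI 10 n) ?_ ?_ ?_
  · rintro t τ ⟨j, hj, rfl, rfl⟩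
    have := hAl j
    have := hBl j
    have hA1 := hAs j
    have hB1 := hBs j
    simp only [wp_seq, wp_ite, wp_skip, wp_setI, IExpr.ok, IExpr.val, IExpr.cost, BExpr.ok,
      BExpr.val, BExpr.cost, RExpr.ok, RExpr.val, RExpr.cost, State.setI_ivar, State.setI_rvar,
      State.setI_rarr, if_true, if_false, Nat.reduceEqDiff, h0, hx0, hx10, hx10', hset, hset',
      hset'', ← hz]
    refine ⟨by omega, fun hlt => ?_, fun hge => ⟨by omega, ?_⟩⟩
    · have hjn : j < n := by omega
      rw [hb j hjn, hc j hjn]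
      refine ⟨⟨trivial, by omega⟩, fun h₁ => ?_, fun h₁ => ?_⟩
      · rw [if_neg (not_lt.2 h₁)] at hA1
        refine ⟨⟨by omega, trivial⟩, fun h₂ => ?_, fun h₂ => ?_⟩
        · rw [if_pos h₂] at hB1
          refine ⟨by omega, by omega, _, ⟨j + 1, hjn, ?_, rfl⟩, by omega⟩
          rw [hA1, hB1]; congr 2
        · rw [if_neg h₂] at hB1
          refine ⟨by omega, _, ⟨j + 1, hjn, ?_, rfl⟩, by omega⟩
          rw [hA1, hB1]
      · rw [if_pos (not_le.1 h₁)] at hA1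
        refine ⟨by omega, ⟨by omega, trivial⟩, fun h₂ => ?_, fun h₂ => ?_⟩
        · rw [if_pos h₂] at hB1
          refine ⟨by omega, by omega, _, ⟨j + 1, hjn, ?_, rfl⟩, by omega⟩
          rw [hA1, hB1]; congr 2; omega
        · rw [if_neg h₂] at hB1
          refine ⟨by omega, _, ⟨j + 1, hjn, ?_, rfl⟩, by omega⟩
          rw [hA1, hB1]; congr 2; omega
    · obtain rfl : j = n := by omega
      rfl
  · exact ⟨0, by omega, by simp [hA, hB], by simp⟩
  · rintro a' σ' ha' rfl
    exact hQ a' n (by omega)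

/-- Copies the real arrays `b` and `c` to the keys. -/
def keysC (b c : ℕ) : Cmd :=
  .seq (.setI 10 (.lit 0)) <|
  .loop (.not (.ile (.var 0) (.var 10)))
    (.seq (.putR 6 (.var 10) (.get b (.var 10))) <| .seq (.putR 6 (.add (.var 0) (.var 10)) (.get c (.var 10))) <|
    .setI 10 (.add (.var 10) (.lit 1)))

theorem wp_keysC {M n b c : ℕ} {K : ℕ → ℝ} {σ : State} {a : ℕ} {Q : ℕ → State → Prop}
    (hb6 : b ≠ 6) (hc6 : c ≠ 6) (h0 : σ.ivar 0 = n) (hM : 2 * n + 5 ≤ M)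
    (hb : ∀ i < n, σ.rarr b i = K i) (hc : ∀ i < n, σ.rarr c i = K (n + i))
    (hQ : ∀ a' σ', a' ≤ a + (40 * n + 20) → (∀ x < 10, σ'.ivar x = σ.ivar x) →
      σ'.rvar = σ.rvar → σ'.iarr = σ.iarr → (∀ d, d ≠ 6 → σ'.rarr d = σ.rarr d) →
      (∀ i < 2 * n, σ'.rarr 6 i = K i) → Q a' σ') : wp M (keysC b c) σ a Q := by
  simp only [keysC, wp_seq, wp_setI, IExpr.ok, IExpr.val, IExpr.cost]
  refine ⟨by omega, ?_⟩
  refine wp_loop (t := 40 * n + 10)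
    (fun t τ => ∃ j ≤ n, τ.ivar 10 = j ∧ t = 40 * (n - j) + 10 ∧ (∀ x < 10, τ.ivar x = σ.ivar x) ∧
      τ.rvar = σ.rvar ∧ τ.iarr = σ.iarr ∧ (∀ d, d ≠ 6 → τ.rarr d = σ.rarr d) ∧
      ∀ i < j, τ.rarr 6 i = K i ∧ τ.rarr 6 (n + i) = K (n + i))
    (fun τ => (∀ x < 10, τ.ivar x = σ.ivar x) ∧
      τ.rvar = σ.rvar ∧ τ.iarr = σ.iarr ∧ (∀ d, d ≠ 6 → τ.rarr d = σ.rarr d) ∧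
      ∀ i < 2 * n, τ.rarr 6 i = K i) ?_ ?_ ?_
  · rintro t τ ⟨j, hj, h10, rfl, hi, hr, hia, hra, hK⟩
    have e0 : τ.ivar 0 = n := (hi 0 (by omega)).trans h0
    simp only [wp_seq, wp_setI, wp_putR, IExpr.ok, IExpr.val, IExpr.cost, BExpr.ok,
      BExpr.val, BExpr.cost, RExpr.ok, RExpr.val, RExpr.cost, State.putR_ivar, State.putR_rarr, e0,
      h10, hb6, hc6, if_false, hra b hb6, hra c hc6]
    refine ⟨by omega, fun hlt => ?_, fun hge => ⟨by omega, hi, hr, hia, hra, fun i hi' => ?_⟩⟩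
    · refine ⟨by omega, by omega, by omega, by omega, by omega, _, ⟨j + 1, by omega, by simp, rfl,
        fun x hx => ?_, hr, hia, fun d hd => ?_, fun i hij => ?_⟩, by omega⟩
      · simp [show x ≠ 10 by omega, hi x hx]
      · simp [hd, hra d hd]
      · simp only [State.setI_rarr, State.putR_rarr, if_true, Function.update_apply]
        rcases Nat.lt_or_ge i j with h' | h'
        · rw [if_neg (by omega), if_neg (by omega), if_neg (by omega), if_neg (by omega)]
          exact hK i h'
        · obtain rfl : i = j := by omega
          rw [if_neg (by omega), if_pos rfl, if_pos rfl]
          exact ⟨hb i (by omega), hc i (by omega)⟩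
    · rcases Nat.lt_or_ge i n with h' | h'
      · exact (hK i (by omega)).1
      · obtain ⟨l, rfl⟩ := Nat.exists_eq_add_of_le h'
        exact (hK l (by omega)).2
  · exact ⟨0, by omega, by simp, by simp, fun x hx => by simp [show x ≠ 10 by omega], rfl, rfl,
      fun _ _ => rfl, fun i hi => by omega⟩
  · rintro a' σ' ha' ⟨h₁, h₂, h₃, h₄, h₅⟩
    exact hQ a' σ' (by omega) h₁ h₂ h₃ h₄ h₅

/-- Makes `-i` the key of `i`. -/
def orderC : Cmd :=
  .seq (.setI 10 (.lit 0)) <| .seq (.setR 5 (.lit 0)) <|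
  .loop (.ile (.var 10) (.add (.var 3) (.lit 1)))
    (.seq (.putR 6 (.var 10) (.var 5)) <| .seq (.setR 5 (.sub (.var 5) (.lit 1))) <|
    .setI 10 (.add (.var 10) (.lit 1)))

theorem wp_orderC {M m : ℕ} {σ : State} {a : ℕ} {Q : ℕ → State → Prop}
    (h3 : σ.ivar 3 = m) (hM : m + 5 ≤ M)
    (hQ : ∀ a' σ', a' ≤ a + (20 * m + 60) → (∀ x < 10, σ'.ivar x = σ.ivar x) →
      (∀ x < 5, σ'.rvar x = σ.rvar x) → σ'.iarr = σ.iarr → (∀ d, d ≠ 6 → σ'.rarr d = σ.rarr d) →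
      (∀ i ≤ m + 1, σ'.rarr 6 i = -(i : ℝ)) → Q a' σ') : wp M orderC σ a Q := by
  simp only [orderC, wp_seq, wp_setI, wp_setR, IExpr.ok, IExpr.val, IExpr.cost, RExpr.ok, RExpr.val,
    RExpr.cost]
  refine ⟨by omega, trivial, ?_⟩
  refine wp_loop (t := 20 * (m + 2) + 10)
    (fun t τ => ∃ j ≤ m + 2, τ.ivar 10 = j ∧ τ.rvar 5 = -(j : ℝ) ∧ t = 20 * (m + 2 - j) + 10 ∧
      (∀ x < 10, τ.ivar x = σ.ivar x) ∧ (∀ x < 5, τ.rvar x = σ.rvar x) ∧ τ.iarr = σ.iarr ∧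
      (∀ d, d ≠ 6 → τ.rarr d = σ.rarr d) ∧ ∀ i < j, τ.rarr 6 i = -(i : ℝ))
    (fun τ => (∀ x < 10, τ.ivar x = σ.ivar x) ∧ (∀ x < 5, τ.rvar x = σ.rvar x) ∧ τ.iarr = σ.iarr ∧
      (∀ d, d ≠ 6 → τ.rarr d = σ.rarr d) ∧ ∀ i ≤ m + 1, τ.rarr 6 i = -(i : ℝ)) ?_ ?_ ?_
  · rintro t τ ⟨j, hj, h10, h5, rfl, hi, hr, hia, hra, hK⟩
    have e3 : τ.ivar 3 = m := (hi 3 (by omega)).trans h3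
    simp only [wp_seq, wp_setI, wp_setR, wp_putR, IExpr.ok, IExpr.val, IExpr.cost, BExpr.ok,
      BExpr.val, BExpr.cost, RExpr.ok, RExpr.val, RExpr.cost, State.putR_ivar, State.putR_rvar,
      State.setR_ivar, e3, h10, h5]
    refine ⟨by omega, fun hle => ?_, fun hgt => ⟨by omega, hi, hr, hia, hra,
      fun i hi' => hK i (by omega)⟩⟩
    refine ⟨by omega, trivial, ⟨trivial, trivial⟩, by omega, _, ⟨j + 1, by omega, by simp, ?_, rfl,
      fun x hx => ?_, fun x hx => ?_, hia, fun d hd => ?_, fun i hij => ?_⟩, by omega⟩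
    · simp; ring
    · simp [show x ≠ 10 by omega, hi x hx]
    · simp [show x ≠ 5 by omega, hr x hx]
    · simp [hd, hra d hd]
    · simp only [State.setI_rarr, State.setR_rarr, State.putR_rarr, if_true, Function.update_apply]
      split_ifs with h'
      · rw [h']
      · exact hK i (by omega)
  · exact ⟨0, by omega, by simp, by simp, by simp, fun x hx => by simp [show x ≠ 10 by omega],
      fun x hx => by simp [show x ≠ 5 by omega], rfl, fun _ _ => rfl, fun i hi => by omega⟩
  · rintro a' σ' ha' ⟨h₁, h₂, h₃, h₄, h₅⟩
    exact hQ a' σ' (by omega) h₁ h₂ h₃ h₄ h₅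

/-! ### Targets in the column or in the row of the start -/

section
variable {n : ℕ} {RX RY : ℕ → ℕ} {r cs ps : ℕ}

/-- A staircase that has not left the row of the start visits all columns in between within that
row, which is therefore free. -/
theorem Reach.hfree_of_row {d : Bool} {g c k : ℕ} (h : Reach n RX RY r cs ps d g c k)
    (h₀ : ¬ Blk n RX RY cs ps) (hk : k ≤ ps) : HFree n RX RY ps cs c := by
  refine ⟨h.bounds.1, fun c' h₁ h₂ => ?_⟩
  obtain ⟨j, hj, d', g', h'⟩ := h.column c' h₁ h₂
  have := h'.bounds.2
  obtain rfl : j = ps := by omega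
  exact h'.free h₀

theorem Reach.vfree_of_column {d : Bool} {g c k : ℕ} (h : Reach n RX RY r cs ps d g c k)
    (h₀ : ¬ Blk n RX RY cs ps) (hc : c ≤ cs) : VFree n RX RY cs ps k := by
  refine ⟨h.bounds.2, fun k' h₁ h₂ => ?_⟩
  obtain ⟨c', hc', d', g', h'⟩ := h.row k' h₁ h₂
  have := h'.bounds.1
  obtain rfl : c' = cs := by omega
  exact h'.free h₀

end

theorem Stair.one_le_links {D : Set (ℝ × ℝ)} {s t : ℝ × ℝ} {π : List (ℝ × ℝ)} (h : Stair D s t π)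
    (hst : s ≠ t) : 1 ≤ links π := by
  obtain ⟨h₁, h₂, -, -⟩ := h
  match π, h₁ with
  | p :: [], h₁ => exact absurd (by simpa using h₁.symm.trans h₂) hst
  | p :: q :: l, h₁ => simp [links]

theorem Stair.two_le_links {D : Set (ℝ × ℝ)} {s t : ℝ × ℝ} {π : List (ℝ × ℝ)} (h : Stair D s t π)
    (hx : s.1 ≠ t.1) (hy : s.2 ≠ t.2) : 2 ≤ links π := by
  obtain ⟨h₁, h₂, -, h₄⟩ := h
  match π, h₁ with
  | p :: [], h₁ => exact absurd (congrArg Prod.fst (by simpa using h₁.symm.trans h₂)) hx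
  | p :: q :: [], h₁ =>
    obtain rfl : p = s := by simpa using h₁
    obtain rfl : q = t := by simpa using h₂
    have hl : Link D p q := by simpa using h₄
    rcases hl.1 with h' | h'
    · exact absurd h' hx
    · exact absurd h' hy
  | p :: q :: q' :: l, h₁ => simp [links]

/-- The constants of the algorithm, and the cells of start and target. -/
def prepareC : Cmd :=
  .seq (.setI 3 (.add (.var 0) (.var 0))) <| .seq (.setI 9 (.add (.var 3) (.lit 5))) <|
  .seq (.setI 1 (.add (.mul (.lit 2) (.var 3)) (.lit 20))) <|
  .seq (countC 4 0 1 0) <| .seq (countC 5 0 1 3) <| .seq (countC 6 2 3 2) <| countC 7 2 3 4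

/-- The state after the preparations. -/
structure Prepared {n : ℕ} (R : Fin n → Rect) (S : VSeg) (t : ℝ × ℝ) (σ : State) : Prop where
  v0 : σ.ivar 0 = n
  v1 : σ.ivar 1 = 4 * n + 20
  v3 : σ.ivar 3 = 2 * n
  v4 : σ.ivar 4 = cellX R S.x
  v5 : σ.ivar 5 = cellX R t.1
  v6 : σ.ivar 6 = cellY R S.y₂
  v7 : σ.ivar 7 = cellY R t.2
  v9 : σ.ivar 9 = 2 * n + 5
  r0 : σ.rvar 0 = S.x
  r2 : σ.rvar 2 = S.y₂
  r3 : σ.rvar 3 = t.1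
  r4 : σ.rvar 4 = t.2
  tree : ∀ v, σ.iarr 0 v = 0
  lowX : ∀ i < n, σ.rarr 0 i = keyX R i
  highX : ∀ i < n, σ.rarr 1 i = keyX R (n + i)
  lowY : ∀ i < n, σ.rarr 2 i = keyY R i
  highY : ∀ i < n, σ.rarr 3 i = keyY R (n + i)

theorem wp_prepareC {M n : ℕ} {R : Fin n → Rect} {S : VSeg} {t : ℝ × ℝ} {Q : ℕ → State → Prop}
    (hM : 4 * n + 25 ≤ M)
    (hQ : ∀ a σ, a ≤ 160 * n + 120 → Prepared R S t σ → Q a σ) :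
    wp M prepareC (inputState R S t) 0 Q := by
  have hx₀ : ∀ i < n, (inputState R S t).rarr 0 i = keyX R i := fun i hi => by
    simp [inputState, keyX, hi]
  have hx₁ : ∀ i < n, (inputState R S t).rarr 1 i = keyX R (n + i) := fun i hi => by
    simp [inputState, keyX, hi]
  have hy₀ : ∀ i < n, (inputState R S t).rarr 2 i = keyY R i := fun i hi => by
    simp [inputState, keyY, hi]
  have hy₁ : ∀ i < n, (inputState R S t).rarr 3 i = keyY R (n + i) := fun i hi => by
    simp [inputState, keyY, hi]
  have h0 : (inputState R S t).ivar 0 = n := by simp [inputState]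
  have r0 : (inputState R S t).rvar 0 = S.x := rfl
  have r2 : (inputState R S t).rvar 2 = S.y₂ := rfl
  have r3 : (inputState R S t).rvar 3 = t.1 := rfl
  have r4 : (inputState R S t).rvar 4 = t.2 := rfl
  have hT : ∀ v, (inputState R S t).iarr 0 v = 0 := fun _ => rfl
  generalize inputState R S t = σ at *
  simp only [prepareC, wp_seq, wp_setI, IExpr.ok, IExpr.val, IExpr.cost, State.setI_ivar, if_true,
    if_false, Nat.reduceEqDiff, OfNat.ofNat_ne_zero, OfNat.zero_ne_ofNat, h0]
  refine ⟨by omega, by omega, by omega, ?_⟩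
  refine wp_countC (n := n) (K := keyX R) (by omega) (by omega) (by simp [h0]) (by omega) hx₀ hx₁
    fun a₁ w₁ ha₁ => ?_
  refine wp_countC (n := n) (K := keyX R) (by omega) (by omega) (by simp [h0]) (by omega) hx₀ hx₁
    fun a₂ w₂ ha₂ => ?_
  refine wp_countC (n := n) (K := keyY R) (by omega) (by omega) (by simp [h0]) (by omega) hy₀ hy₁
    fun a₃ w₃ ha₃ => ?_
  refine wp_countC (n := n) (K := keyY R) (by omega) (by omega) (by simp [h0]) (by omega) hy₀ hy₁
    fun a₄ w₄ ha₄ => ?_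
  refine hQ _ _ (by omega) ⟨?_, ?_, ?_, ?_, ?_, ?_, ?_, ?_, r0, r2, r3, r4, hT, hx₀, hx₁, hy₀, hy₁⟩
  · simp [h0]
  · simp; omega
  · simp; omega
  · simp [cellX, r0]
  · simp [cellX, r3]
  · simp [cellY, r2]
  · simp [cellY, r4]
  · simp; omega

/-- A path from the start to a target above it. -/
def verticalC : Cmd :=
  .seq (.putR 4 (.lit 0) (.var 0)) <| .seq (.putR 5 (.lit 0) (.var 2)) <|
  .ite (.rle (.var 4) (.var 2)) (.setI 1 (.lit 1))
    (.seq (.setI 1 (.lit 2)) <| .seq (.putR 4 (.lit 1) (.var 3)) <| .putR 5 (.lit 1) (.var 4))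

/-- A path from the start to a target in the same row. -/
def horizontalC : Cmd :=
  .seq (.putR 4 (.lit 0) (.var 0)) <| .seq (.putR 5 (.lit 0) (.var 2)) <|
  .seq (.putR 4 (.lit 1) (.var 3)) <| .seq (.putR 5 (.lit 1) (.var 2)) <|
  .ite (.rle (.var 4) (.var 2)) (.setI 1 (.lit 2))
    (.seq (.setI 1 (.lit 3)) <| .seq (.putR 4 (.lit 2) (.var 3)) <| .putR 5 (.lit 2) (.var 4))

section
variable {M n : ℕ} {R : Fin n → Rect} {S : VSeg} {t : ℝ × ℝ} {σ : State} {a : ℕ}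
  {Q : ℕ → State → Prop}

/-- The target is on the vertical line of the start, so every staircase stays in one column and the
straight segment is free. It has no link or one link, which is optimal. -/
theorem wp_verticalC (hgp : GeneralPosition R) (hd : ∀ i j, i ≠ j → Disjoint (R i).toSet (R j).toSet)
    (hS : S.top ∈ domain R) (ht : t ∈ Dxy R S) (hP : Prepared R S t σ) (hM : 5 ≤ M)
    (hts : t.1 ≤ S.x)
    (hQ : ∀ a' σ', a' ≤ a + 30 → IsMinLinkShortestPath (domain R) S.toSet {t} (outputPath σ') →
      Q a' σ') : wp M verticalC σ a Q := by
  obtain ⟨h₁, h₂, d, g, hreach⟩ := reachable_of_mem_Dxy hd hgp ht (r := 0) (by omega)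
  have hx : t.1 = S.x := le_antisymm hts h₁
  have hsx := inCell_cell (axisX hgp) S.x
  have hsy := inCell_cell (axisY hgp) S.y₂
  have hty := inCell_cell (axisY hgp) t.2
  have hfree := (mem_domain_iff_not_blk hsx hsy).1 hS
  simp only [verticalC, wp_seq, wp_ite, wp_setI, wp_putR, IExpr.ok, IExpr.val, IExpr.cost, RExpr.ok,
    RExpr.val, RExpr.cost, BExpr.ok, BExpr.val, BExpr.cost, State.putR_rvar, State.setI_rvar, hP.r0,
    hP.r2, hP.r3, hP.r4]
  refine ⟨by omega, trivial, by omega, trivial, ⟨trivial, trivial⟩, fun hle => ⟨by omega, ?_⟩,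
    fun hgt => ⟨by omega, by omega, trivial, by omega, trivial, ?_⟩⟩
  · have hst : S.top = t := Prod.ext hx.symm (le_antisymm h₂ hle)
    refine hQ _ _ (by omega) (isMinLinkShortestPath_of_stair h₁ h₂ ?_ fun π' _ => ?_)
    · have : outputPath (((σ.putR 4 0 S.x).putR 5 0 S.y₂).setI 1 1) = [S.top] := by
        simp [outputPath, VSeg.top, List.range_succ]
      rw [this, ← hst]
      exact ⟨by simp, by simp, by simpa using hS, by simp⟩
    · simp [links, outputPath]
  · have hlt : S.y₂ < t.2 := not_le.1 hgt
    refine hQ _ _ (by omega) (isMinLinkShortestPath_of_stair h₁ h₂ ?_ fun π' hπ' => ?_)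
    · refine stair_of_fun (f := vertex _) ?_ ?_ ?_ fun i hi => ?_
      · simp
      · simp [vertex, Function.update_apply, VSeg.top]
      · simp [vertex, Function.update_apply]
      · simp only [State.putR_ivar, State.setI_ivar, if_true] at hi
        obtain rfl : i = 0 := by omega
        have hV := hreach.vfree_of_column hfree (by rw [hx])
        have hl := VFree.link hV hsx hsy hty hlt.le
        simpa [vertex, Function.update_apply, hx] using hl
    · refine le_trans ?_ (hπ'.one_le_links fun h => hlt.ne (congrArg Prod.snd h))
      simp [links, outputPath]

/-- The target is in the same row of cells but may be higher inside that row. The horizontal link at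
the height of the start is free, and a vertical link within the cell of the target completes it; two
links are needed when both coordinates differ. -/
theorem wp_horizontalC (hgp : GeneralPosition R)
    (hd : ∀ i j, i ≠ j → Disjoint (R i).toSet (R j).toSet)
    (hS : S.top ∈ domain R) (ht : t ∈ Dxy R S) (hP : Prepared R S t σ) (hM : 5 ≤ M)
    (hts : S.x < t.1) (hrow : cellY R t.2 ≤ cellY R S.y₂)
    (hQ : ∀ a' σ', a' ≤ a + 40 → IsMinLinkShortestPath (domain R) S.toSet {t} (outputPath σ') →
      Q a' σ') : wp M horizontalC σ a Q := by
  obtain ⟨h₁, h₂, d, g, hreach⟩ := reachable_of_mem_Dxy hd hgp ht (r := 0) (by omega)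
  have hsx := inCell_cell (axisX hgp) S.x
  have htx := inCell_cell (axisX hgp) t.1
  have hsy := inCell_cell (axisY hgp) S.y₂
  have hty := inCell_cell (axisY hgp) t.2
  have hfree := (mem_domain_iff_not_blk hsx hsy).1 hS
  have hH := hreach.hfree_of_row hfree hrow
  have hlH := HFree.link hH hsx htx hsy h₁
  have heq : cellY R t.2 = cellY R S.y₂ := le_antisymm hrow hreach.bounds.2
  have hfree' : ¬ Blk n (gridX R) (gridY R) (cellX R t.1) (cellY R S.y₂) := by
    rw [← heq]; exact hreach.free hfree
  have hlV : Link (domain R) (t.1, S.y₂) t :=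
    VFree.link (VFree.refl hfree') htx hsy (by rw [← heq]; exact hty) h₂
  simp only [horizontalC, wp_seq, wp_ite, wp_setI, wp_putR, IExpr.ok, IExpr.val, IExpr.cost, RExpr.ok,
    RExpr.val, RExpr.cost, BExpr.ok, BExpr.val, BExpr.cost, State.putR_rvar, State.setI_rvar, hP.r0,
    hP.r2, hP.r3, hP.r4]
  refine ⟨by omega, trivial, by omega, trivial, by omega, trivial, by omega, trivial,
    ⟨trivial, trivial⟩, fun hle => ⟨by omega, ?_⟩,
    fun hgt => ⟨by omega, by omega, trivial, by omega, trivial, ?_⟩⟩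
  · have hy : S.y₂ = t.2 := le_antisymm h₂ hle
    refine hQ _ _ (by omega) (isMinLinkShortestPath_of_stair h₁ h₂ ?_ fun π' hπ' => ?_)
    · refine stair_of_fun (f := vertex _) ?_ ?_ ?_ fun i hi => ?_
      · simp
      · simp [vertex, Function.update_apply, VSeg.top]
      · simp [vertex, Function.update_apply, hy]
      · simp only [State.putR_ivar, State.setI_ivar, if_true] at hi
        obtain rfl : i = 0 := by omega
        simpa [vertex, Function.update_apply] using hlH
    · refine le_trans ?_ (hπ'.one_le_links fun h => hts.ne (congrArg Prod.fst h))
      simp [links, outputPath]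
  · have hlt : S.y₂ < t.2 := not_le.1 hgt
    refine hQ _ _ (by omega) (isMinLinkShortestPath_of_stair h₁ h₂ ?_ fun π' hπ' => ?_)
    · refine stair_of_fun (f := vertex _) ?_ ?_ ?_ fun i hi => ?_
      · simp
      · simp [vertex, Function.update_apply, VSeg.top]
      · simp [vertex, Function.update_apply]
      · simp only [State.putR_ivar, State.setI_ivar, if_true] at hi
        rcases (show i = 0 ∨ i = 1 by omega) with rfl | rfl
        · simpa [vertex, Function.update_apply] using hlH
        · simpa [vertex, Function.update_apply] using hlV
    · refine le_trans ?_ (hπ'.two_le_links hts.ne hlt.ne)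
      simp [links, outputPath]

end

/-- The algorithm in the general case. -/
def generalC : Cmd :=
  .seq powerC <| .seq (keysC 2 3) <| .seq (sortC 1 2 7) <| .seq (keysC 0 1) <| .seq (sortC 3 4 8) <| .seq orderC <| solveC

/-- The real array of keys serves three purposes in turn: the y-coordinates and the x-coordinates
while sorting, and the negated positions for the predecessor search. Each sort leaves the tree empty
for the next one. -/
theorem wp_generalC {M n : ℕ} {R : Fin n → Rect} {S : VSeg} {t : ℝ × ℝ} {σ : State} {a : ℕ}
    {Q : ℕ → State → Prop} (hgp : GeneralPosition R)
    (hd : ∀ i j, i ≠ j → Disjoint (R i).toSet (R j).toSet)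
    (hS : S.top ∈ domain R) (ht : t ∈ Dxy R S) (hP : Prepared R S t σ) (hM : 8 * n + 30 ≤ M)
    (hts : S.x < t.1) (hrow : cellY R S.y₂ < cellY R t.2)
    (hQ : ∀ a' σ' h, 2 ^ h ≤ 4 * n + 2 → a' ≤ a + (n + 1) * (3500 * h + 9000) →
      IsMinLinkShortestPath (domain R) S.toSet {t} (outputPath σ') → Q a' σ') :
    wp M generalC σ a Q := by
  obtain ⟨h₁, h₂, -⟩ := reachable_of_mem_Dxy hd hgp ht (r := 0) (by omega)
  have hsx := inCell_cell (axisX hgp) S.x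
  have htx := inCell_cell (axisX hgp) t.1
  have hsy := inCell_cell (axisY hgp) S.y₂
  have hty := inCell_cell (axisY hgp) t.2
  have hfree := (mem_domain_iff_not_blk hsx hsy).1 hS
  have hinj : ∀ {K K' : ℕ → ℝ}, Axis n K → (∀ i < 2 * n, K' i = K i) →
      ∀ i < 2 * n, ∀ j < 2 * n, K' i = K' j → i = j := fun hK hKK' i hi j hj h => by
    rw [hKK' i hi, hKK' j hj] at h
    exact hK.inj i hi j hj h
  -- The key array agrees with the coordinates only below `2 * n`, which is all that ranks depend
  -- on.
  have hsorted : ∀ {K K' : ℕ → ℝ} {rk ord : ℕ → ℕ} {sv : ℕ → ℝ}, (∀ i < 2 * n, K' i = K i) →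
      Sorted K' (2 * n) rk ord sv → Sorted K (2 * n) rk ord sv := by
    intro K K' rk ord sv hK hs
    have hrank : ∀ i < 2 * n, rank K' (2 * n) i = rank K (2 * n) i := fun i hi => by
      rw [rank, rank]
      congr 2
      refine Finset.filter_congr fun j hj => ?_
      rw [hK j (Finset.mem_range.1 hj), hK i hi]
    exact ⟨fun i hi => (hs.rk_eq i hi).trans (hrank i hi), hs.ord_lt,
      fun i hi => (hrank _ (hs.ord_lt i hi)).symm.trans (hs.rank_ord i hi),
      fun i hi => (hs.sv_eq i hi).trans (hK _ (hs.ord_lt i hi))⟩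
  simp only [generalC, wp_seq]
  refine wp_powerC (m := 2 * n) hP.v3 (by omega) fun a₀ h ha₀ hN₁ hN₂ => ?_
  obtain ⟨N, hN⟩ : ∃ N, N = 2 ^ h := ⟨_, rfl⟩
  rw [← hN] at hN₁ hN₂ ⊢
  refine wp_keysC (n := n) (K := keyY R) (by omega) (by omega) (by simp [hP.v0]) (by omega)
    hP.lowY hP.highY fun a₁ σ₁ ha₁ hi₁ hr₁ hia₁ hra₁ hk₁ => ?_
  refine wp_sortC (h := h) (N := N) (m := 2 * n) hN (by omega) (by rw [hi₁ 2 (by omega)]; simp)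
    (by rw [hi₁ 3 (by omega)]; simp [hP.v3]) (by omega) (hinj (axisY hgp) hk₁)
    (fun v _ _ => by rw [hia₁]; exact hP.tree v) (by omega) (by omega) (by omega) (by omega)
    fun a₂ σ₂ ha₂ hi₂ hr₂ hia₂ hra₂ hT₂ hs₂ => ?_
  have hra₂' : ∀ b, b ≠ 6 → b ≠ 7 → σ₂.rarr b = σ.rarr b := fun b h₁ h₂ => by
    rw [hra₂ b h₂, hra₁ b h₁]; simp
  have hi₂' : ∀ x < 10, x ≠ 2 → σ₂.ivar x = σ.ivar x := fun x h₁ h₂ => by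
    rw [hi₂ x h₁, hi₁ x h₁]; simp [h₂]
  have h2₂ : σ₂.ivar 2 = N := by rw [hi₂ 2 (by omega), hi₁ 2 (by omega)]; simp
  refine wp_keysC (n := n) (K := keyX R) (by omega) (by omega)
    ((hi₂' 0 (by omega) (by omega)).trans hP.v0) (by omega)
    (by rw [hra₂' 0 (by omega) (by omega)]; exact hP.lowX)
    (by rw [hra₂' 1 (by omega) (by omega)]; exact hP.highX)
    fun a₃ σ₃ ha₃ hi₃ hr₃ hia₃ hra₃ hk₃ => ?_
  refine wp_sortC (h := h) (N := N) (m := 2 * n) hN (by omega) ((hi₃ 2 (by omega)).trans h2₂)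
    ((hi₃ 3 (by omega)).trans ((hi₂' 3 (by omega) (by omega)).trans hP.v3)) (by omega)
    (hinj (axisX hgp) hk₃)
    (fun v h₁ h₂ => by rw [hia₃]; exact hT₂ v h₁ h₂) (by omega) (by omega) (by omega) (by omega)
    fun a₄ σ₄ ha₄ hi₄ hr₄ hia₄ hra₄ hT₄ hs₄ => ?_
  have hi₄' : ∀ x < 10, x ≠ 2 → σ₄.ivar x = σ.ivar x := fun x h₁ h₂ => by
    rw [hi₄ x h₁, hi₃ x h₁, hi₂' x h₁ h₂]
  have h2₄ : σ₄.ivar 2 = N := by rw [hi₄ 2 (by omega), hi₃ 2 (by omega), h2₂]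
  refine wp_orderC (m := 2 * n) ((hi₄' 3 (by omega) (by omega)).trans hP.v3) (by omega)
    fun a₅ σ₅ ha₅ hi₅ hr₅ hia₅ hra₅ hk₅ => ?_
  have hi₅' : ∀ x < 10, x ≠ 2 → σ₅.ivar x = σ.ivar x := fun x h₁ h₂ => by
    rw [hi₅ x h₁, hi₄' x h₁ h₂]
  have hr₅' : ∀ x < 5, σ₅.rvar x = σ.rvar x := fun x hx => by
    rw [hr₅ x hx, hr₄, hr₃, hr₂, hr₁]; simp
  have hC : Ctx n h N M (cellX R S.x) (cellY R S.y₂) (keyX R) (keyY R) S.top :=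
    ⟨hN, by omega, by omega, axisX hgp, isGrid hd hgp, cell_le _, cell_le _, hsx, hsy, hfree⟩
  have hD : Data n N (cellX R S.x) (cellY R S.y₂) (keyX R) (keyY R) S.top σ₅ := by
    refine ⟨(hi₅' 0 (by omega) (by omega)).trans hP.v0, (hi₅ 2 (by omega)).trans h2₄,
      (hi₅' 4 (by omega) (by omega)).trans hP.v4, (hi₅' 6 (by omega) (by omega)).trans hP.v6,
      (hi₅' 9 (by omega) (by omega)).trans hP.v9, (hr₅' 0 (by omega)).trans hP.r0,
      (hr₅' 2 (by omega)).trans hP.r2, ?_, ?_⟩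
    · rw [hia₅, hia₄ 1 (by omega) (by omega) (by omega), hia₄ 2 (by omega) (by omega) (by omega),
        hra₅ 7 (by omega), hra₄ 7 (by omega), hia₃, hra₃ 7 (by omega)]
      exact hsorted hk₁ hs₂
    · rw [hia₅, hra₅ 8 (by omega)]
      exact hsorted hk₃ hs₄
  refine wp_solveC (t := t) hC hD hk₅ ((hi₅' 5 (by omega) (by omega)).trans hP.v5)
    ((hi₅' 7 (by omega) (by omega)).trans hP.v7) ((hi₅' 1 (by omega) (by omega)).trans hP.v1)
    ((hr₅' 3 (by omega)).trans hP.r3) ((hr₅' 4 (by omega)).trans hP.r4) (cell_le _) (cell_le _) hrow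
    htx hty h₁ (fun r hr => (reachable_of_mem_Dxy hd hgp ht hr).2.2) fun a₆ σ₆ ha₆ hst hlow => ?_
  refine hQ a₆ σ₆ h (by omega) ?_ (isMinLinkShortestPath_of_stair h₁ h₂ hst fun π' hπ' => ?_)
  · have e₁ : (n + 1) * (3500 * h + 9000) =
        (2 * n + 2) * (1400 * h + 3600) + (n + 1) * (700 * h + 1800) := by ring
    have e₂ : 2 * n * (120 * h + 200) = 240 * (n * h) + 400 * n := by ring
    have e₃ : (n + 1) * (700 * h + 1800) = 700 * (n * h) + 1800 * n + 700 * h + 1800 := by ring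
    rw [e₁, e₃]
    rw [e₂] at ha₂ ha₄
    clear * - ha₀ ha₁ ha₂ ha₃ ha₄ ha₅ ha₆ hN₂
    linarith [Nat.zero_le (n * h)]
  -- Every competitor yields a staircase of cells with no more links. The case excluded from the
  -- lower bound would put the target on the vertical line of the start.
  · obtain ⟨r, d, g, hA, hle⟩ := hπ'.arrived hgp fun h => hts.ne (congrArg Prod.fst h)
    obtain ⟨hA₁, hA₂, hA₃, hA₄⟩ := hA
    have := hlow r hA₂ d g hA₁ fun ⟨h₁, h₂, h₃⟩ => hts.ne' ((hA₄ h₁).2 h₂ h₃)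
    simp only [links, outputPath, List.length_map, List.length_range] at hle ⊢
    omega

/-- The algorithm. -/
def pathC : Cmd :=
  .seq prepareC <| .ite (.rle (.var 3) (.var 0)) verticalC
    (.ite (.ile (.var 7) (.var 6)) horizontalC generalC)

theorem exists_exec_pathC {M n : ℕ} {R : Fin n → Rect} {S : VSeg} {t : ℝ × ℝ}
    (hd : ∀ i j, i ≠ j → Disjoint (R i).toSet (R j).toSet) (hgp : GeneralPosition R)
    (hS : S.toSet ⊆ domain R) (ht : t ∈ Dxy R S) (hM : 8 * n + 30 ≤ M) :
    ∃ σ k h, Exec M pathC (inputState R S t) σ k ∧ 2 ^ h ≤ 4 * n + 2 ∧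
      k ≤ (n + 1) * (3500 * h + 10000) ∧
      IsMinLinkShortestPath (domain R) S.toSet {t} (outputPath σ) := by
  have hS' : S.top ∈ domain R := hS (by simp [VSeg.top, VSeg.toSet, S.hy.le])
  suffices H : wp M pathC (inputState R S t) 0 fun k σ => ∃ h, 2 ^ h ≤ 4 * n + 2 ∧
      k ≤ (n + 1) * (3500 * h + 10000) ∧
      IsMinLinkShortestPath (domain R) S.toSet {t} (outputPath σ) by
    obtain ⟨σ, k, hE, h, h₁, h₂, h₃⟩ := wp_sound H
    exact ⟨σ, k, h, hE, h₁, by simpa using h₂, h₃⟩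
  simp only [pathC, wp_seq]
  refine wp_prepareC (by omega) fun a σ ha hP => ?_
  have b₁ : cellY R t.2 ≤ 2 * n := cell_le _
  have b₂ : cellY R S.y₂ ≤ 2 * n := cell_le _
  simp only [wp_ite, IExpr.ok, IExpr.val, IExpr.cost, RExpr.ok,
    RExpr.val, RExpr.cost, BExpr.ok, BExpr.val, BExpr.cost, hP.r0, hP.r3, hP.v6, hP.v7]
  refine ⟨⟨trivial, trivial⟩, fun h₁ => ?_, fun h₁ => ⟨by omega, fun h₂ => ?_, fun h₂ => ?_⟩⟩
  · exact wp_verticalC hgp hd hS' ht hP (by omega) h₁ fun a' σ' ha' h =>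
      ⟨0, by omega, by linarith, h⟩
  · exact wp_horizontalC hgp hd hS' ht hP (by omega) (not_le.1 h₁) h₂ fun a' σ' ha' h =>
      ⟨0, by omega, by linarith, h⟩
  · refine wp_generalC hgp hd hS' ht hP hM (not_le.1 h₁) (not_le.1 h₂) fun a' σ' h hh ha' hmin =>
      ⟨h, hh, ?_, hmin⟩
    have e₁ : (n + 1) * (3500 * h + 10000) = (n + 1) * (3500 * h + 9000) + 1000 * n + 1000 := by ring
    rw [e₁]
    linarith

end MinLinkPath

open MinLinkPath in
theorem mainTheorem5 :
    ∃ (P : Cmd) (C : ℕ), ∀ (n : ℕ) (R : Fin n → Rect) (S : VSeg) (t : ℝ × ℝ),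
      (∀ i j, i ≠ j → Disjoint (R i).toSet (R j).toSet) → GeneralPosition R →
      S.toSet ⊆ domain R → t ∈ Dxy R S →
      ∃ (σ : State) (k : ℕ),
        Exec (C * (n + 1)) P (inputState R S t) σ k ∧
        k ≤ C * ((n + 1) * Nat.log 2 (n + 2)) ∧
        IsMinLinkShortestPath (domain R) S.toSet {t} (outputPath σ) := by
  refine ⟨pathC, 20500, fun n R S t hd hgp hS ht => ?_⟩
  obtain ⟨σ, k, h, hE, hh, hk, hmin⟩ :=
    exists_exec_pathC (M := 20500 * (n + 1)) hd hgp hS ht (by omega)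
  refine ⟨σ, k, hE, hk.trans ?_, hmin⟩
  have hlog : 1 ≤ Nat.log 2 (n + 2) := Nat.log_pos (by omega) (by omega)
  have hlt : n + 2 < 2 ^ (Nat.log 2 (n + 2) + 1) := Nat.lt_pow_succ_log_self (by omega) _
  -- The tree has `2 ^ h ≤ 4 * n + 2` leaves, which is less than four times `n + 2`.
  have hh' : h < Nat.log 2 (n + 2) + 3 := by
    refine (Nat.pow_lt_pow_iff_right (a := 2) (by omega)).1 ?_
    rw [show Nat.log 2 (n + 2) + 3 = Nat.log 2 (n + 2) + 1 + 2 by omega, pow_add]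
    omega
  -- With `h` at most the logarithm plus 2, the factor is at most `3500` times the logarithm plus
  -- `17000`. As the logarithm is at least 1, the constant `20500` is enough; it is also ample for
  -- the memory.
  calc (n + 1) * (3500 * h + 10000) ≤ (n + 1) * (20500 * Nat.log 2 (n + 2)) :=
        Nat.mul_le_mul_left _ (by omega)
    _ = 20500 * ((n + 1) * Nat.log 2 (n + 2)) := by ring
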